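/- A straight-line program (SLP) is a context-free grammar with variables $X_1,\dots,X_n$ ($n\ge 1$), each with exactly one rule $X_i\to ab$, where $a,b$ are letters or variables $X_j$ with $j<i$; it generates the string derived from $X_n$. The frequency of a bigram (string of two symbols) in a string is the maximum number of pairwise non-overlapping occurrences. RePair, started with $T_0=T$, does the following for $h=0,1,\dots$ as long as some bigram has frequency at least $2$ in $T_h$: it chooses a bigram $ab$ of largest frequency in $T_h$ and replaces its occurrences, greedily from left to right, by a new variable $\hat c$ with rule $\hat c\to ab$, which gives $T_{h+1}$. The grammar $\mathrm{RePair}(T)$ consists of the rules so introduced and of a starting variable whose right-hand side is the last string. Ties between most frequent bigrams may be resolved arbitrarily. The model is the word RAM (memory with unit-cost operations on words of $w=\Theta(\log N)$ bits, where a sufficiently large constant factor may depend on the alphabet) with uniformly random words as a source of randomness. Space is the number of memory cells used, with the input included. **Theorem.** There are a way to resolve the ties, so that $\mathrm{RePair}(T)$ is a function of the string $T$, and a randomized word RAM program with the following property. Let an SLP with $n$ variables generate a text $T$ of length $N$, let its letters be integers that are at most $N^{O(1)}$, and let $n\le N$ (which holds whenever every variable occurs in the derivation tree of $T$). Let $m$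 be the number of variables of $\mathrm{RePair}(T)$, the starting variable included. Given the SLP, the program computes $\mathrm{RePair}(T)$, without error, in $O(\min(N, nm\log N)\,m)$ expected time and $O(\min(N, nm\log N))$ space, where the constants depend on the exponent of the alphabet bound only. -/

import Mathlib

/-!
  Straight-line programs, RePair grammars, and a randomized word RAM.
-/

open MeasureTheory
open scoped ENNReal

/-- A grammar symbol: a terminal letter (an integer) or the variable with a given index. -/
inductive Symb where
  | letter (a : ℕ)
  | var (i : ℕ)
deriving DecidableEq

/-- The word that stores a symbol: one extra bit separates letters from variables. -/
def Symb.code : Symb → ℕ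
  | .letter a => 2 * a
  | .var i => 2 * i + 1

/-- The words that store a list of rules whose right-hand sides are bigrams. -/
def encodeRules (rs : List (Symb × Symb)) : List ℕ :=
  rs.flatMap fun r => [r.1.code, r.2.code]

/-- `Derives rules x u`: the symbol `x` derives the string of letters `u`, where the right-hand
side of the variable with index `i` is the `i`-th entry of `rules` (indices start at `0`). -/
inductive Derives (rules : List (Symb × Symb)) : Symb → List ℕ → Prop
  | letter (a : ℕ) : Derives rules (.letter a) [a]
  | var {i : ℕ} {x y : Symb} {u v : List ℕ} :
      rules[i]? = some (x, y) → Derives rules x u → Derives rules y v →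
        Derives rules (.var i) (u ++ v)

/-- A straight-line program: every right-hand side is a bigram, and every variable on a right-hand
side is smaller than the variable on the left. The last variable is the starting variable. -/
structure SLP where
  rules : List (Symb × Symb)
  rules_ne_nil : rules ≠ []
  ordered : ∀ (i : ℕ) (x y : Symb), rules[i]? = some (x, y) →
    ∀ j : ℕ, (x = .var j ∨ y = .var j) → j < i

namespace SLP

/-- The number of variables. -/
def numVars (S : SLP) : ℕ := S.rules.length

/-- The last variable derives `T`. -/
def Generates (S : SLP) (T : List ℕ) : Prop := Derives S.rules (.var (S.numVars - 1)) T

/-- Every letter that occurs in a rule is at most `σ`. -/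
def LettersLE (S : SLP) (σ : ℕ) : Prop :=
  ∀ r ∈ S.rules, ∀ a : ℕ, (r.1 = .letter a ∨ r.2 = .letter a) → a ≤ σ

/-- The input of the machine: the number of variables, then two words for each rule. -/
def encode (S : SLP) : List ℕ := S.numVars :: encodeRules S.rules

end SLP

/-! ### RePair -/

/-- The bigram `ab` occurs at position `i` of `w` (positions start at `0`). -/
def OccursAt (a b : Symb) (w : List Symb) (i : ℕ) : Prop :=
  w[i]? = some a ∧ w[i + 1]? = some b

instance (a b : Symb) (w : List Symb) (i : ℕ) : Decidable (OccursAt a b w i) :=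
  inferInstanceAs (Decidable (_ ∧ _))

/-- The frequency of the bigram `ab` in `w`: the maximum number of occurrences that do not
overlap each other. -/
def freq (a b : Symb) (w : List Symb) : ℕ :=
  ((Finset.range w.length).powerset.filter fun P =>
    (∀ i ∈ P, OccursAt a b w i) ∧ ∀ i ∈ P, ∀ j ∈ P, i < j → i + 2 ≤ j).sup Finset.card

/-- Replace the occurrences of the bigram `ab` by `c`, greedily from left to right. -/
def replaceBigram (a b c : Symb) : List Symb → List Symb
  | [] => []
  | [x] => [x]
  | x :: y :: t =>
      if x = a ∧ y = b then c :: replaceBigram a b c t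
      else x :: replaceBigram a b c (y :: t)

/-- `RePairFrom h w rs s`: started at level `h` with the string `w`, RePair (with some resolution
of the ties) introduces variables `h, h + 1, …` with right-hand sides `rs`, and stops with the
string `s`. -/
inductive RePairFrom : ℕ → List Symb → List (Symb × Symb) → List Symb → Prop
  | done {h : ℕ} {w : List Symb} : (∀ a b, freq a b w < 2) → RePairFrom h w [] w
  | step {h : ℕ} {w : List Symb} {a b : Symb} {rs : List (Symb × Symb)} {s : List Symb} :
      2 ≤ freq a b w → (∀ a' b', freq a' b' w ≤ freq a b w) →
      RePairFrom (h + 1) (replaceBigram a b (.var h) w) rs s →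
      RePairFrom h w ((a, b) :: rs) s

/-- A grammar as produced by RePair: variables whose right-hand sides are the bigrams in `rules`,
and a starting variable whose right-hand side is `start`. -/
structure RePairGrammar where
  rules : List (Symb × Symb)
  start : List Symb

namespace RePairGrammar

/-- The number of variables, the starting variable included. -/
def numVars (G : RePairGrammar) : ℕ := G.rules.length + 1

/-- The output of the machine: the number of bigram rules, two words for each of them, the length
of the starting right-hand side, and one word for each of its symbols. -/
def encode (G : RePairGrammar) : List ℕ :=
  G.rules.length :: encodeRules G.rules ++ G.start.length :: G.start.map Symb.code

end RePairGrammar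

/-- `G` is obtained by RePair from the text `T`, with some resolution of the ties. -/
def IsRePair (T : List ℕ) (G : RePairGrammar) : Prop :=
  RePairFrom 0 (T.map Symb.letter) G.rules G.start

/-! ### The randomized word RAM -/

namespace WordRAM

inductive BinOp where
  | add | sub | mul | div | mod | and | or | xor | shl | shr | eq | lt

/-- Binary operations on `w`-bit words; arithmetic is modulo `2 ^ w`. -/
def BinOp.eval (w : ℕ) : BinOp → ℕ → ℕ → ℕ
  | .add, x, y => (x + y) % 2 ^ w
  | .sub, x, y => (x + 2 ^ w - y) % 2 ^ w
  | .mul, x, y => (x * y) % 2 ^ w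
  | .div, x, y => (x / y) % 2 ^ w
  | .mod, x, y => (x % y) % 2 ^ w
  | .and, x, y => (x &&& y) % 2 ^ w
  | .or, x, y => (x ||| y) % 2 ^ w
  | .xor, x, y => (x ^^^ y) % 2 ^ w
  | .shl, x, y => (x <<< y) % 2 ^ w
  | .shr, x, y => (x >>> y) % 2 ^ w
  | .eq, x, y => (if x = y then 1 else 0) % 2 ^ w
  | .lt, x, y => (if x < y then 1 else 0) % 2 ^ w

/-- Programs, over registers numbered by `ℕ` (a program names finitely many of them). -/
inductive Prog where
  | skip
  /-- `r := k` -/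
  | const (r k : ℕ)
  /-- `r := s` -/
  | copy (r s : ℕ)
  /-- `r := s o t` -/
  | op (o : BinOp) (r s t : ℕ)
  /-- `r := memory[s]` -/
  | load (r s : ℕ)
  /-- `memory[r] := s` -/
  | store (r s : ℕ)
  /-- `r :=` a fresh uniformly random word -/
  | rand (r : ℕ)
  | seq (p q : Prog)
  /-- run `p` if register `r` is not `0`, and `q` otherwise -/
  | ite (r : ℕ) (p q : Prog)
  /-- repeat `p` as long as register `r` is not `0` -/
  | while (r : ℕ) (p : Prog)

/-- The store of the machine: registers, memory, the number of random words drawn so far, and the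
number of memory cells in use, i.e. the cells from address `0` up to the largest address that was
occupied by the input or has been accessed since. -/
structure Store where
  reg : ℕ → ℕ
  mem : ℕ → ℕ
  drawn : ℕ
  cells : ℕ

/-- Write a register. -/
def Store.setReg (s : Store) (r v : ℕ) : Store := { s with reg := Function.update s.reg r v }

/-- A configuration: the stack of the programs that remain to be run, and the store. The stack of
a run ranges over a finite set that depends on the program only (its program points). -/
abbrev Config := List Prog × Store

/-- One step of the machine with `w`-bit words, where `ω` is the sequence of random words. Every
step has unit cost. A configuration with an empty stack has halted. -/
def step (w : ℕ) (ω : ℕ → Fin (2 ^ w)) : Config → Config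
  | ([], s) => ([], s)
  | (.skip :: K, s) => (K, s)
  | (.const r k :: K, s) => (K, s.setReg r (k % 2 ^ w))
  | (.copy r r' :: K, s) => (K, s.setReg r (s.reg r'))
  | (.op o r r₁ r₂ :: K, s) => (K, s.setReg r (o.eval w (s.reg r₁) (s.reg r₂)))
  | (.load r r' :: K, s) =>
      (K, { s.setReg r (s.mem (s.reg r')) with cells := max s.cells (s.reg r' + 1) })
  | (.store r r' :: K, s) =>
      (K, { s with
        mem := Function.update s.mem (s.reg r) (s.reg r')
        cells := max s.cells (s.reg r + 1) })
  | (.rand r :: K, s) => (K, { s.setReg r (ω s.drawn : ℕ) with drawn := s.drawn + 1 })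
  | (.seq p q :: K, s) => (p :: q :: K, s)
  | (.ite r p q :: K, s) => (if s.reg r ≠ 0 then p :: K else q :: K, s)
  | (.while r p :: K, s) => (if s.reg r ≠ 0 then p :: .while r p :: K else K, s)

/-- The initial configuration: the input words occupy the addresses `0, 1, …`; all other cells and
all registers hold `0`. -/
def init (P : Prog) (input : List ℕ) : Config :=
  ([P], { reg := fun _ => 0, mem := fun i => input.getD i 0, drawn := 0, cells := input.length })

/-- The configuration after `t` steps. -/
def run (P : Prog) (w : ℕ) (input : List ℕ) (ω : ℕ → Fin (2 ^ w)) (t : ℕ) : Config :=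
  (step w ω)^[t] (init P input)

/-- The machine has halted. -/
def Halted (c : Config) : Prop := c.1 = []

/-- The words `out` stand in memory from the address in register `0` on. -/
def Outputs (c : Config) (out : List ℕ) : Prop :=
  ∀ i : ℕ, ∀ h : i < out.length, c.2.mem (c.2.reg 0 + i) = out[i]

/-- The number of steps until the machine halts; `⊤` if it does not halt. -/
noncomputable def runTime (P : Prog) (w : ℕ) (input : List ℕ) (ω : ℕ → Fin (2 ^ w)) : ℕ∞ :=
  ⨅ (t : ℕ) (_ : Halted (run P w input ω t)), (t : ℕ∞)

/-- A run of `t` steps depends on the first `t` random words only. -/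
theorem run_congr (P : Prog) (w : ℕ) (input : List ℕ) (ω ω' : ℕ → Fin (2 ^ w)) (t : ℕ)
    (h : ∀ i < t, ω i = ω' i) :
    run P w input ω t = run P w input ω' t ∧ (run P w input ω t).2.drawn ≤ t := by
  induction t with
  | zero => exact ⟨rfl, le_rfl⟩
  | succ t ih =>
    obtain ⟨h₁, h₂⟩ := ih fun i hi => h i (by omega)
    have e : ∀ η : ℕ → Fin (2 ^ w), run P w input η (t + 1) = step w η (run P w input η t) :=
      fun η => Function.iterate_succ_apply' _ _ _
    rw [e, e, ← h₁]
    generalize run P w input ω t = c at h₂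
    obtain ⟨K, s⟩ := c
    have h₃ : ω s.drawn = ω' s.drawn := h _ (by simp only at h₂; omega)
    simp only at h₂
    rcases K with _ | ⟨p, K⟩
    · exact ⟨rfl, by simp only [step]; omega⟩
    · cases p <;> simp only [step, Store.setReg, h₃, true_and] <;> omega

/-- The number of steps is a random variable, so that its expectation makes sense. -/
theorem measurable_runTime (P : Prog) (w : ℕ) (input : List ℕ) :
    Measurable fun ω => (runTime P w input ω : ℝ≥0∞) := by
  have hm : ∀ t : ℕ, MeasurableSet {ω | Halted (run P w input ω t)} := by
    intro t
    let ext : (Fin t → Fin (2 ^ w)) → ℕ → Fin (2 ^ w) := fun v i =>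
      if hi : i < t then v ⟨i, hi⟩ else 0
    have he : {ω | Halted (run P w input ω t)} =
        (fun (ω : ℕ → Fin (2 ^ w)) (i : Fin t) => ω i) ⁻¹'
          {v | Halted (run P w input (ext v) t)} := by
      ext ω
      have := (run_congr P w input ω (ext fun i : Fin t => ω i) t
        (fun i hi => by simp [ext, hi])).1
      simp [this]
    rw [he]
    exact (measurable_pi_lambda _ fun i => measurable_pi_apply _) (Set.toFinite _).measurableSet
  classical
  have : (fun ω => (runTime P w input ω : ℝ≥0∞)) =
      fun ω => ⨅ t : ℕ, if Halted (run P w input ω t) then (t : ℝ≥0∞) else ⊤ := by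
    funext ω
    simp only [runTime, ENat.toENNReal_iInf]
    refine iInf_congr fun t => ?_
    split_ifs with h <;> simp [h]
  rw [this]
  exact Measurable.iInf fun t => Measurable.ite (hm t) measurable_const measurable_const

/-- The law of a sequence of independent, uniformly distributed `w`-bit words. -/
noncomputable def randomWords (w : ℕ) : Measure (ℕ → Fin (2 ^ w)) :=
  Measure.infinitePi fun _ => (PMF.uniformOfFintype (Fin (2 ^ w))).toMeasure

/-- The expected number of steps. -/
noncomputable def expectedTime (P : Prog) (w : ℕ) (input : List ℕ) : ℝ≥0∞ :=
  ∫⁻ ω, (runTime P w input ω : ℝ≥0∞) ∂(randomWords w)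

end WordRAM

set_option linter.constructorNameAsVariable false

/-! RePair is simulated on the grammar instead of the text. Right-hand sides are lists of tokens,
each a run `x^k` or a variable, and `occ i` is the number of occurrences of variable `i` in the
derivation tree. The program never draws a random word, so the expected time is a worst-case bound.

A round has three steps. Every variable but the start first hands its leftmost and rightmost run to
the rules that contain it. Afterwards adjacent tokens never share a run (`Unc.popAll`), so each
bigram occurrence is visible in exactly one rule, and the frequency in the text is the sum over the
rules of local counts weighted by `occ` (`tot_ents`, `Gm.tot_eq`). Then a most frequent bigram `ab`
is chosen. Finally only leading `b`-runs and trailing `a`-runs are popped. No occurrence of `ab`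
then crosses the boundary of a variable (`Unc.uncross`), so that replacing it in the right-hand
sides replaces it in the text (`repl_iev`). The weights `occ` never change: variables disappear only
when their string has become empty.

Variables that occur once are expanded beforehand, so every inner variable that still derives
something occurs at least twice. If such a variable survives popping, its string had at least three
letters and contains a bigram, which the text then contains twice. Hence when no bigram is frequent,
only the start rule is left, and it spells out the final string (`Unced.collapse`).

The number of tokens has two bounds (`Gm.tokens`). The letters written in the rules number at most
`N`, because each of them occurs in the text. Also, a potential (`pot`) starts at `O(n)`, is not
raised by replacement (`Gh.step`), and grows by `O(log N)` per variable occurrence when runs are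
popped (`Gh.expand`), hence `O(n m log N)` after `m` rounds. Each round is linear in the size of the
buffer.

Ties go to the least bigram. Letters are numbered in increasing order by a radix sort in base `2n`,
whose cost is within the bound because `n log N / log (2n)` is. The frequency as a maximal packing
equals the greedy count (`freq_eq_cnt`).

The program is written in a small structured language with a timed big-step semantics. `Ev.sim`
transfers its runs to the machine, and `W` is the total-correctness judgement in which the algorithm
is verified. -/

namespace RP
open WordRAM

/-! ### A structured language and its compilation to the word RAM -/

/-- The variables of the structured language. -/
inductive Vr where
  | o | n | i | j | p | k | d | c | x | y | z | t | r | m | nz | sp | ps | pc | sf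
  | q | a | b | al | pv | e | bv | h | u | l
deriving DecidableEq

/-- The arrays of the structured language. -/
inductive Ar where
  | occ | q | ord | nx | hd | idp | nm | stk | av | ac | bv | bc | lx | lc | rx | rc | ne
  | fs | ls | ch | cn | cy | cw | ct | ra | rb
deriving DecidableEq

/-- The order of the constructors matters: `o` becomes register 0, where the output address is
expected, and `n` becomes register 1, which `loadP` fills. Register 99 holds the base address of the
arrays, and registers from 100 on are scratch. -/
def Vr.idx (x : Vr) : ℕ := x.ctorIdx
def Ar.idx (x : Ar) : ℕ := x.ctorIdx

theorem Vr.idx_inj {x y : Vr} (h : x.idx = y.idx) : x = y := by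
  have : ∀ z : Vr, Vr.ofNat z.ctorIdx = z := by intro z; cases z <;> rfl
  rw [← this x, ← this y]; exact congrArg _ h

theorem Ar.idx_inj {x y : Ar} (h : x.idx = y.idx) : x = y := by
  have : ∀ z : Ar, Ar.ofNat z.ctorIdx = z := by intro z; cases z <;> rfl
  rw [← this x, ← this y]; exact congrArg _ h

theorem Vr.idx_lt (x : Vr) : x.idx < 99 := by cases x <;> decide
theorem Ar.idx_lt (x : Ar) : x.idx < 32 := by cases x <;> decide

inductive Exp where
  | c (k : ℕ)
  | v (x : Vr)
  | op (o : BinOp) (e f : Exp)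
  | rd (k : Ar) (e : Exp)
  | inp (e : Exp)

inductive Cmd where
  | asg (x : Vr) (e : Exp)
  | put (k : Ar) (e f : Exp)
  | poke (e f : Exp)
  | seq (c d : Cmd)
  | ite (e : Exp) (c d : Cmd)
  | skip
  | wh (e : Exp) (c : Cmd)

/-- Abstract states: variables, arrays, and an output area. -/
structure St where
  v : Vr → ℕ
  a : Ar → ℕ → ℕ
  o : ℕ → ℕ

/-- Word length, size of the input area, number of array records, number of output cells, bound for
the number of cells, and the input. -/
structure Ctx where
  w : ℕ
  b : ℕ
  I : ℕ
  J : ℕ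
  Z : ℕ
  inp : ℕ → ℕ

structure Ctx.Valid (C : Ctx) : Prop where
  bound : C.b + 32 * C.I + C.J ≤ C.Z
  small : C.Z + 32 < 2 ^ C.w
  inp : ∀ j, C.inp j < 2 ^ C.w

def eqn (x y : ℕ) : ℕ := if x = y then 1 else 0
def ltn (x y : ℕ) : ℕ := if x < y then 1 else 0

@[simp] theorem eqn_eq_zero {x y : ℕ} : eqn x y = 0 ↔ x ≠ y := by simp [eqn]
@[simp] theorem ltn_eq_zero {x y : ℕ} : ltn x y = 0 ↔ y ≤ x := by simp [ltn]
theorem eqn_le (x y : ℕ) : eqn x y ≤ 1 := by grind [eqn]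
theorem ltn_le (x y : ℕ) : ltn x y ≤ 1 := by grind [ltn]

/-- Arithmetic without wrap-around, for which `okOp` says when it agrees with the machine; in
particular subtraction is admitted only where it does not truncate. Bit operations are not used and
get a junk value. -/
def idl : BinOp → ℕ → ℕ → ℕ
  | .add, x, y => x + y
  | .sub, x, y => x - y
  | .mul, x, y => x * y
  | .div, x, y => x / y
  | .mod, x, y => x % y
  | .eq, x, y => eqn x y
  | .lt, x, y => ltn x y
  | _, _, _ => 0

def okOp (w : ℕ) : BinOp → ℕ → ℕ → Prop
  | .add, x, y => x + y < 2 ^ w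
  | .sub, x, y => y ≤ x
  | .mul, x, y => x * y < 2 ^ w
  | .div, _, _ => True
  | .mod, _, _ => True
  | .eq, _, _ => True
  | .lt, _, _ => True
  | _, _, _ => False

def Exp.eval (C : Ctx) (s : St) : Exp → ℕ
  | .c k => k
  | .v x => s.v x
  | .op o e f => idl o (e.eval C s) (f.eval C s)
  | .rd k e => s.a k (e.eval C s)
  | .inp e => C.inp (e.eval C s)

def Exp.ok (C : Ctx) (s : St) : Exp → Prop
  | .c k => k < 2 ^ C.w
  | .v _ => True
  | .op o e f => e.ok C s ∧ f.ok C s ∧ okOp C.w o (e.eval C s) (f.eval C s)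
  | .rd _ e => e.ok C s ∧ e.eval C s < C.I
  | .inp e => e.ok C s ∧ e.eval C s < C.b

def Exp.cost : Exp → ℕ
  | .c _ => 1
  | .v _ => 1
  | .op _ e f => e.cost + f.cost + 3
  | .rd _ e => e.cost + 12
  | .inp e => e.cost + 2

/-- The arrays are interleaved in records of 32 cells, one cell per array, so a single number of
records bounds all arrays at once. -/
def addr (k : Ar) (d : ℕ) : Prog :=
  .seq (.const (d + 1) 32) (.seq (.op .mul d d (d + 1)) (.seq (.op .add d d 99)
    (.seq (.const (d + 1) k.idx) (.op .add d d (d + 1)))))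

/-- Registers from `d` on serve as an evaluation stack: the value ends up in `d`, and registers
below `d` are untouched. -/
def Exp.comp : Exp → ℕ → Prog
  | .c k, d => .const d k
  | .v x, d => .copy d x.idx
  | .op o e f, d => .seq (e.comp d) (.seq (f.comp (d + 1)) (.op o d d (d + 1)))
  | .rd k e, d => .seq (e.comp d) (.seq (addr k d) (.load d d))
  | .inp e, d => .seq (e.comp d) (.load d d)

/-- The machine loop tests a register, so the guard is evaluated once before the loop and again at
the end of the body. In stores the value comes before the address, whose computation uses only
registers from 101 on. -/
def Cmd.comp : Cmd → Prog
  | .asg x e => .seq (e.comp 100) (.copy x.idx 100)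
  | .put k e f => .seq (f.comp 100) (.seq (e.comp 101) (.seq (addr k 101) (.store 101 100)))
  | .poke e f => .seq (f.comp 100) (.seq (e.comp 101) (.store 101 100))
  | .seq c d => .seq c.comp d.comp
  | .ite e c d => .seq (e.comp 100) (.ite 100 c.comp d.comp)
  | .skip => .skip
  | .wh e c => .seq (e.comp 100) (.while 100 (.seq c.comp (e.comp 100)))

def St.setv (s : St) (x : Vr) (k : ℕ) : St := { s with v := Function.update s.v x k }
def St.seta (s : St) (f : Ar) (i k : ℕ) : St :=
  { s with a := Function.update s.a f (Function.update (s.a f) i k) }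
def St.seto (s : St) (i k : ℕ) : St := { s with o := Function.update s.o i k }

/-- Big-step semantics with the exact number of machine steps. The premises rule out overflow and
accesses outside the areas, so that states can be reasoned about with plain natural numbers. -/
inductive Ev (C : Ctx) : Cmd → St → St → ℕ → Prop
  | asg {x e s} : e.ok C s → Ev C (.asg x e) s (s.setv x (e.eval C s)) (e.cost + 2)
  | put {k e f s} : e.ok C s → f.ok C s → e.eval C s < C.I →
      Ev C (.put k e f) s (s.seta k (e.eval C s) (f.eval C s)) (e.cost + f.cost + 13)
  | poke {e f s i} : e.ok C s → f.ok C s → i < C.J → e.eval C s = C.b + 32 * C.I + i →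
      Ev C (.poke e f) s (s.seto i (f.eval C s)) (e.cost + f.cost + 3)
  | seq {c d s s₁ s₂ t₁ t₂} : Ev C c s s₁ t₁ → Ev C d s₁ s₂ t₂ → Ev C (.seq c d) s s₂ (t₁ + t₂ + 1)
  | ite_true {e c d s s₁ t} : e.ok C s → e.eval C s ≠ 0 → Ev C c s s₁ t →
      Ev C (.ite e c d) s s₁ (e.cost + (t + 1) + 1)
  | ite_false {e c d s s₁ t} : e.ok C s → e.eval C s = 0 → Ev C d s s₁ t →
      Ev C (.ite e c d) s s₁ (e.cost + (t + 1) + 1)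
  | skip {s} : Ev C .skip s s 1
  | wh_true {e c s s₁ s₂ t₁ t₂} : e.ok C s → e.eval C s ≠ 0 → Ev C c s s₁ t₁ →
      Ev C (.wh e c) s₁ s₂ t₂ → Ev C (.wh e c) s s₂ (e.cost + t₁ + t₂ + 2)
  | wh_false {e c s} : e.ok C s → e.eval C s = 0 → Ev C (.wh e c) s s (e.cost + 2)

/-- The simulation relation. Scratch registers are left free, and abstract arrays are tied to the
memory only inside the `I` records. -/
structure Rel (C : Ctx) (s : St) (σ : Store) : Prop where
  reg : ∀ x : Vr, σ.reg x.idx = s.v x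
  mem : ∀ (k : Ar) (i : ℕ), i < C.I → σ.mem (C.b + 32 * i + k.idx) = s.a k i
  out : ∀ j < C.J, σ.mem (C.b + 32 * C.I + j) = s.o j
  inp : ∀ j < C.b, σ.mem j = C.inp j
  base : σ.reg 99 = C.b
  cells : σ.cells ≤ C.Z
  bv : ∀ x, s.v x < 2 ^ C.w
  ba : ∀ k i, s.a k i < 2 ^ C.w

/-- Quantifying over the rest `K` of the stack is what lets runs be composed. -/
def Runs (w : ℕ) (ω : ℕ → Fin (2 ^ w)) (p : Prog) (σ σ' : Store) (t : ℕ) : Prop :=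
  ∀ K, (step w ω)^[t] (p :: K, σ) = (K, σ')

section
variable {w : ℕ} {ω : ℕ → Fin (2 ^ w)}

theorem Runs.seq {p q : Prog} {σ σ₁ σ₂ : Store} {t₁ t₂ : ℕ} (h₁ : Runs w ω p σ σ₁ t₁)
    (h₂ : Runs w ω q σ₁ σ₂ t₂) : Runs w ω (.seq p q) σ σ₂ (t₁ + t₂ + 1) := by
  intro K
  rw [show t₁ + t₂ + 1 = t₂ + (t₁ + 1) by omega, Function.iterate_add_apply,
    Function.iterate_succ_apply]
  simp only [step]
  rw [h₁, h₂]

theorem Runs.one {p : Prog} {σ σ' : Store} (h : ∀ K, step w ω (p :: K, σ) = (K, σ')) :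
    Runs w ω p σ σ' 1 := fun K => h K

theorem Runs.ite_true {r : ℕ} {p q : Prog} {σ σ' : Store} {t : ℕ} (hr : σ.reg r ≠ 0)
    (h : Runs w ω p σ σ' t) : Runs w ω (.ite r p q) σ σ' (t + 1) := by
  intro K
  rw [Function.iterate_succ_apply]; simp only [step, if_pos hr]; exact h K

theorem Runs.ite_false {r : ℕ} {p q : Prog} {σ σ' : Store} {t : ℕ} (hr : σ.reg r = 0)
    (h : Runs w ω q σ σ' t) : Runs w ω (.ite r p q) σ σ' (t + 1) := by
  intro K
  rw [Function.iterate_succ_apply]; simp only [step, hr]; exact h K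

theorem Runs.while_false {r : ℕ} {p : Prog} {σ : Store} (hr : σ.reg r = 0) :
    Runs w ω (.while r p) σ σ 1 := by
  intro K
  simp [step, hr]

end

/-- Two stores agree below the register `d` and on the memory. -/
structure Agree (C : Ctx) (d : ℕ) (σ σ' : Store) : Prop where
  reg : ∀ r < d, σ'.reg r = σ.reg r
  mem : σ'.mem = σ.mem
  cells : σ.cells ≤ C.Z → σ'.cells ≤ C.Z

theorem Agree.trans {C : Ctx} {d e : ℕ} {σ σ' σ'' : Store} (h : Agree C d σ σ')
    (h' : Agree C e σ' σ'') (hde : d ≤ e) : Agree C d σ σ'' :=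
  ⟨fun r hr => (h'.reg r (by omega)).trans (h.reg r hr), h'.mem.trans h.mem,
    fun hc => h'.cells (h.cells hc)⟩

theorem Agree.rel {C : Ctx} {d : ℕ} {s : St} {σ σ' : Store} (h : Agree C d σ σ') (hd : 100 ≤ d)
    (hr : Rel C s σ) : Rel C s σ' where
  reg x := by rw [h.reg _ (by have := x.idx_lt; omega)]; exact hr.reg x
  mem := by rw [h.mem]; exact hr.mem
  out := by rw [h.mem]; exact hr.out
  inp := by rw [h.mem]; exact hr.inp
  base := by rw [h.reg _ (by omega)]; exact hr.base
  cells := h.cells hr.cells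
  bv := hr.bv
  ba := hr.ba

theorem Agree.setReg {C : Ctx} {d r v : ℕ} {σ : Store} (h : d ≤ r) : Agree C d σ (σ.setReg r v) :=
  ⟨fun q hq => by simp [Store.setReg, Function.update_of_ne (show q ≠ r by omega)], rfl, fun h => h⟩

theorem idl_lt {w : ℕ} {o : BinOp} {x y : ℕ} (hw : 1 < 2 ^ w) (hx : x < 2 ^ w) (hy : y < 2 ^ w)
    (h : okOp w o x y) : idl o x y < 2 ^ w := by
  cases o <;> simp only [okOp, idl] at * <;> try omega
  · exact lt_of_le_of_lt (Nat.div_le_self _ _) hx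
  · exact lt_of_le_of_lt (Nat.mod_le _ _) hx
  · have := eqn_le x y; omega
  · have := ltn_le x y; omega

theorem eval_eq_idl {w : ℕ} {o : BinOp} {x y : ℕ} (hw : 1 < 2 ^ w) (hx : x < 2 ^ w)
    (hy : y < 2 ^ w) (h : okOp w o x y) : o.eval w x y = idl o x y := by
  have h1 := idl_lt hw hx hy h
  cases o <;> simp only [okOp, idl, BinOp.eval] at * <;> try exact Nat.mod_eq_of_lt h1
  rw [show x + 2 ^ w - y = (x - y) + 2 ^ w by omega, Nat.add_mod_right]
  exact Nat.mod_eq_of_lt h1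

theorem Exp.eval_lt {C : Ctx} (hC : C.Valid) {s : St} (bv : ∀ x, s.v x < 2 ^ C.w)
    (ba : ∀ k i, s.a k i < 2 ^ C.w) : ∀ {e : Exp}, e.ok C s → e.eval C s < 2 ^ C.w
  | .c _, h => h
  | .v _, _ => bv _
  | .op _ _ _, h => idl_lt (by have := hC.small; omega) (eval_lt hC bv ba h.1)
      (eval_lt hC bv ba h.2.1) h.2.2
  | .rd _ _, _ => ba _ _
  | .inp _, _ => hC.inp _

theorem runs_addr {C : Ctx} (hC : C.Valid) {ω : ℕ → Fin (2 ^ C.w)} {σ : Store} {k : Ar} {d i : ℕ}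
    (hd : 100 ≤ d) (hb : σ.reg 99 = C.b) (hi : σ.reg d = i) (hI : i < C.I) :
    ∃ σ', Runs C.w ω (addr k d) σ σ' 9 ∧ Agree C d σ σ' ∧
      σ'.reg d = C.b + 32 * i + k.idx := by
  have h1 := hC.bound
  have h2 := hC.small
  have h3 := k.idx_lt
  refine ⟨_, Runs.seq (Runs.one fun K => rfl) (Runs.seq (Runs.one fun K => rfl)
    (Runs.seq (Runs.one fun K => rfl) (Runs.seq (Runs.one fun K => rfl)
    (Runs.one fun K => rfl)))), ?_, ?_⟩
  · refine Agree.trans ?_ (Agree.setReg le_rfl) le_rfl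
    refine Agree.trans ?_ (Agree.setReg (by omega)) le_rfl
    refine Agree.trans ?_ (Agree.setReg le_rfl) le_rfl
    refine Agree.trans ?_ (Agree.setReg le_rfl) le_rfl
    exact Agree.setReg (by omega)
  · have e1 : (32 : ℕ) % 2 ^ C.w = 32 := Nat.mod_eq_of_lt (by omega)
    have e2 : k.idx % 2 ^ C.w = k.idx := Nat.mod_eq_of_lt (by omega)
    have e3 : i * 32 % 2 ^ C.w = i * 32 := Nat.mod_eq_of_lt (by omega)
    have e4 : (i * 32 + C.b) % 2 ^ C.w = i * 32 + C.b := Nat.mod_eq_of_lt (by omega)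
    have e5 : (i * 32 + C.b + k.idx) % 2 ^ C.w = i * 32 + C.b + k.idx :=
      Nat.mod_eq_of_lt (by omega)
    have n1 : (99 : ℕ) ≠ d := by omega
    have n2 : (99 : ℕ) ≠ d + 1 := by omega
    simp [Store.setReg, BinOp.eval, e1, e2, e3, e4, e5, n1, n2, hb, hi]
    omega

theorem runs_exp {C : Ctx} (hC : C.Valid) {ω : ℕ → Fin (2 ^ C.w)} {s : St} :
    ∀ (e : Exp) (d : ℕ) (σ : Store), 100 ≤ d → Rel C s σ → e.ok C s →
      ∃ σ', Runs C.w ω (e.comp d) σ σ' e.cost ∧ Agree C d σ σ' ∧ σ'.reg d = e.eval C s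
  | .c k, d, σ, hd, hr, h => ⟨_, Runs.one fun K => rfl, Agree.setReg le_rfl, by
      simp only [Exp.ok] at h
      simp [Store.setReg, Exp.eval, Nat.mod_eq_of_lt h]⟩
  | .v x, d, σ, hd, hr, h => ⟨_, Runs.one fun K => rfl, Agree.setReg le_rfl, by
      simp [Store.setReg, Exp.eval, hr.reg]⟩
  | .op o e f, d, σ, hd, hr, h => by
      obtain ⟨σ₁, r1, a1, v1⟩ := runs_exp hC (ω := ω) e d σ hd hr h.1
      obtain ⟨σ₂, r2, a2, v2⟩ := runs_exp hC (ω := ω) f (d + 1) σ₁ (by omega) (a1.rel hd hr) h.2.1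
      refine ⟨_, ?_, (a1.trans a2 (by omega)).trans (Agree.setReg (r := d)
        (v := o.eval C.w (σ₂.reg d) (σ₂.reg (d + 1))) le_rfl) le_rfl, ?_⟩
      · have := Runs.seq r1 (Runs.seq r2 (Runs.one (p := .op o d d (d + 1))
          (σ' := σ₂.setReg d (o.eval C.w (σ₂.reg d) (σ₂.reg (d + 1)))) fun K => rfl))
        grind [Exp.comp, Exp.cost]
      · have b1 := Exp.eval_lt hC hr.bv hr.ba h.1
        have b2 := Exp.eval_lt hC hr.bv hr.ba h.2.1
        simp only [Store.setReg, Function.update_self, Exp.eval, v2, a2.reg d (by omega), v1]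
        exact eval_eq_idl (by have := hC.small; omega) b1 b2 h.2.2
  | .rd k e, d, σ, hd, hr, h => by
      obtain ⟨σ₁, r1, a1, v1⟩ := runs_exp hC (ω := ω) e d σ hd hr h.1
      obtain ⟨σ₂, r2, a2, v2⟩ := runs_addr hC (ω := ω) (k := k) hd (a1.rel hd hr).base v1 h.2
      have h1 := hC.bound
      have h3 := k.idx_lt
      have h4 := h.2
      refine ⟨_, Runs.seq r1 (Runs.seq r2 (Runs.one (p := .load d d)
        (σ' := { σ₂.setReg d (σ₂.mem (σ₂.reg d)) with cells := max σ₂.cells (σ₂.reg d + 1) })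
        fun K => rfl)), (a1.trans a2 le_rfl).trans ?_ le_rfl, ?_⟩
      · refine ⟨fun q hq => ?_, rfl, fun hc => ?_⟩
        · simp [Store.setReg, Function.update_of_ne (show q ≠ d by omega)]
        grind
      · simp only [Store.setReg, Function.update_self, Exp.eval, v2, a2.mem, a1.mem]
        exact hr.mem _ _ h.2
  | .inp e, d, σ, hd, hr, h => by
      obtain ⟨σ₁, r1, a1, v1⟩ := runs_exp hC (ω := ω) e d σ hd hr h.1
      have h1 := hC.bound
      have h4 := h.2
      refine ⟨_, Runs.seq r1 (Runs.one (p := .load d d)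
        (σ' := { σ₁.setReg d (σ₁.mem (σ₁.reg d)) with cells := max σ₁.cells (σ₁.reg d + 1) })
        fun K => rfl), a1.trans ?_ le_rfl, ?_⟩
      · refine ⟨fun q hq => ?_, rfl, fun hc => ?_⟩
        · simp [Store.setReg, Function.update_of_ne (show q ≠ d by omega)]
        grind
      · simp only [Store.setReg, Function.update_self, Exp.eval, v1, a1.mem]
        exact hr.inp _ h.2

theorem runs_guard {C : Ctx} (hC : C.Valid) {ω : ℕ → Fin (2 ^ C.w)} {e : Exp}
    {s : St} {σ : Store} (hr : Rel C s σ) (ho : e.ok C s) :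
    ∃ σ', Runs C.w ω (e.comp 100) σ σ' e.cost ∧ Rel C s σ' ∧ σ'.reg 100 = e.eval C s := by
  obtain ⟨σ', r, a, v⟩ := runs_exp hC (ω := ω) e 100 σ le_rfl hr ho
  exact ⟨σ', r, a.rel le_rfl hr, v⟩

/-- Induction on the evaluation. Distinct pairs of array and index have distinct addresses because
array indices are below 32, and the input, record and output areas follow each other in memory. -/
theorem Ev.sim {C : Ctx} (hC : C.Valid) {ω : ℕ → Fin (2 ^ C.w)} {c : Cmd} {s s' : St} {t : ℕ}
    (h : Ev C c s s' t) : ∀ σ, Rel C s σ → ∃ σ', Runs C.w ω c.comp σ σ' t ∧ Rel C s' σ' := by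
  have hb := hC.bound
  have hs := hC.small
  induction h with
  | @asg x e s he =>
    intro σ hr
    obtain ⟨σ₁, r1, a1, v1⟩ := runs_exp hC (ω := ω) e 100 σ le_rfl hr he
    have hr1 := a1.rel le_rfl hr
    refine ⟨_, Runs.seq r1 (Runs.one fun K => rfl), ?_⟩
    exact
      { reg := fun y => by
          by_cases hxy : y = x
          · subst hxy; simp [Store.setReg, St.setv, v1]
          · have : y.idx ≠ x.idx := fun hh => hxy (Vr.idx_inj hh)
            simp [Store.setReg, St.setv, Function.update_of_ne this, Function.update_of_ne hxy,
              hr1.reg]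
        mem := hr1.mem
        out := hr1.out
        inp := hr1.inp
        base := by
          have := x.idx_lt
          simp only [Store.setReg]
          rw [Function.update_of_ne (by omega)]; exact hr1.base
        cells := hr1.cells
        bv := fun y => by
          simp only [St.setv, Function.update_apply]
          split_ifs
          · exact Exp.eval_lt hC hr.bv hr.ba he
          · exact hr.bv y
        ba := hr.ba }
  | @put k e f s he hf hi =>
    intro σ hr
    obtain ⟨σ₁, r1, a1, v1⟩ := runs_exp hC (ω := ω) f 100 σ le_rfl hr hf
    have hr1 := a1.rel le_rfl hr
    obtain ⟨σ₂, r2, a2, v2⟩ := runs_exp hC (ω := ω) e 101 σ₁ (by omega) hr1 he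
    have hr2 := a2.rel (by omega) hr1
    obtain ⟨σ₃, r3, a3, v3⟩ := runs_addr hC (ω := ω) (k := k) (d := 101) (by omega) hr2.base v2 hi
    have hr3 := a3.rel (by omega) hr2
    have hk := k.idx_lt
    have hrun := Runs.seq r1 (Runs.seq r2 (Runs.seq r3
      (Runs.one (ω := ω) (p := .store 101 100) fun K => rfl)))
    rw [show f.cost + (e.cost + (9 + 1 + 1) + 1) + 1 = e.cost + f.cost + 13 by omega] at hrun
    refine ⟨_, hrun, ?_⟩
    · have e1 : σ₃.reg 100 = f.eval C s := by
        rw [a3.reg _ (by omega), a2.reg _ (by omega), v1]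
      exact
        { reg := hr3.reg
          mem := fun l i hI => by
            have hl := l.idx_lt
            simp only [v3, e1, St.seta]
            by_cases hlk : l = k
            · subst hlk
              simp only [Function.update_self]
              by_cases hie : i = e.eval C s
              · subst hie; simp
              · rw [Function.update_of_ne (by omega), Function.update_of_ne hie]
                exact hr3.mem _ _ hI
            · have : l.idx ≠ k.idx := fun hh => hlk (Ar.idx_inj hh)
              rw [Function.update_of_ne (by omega), Function.update_of_ne hlk]
              exact hr3.mem _ _ hI
          out := fun j hj => by
            simp only [v3, e1, St.seta]
            rw [Function.update_of_ne (by omega)]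
            exact hr3.out j hj
          inp := fun j hj => by
            simp only [v3, e1]
            rw [Function.update_of_ne (by omega)]
            exact hr3.inp j hj
          base := hr3.base
          cells := by
            simp only [max_le_iff, v3]
            exact ⟨hr3.cells, by omega⟩
          bv := hr.bv
          ba := fun l i => by
            simp only [St.seta, Function.update_apply]
            split_ifs
            · simp only [Function.update_apply]
              split_ifs
              · exact Exp.eval_lt hC hr.bv hr.ba hf
              · exact hr.ba _ i
            · exact hr.ba l i }
  | @poke e f s i he hf hi heq =>
    intro σ hr
    obtain ⟨σ₁, r1, a1, v1⟩ := runs_exp hC (ω := ω) f 100 σ le_rfl hr hf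
    have hr1 := a1.rel le_rfl hr
    obtain ⟨σ₂, r2, a2, v2⟩ := runs_exp hC (ω := ω) e 101 σ₁ (by omega) hr1 he
    have hr3 := a2.rel (by omega) hr1
    have hrun := Runs.seq r1 (Runs.seq r2 (Runs.one (ω := ω) (p := .store 101 100) fun K => rfl))
    rw [show f.cost + (e.cost + 1 + 1) + 1 = e.cost + f.cost + 3 by omega] at hrun
    refine ⟨_, hrun, ?_⟩
    · have e1 : σ₂.reg 100 = f.eval C s := by
        rw [a2.reg _ (by omega), v1]
      exact
        { reg := hr3.reg
          mem := fun l i hI => by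
            have hl := l.idx_lt
            simp only [v2, e1, heq, St.seto]
            rw [Function.update_of_ne (by omega)]
            exact hr3.mem _ _ hI
          out := fun j hj => by
            simp only [v2, e1, heq, St.seto]
            by_cases hij : j = i
            · subst hij; simp
            · rw [Function.update_of_ne (by omega), Function.update_of_ne hij]
              exact hr3.out j hj
          inp := fun j hj => by
            simp only [v2, e1, heq]
            rw [Function.update_of_ne (by omega)]
            exact hr3.inp j hj
          base := hr3.base
          cells := by
            simp only [max_le_iff, v2, heq]
            exact ⟨hr3.cells, by omega⟩
          bv := hr.bv
          ba := hr.ba }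
  | seq _ _ ih1 ih2 =>
    intro σ hr
    obtain ⟨σ₁, r1, h1⟩ := ih1 σ hr
    obtain ⟨σ₂, r2, h2⟩ := ih2 σ₁ h1
    exact ⟨σ₂, r1.seq r2, h2⟩
  | @ite_true e c d s s₁ t he h0 _ ih =>
    intro σ hr
    obtain ⟨σ₁, r1, h1, v1⟩ := runs_guard hC (ω := ω) hr he
    obtain ⟨σ₂, r2, h2⟩ := ih σ₁ h1
    exact ⟨σ₂, Runs.seq r1 (Runs.ite_true (by omega) r2), h2⟩
  | @ite_false e c d s s₁ t he h0 _ ih =>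
    intro σ hr
    obtain ⟨σ₁, r1, h1, v1⟩ := runs_guard hC (ω := ω) hr he
    obtain ⟨σ₂, r2, h2⟩ := ih σ₁ h1
    exact ⟨σ₂, Runs.seq r1 (Runs.ite_false (by omega) r2), h2⟩
  | skip => exact fun σ hr => ⟨σ, Runs.one fun K => rfl, hr⟩
  | @wh_true e c s s₁ s₂ t₁ t₂ he h0 _ _ ih1 ih2 =>
    intro σ hr
    obtain ⟨σ₁, r1, h1, v1⟩ := runs_guard hC (ω := ω) hr he
    obtain ⟨σ₂, r2, h2⟩ := ih1 σ₁ h1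
    obtain ⟨σ₃, r3, h3⟩ := ih2 σ₂ h2
    refine ⟨σ₃, fun K => ?_, h3⟩
    have e3 := r3 K
    -- The remaining loop begins by unfolding its `seq`. The machine, already inside the `while`,
    -- arrives at the configuration after this unfolding, so that one step is removed from the run.
    have hc : t₂ = (t₂ - 1) + 1 := by
      rcases t₂ with _ | t₂
      · simp [Cmd.comp] at e3
      · rfl
    rw [hc, Function.iterate_succ_apply] at e3
    simp only [Cmd.comp, step] at e3 ⊢
    rw [show e.cost + t₁ + t₂ + 2 = (t₂ - 1) + (t₁ + (1 + (1 + (e.cost + 1)))) by omega]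
    rw [Function.iterate_add_apply _ (t₂ - 1), Function.iterate_add_apply _ t₁,
      Function.iterate_add_apply _ 1 (1 + (e.cost + 1)), Function.iterate_add_apply _ 1 (e.cost + 1),
      Function.iterate_succ_apply _ e.cost]
    simp only [step]
    rw [r1]
    simp only [Function.iterate_one, step, v1, h0, ne_eq, not_false_eq_true, if_true]
    rw [r2, e3]
  | @wh_false e c s he h0 =>
    intro σ hr
    obtain ⟨σ₁, r1, h1, v1⟩ := runs_guard hC (ω := ω) hr he
    exact ⟨σ₁, Runs.seq r1 (Runs.while_false (by omega)), h1⟩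

/-! ### Frame conditions -/

/-- A syntactic and computable over-approximation of what is written; at each use the frame
condition is settled by `rfl`. -/
def Cmd.modV : Cmd → Vr → Bool
  | .asg x _, y => decide (y = x)
  | .put _ _ _, _ => false
  | .poke _ _, _ => false
  | .seq c d, y => c.modV y || d.modV y
  | .ite _ c d, y => c.modV y || d.modV y
  | .skip, _ => false
  | .wh _ c, y => c.modV y

def Cmd.modA : Cmd → Ar → Bool
  | .asg _ _, _ => false
  | .put k _ _, y => decide (y = k)
  | .poke _ _, _ => false
  | .seq c d, y => c.modA y || d.modA y
  | .ite _ c d, y => c.modA y || d.modA y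
  | .skip, _ => false
  | .wh _ c, y => c.modA y

structure Frame (c : Cmd) (s s' : St) : Prop where
  v : ∀ x, c.modV x = false → s'.v x = s.v x
  a : ∀ k, c.modA k = false → s'.a k = s.a k

theorem Ev.frame {C : Ctx} {c : Cmd} {s s' : St} {t : ℕ} (h : Ev C c s s' t) : Frame c s s' := by
  induction h with
  | asg => exact ⟨fun x hx => by simp_all [Cmd.modV, St.setv], fun _ _ => rfl⟩
  | put => exact ⟨fun _ _ => rfl, fun x hx => by simp_all [Cmd.modA, St.seta]⟩
  | poke => exact ⟨fun _ _ => rfl, fun _ _ => rfl⟩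
  | seq _ _ h1 h2 =>
    refine ⟨fun x hx => ?_, fun x hx => ?_⟩
    · simp only [Cmd.modV, Bool.or_eq_false_iff] at hx
      rw [h2.v x hx.2, h1.v x hx.1]
    · simp only [Cmd.modA, Bool.or_eq_false_iff] at hx
      rw [h2.a x hx.2, h1.a x hx.1]
  | ite_true _ _ _ h1 =>
    refine ⟨fun x hx => ?_, fun x hx => ?_⟩
    · simp only [Cmd.modV, Bool.or_eq_false_iff] at hx
      rw [h1.v x hx.1]
    · simp only [Cmd.modA, Bool.or_eq_false_iff] at hx
      rw [h1.a x hx.1]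
  | ite_false _ _ _ h1 =>
    refine ⟨fun x hx => ?_, fun x hx => ?_⟩
    · simp only [Cmd.modV, Bool.or_eq_false_iff] at hx
      rw [h1.v x hx.2]
    · simp only [Cmd.modA, Bool.or_eq_false_iff] at hx
      rw [h1.a x hx.2]
  | skip => exact ⟨fun _ _ => rfl, fun _ _ => rfl⟩
  | wh_true _ _ _ _ h1 h2 =>
    refine ⟨fun x hx => ?_, fun x hx => ?_⟩
    · rw [h2.v x hx, h1.v x hx]
    · rw [h2.a x hx, h1.a x hx]
  | wh_false => exact ⟨fun _ _ => rfl, fun _ _ => rfl⟩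

/-! ### Total correctness with time bounds -/

/-- Started in `s`, the command halts within `t` steps in a state with the property `Q`. -/
def W (C : Ctx) (c : Cmd) (s : St) (t : ℕ) (Q : St → Prop) : Prop :=
  ∃ s' t', t' ≤ t ∧ Ev C c s s' t' ∧ Q s'

theorem W.mono {C : Ctx} {c : Cmd} {s : St} {t t' : ℕ} {Q Q' : St → Prop} (h : W C c s t Q)
    (ht : t ≤ t') (hQ : ∀ s', Frame c s s' → Q s' → Q' s') : W C c s t' Q' := by
  obtain ⟨s', u, hu, he, hq⟩ := h
  exact ⟨s', u, hu.trans ht, he, hQ s' he.frame hq⟩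

theorem W.seq {C : Ctx} {c d : Cmd} {s : St} {t₁ t₂ : ℕ} {Q : St → Prop}
    (h : W C c s t₁ fun s₁ => Frame c s s₁ → W C d s₁ t₂ Q) :
    W C (.seq c d) s (t₁ + t₂ + 1) Q := by
  obtain ⟨s₁, u₁, hu₁, he₁, hq⟩ := h
  obtain ⟨s₂, u₂, hu₂, he₂, hq₂⟩ := hq he₁.frame
  exact ⟨s₂, _, by omega, .seq he₁ he₂, hq₂⟩

theorem W.ite {C : Ctx} {e : Exp} {c d : Cmd} {s : St} {t : ℕ} {Q : St → Prop}
    (ho : e.ok C s) (h1 : e.eval C s ≠ 0 → W C c s t Q) (h2 : e.eval C s = 0 → W C d s t Q) :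
    W C (.ite e c d) s (e.cost + (t + 1) + 1) Q := by
  by_cases h : e.eval C s = 0
  · obtain ⟨s₁, u₁, hu₁, he₁, hq⟩ := h2 h
    exact ⟨s₁, _, by omega, .ite_false ho h he₁, hq⟩
  · obtain ⟨s₁, u₁, hu₁, he₁, hq⟩ := h1 h
    exact ⟨s₁, _, by omega, .ite_true ho h he₁, hq⟩

/-- Loops, with an invariant that is indexed by the time that remains. -/
theorem W.wh {C : Ctx} {e : Exp} {c : Cmd} (Inv : ℕ → St → Prop)
    (h : ∀ k s, Inv k s → e.ok C s ∧ (e.eval C s ≠ 0 →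
      ∃ t k', t + k' + e.cost + 2 ≤ k ∧ W C c s t (Inv k'))) :
    ∀ k s, Inv k s →
      W C (.wh e c) s (k + e.cost + 2) fun s' => e.eval C s' = 0 ∧ ∃ k' ≤ k, Inv k' s' := by
  intro k
  induction k using Nat.strong_induction_on with
  | _ k ih =>
    intro s hi
    obtain ⟨ho, h1⟩ := h k s hi
    by_cases h0 : e.eval C s = 0
    · exact ⟨s, _, by omega, .wh_false ho h0, h0, k, le_rfl, hi⟩
    · obtain ⟨t, k', hk, s₁, u₁, hu₁, he₁, hq₁⟩ := h1 h0
      obtain ⟨s₂, u₂, hu₂, he₂, hq₂, k'', hk'', hi''⟩ := ih k' (by omega) s₁ hq₁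
      exact ⟨s₂, _, by omega, .wh_true ho h0 he₁ he₂, hq₂, k'', by omega, hi''⟩

/-- Loops whose iterations take a bounded time, with an invariant that is indexed by the number of
iterations that remain. -/
theorem W.loop {C : Ctx} {e : Exp} {c : Cmd} (Inv : ℕ → St → Prop) (T : ℕ)
    (h0 : ∀ s, Inv 0 s → e.ok C s ∧ e.eval C s = 0)
    (h1 : ∀ k s, Inv (k + 1) s → e.ok C s ∧ e.eval C s ≠ 0 ∧ W C c s T (Inv k)) :
    ∀ k s, Inv k s → W C (.wh e c) s (k * (T + e.cost + 2) + e.cost + 2) (Inv 0) := by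
  intro k
  induction k with
  | zero =>
    intro s hi
    obtain ⟨ho, h⟩ := h0 s hi
    exact ⟨s, _, by omega, .wh_false ho h, hi⟩
  | succ k ih =>
    intro s hi
    obtain ⟨ho, h, s₁, u₁, hu₁, he₁, hq₁⟩ := h1 k s hi
    obtain ⟨s₂, u₂, hu₂, he₂, hq₂⟩ := ih s₁ hq₁
    exact ⟨s₂, _, by rw [Nat.succ_mul]; omega, .wh_true ho h he₁ he₂, hq₂⟩

/-- Symbolic execution of commands without loops. The value at a loop is junk, which is harmless as
`Cmd.ok` is false there. -/
def Cmd.exec (C : Ctx) : Cmd → St → St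
  | .asg x e, s => s.setv x (e.eval C s)
  | .put k e f, s => s.seta k (e.eval C s) (f.eval C s)
  | .poke e f, s => s.seto (e.eval C s - (C.b + 32 * C.I)) (f.eval C s)
  | .seq c d, s => d.exec C (c.exec C s)
  | .ite e c d, s => if e.eval C s = 0 then d.exec C s else c.exec C s
  | .skip, s => s
  | .wh _ _, s => s

def Cmd.ok (C : Ctx) : Cmd → St → Prop
  | .asg _ e, s => e.ok C s
  | .put _ e f, s => e.ok C s ∧ f.ok C s ∧ e.eval C s < C.I
  | .poke e f, s => e.ok C s ∧ f.ok C s ∧ C.b + 32 * C.I ≤ e.eval C s ∧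
      e.eval C s < C.b + 32 * C.I + C.J
  | .seq c d, s => c.ok C s ∧ d.ok C (c.exec C s)
  | .ite e c d, s => e.ok C s ∧ if e.eval C s = 0 then d.ok C s else c.ok C s
  | .skip, _ => True
  | .wh _ _, _ => False

def Cmd.cost : Cmd → ℕ
  | .asg _ e => e.cost + 2
  | .put _ e f => e.cost + f.cost + 13
  | .poke e f => e.cost + f.cost + 3
  | .seq c d => c.cost + d.cost + 1
  | .ite e c d => e.cost + max c.cost d.cost + 2
  | .skip => 1
  | .wh _ _ => 0

theorem Cmd.ev {C : Ctx} : ∀ (c : Cmd) (s : St), c.ok C s →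
    ∃ t ≤ c.cost, Ev C c s (c.exec C s) t
  | .asg _ _, _, h => ⟨_, le_rfl, .asg h⟩
  | .put _ _ _, _, h => ⟨_, le_rfl, .put h.1 h.2.1 h.2.2⟩
  | .poke _ _, _, h => ⟨_, le_rfl, .poke h.1 h.2.1 (by have := h.2.2; omega)
      (by have := h.2.2; omega)⟩
  | .seq c d, s, h => by
      obtain ⟨t, ht, h1⟩ := c.ev s h.1
      obtain ⟨u, hu, h2⟩ := d.ev _ h.2
      exact ⟨_, by simp only [Cmd.cost]; omega, .seq h1 h2⟩
  | .ite e c d, s, h => by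
      simp only [Cmd.ok] at h
      simp only [Cmd.exec, Cmd.cost]
      by_cases h0 : e.eval C s = 0
      · simp only [h0, if_true] at h ⊢
        obtain ⟨t, ht, h1⟩ := d.ev s h.2
        exact ⟨_, by omega, .ite_false h.1 h0 h1⟩
      · simp only [h0, if_false] at h ⊢
        obtain ⟨t, ht, h1⟩ := c.ev s h.2
        exact ⟨_, by omega, .ite_true h.1 h0 h1⟩
  | .skip, _, _ => ⟨_, le_rfl, .skip⟩
  | .wh _ _, _, h => h.elim

theorem W.basic {C : Ctx} {c : Cmd} {s : St} {t : ℕ} {Q : St → Prop} (ho : c.ok C s)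
    (ht : c.cost ≤ t) (hq : Q (c.exec C s)) : W C c s t Q := by
  obtain ⟨u, hu, he⟩ := c.ev s ho
  exact ⟨_, u, hu.trans ht, he, hq⟩

end RP

namespace RP

/-! ### Greedy counting and replacement -/

section
variable {α β : Type*} [DecidableEq α] [DecidableEq β]

/-- The number of occurrences of a bigram that are found greedily from left to right. -/
def cnt (a b : α) : List α → ℕ
  | [] => 0
  | [_] => 0
  | x :: y :: t => if x = a ∧ y = b then cnt a b t + 1 else cnt a b (y :: t)

/-- Greedy replacement over an arbitrary alphabet. -/
def repl (a b c : α) : List α → List α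
  | [] => []
  | [x] => [x]
  | x :: y :: t => if x = a ∧ y = b then c :: repl a b c t else x :: repl a b c (y :: t)

variable {a b c : α}

theorem cnt_cons_ne {x : α} (h : x ≠ a) (t : List α) : cnt a b (x :: t) = cnt a b t := by
  cases t <;> simp [cnt, h]

theorem repl_cons_ne {x : α} (h : x ≠ a) (t : List α) :
    repl a b c (x :: t) = x :: repl a b c t := by
  cases t <;> simp [repl, h]

theorem repl_cons_cons (t : List α) : repl a b c (a :: b :: t) = c :: repl a b c t := by
  simp [repl]

theorem repl_cons_head {x : α} {t : List α} (h : t.head? ≠ some b) :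
    repl a b c (x :: t) = x :: repl a b c t := by
  cases t with
  | nil => simp [repl]
  | cons y t => grind [repl]

theorem cnt_cons_bounds (t : List α) :
    ∀ x, cnt a b t ≤ cnt a b (x :: t) ∧ cnt a b (x :: t) ≤ cnt a b t + 1 := by
  induction t with
  | nil => simp [cnt]
  | cons y t ih => grind [cnt]

/-- If no occurrence straddles the cut, the greedy scan of the whole string restarts at the cut. -/
theorem cnt_append {u v : List α} (h : ¬(u.getLast? = some a ∧ v.head? = some b)) :
    cnt a b (u ++ v) = cnt a b u + cnt a b v := by
  induction u using cnt.induct a b <;> cases v <;> grind [cnt]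

theorem cnt_append_cross (hab : a ≠ b) {u v : List α} (hu : u.getLast? = some a)
    (hv : v.head? = some b) : cnt a b (u ++ v) = cnt a b u + cnt a b v + 1 := by
  induction u using cnt.induct a b <;> cases v <;> grind [cnt, cnt_cons_ne]

/-- At a cut that does not lie inside a run, the count is additive up to the occurrence that
straddles the cut. For `a = b` there is no such occurrence; for `a ≠ b` occurrences cannot overlap,
so it costs no other one. -/
theorem cnt_append_of_ne {u v : List α} (h : ∀ x, u.getLast? = some x → v.head? ≠ some x) :
    cnt a b (u ++ v) =
      cnt a b u + cnt a b v + if u.getLast? = some a ∧ v.head? = some b then 1 else 0 := by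
  grind [cnt_append_cross, cnt_append]

theorem cnt_append_le (u v : List α) : cnt a b u + cnt a b v ≤ cnt a b (u ++ v) := by
  induction u using cnt.induct a b <;> grind [cnt, cnt_cons_bounds]

theorem repl_append {u v : List α} (h : ¬(u.getLast? = some a ∧ v.head? = some b)) :
    repl a b c (u ++ v) = repl a b c u ++ repl a b c v := by
  induction u using cnt.induct a b <;> cases v <;> grind [repl]

theorem length_repl (w : List α) : (repl a b c w).length + cnt a b w = w.length := by
  induction w using cnt.induct a b <;> grind [cnt, repl]

theorem mem_repl {w : List α} {x : α} (h : x ∈ repl a b c w) : x = c ∨ x ∈ w := by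
  induction w using cnt.induct a b <;> grind [repl]

theorem cnt_map {f : α → β} {w : List α} (ha : ∀ x ∈ w, f x = f a ↔ x = a)
    (hb : ∀ x ∈ w, f x = f b ↔ x = b) : cnt (f a) (f b) (w.map f) = cnt a b w := by
  induction w using cnt.induct a b <;> grind [cnt]

theorem repl_map {f : α → β} {w : List α} (ha : ∀ x ∈ w, f x = f a ↔ x = a)
    (hb : ∀ x ∈ w, f x = f b ↔ x = b) :
    repl (f a) (f b) (f c) (w.map f) = (repl a b c w).map f := by
  induction w using cnt.induct a b <;> grind [repl]

theorem cnt_replicate (x : α) :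
    ∀ k, cnt a b (List.replicate k x) = if x = a ∧ x = b then k / 2 else 0
  | 0 => by simp [cnt]
  | 1 => by simp [cnt]
  | k + 2 => by
    have h0 := cnt_replicate x k
    have h1 := cnt_replicate x (k + 1)
    grind [cnt]

theorem mem_of_cnt_ne_zero {w : List α} (h : cnt a b w ≠ 0) : a ∈ w ∧ b ∈ w := by
  induction w using cnt.induct a b <;> grind [cnt]

end

theorem replaceBigram_eq (a b c : Symb) (w : List Symb) : replaceBigram a b c w = repl a b c w := by
  induction w using cnt.induct a b <;> grind [repl, replaceBigram]

/-- A set of occurrences that do not overlap each other. -/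
def Packing (a b : Symb) (w : List Symb) (P : Finset ℕ) : Prop :=
  (∀ i ∈ P, OccursAt a b w i) ∧ ∀ i ∈ P, ∀ j ∈ P, i < j → i + 2 ≤ j

/-- Exchange argument for the greedy choice. If the bigram stands at the front, at most one member
of the packing is at position 0 or 1, and the others are a packing of the string without its first
two symbols. Otherwise position 0 is not in the packing. -/
theorem Packing.card_le {a b : Symb} {w : List Symb} :
    ∀ {P : Finset ℕ}, Packing a b w P → P.card ≤ cnt a b w := by
  induction w using cnt.induct a b with
  | case1 =>
    intro P h
    have : P = ∅ := Finset.eq_empty_of_forall_notMem fun i hi => by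
      have := h.1 i hi; simp [OccursAt] at this
    simp [this]
  | case2 x =>
    intro P h
    have : P = ∅ := Finset.eq_empty_of_forall_notMem fun i hi => by
      have := h.1 i hi; simp [OccursAt] at this
    simp [this]
  | case3 x y t hxy ih =>
    intro P h
    have h1 : Packing a b t ((P.filter (2 ≤ ·)).image (· - 2)) := by
      refine ⟨fun i hi => ?_, fun i hi j hj hij => ?_⟩
      · simp only [Finset.mem_image, Finset.mem_filter] at hi
        obtain ⟨k, ⟨hk, h2⟩, rfl⟩ := hi
        obtain ⟨k, rfl⟩ := Nat.exists_eq_add_of_le' h2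
        have := h.1 _ hk
        simpa [OccursAt, show k + 2 + 1 = k + 1 + 2 by omega] using this
      · simp only [Finset.mem_image, Finset.mem_filter] at hi hj
        obtain ⟨k, ⟨hk, h2⟩, rfl⟩ := hi
        obtain ⟨l, ⟨hl, h3⟩, rfl⟩ := hj
        have := h.2 k hk l hl (by omega)
        omega
    have h2 := ih h1
    rw [Finset.card_image_of_injOn] at h2
    · have h3 : (P.filter (¬ 2 ≤ ·)).card ≤ 1 := by
        refine Finset.card_le_one.2 fun i hi j hj => ?_
        simp only [Finset.mem_filter] at hi hj
        rcases lt_trichotomy i j with hlt | hlt | hlt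
        · have := h.2 i hi.1 j hj.1 hlt; omega
        · exact hlt
        · have := h.2 j hj.1 i hi.1 hlt; omega
      have h4 := Finset.card_filter_add_card_filter_not (s := P) (2 ≤ ·)
      grind [cnt]
    · intro i hi j hj hij
      grind
  | case4 x y t hxy ih =>
    intro P h
    have h0 : ∀ i ∈ P, 1 ≤ i := by
      intro i hi
      rcases i with _ | i
      · have := h.1 _ hi
        simp only [OccursAt, List.getElem?_cons_zero, Option.some.injEq, zero_add,
          List.getElem?_cons_succ] at this
        exact absurd this hxy
      · omega
    have h1 : Packing a b (y :: t) (P.image (· - 1)) := by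
      refine ⟨fun i hi => ?_, fun i hi j hj hij => ?_⟩
      · simp only [Finset.mem_image] at hi
        obtain ⟨k, hk, rfl⟩ := hi
        obtain ⟨k, rfl⟩ := Nat.exists_eq_add_of_le' (h0 k hk)
        have := h.1 _ hk
        simpa [OccursAt] using this
      · simp only [Finset.mem_image] at hi hj
        obtain ⟨k, hk, rfl⟩ := hi
        obtain ⟨l, hl, rfl⟩ := hj
        have := h.2 k hk l hl (by omega)
        have := h0 k hk
        omega
    have h2 := ih h1
    rw [Finset.card_image_of_injOn] at h2
    · grind [cnt]
    · intro i hi j hj hij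
      grind

theorem exists_packing (a b : Symb) (w : List Symb) :
    ∃ P, Packing a b w P ∧ P.card = cnt a b w := by
  induction w using cnt.induct a b with
  | case1 => exact ⟨∅, by simp [Packing], rfl⟩
  | case2 x => exact ⟨∅, by simp [Packing], rfl⟩
  | case3 x y t hxy ih =>
    obtain ⟨P, h, hc⟩ := ih
    refine ⟨insert 0 (P.image (· + 2)), ⟨fun i hi => ?_, fun i hi j hj hij => ?_⟩, ?_⟩
    · simp only [Finset.mem_insert, Finset.mem_image] at hi
      rcases hi with rfl | ⟨k, hk, rfl⟩
      · simp [OccursAt, hxy]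
      · have := h.1 _ hk
        simpa [OccursAt, show k + 2 + 1 = k + 1 + 2 by omega] using this
    · simp only [Finset.mem_insert, Finset.mem_image] at hi hj
      rcases hi with rfl | ⟨k, hk, rfl⟩
      · omega
      · rcases hj with rfl | ⟨l, hl, rfl⟩
        · omega
        · have := h.2 k hk l hl (by omega); omega
    · rw [Finset.card_insert_of_notMem (by simp), Finset.card_image_of_injective _ (by
        intro i j hij; simpa using hij), hc]
      grind [cnt]
  | case4 x y t hxy ih =>
    obtain ⟨P, h, hc⟩ := ih
    refine ⟨P.image (· + 1), ⟨fun i hi => ?_, fun i hi j hj hij => ?_⟩, ?_⟩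
    · simp only [Finset.mem_image] at hi
      obtain ⟨k, hk, rfl⟩ := hi
      have := h.1 _ hk
      simpa [OccursAt] using this
    · simp only [Finset.mem_image] at hi hj
      obtain ⟨k, hk, rfl⟩ := hi
      obtain ⟨l, hl, rfl⟩ := hj
      have := h.2 k hk l hl (by omega); omega
    · rw [Finset.card_image_of_injective _ (by intro i j hij; simpa using hij), hc]
      grind [cnt]

theorem freq_eq_cnt (a b : Symb) (w : List Symb) : freq a b w = cnt a b w := by
  apply le_antisymm
  · unfold freq
    refine Finset.sup_le fun P hP => ?_
    rw [Finset.mem_filter] at hP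
    exact Packing.card_le hP.2
  · obtain ⟨P, h, hc⟩ := exists_packing a b w
    rw [← hc]
    unfold freq
    refine Finset.le_sup (f := Finset.card) ?_
    rw [Finset.mem_filter, Finset.mem_powerset]
    refine ⟨fun i hi => ?_, h⟩
    have := (h.1 i hi).1
    grind

/-! ### A canonical resolution of the ties -/

/-- Letters come before variables. -/
def skey : Symb → ℕ ×ₗ ℕ
  | .letter a => toLex (0, a)
  | .var i => toLex (1, i)

theorem skey_inj {x y : Symb} (h : skey x = skey y) : x = y := by
  cases x <;> cases y <;> simp_all [skey]

/-- The bigram `ab` is the least one among the most frequent bigrams, and is worth replacing. -/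
def Best (w : List Symb) (a b : Symb) : Prop :=
  2 ≤ cnt a b w ∧ ∀ a' b', cnt a' b' w ≤ cnt a b w ∧
    (cnt a' b' w = cnt a b w → skey a < skey a' ∨ a = a' ∧ skey b ≤ skey b')

theorem Best.unique {w : List Symb} {a b a' b' : Symb} (h : Best w a b) (h' : Best w a' b') :
    a = a' ∧ b = b' := by
  have e : cnt a' b' w = cnt a b w := le_antisymm (h.2 _ _).1 (h'.2 _ _).1
  have h1 := (h.2 _ _).2 e
  have h2 := (h'.2 _ _).2 e.symm
  grind [skey_inj]

theorem exists_best {w : List Symb} {a b : Symb} (h : 2 ≤ cnt a b w) : ∃ a b, Best w a b := by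
  have hle : ∀ x y, cnt x y w ≤ w.length := fun x y => by
    have := length_repl (a := x) (b := y) (c := x) w; omega
  -- The complement of the count makes the most frequent bigrams minimal. Well-foundedness of the
  -- lexicographic order yields a minimum although there are infinitely many candidate bigrams.
  let f : Symb × Symb → ℕ ×ₗ ((ℕ ×ₗ ℕ) ×ₗ (ℕ ×ₗ ℕ)) := fun p =>
    toLex (w.length - cnt p.1 p.2 w, toLex (skey p.1, skey p.2))
  obtain ⟨⟨x, y⟩, hm, hmin⟩ := (InvImage.wf f wellFounded_lt).has_min
    {p : Symb × Symb | 2 ≤ cnt p.1 p.2 w} ⟨(a, b), h⟩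
  refine ⟨x, y, hm, fun x' y' => ?_⟩
  by_cases h2 : 2 ≤ cnt x' y' w
  · have := hmin (x', y') h2
    simp only [InvImage, f, Prod.Lex.toLex_lt_toLex, not_or, not_and, not_lt] at this
    grind [cnt, skey_inj]
  grind

/-- RePair with the canonical resolution of the ties. -/
inductive Canon : ℕ → List Symb → List (Symb × Symb) → List Symb → Prop
  | done {h : ℕ} {w : List Symb} : (∀ a b, cnt a b w < 2) → Canon h w [] w
  | step {h : ℕ} {w : List Symb} {a b : Symb} {rs : List (Symb × Symb)} {s : List Symb} :
      Best w a b → Canon (h + 1) (repl a b (.var h) w) rs s → Canon h w ((a, b) :: rs) s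

theorem Canon.rePairFrom {h : ℕ} {w s : List Symb} {rs : List (Symb × Symb)}
    (H : Canon h w rs s) : RePairFrom h w rs s := by
  induction H with
  | done h => exact .done fun a b => by rw [freq_eq_cnt]; exact h a b
  | step hb _ ih =>
    refine .step (by rw [freq_eq_cnt]; exact hb.1)
      (fun a' b' => by rw [freq_eq_cnt, freq_eq_cnt]; exact (hb.2 a' b').1) ?_
    grind [replaceBigram_eq]

theorem Canon.unique {h : ℕ} {w s s' : List Symb} {rs rs' : List (Symb × Symb)}
    (H : Canon h w rs s) (H' : Canon h w rs' s') : rs = rs' ∧ s = s' := by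
  induction H generalizing rs' s' with
  | done h =>
    cases H' with
    | done => exact ⟨rfl, rfl⟩
    | step hb _ => exact absurd hb.1 (not_le.2 (h _ _))
  | step hb _ ih =>
    cases H' with
    | done h => exact absurd hb.1 (not_le.2 (h _ _))
    | step hb' H' =>
      obtain ⟨rfl, rfl⟩ := hb.unique hb'
      grind

/-- Each replacement removes at least two symbols. This bounds the number of rules by the length of
the text. -/
theorem Canon.length_add {h : ℕ} {w s : List Symb} {rs : List (Symb × Symb)}
    (H : Canon h w rs s) : s.length + 2 * rs.length ≤ w.length := by
  induction H with
  | done h => simp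
  | @step h w a b rs s hb _ ih =>
    have := length_repl (a := a) (b := b) (c := .var h) w
    have := hb.1
    grind

theorem exists_canon (w : List Symb) : ∀ h, ∃ rs s, Canon h w rs s := by
  generalize hl : w.length = l
  induction l using Nat.strong_induction_on generalizing w with
  | _ l ih =>
    intro h
    by_cases hc : ∃ a b, 2 ≤ cnt a b w
    · obtain ⟨a, b, hab⟩ := hc
      obtain ⟨a, b, hb⟩ := exists_best hab
      have := length_repl (a := a) (b := b) (c := .var h) w
      have := hb.1
      obtain ⟨rs, s, H⟩ := ih _ (by omega) (repl a b (.var h) w) rfl (h + 1)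
      exact ⟨_, _, .step hb H⟩
    · push Not at hc
      exact ⟨_, _, .done hc⟩

/-- RePair with the canonical resolution of the ties, as a function of the text. -/
noncomputable def repair (T : List ℕ) : RePairGrammar where
  rules := (exists_canon (T.map Symb.letter) 0).choose
  start := (exists_canon (T.map Symb.letter) 0).choose_spec.choose

theorem canon_repair (T : List ℕ) :
    Canon 0 (T.map Symb.letter) (repair T).rules (repair T).start :=
  (exists_canon (T.map Symb.letter) 0).choose_spec.choose_spec

theorem isRePair_repair (T : List ℕ) : IsRePair T (repair T) := (canon_repair T).rePairFrom

end RP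

namespace RP

/-! ### Run-length encoded grammars -/

/-- Tokens of a right-hand side: a run of `k` copies of the symbol `x`, or a variable. -/
inductive Tk where
  | run (x k : ℕ)
  | var (j : ℕ)

/-- The uncompressed right-hand side. -/
def items (r : List Tk) : List (ℕ ⊕ ℕ) :=
  r.flatMap fun t => match t with
    | .run x k => List.replicate k (.inl x)
    | .var j => [.inr j]

def iv (V : ℕ → List ℕ) : ℕ ⊕ ℕ → List ℕ
  | .inl x => [x]
  | .inr j => V j

/-- The string derived from a right-hand side, given the strings derived from the variables. -/
def iev (V : ℕ → List ℕ) (u : List (ℕ ⊕ ℕ)) : List ℕ := u.flatMap (iv V)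

@[simp] theorem items_nil : items [] = [] := rfl
@[simp] theorem items_append (r s : List Tk) : items (r ++ s) = items r ++ items s := by
  simp [items]
theorem items_run (x k : ℕ) (r : List Tk) :
    items (.run x k :: r) = List.replicate k (.inl x) ++ items r := rfl
theorem items_var (j : ℕ) (r : List Tk) : items (.var j :: r) = .inr j :: items r := rfl
@[simp] theorem iev_nil (V : ℕ → List ℕ) : iev V [] = [] := rfl
@[simp] theorem iev_append (V : ℕ → List ℕ) (u v : List (ℕ ⊕ ℕ)) :
    iev V (u ++ v) = iev V u ++ iev V v := by simp [iev]
@[simp] theorem iev_cons (V : ℕ → List ℕ) (t : ℕ ⊕ ℕ) (v : List (ℕ ⊕ ℕ)) :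
    iev V (t :: v) = iv V t ++ iev V v := by simp [iev]
@[simp] theorem iev_replicate (V : ℕ → List ℕ) (x k : ℕ) :
    iev V (List.replicate k (.inl x)) = List.replicate k x := by
  induction k with
  | zero => rfl
  | succ k ih => simp [List.replicate_succ, ih, iv]

theorem mem_items_var {r : List Tk} {j : ℕ} : (.inr j : ℕ ⊕ ℕ) ∈ items r ↔ Tk.var j ∈ r := by
  induction r with
  | nil => simp
  | cons t r ih => cases t <;> simp [items_run, items_var, ih]

/-- Every right-hand side consists of letters and of smaller variables that derive something. -/
structure Wf (n : ℕ) (U : ℕ → List (ℕ ⊕ ℕ)) (V : ℕ → List ℕ) : Prop where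
  val : ∀ i < n, V i = iev V (U i)
  ord : ∀ i < n, ∀ j, .inr j ∈ U i → j < i ∧ V j ≠ []

/-- What remains of a rule when runs have been popped at both ends. -/
structure Res where
  L : ℕ × ℕ
  R : ℕ × ℕ
  mid : List Tk

def tk (p : ℕ × ℕ) : List Tk := if p.2 = 0 then [] else [.run p.1 p.2]

theorem items_tk (p : ℕ × ℕ) : items (tk p) = List.replicate p.2 (.inl p.1) := by grind [tk, items]

/-- The state of the pass that pops runs: the run popped at the left end, the tokens emitted, the
pending run, and whether anything has left the pending position. -/
structure US where
  D : ℕ × ℕ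
  em : List Tk
  p : ℕ × ℕ
  sf : Bool

namespace US

def A (s : US) : List Tk := tk s.D ++ s.em ++ tk s.p

/-- The pending run leaves its position. It becomes the popped left run only if nothing has left
before it and its symbol may be popped; otherwise it is emitted. -/
def flush (pl : ℕ → Bool) (s : US) : US :=
  if s.p.2 = 0 then s
  else if s.sf = false ∧ pl s.p.1 = true then ⟨s.p, s.em, (s.p.1, 0), true⟩
  else ⟨s.D, s.em ++ [.run s.p.1 s.p.2], (s.p.1, 0), true⟩

def feedR (pl : ℕ → Bool) (s : US) (x k : ℕ) : US :=
  if k = 0 then s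
  else if s.p.2 ≠ 0 ∧ s.p.1 = x then { s with p := (x, s.p.2 + k) }
  else { flush pl s with p := (x, k) }

def feedV (pl : ℕ → Bool) (s : US) (j : ℕ) : US :=
  { flush pl s with em := (flush pl s).em ++ [.var j], sf := true }

/-- A variable is replaced by its popped left run, by itself unless nothing remains of it, and by
its popped right run. -/
def feed (pl : ℕ → Bool) (P : ℕ → Res) (s : US) : Tk → US
  | .run x k => feedR pl s x k
  | .var j =>
      let s₁ := feedR pl s (P j).L.1 (P j).L.2
      let s₂ := if (P j).mid = [] then s₁ else feedV pl s₁ j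
      feedR pl s₂ (P j).R.1 (P j).R.2

/-- The run still pending at the end is the rightmost one. If it is also the first, it goes to the
left when the left test allows this, so that a rule consisting of a single run is not popped twice.
-/
def fin (pl pr : ℕ → Bool) (s : US) : Res :=
  if s.p.2 = 0 then ⟨s.D, (0, 0), s.em⟩
  else if s.sf = false ∧ pl s.p.1 = true then ⟨s.p, (0, 0), s.em⟩
  else if pr s.p.1 = true then ⟨s.D, s.p, s.em⟩
  else ⟨s.D, (0, 0), s.em ++ [.run s.p.1 s.p.2]⟩

def init : US := ⟨(0, 0), [], (0, 0), false⟩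

/-- Adjacent runs have different symbols. -/
def CR : Tk → Tk → Prop
  | .run x _, .run y _ => x ≠ y
  | _, _ => True

def Can (A : List Tk) : Prop := (∀ x k, Tk.run x k ∈ A → 0 < k) ∧ A.IsChain CR

/-- `last` keeps the list canonical: without a pending run the list is empty or ends in a variable,
so a new run has nothing to merge with. `left` says that if nothing was popped on the left, this was
because the first token could not be popped. -/
structure Inv (pl : ℕ → Bool) (s : US) : Prop where
  start : s.sf = false → s.D.2 = 0 ∧ s.em = []
  last : s.p.2 = 0 → s.A = [] ∨ ∃ A₀ j, s.A = A₀ ++ [.var j]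
  can : Can s.A
  left : s.D.2 = 0 → (∀ x k, s.em.head? = some (.run x k) → pl x = false) ∧
    (s.sf = true → s.em ≠ [])
  popped : s.D.2 ≠ 0 → pl s.D.1 = true

theorem Inv.init (pl : ℕ → Bool) : Inv pl init :=
  ⟨by simp [US.init], by simp [US.init, A, tk], by simp [Can, US.init, A, tk],
    by simp [US.init], by simp [US.init]⟩

theorem A_flush {pl : ℕ → Bool} {s : US} (h : s.sf = false → s.D.2 = 0 ∧ s.em = []) :
    (flush pl s).A = s.A := by grind [flush, A, tk]

theorem flush_p {pl : ℕ → Bool} {s : US} : (flush pl s).p.2 = 0 := by grind [flush]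

theorem flush_start {pl : ℕ → Bool} {s : US} (h : s.sf = false → s.D.2 = 0 ∧ s.em = []) :
    (flush pl s).sf = false → (flush pl s).D.2 = 0 ∧ (flush pl s).em = [] := by grind [flush]

theorem flush_left {pl : ℕ → Bool} {s : US} (hs : s.sf = false → s.D.2 = 0 ∧ s.em = [])
    (h : s.D.2 = 0 → (∀ x k, s.em.head? = some (.run x k) → pl x = false) ∧
      (s.sf = true → s.em ≠ [])) :
    (flush pl s).D.2 = 0 →
      (∀ x k, (flush pl s).em.head? = some (.run x k) → pl x = false) ∧
      ((flush pl s).sf = true → (flush pl s).em ≠ []) := by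
  unfold flush
  split_ifs with h0 h1
  · exact h
  · exact fun h2 => absurd h2 h0
  · intro h2
    obtain ⟨h3, h4⟩ := h h2
    refine ⟨fun x k hx => ?_, fun _ => by simp⟩
    by_cases he : s.em = []
    · simp_all
    · rw [List.head?_append_of_ne_nil _ he] at hx
      exact h3 x k hx

theorem flush_popped {pl : ℕ → Bool} {s : US} (h : s.D.2 ≠ 0 → pl s.D.1 = true) :
    (flush pl s).D.2 ≠ 0 → pl (flush pl s).D.1 = true := by grind [flush]

theorem feedR_cases {pl : ℕ → Bool} {s : US} (h : Inv pl s) (x k : ℕ) :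
    (k = 0 ∧ (feedR pl s x k) = s) ∨
    (0 < k ∧ (feedR pl s x k).p.2 ≠ 0 ∧ (feedR pl s x k).p.1 = x ∧
      ((∃ A₀ l, 0 < l ∧ s.A = A₀ ++ [.run x l] ∧ (feedR pl s x k).A = A₀ ++ [.run x (l + k)]) ∨
      ((feedR pl s x k).A = s.A ++ [.run x k] ∧ ∀ A₀ l, s.A ≠ A₀ ++ [.run x l]))) := by
  unfold feedR
  split_ifs with h0 h1
  · exact Or.inl ⟨h0, rfl⟩
  · grind [tk, A]
  · refine Or.inr ⟨by omega, by simpa using h0, rfl, Or.inr ⟨?_, ?_⟩⟩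
    · have := A_flush (pl := pl) h.start
      grind [A, tk, flush_p]
    · intro A₀ l hA
      by_cases hp : s.p.2 = 0
      · rcases h.last hp with h2 | ⟨A₁, j, h2⟩
        · simp_all
        simp_all
      · have h2 : s.p.1 ≠ x := fun hc => h1 ⟨hp, hc⟩
        simp only [A, tk, hp, if_false] at hA
        have := (List.append_inj' hA rfl).2
        simp_all

theorem items_feedR {pl : ℕ → Bool} {s : US} (h : Inv pl s) (x k : ℕ) :
    items (feedR pl s x k).A = items s.A ++ List.replicate k (.inl x) := by
  rcases feedR_cases h x k with ⟨rfl, h1⟩ | ⟨-, -, -, ⟨A₀, l, -, h2, h3⟩ | ⟨h2, -⟩⟩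
  · simp [h1]
  · simp_all [items_append, items_run, items_nil]
  · rw [h2]; simp [items]

theorem Can.append_run {A₀ : List Tk} {x k : ℕ} (h : Can A₀) (hk : 0 < k)
    (hne : ∀ A₁ l, A₀ ≠ A₁ ++ [.run x l]) : Can (A₀ ++ [.run x k]) := by
  refine ⟨fun y l hy => ?_, List.isChain_append.2 ⟨h.2, by simp, fun t ht u hu => ?_⟩⟩
  · simp only [List.mem_append, List.mem_singleton, Tk.run.injEq] at hy
    rcases hy with hy | ⟨rfl, rfl⟩
    · exact h.1 y l hy
    · exact hk
  · simp only [List.head?_cons, Option.mem_def, Option.some.injEq] at hu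
    subst hu
    cases t with
    | run y l =>
      rintro rfl
      obtain ⟨A₁, hA⟩ := List.getLast?_eq_some_iff.1 ht
      exact hne A₁ l hA
    | var j => trivial

theorem Can.append_var {A₀ : List Tk} {j : ℕ} (h : Can A₀) : Can (A₀ ++ [.var j]) := by
  refine ⟨fun y l hy => ?_, List.isChain_append.2 ⟨h.2, by simp, fun t ht u hu => ?_⟩⟩
  · simp only [List.mem_append, List.mem_singleton, reduceCtorEq, or_false] at hy
    exact h.1 y l hy
  · simp only [List.head?_cons, Option.mem_def, Option.some.injEq] at hu
    subst hu
    cases t <;> trivial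

theorem isChain_replace_last {α : Type*} {R : α → α → Prop} {A₀ : List α} {t u : α}
    (h : (A₀ ++ [t]).IsChain R) (htu : ∀ v, R v t → R v u) : (A₀ ++ [u]).IsChain R := by
  rw [List.isChain_append] at h ⊢
  simp_all

theorem Can.merge {A₀ : List Tk} {x l k : ℕ} (h : Can (A₀ ++ [.run x l])) :
    Can (A₀ ++ [.run x (l + k)]) := by
  have hl : 0 < l := h.1 x l (by simp)
  refine ⟨fun y m hy => ?_, isChain_replace_last h.2 fun v hv => ?_⟩
  · simp only [List.mem_append, List.mem_singleton, Tk.run.injEq] at hy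
    rcases hy with hy | ⟨rfl, rfl⟩
    · exact h.1 y m (by simp [hy])
    · omega
  · cases v with
    | run y m => exact hv
    | var j => trivial

theorem Inv.feedR {pl : ℕ → Bool} {s : US} (h : Inv pl s) (x k : ℕ) :
    Inv pl (feedR pl s x k) := by
  have hcan : Can (US.feedR pl s x k).A := by
    rcases feedR_cases h x k with ⟨rfl, h1⟩ | ⟨hk, -, -, ⟨A₀, l, -, h2, h3⟩ | ⟨h2, h3⟩⟩
    · rw [h1]; exact h.can
    · rw [h3]; exact Can.merge (h2 ▸ h.can)
    · rw [h2]; exact h.can.append_run hk h3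
  refine ⟨?_, ?_, hcan, ?_, ?_⟩
  all_goals unfold US.feedR
  all_goals split_ifs with h0 h1
  · exact h.start
  · exact h.start
  · exact flush_start h.start
  · exact h.last
  · simp_all
  · exact fun hc => absurd hc h0
  · exact h.left
  · exact h.left
  · exact flush_left h.start h.left
  · exact h.popped
  · exact h.popped
  · exact flush_popped h.popped

theorem A_feedV {pl : ℕ → Bool} {s : US} (h : Inv pl s) (j : ℕ) :
    (feedV pl s j).A = s.A ++ [.var j] := by
  have e := A_flush (pl := pl) h.start
  have hp : tk (flush pl s).p = [] := by simp [tk, flush_p]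
  calc (feedV pl s j).A = tk (flush pl s).D ++ ((flush pl s).em ++ [.var j]) ++ tk (flush pl s).p := rfl
    _ = _ := by rw [← e]; simp [A, hp]

theorem Inv.feedV {pl : ℕ → Bool} {s : US} (h : Inv pl s) (j : ℕ) : Inv pl (feedV pl s j) := by
  refine ⟨by simp [US.feedV], fun _ => Or.inr ⟨_, j, A_feedV h j⟩,
    by rw [A_feedV h j]; exact h.can.append_var, fun h0 => ?_, flush_popped h.popped⟩
  obtain ⟨h1, h2⟩ := flush_left h.start h.left h0
  refine ⟨fun x k hx => ?_, fun _ => by simp [US.feedV]⟩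
  simp only [US.feedV] at hx
  by_cases he : (flush pl s).em = []
  · simp [he] at hx
  · rw [List.head?_append_of_ne_nil _ he] at hx
    exact h1 x k hx

/-- The right-hand side after the popped runs of the variables have been inserted. -/
def expand (P : ℕ → Res) (u : List (ℕ ⊕ ℕ)) : List (ℕ ⊕ ℕ) :=
  u.flatMap fun t => match t with
    | .inl x => [.inl x]
    | .inr j => List.replicate (P j).L.2 (.inl (P j).L.1) ++
        (if (P j).mid = [] then [] else [.inr j]) ++ List.replicate (P j).R.2 (.inl (P j).R.1)

@[simp] theorem expand_append (P : ℕ → Res) (u v : List (ℕ ⊕ ℕ)) :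
    expand P (u ++ v) = expand P u ++ expand P v := by simp [expand]

theorem expand_replicate (P : ℕ → Res) (x k : ℕ) :
    expand P (List.replicate k (.inl x)) = List.replicate k (.inl x) := by
  induction k with
  | zero => rfl
  | succ k ih =>
    rw [List.replicate_succ, ← List.singleton_append, expand_append, ih]; rfl

theorem Inv.feed {pl : ℕ → Bool} {P : ℕ → Res} {s : US} (h : Inv pl s) (t : Tk) :
    Inv pl (feed pl P s t) ∧ items (feed pl P s t).A = items s.A ++ expand P (items [t]) := by
  cases t with
  | run x k =>
    refine ⟨h.feedR x k, ?_⟩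
    rw [items_run, items_nil, List.append_nil, expand_replicate]
    exact items_feedR h x k
  | var j =>
    have h1 := h.feedR (P j).L.1 (P j).L.2
    have e1 := items_feedR h (P j).L.1 (P j).L.2
    simp only [US.feed]
    split_ifs with hm
    · refine ⟨h1.feedR _ _, ?_⟩
      grind [items_feedR, expand, items]
    · have h2 := h1.feedV j
      refine ⟨h2.feedR _ _, ?_⟩
      grind [items_feedR, A_feedV, items_append, expand, items]

theorem Inv.foldl {pl : ℕ → Bool} {P : ℕ → Res} (r : List Tk) :
    ∀ {s : US}, Inv pl s → Inv pl (r.foldl (US.feed pl P) s) ∧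
      items (r.foldl (US.feed pl P) s).A = items s.A ++ expand P (items r) := by
  induction r with
  | nil => intro s h; simp [h, expand]
  | cons t r ih =>
    intro s h
    obtain ⟨h1, e1⟩ := h.feed (P := P) t
    obtain ⟨h2, e2⟩ := ih h1
    refine ⟨h2, ?_⟩
    rw [List.foldl_cons, e2, e1, ← List.singleton_append (l := r), items_append, expand_append,
      List.append_assoc]

theorem A_fin {pl pr : ℕ → Bool} {s : US} (h : Inv pl s) :
    s.A = tk (fin pl pr s).L ++ (fin pl pr s).mid ++ tk (fin pl pr s).R := by
  unfold fin
  split_ifs with h0 h1 h2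
  · simp [A, tk, h0]
  · obtain ⟨h3, h4⟩ := h.start h1.1
    simp [A, tk, h3, h4]
  · rfl
  · simp [A, tk, h0]

theorem fin_left {pl pr : ℕ → Bool} {s : US} (h : Inv pl s) (h0 : (fin pl pr s).L.2 = 0) :
    ∀ x k, (fin pl pr s).mid.head? = some (.run x k) → pl x = false := by
  revert h0
  unfold fin
  split_ifs with h0 h1 h2
  · exact fun h3 => (h.left h3).1
  · exact fun h3 => absurd h3 h0
  · exact fun h3 => (h.left h3).1
  · intro h3 x k hx
    have hl := flush_left (pl := pl) h.start h.left
    grind [flush]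

theorem fin_left_popped {pl pr : ℕ → Bool} {s : US} (h : Inv pl s)
    (h0 : (fin pl pr s).L.2 ≠ 0) : pl (fin pl pr s).L.1 = true := by
  revert h0
  unfold fin
  split_ifs with h0 h1 h2
  · exact h.popped
  · exact fun _ => h1.2
  · exact h.popped
  · exact h.popped

theorem fin_right_popped {pl pr : ℕ → Bool} {s : US}
    (h0 : (fin pl pr s).R.2 ≠ 0) : pr (fin pl pr s).R.1 = true := by grind [fin]

theorem fin_right {pl pr : ℕ → Bool} {s : US} (h : Inv pl s) (h0 : (fin pl pr s).R.2 = 0) :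
    ∀ x k, (fin pl pr s).mid.getLast? = some (.run x k) → pr x = false := by
  revert h0
  unfold fin
  split_ifs with h0 h1 h2
  · intro _ x k hx
    rcases h.last h0 with h3 | ⟨A₀, j, h3⟩
    · grind [A, tk]
    · obtain ⟨E, hE⟩ := List.getLast?_eq_some_iff.1 hx
      have hE : s.em = E ++ [.run x k] := hE
      simp only [A, tk, h0, if_true, List.append_nil] at h3
      rw [hE, ← List.append_assoc] at h3
      have := (List.append_inj' h3 rfl).2
      simp at this
  · simp [(h.start h1.1).2]
  · exact fun h3 => absurd h3 h0
  simp_all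

end US

/-- One rule of a pass that pops the leftmost run if `pl` holds for its symbol, and the rightmost
run if `pr` does. -/
def uncRule (pl pr : ℕ → Bool) (P : ℕ → Res) (r : List Tk) : Res :=
  US.fin pl pr (r.foldl (US.feed pl P) US.init)

def rep (p : ℕ × ℕ) : List ℕ := List.replicate p.2 p.1

/-- The result of a pass over a grammar. -/
structure Unc (n : ℕ) (pl pr : ℕ → ℕ → Bool) (G : ℕ → List Tk) (P : ℕ → Res) : Prop where
  eq : ∀ i < n, P i = uncRule (pl i) (pr i) P (G i)

theorem Unc.split_items {n : ℕ} {pl pr : ℕ → ℕ → Bool} {G : ℕ → List Tk} {P : ℕ → Res}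
    (h : Unc n pl pr G P) {i : ℕ} (hi : i < n) :
    List.replicate (P i).L.2 (.inl (P i).L.1) ++ items (P i).mid ++
      List.replicate (P i).R.2 (.inl (P i).R.1) = US.expand P (items (G i)) ∧
    US.Can (tk (P i).L ++ (P i).mid ++ tk (P i).R) := by
  obtain ⟨h1, h2⟩ := US.Inv.foldl (P := P) (G i) (US.Inv.init (pl i))
  have h3 := US.A_fin (pr := pr i) h1
  have h4 := h.eq i hi
  unfold uncRule at h4
  rw [← h4] at h3
  constructor
  · rw [h3, show US.init.A = [] from rfl] at h2
    grind [items_append, items_tk, items_nil]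
  · rw [← h3]; exact h1.can

/-- The strings derived after the pass. -/
def trim (V : ℕ → List ℕ) (P : ℕ → Res) (i : ℕ) : List ℕ :=
  ((V i).drop (P i).L.2).take ((V i).length - (P i).L.2 - (P i).R.2)

theorem trim_eq {V : ℕ → List ℕ} {P : ℕ → Res} {i : ℕ} {m : List ℕ}
    (h : V i = rep (P i).L ++ m ++ rep (P i).R) : trim V P i = m := by simp_all [trim, rep]

structure Unc.Val (n : ℕ) (V : ℕ → List ℕ) (P : ℕ → Res) (i : ℕ) : Prop where
  split : V i = rep (P i).L ++ trim V P i ++ rep (P i).R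
  val : trim V P i = iev (trim V P) (items (P i).mid)
  nil : (P i).mid = [] ↔ trim V P i = []
  mem : ∀ j, .inr j ∈ items (P i).mid → j < i ∧ trim V P j ≠ []

/-- The variables of a right-hand side. -/
def vars (u : List (ℕ ⊕ ℕ)) : List ℕ := u.filterMap Sum.getRight?

@[simp] theorem vars_nil : vars [] = [] := rfl
@[simp] theorem vars_append (u v : List (ℕ ⊕ ℕ)) : vars (u ++ v) = vars u ++ vars v := by
  simp [vars]
@[simp] theorem vars_inl (x : ℕ) (u : List (ℕ ⊕ ℕ)) : vars (.inl x :: u) = vars u := rfl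
@[simp] theorem vars_inr (j : ℕ) (u : List (ℕ ⊕ ℕ)) : vars (.inr j :: u) = j :: vars u := rfl
@[simp] theorem vars_replicate (x k : ℕ) : vars (List.replicate k (.inl x)) = [] := by
  induction k with
  | zero => rfl
  | succ k ih => simpa [List.replicate_succ] using ih

theorem mem_vars {u : List (ℕ ⊕ ℕ)} {j : ℕ} : j ∈ vars u ↔ .inr j ∈ u := by
  induction u with
  | nil => simp
  | cons t u ih => cases t <;> simp [ih]

theorem vars_expand {P : ℕ → Res} (u : List (ℕ ⊕ ℕ)) :
    vars (US.expand P u) = (vars u).filter fun j => !(P j).mid.isEmpty := by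
  induction u with
  | nil => rfl
  | cons t u ih =>
    rw [← List.singleton_append, US.expand_append, vars_append, ih]
    cases t with
    | inl x => simp [US.expand]
    | inr k =>
      by_cases hk : (P k).mid = [] <;> simp [US.expand, hk]

/-- Popping never creates occurrences of variables; it only deletes those of emptied variables.
Bounds for the number of variables per rule therefore persist. -/
theorem Unc.vars_mid {n : ℕ} {pl pr : ℕ → ℕ → Bool} {G : ℕ → List Tk} {P : ℕ → Res}
    (h : Unc n pl pr G P) {i : ℕ} (hi : i < n) :
    vars (items (P i).mid) = (vars (items (G i))).filter fun j => !(P j).mid.isEmpty := by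
  rw [← vars_expand, ← (h.split_items hi).1]
  simp

theorem iev_expand {V V' : ℕ → List ℕ} {P : ℕ → Res} {u : List (ℕ ⊕ ℕ)}
    (h : ∀ j, .inr j ∈ u → V j = rep (P j).L ++ V' j ++ rep (P j).R ∧ ((P j).mid = [] → V' j = [])) :
    iev V' (US.expand P u) = iev V u := by
  induction u with
  | nil => simp [US.expand]
  | cons t u ih =>
    have ih := ih fun j hj => h j (by simp [hj])
    grind [US.expand_append, iev_append, US.expand, iv, iev_replicate, iev_cons, iev_nil, rep]

theorem iev_eq_nil {V : ℕ → List ℕ} {u : List (ℕ ⊕ ℕ)} (h : ∀ j, .inr j ∈ u → V j ≠ []) :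
    iev V u = [] ↔ u = [] := by
  constructor
  · intro h0
    cases u with
    | nil => rfl
    | cons t u =>
      simp only [iev_cons, List.append_eq_nil_iff] at h0
      grind [iv]
  · rintro rfl; rfl

theorem items_eq_nil {r : List Tk} (h : ∀ x k, Tk.run x k ∈ r → 0 < k) : items r = [] ↔ r = [] := by
  constructor
  · intro h0
    cases r with
    | nil => rfl
    | cons t u =>
      cases t with
      | run x k =>
        have := h x k (by simp)
        simp [items_run] at h0; omega
      | var j => simp [items_var] at h0
  · rintro rfl; rfl

theorem US.Can.of_infix {A B D : List Tk} (h : US.Can (A ++ B ++ D)) : US.Can B :=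
  ⟨fun x k hx => h.1 x k (by simp [hx]),
    (List.isChain_append.1 (List.isChain_append.1 h.2).1).2.1⟩

/-- Strong induction on the index. Inserting the popped runs of the smaller variables leaves the
derived string unchanged; the popped runs of the rule are then its two ends, and the tokens in
between derive the rest. -/
theorem Unc.vals {n : ℕ} {pl pr : ℕ → ℕ → Bool} {G : ℕ → List Tk} {P : ℕ → Res} {V : ℕ → List ℕ}
    (h : Unc n pl pr G P) (hw : Wf n (fun i => items (G i)) V) :
    ∀ i < n, Unc.Val n V P i := by
  intro i
  induction i using Nat.strong_induction_on with
  | _ i ih =>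
    intro hi
    obtain ⟨e1, hc⟩ := h.split_items hi
    have e2 : iev (trim V P) (US.expand P (items (G i))) = V i := by
      rw [iev_expand (V := V), ← hw.val i hi]
      intro j hj
      have hj' := hw.ord i hi j hj
      have hv := ih j hj'.1 (by omega)
      exact ⟨hv.split, hv.nil.1⟩
    rw [← e1] at e2
    simp only [iev_append, iev_replicate] at e2
    have e3 := trim_eq e2.symm
    have hmem : ∀ j, .inr j ∈ items (P i).mid → j < i ∧ trim V P j ≠ [] := by
      intro j hj
      rw [← mem_vars, h.vars_mid hi, List.mem_filter, mem_vars] at hj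
      have hj' := hw.ord i hi j hj.1
      have hv := ih j hj'.1 (by omega)
      exact ⟨hj'.1, fun h0 => by simpa [hv.nil.2 h0] using hj.2⟩
    refine ⟨by rw [e3]; exact e2.symm, e3, ?_, hmem⟩
    rw [e3, iev_eq_nil fun j hj => (hmem j hj).2, items_eq_nil hc.of_infix.1]

theorem Unc.wf {n : ℕ} {pl pr : ℕ → ℕ → Bool} {G : ℕ → List Tk} {P : ℕ → Res} {V : ℕ → List ℕ}
    (h : Unc n pl pr G P) (hw : Wf n (fun i => items (G i)) V) :
    Wf n (fun i => items (P i).mid) (trim V P) :=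
  ⟨fun i hi => (h.vals hw i hi).val, fun i hi => (h.vals hw i hi).mem⟩

theorem Unc.top {n : ℕ} {pl pr : ℕ → ℕ → Bool} {G : ℕ → List Tk} {P : ℕ → Res} {V : ℕ → List ℕ}
    (h : Unc n pl pr G P) (hw : Wf n (fun i => items (G i)) V) {i : ℕ} (hi : i < n)
    (hpl : ∀ x, pl i x = false) (hpr : ∀ x, pr i x = false) : trim V P i = V i := by
  have h1 := (US.Inv.foldl (P := P) (G i) (US.Inv.init (pl i))).1
  have h2 := US.fin_left_popped (pr := pr i) h1
  have h3 := US.fin_right_popped (pl := pl i) (pr := pr i) (s := (G i).foldl (US.feed (pl i) P) US.init)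
  have h4 := h.eq i hi
  unfold uncRule at h4
  rw [← h4, hpl] at h2
  rw [← h4, hpr] at h3
  have h5 := (h.vals hw i hi).split
  grind [rep]

/-- The first symbol derived by a token. -/
def hdv (V : ℕ → List ℕ) : Tk → Option ℕ
  | .run x _ => some x
  | .var j => (V j).head?

def lsv (V : ℕ → List ℕ) : Tk → Option ℕ
  | .run x _ => some x
  | .var j => (V j).getLast?

theorem head?_iev {V : ℕ → List ℕ} {r : List Tk} (h : ∀ x k, Tk.run x k ∈ r → 0 < k)
    (hv : ∀ j, Tk.var j ∈ r → V j ≠ []) : (iev V (items r)).head? = r.head?.bind (hdv V) := by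
  cases r with
  | nil => rfl
  | cons t r =>
    cases t with
    | run x k =>
      have := h x k (by simp)
      obtain ⟨k, rfl⟩ := Nat.exists_eq_add_of_lt this
      simp [items_run, hdv, List.replicate_succ, iv]
    | var j =>
      have := hv j (by simp)
      simp [items_var, hdv, iv, List.head?_append_of_ne_nil _ this]

theorem getLast?_iev {V : ℕ → List ℕ} {r : List Tk} (h : ∀ x k, Tk.run x k ∈ r → 0 < k)
    (hv : ∀ j, Tk.var j ∈ r → V j ≠ []) :
    (iev V (items r)).getLast? = r.getLast?.bind (lsv V) := by
  rcases List.eq_nil_or_concat r with rfl | ⟨r, t, rfl⟩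
  · rfl
  · rw [List.concat_eq_append] at *
    rw [items_append, iev_append, List.getLast?_append]
    cases t with
    | run x k =>
      have := h x k (by simp)
      obtain ⟨k, rfl⟩ := Nat.exists_eq_add_of_lt this
      simp [items_run, lsv, List.getLast?_replicate]
    | var j =>
      have := hv j (by simp)
      simp [items_var, lsv, iv, List.getLast?_eq_getLast_of_ne_nil this]

end RP

namespace RP

/-! ### Popping all runs -/

/-- The strings derived from adjacent tokens do not share a run. -/
def VR (V : ℕ → List ℕ) (t u : Tk) : Prop := ∀ x, lsv V t = some x → hdv V u ≠ some x

namespace US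

theorem chain_feedR {V : ℕ → List ℕ} {pl : ℕ → Bool} {s : US} (h : Inv pl s)
    (hc : s.A.IsChain (VR V)) {x k : ℕ}
    (hl : ∀ j, s.A.getLast? = some (.var j) → (V j).getLast? ≠ some x) :
    (feedR pl s x k).A.IsChain (VR V) := by
  rcases feedR_cases h x k with ⟨rfl, h1⟩ | ⟨hk, -, -, ⟨A₀, l, -, h2, h3⟩ | ⟨h2, h3⟩⟩
  · rw [h1]; exact hc
  · rw [h3]; exact isChain_replace_last (t := .run x l) (by rw [← h2]; exact hc) fun v hv => hv
  · rw [h2]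
    refine List.isChain_append.2 ⟨hc, by simp, fun t ht u hu => ?_⟩
    simp only [List.head?_cons, Option.mem_def, Option.some.injEq] at hu
    subst hu
    intro y hy
    simp only [hdv, ne_eq, Option.some.injEq]
    rintro rfl
    cases t with
    | run z l =>
      simp only [lsv, Option.some.injEq] at hy
      subst hy
      obtain ⟨A₁, hA⟩ := List.getLast?_eq_some_iff.1 ht
      exact h3 A₁ l hA
    | var j => exact hl j ht hy

theorem chain_feedV {V : ℕ → List ℕ} {pl : ℕ → Bool} {s : US} (h : Inv pl s)
    (hc : s.A.IsChain (VR V)) {j : ℕ}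
    (hl : ∀ t, s.A.getLast? = some t → ∀ x, lsv V t = some x → (V j).head? ≠ some x) :
    (feedV pl s j).A.IsChain (VR V) := by
  rw [A_feedV h]
  refine List.isChain_append.2 ⟨hc, by simp, fun t ht u hu => ?_⟩
  simp only [List.head?_cons, Option.mem_def, Option.some.injEq] at hu
  subst hu
  exact hl t ht

theorem getLast?_A {s : US} (h : s.p.2 ≠ 0) : s.A.getLast? = some (.run s.p.1 s.p.2) := by
  simp [A, tk, h]

theorem flush_sf {pl : ℕ → Bool} (hpl : ∀ x, pl x = true) {s : US}
    (hs : s.sf = true → s.D.2 ≠ 0) : (flush pl s).sf = true → (flush pl s).D.2 ≠ 0 := by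
  grind [flush]

theorem feedR_sf {pl : ℕ → Bool} (hpl : ∀ x, pl x = true) {s : US} {x k : ℕ}
    (hs : s.sf = true → s.D.2 ≠ 0) :
    (feedR pl s x k).sf = true → (feedR pl s x k).D.2 ≠ 0 := by grind [feedR, flush_sf]

theorem feedV_sf {pl : ℕ → Bool} (hpl : ∀ x, pl x = true) {s : US} {j : ℕ} (hp : s.p.2 ≠ 0)
    (hs : s.sf = true → s.D.2 ≠ 0) :
    (feedV pl s j).sf = true → (feedV pl s j).D.2 ≠ 0 := by
  intro _
  refine flush_sf hpl hs ?_
  grind [flush]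

/-- The invariant of the pass that pops all runs. -/
structure Full (V : ℕ → List ℕ) (pl : ℕ → Bool) (s : US) : Prop where
  inv : Inv pl s
  last : s.A = [] ∨ s.p.2 ≠ 0
  sf : (∀ x, pl x = true) → s.sf = true → s.D.2 ≠ 0
  chain : s.A.IsChain (VR V)

theorem feedR_p {pl : ℕ → Bool} {s : US} (h : Inv pl s) {x k : ℕ} (hk : k ≠ 0) :
    (feedR pl s x k).p.2 ≠ 0 ∧ (feedR pl s x k).p.1 = x := by grind [feedR_cases]

theorem Full.feedR {V : ℕ → List ℕ} {pl : ℕ → Bool} {s : US} (h : Full V pl s) {x k : ℕ} :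
    Full V pl (feedR pl s x k) := by
  refine ⟨h.inv.feedR x k, ?_, fun hpl => feedR_sf hpl (h.sf hpl),
    chain_feedR h.inv h.chain fun j hj => ?_⟩
  · by_cases hk : k = 0
    · simpa [US.feedR, hk] using h.last
    · exact Or.inr (feedR_p h.inv hk).1
  · rcases h.last with h1 | h1
    · simp [h1] at hj
    · simp [getLast?_A h1] at hj

/-- A surviving variable arrives between its own popped runs, which are non-empty and which its
remaining string does not continue. So it shares no run with its neighbours, and a run is pending
again afterwards. -/
theorem Full.feed {V : ℕ → List ℕ} {pl : ℕ → Bool} {P : ℕ → Res} {s : US} (h : Full V pl s) {t : Tk}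
    (ht : ∀ j, t = .var j → ((P j).mid ≠ [] → (P j).L.2 ≠ 0 ∧ (P j).R.2 ≠ 0 ∧
      (V j).head? ≠ some (P j).L.1 ∧ (V j).getLast? ≠ some (P j).R.1)) :
    Full V pl (feed pl P s t) := by
  cases t with
  | run x k => exact h.feedR
  | var j =>
    have h1 : Full V pl (US.feedR pl s (P j).L.1 (P j).L.2) := h.feedR
    simp only [US.feed]
    split_ifs with hm
    · exact h1.feedR
    · obtain ⟨hL, hR, hh, hl⟩ := ht j rfl hm
      have h2 := feedR_p (pl := pl) h.inv (x := (P j).L.1) hL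
      have h3 := h1.inv.feedV j
      have c3 : (US.feedV pl (US.feedR pl s (P j).L.1 (P j).L.2) j).A.IsChain (VR V) := by
        refine chain_feedV h1.inv h1.chain fun t ht x hx => ?_
        grind [getLast?_A, lsv]
      refine ⟨h3.feedR _ _, Or.inr (feedR_p h3 hR).1,
        fun hpl => feedR_sf hpl (feedV_sf hpl h2.1 (h1.sf hpl)), chain_feedR h3 c3 fun k hk => ?_⟩
      rw [A_feedV h1.inv] at hk
      simp_all

theorem Full.foldl {V : ℕ → List ℕ} {pl : ℕ → Bool} {P : ℕ → Res} (r : List Tk)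
    (ht : ∀ j, Tk.var j ∈ r → ((P j).mid ≠ [] → (P j).L.2 ≠ 0 ∧ (P j).R.2 ≠ 0 ∧
      (V j).head? ≠ some (P j).L.1 ∧ (V j).getLast? ≠ some (P j).R.1)) :
    ∀ {s : US}, Full V pl s → Full V pl (r.foldl (US.feed pl P) s) := by
  induction r with
  | nil => exact fun h => h
  | cons t r ih =>
    intro s h
    exact ih (fun j hj => ht j (by simp [hj])) (h.feed fun j hj => ht j (by simp [hj]))

theorem Full.init (V : ℕ → List ℕ) (pl : ℕ → Bool) : Full V pl init :=
  ⟨Inv.init pl, Or.inl rfl, fun _ => by simp [US.init], by simp [A, tk, US.init]⟩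

end US

/-- Both claims are proved by one induction on the index: that the popped runs are maximal at both
ends of the smaller variables gives the chain condition in the current rule, and the chain condition
at the two ends gives maximality for the current variable. -/
theorem Unc.popAll {n : ℕ} {pl pr : ℕ → ℕ → Bool} {G : ℕ → List Tk} {P : ℕ → Res} {V : ℕ → List ℕ}
    (h : Unc n pl pr G P) (hw : Wf n (fun i => items (G i)) V)
    (hall : ∀ i, i + 1 < n → ∀ x, pl i x = true ∧ pr i x = true) :
    ∀ i < n, (P i).mid.IsChain (VR (trim V P)) ∧
      (i + 1 < n → trim V P i ≠ [] → (P i).L.2 ≠ 0 ∧ (P i).R.2 ≠ 0 ∧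
        (trim V P i).head? ≠ some (P i).L.1 ∧ (trim V P i).getLast? ≠ some (P i).R.1) := by
  intro i
  induction i using Nat.strong_induction_on with
  | _ i ih =>
    intro hi
    have hF : US.Full (trim V P) (pl i) ((G i).foldl (US.feed (pl i) P) US.init) := by
      refine US.Full.foldl (G i) (fun j hj hm => ?_) (US.Full.init _ _)
      have hj' := (hw.ord i hi j (mem_items_var.2 hj)).1
      exact (ih j hj' (by omega)).2 (by omega) fun h0 => hm ((h.vals hw j (by omega)).nil.2 h0)
    have hA := US.A_fin (pr := pr i) hF.inv
    have he := h.eq i hi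
    unfold uncRule at he
    have hv := h.vals hw i hi
    have hchain := hF.chain
    have hcan := hF.inv.can
    rw [hA, ← he] at hchain hcan
    refine ⟨(List.isChain_append.1 (List.isChain_append.1 hchain).1).2.1, fun hi1 hne => ?_⟩
    have hpl := fun x => (hall i hi1 x).1
    have hpr := fun x => (hall i hi1 x).2
    have hm : (P i).mid ≠ [] := fun hc => hne (hv.nil.1 hc)
    have hLR : (P i).L.2 ≠ 0 ∧ (P i).R.2 ≠ 0 := by
      rw [he] at hm ⊢
      revert hm
      unfold US.fin
      split_ifs with h0 h1 h2
      · intro hm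
        rcases hF.last with h3 | h3
        · simp_all [US.A]
        omega
      · exact fun hm => absurd (hF.inv.start h1.1).2 hm
      · intro hm
        refine ⟨hF.sf hpl ?_, h0⟩
        simp_all
      · exact absurd (hpr _) h2
    have hpos := hcan.of_infix.1
    have hvn : ∀ j, Tk.var j ∈ (P i).mid → trim V P j ≠ [] := fun j hj =>
      (hv.mem j (mem_items_var.2 hj)).2
    refine ⟨hLR.1, hLR.2, ?_, ?_⟩
    · rw [hv.val, head?_iev hpos hvn]
      obtain ⟨t, r, hr⟩ := List.exists_cons_of_ne_nil hm
      rw [hr] at hchain ⊢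
      have h1 := (List.isChain_append.1 (List.isChain_append.1 hchain).1).2.2
      rw [tk, if_neg hLR.1] at h1
      exact h1 _ rfl t rfl _ rfl
    · rw [hv.val, getLast?_iev hpos hvn]
      obtain ⟨t, ht⟩ : ∃ t, (P i).mid.getLast? = some t := ⟨_, List.getLast?_eq_getLast_of_ne_nil hm⟩
      have h1 := (List.isChain_append.1 hchain).2.2 t (by simp_all) (.run (P i).R.1 (P i).R.2) (by
        rw [tk, if_neg hLR.2]; rfl)
      rw [ht]
      intro h2
      exact h1 _ h2 rfl

/-! ### Uncrossing a bigram -/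

/-- If the first remaining token were a run of `b`, then either it would have been popped, or a
`b`-run was popped just before it, which contradicts that adjacent runs have different symbols. If
it is a variable, induction applies. The right end is symmetric. -/
theorem Unc.uncross {n a b : ℕ} {pl pr : ℕ → ℕ → Bool} {G : ℕ → List Tk} {P : ℕ → Res}
    {V : ℕ → List ℕ} (h : Unc n pl pr G P) (hw : Wf n (fun i => items (G i)) V)
    (hab : ∀ i, i + 1 < n → ∀ x, pl i x = decide (x = b) ∧ pr i x = decide (x = a)) :
    ∀ i, i + 1 < n → (trim V P i).head? ≠ some b ∧ (trim V P i).getLast? ≠ some a := by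
  intro i
  induction i using Nat.strong_induction_on with
  | _ i ih =>
    intro hi1
    have hi : i < n := by omega
    have hI := (US.Inv.foldl (P := P) (G i) (US.Inv.init (pl i))).1
    have he := h.eq i hi
    unfold uncRule at he
    have hfl := US.fin_left (pr := pr i) hI
    have hfr := US.fin_right (pr := pr i) hI
    have hlp := US.fin_left_popped (pr := pr i) hI
    have hrp := US.fin_right_popped (pl := pl i) (pr := pr i)
      (s := (G i).foldl (US.feed (pl i) P) US.init)
    rw [← he] at hfl hfr hlp hrp
    have hv := h.vals hw i hi
    have hcan := (h.split_items hi).2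
    have hpos := hcan.of_infix.1
    have hvn : ∀ j, Tk.var j ∈ (P i).mid → j < i ∧ trim V P j ≠ [] := fun j hj =>
      hv.mem j (mem_items_var.2 hj)
    rw [hv.val, head?_iev hpos fun j hj => (hvn j hj).2, getLast?_iev hpos fun j hj => (hvn j hj).2]
    constructor
    · cases hm : (P i).mid with
      | nil => simp
      | cons t r =>
        simp only [List.head?_cons, Option.bind_some]
        cases t with
        | run x k =>
          simp only [hdv, ne_eq, Option.some.injEq]
          rintro rfl
          by_cases hL : (P i).L.2 = 0
          · simp_all
          · have h1 := hlp hL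
            rw [(hab i hi1 _).1, decide_eq_true_iff] at h1
            have h2 := (List.isChain_append.1 (List.isChain_append.1 hcan.2).1).2.2
            rw [tk, if_neg hL, hm] at h2
            exact h2 _ rfl _ rfl h1
        | var j =>
          have := (hvn j (by simp [hm])).1
          exact (ih j this (by omega)).1
    · cases hm : (P i).mid.getLast? with
      | none => simp
      | some t =>
        simp only [Option.bind_some]
        cases t with
        | run x k =>
          simp only [lsv, ne_eq, Option.some.injEq]
          rintro rfl
          by_cases hR : (P i).R.2 = 0
          · simp_all
          · have h1 := hrp hR
            rw [(hab i hi1 _).2, decide_eq_true_iff] at h1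
            have h2 := (List.isChain_append.1 hcan.2).2.2 _ (by
              rw [List.getLast?_append, hm]; rfl) (.run (P i).R.1 (P i).R.2) (by
              rw [tk, if_neg hR]; rfl)
            exact h2 h1.symm
        | var j =>
          obtain ⟨r, hr⟩ := List.getLast?_eq_some_iff.1 hm
          have := (hvn j (by simp [hr])).1
          exact (ih j this (by omega)).2

/-- If a bigram does not cross the boundaries of the variables, then it can be replaced in the
right-hand sides. -/
theorem repl_iev {V V' : ℕ → List ℕ} {a b c : ℕ} {u : List (ℕ ⊕ ℕ)}
    (h : ∀ j, .inr j ∈ u → V j ≠ [] ∧ (V j).head? ≠ some b ∧ (V j).getLast? ≠ some a ∧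
      V' j = repl a b c (V j)) :
    repl a b c (iev V u) = iev V' (repl (.inl a) (.inl b) (.inl c) u) := by
  induction u using cnt.induct (.inl a : ℕ ⊕ ℕ) (.inl b) with
  | case1 => simp [repl]
  | case2 x =>
    cases x with
    | inl x => simp [repl, iv]
    | inr j => simp_all [repl, iv]
  | case3 x y t hxy ih => simp_all [iev_cons, iv, repl_cons_cons]
  | case4 x y t hxy ih =>
    have ih := ih fun j hj => h j (by simp at hj ⊢; tauto)
    have e : repl (.inl a) (.inl b) (.inl c) (x :: y :: t) =
        x :: repl (.inl a : ℕ ⊕ ℕ) (.inl b) (.inl c) (y :: t) := by simp [repl, hxy]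
    rw [e, iev_cons V' x, iev_cons V x, ← ih]
    cases x with
    | inl x =>
      simp only [iv, List.singleton_append]
      cases y with
      | inl y => grind [iev_cons, iv, repl]
      | inr j => simp_all [repl_cons_head, iev_cons, iv]
    | inr j => grind [iv, repl_append]

/-! ### Balanced weights -/

/-- `occ` counts the occurrences of the variables in the derivation tree. -/
structure Bal (n : ℕ) (occ : ℕ → ℕ) (U : ℕ → List (ℕ ⊕ ℕ)) (V : ℕ → List ℕ) : Prop where
  one : occ (n - 1) = 1
  bal : ∀ k < n - 1, V k ≠ [] → occ k = ∑ i ∈ Finset.range n, occ i * (vars (U i)).count k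

theorem sum_map_eq {l : List ℕ} {m : ℕ} (h : ∀ k ∈ l, k < m) (μ : ℕ → ℕ) :
    (l.map μ).sum = ∑ k ∈ Finset.range m, l.count k * μ k := by
  rw [Finset.sum_list_map_count]
  simp only [smul_eq_mul]
  refine Finset.sum_subset (fun k hk => ?_) fun k _ hk => ?_
  · simp_all
  · rw [List.count_eq_zero.2 (by simpa using hk), zero_mul]

/-- Double counting over the derivation tree: by balance, the contributions of the children regroup
to the weighted sum of `μ` over all inner variables. They cancel, and only the start variable, of
multiplicity one, remains. -/
theorem Bal.sum {n : ℕ} {occ : ℕ → ℕ} {U : ℕ → List (ℕ ⊕ ℕ)} {V : ℕ → List ℕ} (h : Bal n occ U V)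
    (hn : 0 < n) (hw : Wf n U V) {μ w : ℕ → ℕ} (hμ : ∀ k, V k = [] → μ k = 0)
    (hs : ∀ i < n, μ i = w i + ((vars (U i)).map μ).sum) :
    μ (n - 1) = ∑ i ∈ Finset.range n, occ i * w i := by
  have h1 : ∑ i ∈ Finset.range n, occ i * ((vars (U i)).map μ).sum =
      ∑ k ∈ Finset.range (n - 1), occ k * μ k := by
    have h2 : ∀ i ∈ Finset.range n, occ i * ((vars (U i)).map μ).sum =
        ∑ k ∈ Finset.range (n - 1), occ i * ((vars (U i)).count k * μ k) := by
      intro i hi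
      rw [Finset.mem_range] at hi
      rw [sum_map_eq (m := n - 1) (fun k hk => ?_), Finset.mul_sum]
      have := (hw.ord i hi k (mem_vars.1 hk)).1
      omega
    rw [Finset.sum_congr rfl h2, Finset.sum_comm]
    refine Finset.sum_congr rfl fun k hk => ?_
    rw [Finset.mem_range] at hk
    by_cases hv : V k = []
    · simp [hμ k hv]
    · rw [h.bal k hk hv, Finset.sum_mul]
      grind
  have h3 : ∑ i ∈ Finset.range n, occ i * μ i =
      ∑ i ∈ Finset.range n, occ i * w i + ∑ k ∈ Finset.range (n - 1), occ k * μ k := by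
    rw [← h1, ← Finset.sum_add_distrib]
    refine Finset.sum_congr rfl fun i hi => ?_
    grind
  obtain ⟨m, rfl⟩ : ∃ m, n = m + 1 := ⟨n - 1, by omega⟩
  simp only [Nat.add_sub_cancel] at *
  rw [Finset.sum_range_succ] at h3
  have := h.one
  grind

/-- The variables below `k` that occur when the variables from `k` on are expanded contribute at
most the weight of the starting variable. -/
theorem cut_le {n : ℕ} {occ : ℕ → ℕ} {R : ℕ → ℕ → ℕ} {μ : ℕ → ℕ} (hn : 0 < n)
    (h1 : occ (n - 1) = 1)
    (hμ : ∀ i < n, ∑ j ∈ Finset.range i, R j i * μ j ≤ μ i) :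
    ∀ d k, k + d + 1 = n →
      (∀ j, k ≤ j → j < n - 1 → μ j ≠ 0 → occ j = ∑ i ∈ Finset.Ico (j + 1) n, occ i * R j i) →
      ∑ j ∈ Finset.range k, (∑ i ∈ Finset.Ico k n, occ i * R j i) * μ j ≤ μ (n - 1) := by
  intro d
  induction d with
  | zero =>
    intro k hk _
    have : k = n - 1 := by omega
    simp_all
  | succ d ih =>
    intro k hk ho
    have h2 := ih (k + 1) (by omega) fun j hj => ho j (by omega)
    have e : ∀ j, ∑ i ∈ Finset.Ico k n, occ i * R j i =
        occ k * R j k + ∑ i ∈ Finset.Ico (k + 1) n, occ i * R j i := fun j =>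
      Finset.sum_eq_sum_Ico_succ_bot (by omega) _
    simp only [e, add_mul, Finset.sum_add_distrib]
    rw [Finset.sum_range_succ] at h2
    have h3 : ∑ j ∈ Finset.range k, occ k * R j k * μ j ≤ occ k * μ k := by
      simp only [mul_assoc, ← Finset.mul_sum]
      exact Nat.mul_le_mul_left _ (hμ k (by omega))
    grind

/-- The occurrences of `j` in the derivation tree are roots of disjoint subtrees, and `μ` is
superadditive. It is applied to lengths and to bigram counts. -/
theorem Bal.mul_le {n : ℕ} {occ : ℕ → ℕ} {U : ℕ → List (ℕ ⊕ ℕ)} {V : ℕ → List ℕ} (h : Bal n occ U V)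
    (hw : Wf n U V) {μ : ℕ → ℕ} (hμ : ∀ k, V k = [] → μ k = 0)
    (hs : ∀ i < n, ((vars (U i)).map μ).sum ≤ μ i) {j : ℕ} (hj : j < n - 1) :
    occ j * μ j ≤ μ (n - 1) := by
  have hlt : ∀ i < n, ∀ k ∈ vars (U i), k < i := fun i hi k hk => (hw.ord i hi k (mem_vars.1 hk)).1
  -- The multiplicity of `j` in rule `i`. Since variables refer to smaller ones only, balance sees
  -- just the rules above `j`, as `cut_le` requires.
  let R : ℕ → ℕ → ℕ := fun j i => if i < n then (vars (U i)).count j else 0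
  have hR : ∀ i j, i ≤ j → R j i = 0 := by
    intro i j hij
    simp only [R]
    split_ifs with hi
    · exact List.count_eq_zero.2 fun hm => absurd (hlt i hi j hm) (by omega)
    · rfl
  have hb : ∀ j, j < n - 1 → μ j ≠ 0 → occ j = ∑ i ∈ Finset.Ico (j + 1) n, occ i * R j i := by
    intro j hj h0
    rw [h.bal j hj fun hv => h0 (hμ j hv), Finset.range_eq_Ico,
      ← Finset.sum_Ico_consecutive _ (Nat.zero_le (j + 1)) (by omega : j + 1 ≤ n)]
    rw [Finset.sum_eq_zero, zero_add]
    · refine Finset.sum_congr rfl fun i hi => ?_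
      grind
    grind
  by_cases h0 : μ j = 0
  · simp [h0]
  have h1 := cut_le (R := R) (μ := μ) (by omega) h.one (fun i hi => ?_) (n - (j + 1) - 1) (j + 1)
    (by omega) fun k _ => hb k
  · refine le_trans ?_ h1
    rw [hb j hj h0]
    exact Finset.single_le_sum (f := fun j => (∑ i ∈ Finset.Ico _ n, occ i * R j i) * μ j)
      (fun _ _ => Nat.zero_le _) (Finset.mem_range.2 (Nat.lt_succ_self j))
  · simp only [R, hi, if_true]
    rw [← sum_map_eq (hlt i hi)]
    exact hs i hi

/-! ### Counting bigrams -/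

def thd (f : ℕ → ℕ) : Tk → ℕ
  | .run x _ => x
  | .var j => f j

/-- The bigrams of a right-hand side, with weights; `q` is the symbol that comes before. -/
def ents (f l : ℕ → ℕ) (o : ℕ) : Option ℕ → List Tk → List (ℕ × ℕ × ℕ)
  | _, [] => []
  | q, t :: r =>
      (match q with
        | none => []
        | some p => [(p, thd f t, o)]) ++
      (match t with
        | .run x k => [(x, x, o * (k / 2))]
        | .var _ => []) ++ ents f l o (some (thd l t)) r

def tot (x y : ℕ) (E : List (ℕ × ℕ × ℕ)) : ℕ :=
  ((E.filter fun e => e.1 = x ∧ e.2.1 = y).map fun e => e.2.2).sum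

@[simp] theorem tot_append (x y : ℕ) (E F : List (ℕ × ℕ × ℕ)) :
    tot x y (E ++ F) = tot x y E + tot x y F := by simp [tot]

@[simp] theorem tot_nil (x y : ℕ) : tot x y [] = 0 := rfl

theorem tot_singleton (x y p q o : ℕ) :
    tot x y [(p, q, o)] = if p = x ∧ q = y then o else 0 := by grind [tot]

/-- By the chain condition each boundary between tokens is no cut inside a run, so the count of the
derived string is the sum of the counts inside the tokens and of the straddling pairs. A run of
length `k` holds `k / 2` disjoint squares. Counts inside variables stay on the left, because they
are charged to the rules of those variables. -/
theorem tot_ents {V : ℕ → List ℕ} {f l : ℕ → ℕ} {o x y : ℕ} {r : List Tk}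
    (hpos : ∀ x k, Tk.run x k ∈ r → 0 < k)
    (hf : ∀ j, Tk.var j ∈ r → (V j).head? = some (f j) ∧ (V j).getLast? = some (l j))
    (hc : r.IsChain (VR V)) (q : Option ℕ) :
    tot x y (ents f l o q r) + o * ((vars (items r)).map fun j => cnt x y (V j)).sum =
      o * (cnt x y (iev V (items r)) +
        if q = some x ∧ (iev V (items r)).head? = some y then 1 else 0) := by
  induction r generalizing q with
  | nil => simp [ents, cnt]
  | cons t r ih =>
    have hne : ∀ j, Tk.var j ∈ t :: r → V j ≠ [] := fun j hj h0 => by grind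
    have ih := ih (fun x k hx => hpos x k (by simp [hx])) (fun j hj => hf j (by simp [hj]))
      (List.isChain_cons.1 hc).2 (some (thd l t))
    have hh := head?_iev (V := V) hpos hne
    have hh' := head?_iev (V := V) (r := r) (fun x k hx => hpos x k (by simp [hx]))
      fun j hj => hne j (by simp [hj])
    have e1 : hdv V t = some (thd f t) := by
      cases t with
      | run z k => rfl
      | var j => exact (hf j (by simp)).1
    have e2 : lsv V t = some (thd l t) := by
      cases t with
      | run z k => rfl
      | var j => exact (hf j (by simp)).2
    have e3 : (iev V (items [t])).getLast? = some (thd l t) := by grind [getLast?_iev]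
    have e4 : iev V (items (t :: r)) = iev V (items [t]) ++ iev V (items r) := by
      rw [← List.singleton_append, items_append, iev_append]
    have e5 : cnt x y (iev V (items (t :: r))) = cnt x y (iev V (items [t])) +
        cnt x y (iev V (items r)) +
        if some (thd l t) = some x ∧ (iev V (items r)).head? = some y then 1 else 0 := by
      rw [e4, cnt_append_of_ne, e3]
      intro z hz
      rw [e3] at hz
      rw [hh']
      cases r with
      | nil => simp
      | cons u r =>
        simp only [List.head?_cons, Option.bind_some]
        exact (List.isChain_cons_cons.1 hc).1 z (by rw [e2, hz])
    simp only [List.head?_cons, Option.bind_some, e1] at hh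
    rw [e5, hh]
    simp only [ents, tot_append]
    have e6 : tot x y (match q with
        | none => []
        | some p => [(p, thd f t, o)]) =
        o * (if q = some x ∧ some (thd f t) = some y then 1 else 0) := by
      cases q with
      | none => simp
      | some p => grind [tot_singleton]
    rw [e6]
    rw [mul_add] at ih
    cases t with
    | run z k =>
      have e7 : o * cnt x y (iev V (items [.run z k])) = tot x y [(z, z, o * (k / 2))] := by
        grind [items_run, items_nil, iev_replicate, cnt_replicate, tot_singleton]
      grind [vars, items, items_run, vars_append, vars_replicate]
    | var j => grind [cnt, iev, items, items_var, iv, vars, tot_nil]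

end RP

namespace RP

/-! ### Replacing a bigram in a run-length encoded right-hand side -/

def Pos (r : List Tk) : Prop := ∀ x k, Tk.run x k ∈ r → 0 < k

theorem Pos.cons {t : Tk} {r : List Tk} (h : Pos (t :: r)) : Pos r :=
  fun x k hx => h x k (by simp [hx])

theorem pos_nil : Pos [] := by simp [Pos]

theorem Pos.append {r s : List Tk} (h : Pos r) (h' : Pos s) : Pos (r ++ s) := by
  intro x k hx
  rcases List.mem_append.1 hx with hx | hx
  · exact h x k hx
  · exact h' x k hx

theorem pos_tk (p : ℕ × ℕ) : Pos (tk p) := by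
  intro x k hx
  grind [tk]

theorem pos_run {x k : ℕ} (h : 0 < k) : Pos [.run x k] := by
  intro y l hx; simp at hx; omega

theorem pos_var {j : ℕ} : Pos [.var j] := by
  intro y l hx; simp at hx

/-- The state of the pass that replaces a bigram: the pending run and the tokens emitted. -/
structure RS where
  p : ℕ × ℕ
  em : List Tk

namespace RS

/-- For `a ≠ b` one symbol is taken from a pending `a`-run and one from the `b`-run after it. For `a
= b` a run is halved on arrival, and only the odd symbol stays pending. Empty runs vanish in `tk`.
-/
def feed (a b c : ℕ) (s : RS) : Tk → RS
  | .run x k =>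
      if a ≠ b then
        if s.p.2 ≠ 0 ∧ s.p.1 = a ∧ x = b then
          ⟨(x, k - 1), s.em ++ tk (s.p.1, s.p.2 - 1) ++ [.run c 1]⟩
        else ⟨(x, k), s.em ++ tk s.p⟩
      else if x = a then ⟨(x, k % 2), s.em ++ tk s.p ++ tk (c, k / 2)⟩
      else ⟨(x, k), s.em ++ tk s.p⟩
  | .var j => ⟨(0, 0), s.em ++ tk s.p ++ [.var j]⟩

def fin (s : RS) : List Tk := s.em ++ tk s.p

theorem repl_replicate {a b c x k : ℕ} (h : a = b → x = a → k ≤ 1) :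
    repl (.inl a) (.inl b) (.inl c) (List.replicate k (.inl x : ℕ ⊕ ℕ)) =
      List.replicate k (.inl x) := by
  induction k with
  | zero => rfl
  | succ k ih =>
    have ih := ih fun h1 h2 => by omega
    grind [repl_cons_head, repl_cons_ne]

theorem repl_run_append {a b c x k : ℕ} {u : List (ℕ ⊕ ℕ)} (h : a = b → x = a → k ≤ 1)
    (hu : k ≠ 0 → x = a → u.head? ≠ some (.inl b)) :
    repl (.inl a) (.inl b) (.inl c) (List.replicate k (.inl x : ℕ ⊕ ℕ) ++ u) =
      List.replicate k (.inl x) ++ repl (.inl a) (.inl b) (.inl c) u := by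
  grind [repl_append, repl_replicate]

theorem repl_cross {a b c k l : ℕ} (hab : a ≠ b) (hk : k ≠ 0) (hl : 0 < l) {u : List (ℕ ⊕ ℕ)} :
    repl (.inl a) (.inl b) (.inl c)
        (List.replicate k (.inl a : ℕ ⊕ ℕ) ++ (List.replicate l (.inl b) ++ u)) =
      List.replicate (k - 1) (.inl a) ++ .inl c ::
        repl (.inl a) (.inl b) (.inl c) (List.replicate (l - 1) (.inl b) ++ u) := by
  obtain ⟨k, rfl⟩ := Nat.exists_eq_succ_of_ne_zero hk
  obtain ⟨l, rfl⟩ := Nat.exists_eq_succ_of_ne_zero hl.ne'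
  simp only [Nat.succ_eq_add_one, Nat.add_sub_cancel]
  rw [List.replicate_succ', List.append_assoc, repl_run_append (fun h => absurd h hab)]
  · grind [repl_cons_cons]
  simp_all

theorem repl_even {a c : ℕ} {u : List (ℕ ⊕ ℕ)} : ∀ k,
    repl (.inl a) (.inl a) (.inl c) (List.replicate k (.inl a : ℕ ⊕ ℕ) ++ u) =
      List.replicate (k / 2) (.inl c) ++
        repl (.inl a) (.inl a) (.inl c) (List.replicate (k % 2) (.inl a) ++ u)
  | 0 => by simp
  | 1 => by simp
  | k + 2 => by
    rw [show (k + 2) / 2 = k / 2 + 1 by omega, show (k + 2) % 2 = k % 2 by omega,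
      List.replicate_succ, List.replicate_succ, List.cons_append, List.cons_append, repl_cons_cons,
      repl_even k]
    rfl

/-- The last two hypotheses make the emitted prefix final: the pending run is not continued by the
next token, and for `a = b` it has been halved already. -/
theorem items_foldl {a b c : ℕ} (r : List Tk) : ∀ (s : RS), Pos r → r.IsChain US.CR →
    (∀ x k, r.head? = some (.run x k) → s.p.2 ≠ 0 → s.p.1 ≠ x) →
    (a = b → s.p.1 = a → s.p.2 ≤ 1) →
    items (r.foldl (feed a b c) s).fin = items s.em ++
      repl (.inl a) (.inl b) (.inl c) (List.replicate s.p.2 (.inl s.p.1) ++ items r) := by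
  induction r with
  | nil => grind [fin, items_append, items_tk, items_nil, repl_replicate]
  | cons t r ih =>
    intro s hp hc hs h
    rw [List.foldl_cons]
    have hc' := List.isChain_cons.1 hc
    cases t with
    | var j =>
      rw [ih _ hp.cons hc'.2 (by simp [feed]) (by simp [feed])]
      simp only [feed, items_append, items_tk, items_var, items_nil, List.replicate_zero,
        List.nil_append, List.append_assoc]
      rw [repl_run_append h (by simp), repl_cons_ne (by simp)]
      rfl
    | run x k =>
      have hk := hp x k (by simp)
      have hx : ∀ y l, r.head? = some (.run y l) → x ≠ y := fun y l hy => hc'.1 _ hy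
      have hne : ¬(s.p.2 ≠ 0 ∧ s.p.1 = a ∧ x = b) →
          repl (.inl a) (.inl b) (.inl c) (List.replicate s.p.2 (.inl s.p.1) ++
            (List.replicate k (.inl x) ++ items r)) = List.replicate s.p.2 (.inl s.p.1) ++
          repl (.inl a) (.inl b) (.inl c) (List.replicate k (.inl x) ++ items r) := by
        grind [repl_run_append]
      rw [items_run]
      simp only [feed]
      split_ifs with h1 h2 h3
      · obtain ⟨h4, h5, h6⟩ := h2
        rw [ih _ hp.cons hc'.2 (fun y l hy _ => hx y l hy) (fun h => absurd h h1)]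
        simp_all [repl_cross, items_tk, items_run]
      · rw [ih _ hp.cons hc'.2 (fun y l hy _ => hx y l hy) (fun h => absurd h h1), hne h2]
        simp [items_tk]
      · have h1 : a = b := by simpa using h1
        subst h1; subst h3
        rw [ih _ hp.cons hc'.2 (fun y l hy _ => hx y l hy) (fun _ _ => by simp only; omega), hne,
          repl_even k]
        · simp [items_tk]
        grind
      · have h1 : a = b := by simpa using h1
        subst h1
        rw [ih _ hp.cons hc'.2 (fun y l hy _ => hx y l hy) (fun _ h => absurd h h3), hne]
        · simp [items_tk]
        omega

theorem length_tk (p : ℕ × ℕ) : (tk p).length ≤ 1 := by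
  unfold tk; split_ifs <;> simp

theorem length_feed (a b c : ℕ) (s : RS) (t : Tk) :
    (feed a b c s t).em.length + (tk (feed a b c s t).p).length ≤
      s.em.length + (tk s.p).length + 2 := by
  cases t with
  | var j => grind [feed, tk]
  | run x k => grind [length_tk, feed, tk]

theorem length_foldl (a b c : ℕ) (r : List Tk) : ∀ (s : RS),
    (r.foldl (feed a b c) s).fin.length ≤ s.em.length + (tk s.p).length + 2 * r.length := by
  induction r with
  | nil => intro s; simp [fin]
  | cons t r ih =>
    intro s
    have := ih (feed a b c s t)
    have := length_feed a b c s t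
    grind

theorem pos_feed {a b c : ℕ} {s : RS} {t : Tk} (h : Pos s.em) : Pos (feed a b c s t).em := by
  cases t with
  | var j => exact (h.append (pos_tk _)).append pos_var
  | run x k =>
    simp only [feed]
    split_ifs
    · exact (h.append (pos_tk _)).append (pos_run one_pos)
    · exact h.append (pos_tk _)
    · exact (h.append (pos_tk _)).append (pos_tk _)
    · exact h.append (pos_tk _)

theorem pos_foldl {a b c : ℕ} (r : List Tk) : ∀ (s : RS), Pos s.em →
    Pos (r.foldl (feed a b c) s).fin := by
  induction r with
  | nil => intro s h; exact h.append (pos_tk _)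
  | cons t r ih => grind [pos_feed]

end RS

/-- The right-hand side after the replacement. -/
def replTk (a b c : ℕ) (r : List Tk) : List Tk := (r.foldl (RS.feed a b c) ⟨(0, 0), []⟩).fin

theorem items_replTk {a b c : ℕ} {r : List Tk} (h : US.Can r) :
    items (replTk a b c r) = repl (.inl a) (.inl b) (.inl c) (items r) := by
  rw [replTk, RS.items_foldl r _ h.1 h.2 (by simp) (by simp)]
  simp

/-- A token adds at most two tokens to the result. This is why the buffer is required to hold twice
the current number of tokens. -/
theorem length_replTk (a b c : ℕ) (r : List Tk) : (replTk a b c r).length ≤ 2 * r.length := by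
  grind [RS.length_foldl, replTk, tk]

theorem pos_replTk (a b c : ℕ) (r : List Tk) : Pos (replTk a b c r) :=
  RS.pos_foldl r _ pos_nil

/-! ### A potential -/

def bigT : Tk → Bool
  | .run _ k => decide (2 ≤ k)
  | .var _ => false

def bigH : List Tk → Bool
  | [] => false
  | t :: _ => bigT t

/-- A run can be halved once per binary digit, and each halving may leave an additional token for
the odd symbol; the binary length pays for these. The unit that `pot` charges for two adjacent runs
of length at least two pays for the new symbol in `a^(k-1) c b^(l-1)`. -/
def wt : Tk → ℕ
  | .run _ k => Nat.size k
  | .var _ => 1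

/-- The potential of a list of tokens. -/
def pot : List Tk → ℕ
  | [] => 0
  | t :: g => wt t + (if bigT t = true ∧ bigH g = true then 1 else 0) + pot g

/-- Some list of tokens with a small potential stands for the right-hand side `u`. -/
def Gh (u : List (ℕ ⊕ ℕ)) (B : ℕ) : Prop := ∃ g, Pos g ∧ items g = u ∧ pot g ≤ B

theorem pot_tk_append (p : ℕ × ℕ) (g : List Tk) :
    pot (tk p ++ g) = Nat.size p.2 + (if 2 ≤ p.2 ∧ bigH g = true then 1 else 0) + pot g := by
  unfold tk
  split_ifs with h h1 h1 <;> simp_all [pot, wt, bigT]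

theorem pot_run (x k : ℕ) (g : List Tk) : pot (.run x k :: g) =
    Nat.size k + (if 2 ≤ k ∧ bigH g = true then 1 else 0) + pot g := by
  simp [pot, wt, bigT]

theorem pot_tk_le {x y k l : ℕ} (h : k ≤ l) (g : List Tk) :
    pot (tk (y, k) ++ g) ≤ pot (.run x l :: g) := by
  rw [pot_tk_append, pot_run]
  have := Nat.size_le_size h
  grind

theorem bigH_tk_append (p : ℕ × ℕ) (g : List Tk) :
    bigH (tk p ++ g) = if p.2 = 0 then bigH g else decide (2 ≤ p.2) := by grind [tk, bigH, bigT]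

theorem size_pos' {k : ℕ} (h : 0 < k) : 1 ≤ Nat.size k := Nat.size_pos.2 h

theorem size_half {k : ℕ} (h : 2 ≤ k) : Nat.size k = Nat.size (k / 2) + 1 := by
  have h1 := Nat.size_eq_bits_len k
  conv_lhs => rw [← Nat.bit_bodd_div2 k]
  rw [Nat.size_bit, Nat.div2_val]
  rw [Nat.bit_bodd_div2]; omega

/-- Halving trades one binary digit for the odd symbol; a replacement between two runs uses up their
adjacency charge, or empties one of them. The last conclusion strengthens the induction: the charge
between the preceding token and the head must not grow. The induction is on the expanded length,
because the rest may begin with a shortened run. -/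
theorem Gh.step {a b c : ℕ} : ∀ (m : ℕ) (g : List Tk), (items g).length ≤ m → Pos g →
    ∃ g', Pos g' ∧ items g' = repl (.inl a) (.inl b) (.inl c) (items g) ∧ pot g' ≤ pot g ∧
      (bigH g' = true → bigH g = true) := by
  intro m
  induction m with
  | zero =>
    intro g hm hg
    have : g = [] := (items_eq_nil hg).1 (List.length_eq_zero_iff.1 (by omega))
    subst this
    exact ⟨[], hg, rfl, le_rfl, id⟩
  | succ m ih =>
    intro g hm hg
    cases g with
    | nil => exact ⟨[], hg, rfl, le_rfl, id⟩
    | cons t g =>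
      have keep : items (t :: g) = items [t] ++ items g := by
        rw [← items_append]; rfl
      have hlen : (items (t :: g)).length = (items [t]).length + (items g).length := by
        rw [keep, List.length_append]
      have hpos1 : 0 < (items [t]).length := by
        cases t with
        | run x k => have := hg x k (by simp); simpa [items_run] using this
        | var j => simp [items_var]
      have keep' : repl (.inl a) (.inl b) (.inl c) (items (t :: g)) =
          items [t] ++ repl (.inl a) (.inl b) (.inl c) (items g) →
          ∃ g', Pos g' ∧ items g' = repl (.inl a) (.inl b) (.inl c) (items (t :: g)) ∧
            pot g' ≤ pot (t :: g) ∧ (bigH g' = true → bigH (t :: g) = true) := by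
        intro he
        obtain ⟨g', h1, h2, h3, h4⟩ := ih g (by omega) hg.cons
        refine ⟨t :: g', ?_, ?_, ?_, fun h => h⟩
        · intro y l hy
          rcases List.mem_cons.1 hy with hy | hy
          · exact hg y l (by simp [hy])
          · exact h1 y l hy
        · rw [he, ← h2, ← items_append]; rfl
        grind [pot, bigT, bigH]
      cases t with
      | var j => grind [items_var, items_nil, repl_cons_ne]
      | run x k =>
        have hk := hg x k (by simp)
        by_cases hx : x = a
        swap
        · grind [items_run, items_nil, RS.repl_run_append]
        subst hx
        have hkeep2 : ((x = b → k ≤ 1) ∧ ∀ l g₁, g ≠ .run b l :: g₁) →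
            repl (.inl x) (.inl b) (.inl c) (items (.run x k :: g)) =
          items [.run x k] ++ repl (.inl x) (.inl b) (.inl c) (items g) := by
          rintro ⟨h1, h2⟩
          rw [items_run, items_run, items_nil, List.append_nil]
          refine RS.repl_run_append (fun h _ => h1 h) fun _ _ => ?_
          cases g with
          | nil => simp
          | cons t g =>
            cases t with
            | var j => simp [items_var]
            | run y l =>
              have hl := hg y l (by simp)
              grind [items_run]
        by_cases hb : x = b
        · subst hb
          by_cases hk2 : 2 ≤ k
          · have hE := RS.repl_even (a := x) (c := c) (u := items g) k
            -- The odd symbol is put back in front of the rest, where it may still be matched.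
            obtain ⟨g', h1, h2, h3, h4⟩ := ih (tk (x, k % 2) ++ g) (by
              grind [items_append, items_tk, items_run, items_nil]) ((pos_tk _).append hg.cons)
            simp only [items_append, items_tk] at h2
            refine ⟨.run c (k / 2) :: g', ?_, ?_, ?_, ?_⟩
            · rw [← List.singleton_append]
              exact (pos_run (by omega)).append h1
            · grind [items_run]
            · rw [pot_tk_append] at h3
              rw [bigH_tk_append] at h4
              simp only [pot, wt, bigT, size_half hk2, decide_eq_true_eq]
              rcases Nat.mod_two_eq_zero_or_one k with h5 | h5
              · simp only [h5, Nat.size_zero, if_true] at h3 h4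
                grind
              · simp only [h5, Nat.size_one, show ¬(2 ≤ 1) by omega, false_and, if_false,
                  one_ne_zero, decide_false, Bool.false_eq_true] at h3 h4
                grind
            grind [bigH, bigT]
          · have hk1 : k = 1 := by omega
            subst hk1
            -- Neighbouring runs with the same symbol are not excluded here, so a single `x` can
            -- pair with the first symbol of the next run.
            by_cases hg1 : ∃ l g₁, g = .run x l :: g₁
            · obtain ⟨l, g₁, rfl⟩ := hg1
              have hl := hg x l (by simp)
              obtain ⟨g', h1, h2, h3, h4⟩ := ih (tk (x, l - 1) ++ g₁) (by
                grind [items_append, items_tk, items_run, items_nil]) ((pos_tk _).append hg.cons.cons)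
              simp only [items_append, items_tk] at h2
              refine ⟨.run c 1 :: g', ?_, ?_, ?_, by simp [bigH, bigT]⟩
              · rw [← List.singleton_append]
                exact (pos_run (by omega)).append h1
              · rw [items_run, items_run, items_run, h2]
                obtain ⟨l, rfl⟩ := Nat.exists_eq_succ_of_ne_zero hl.ne'
                grind [repl_cons_cons]
              · have h5 := pot_tk_le (x := x) (y := x) (show l - 1 ≤ l by omega) g₁
                grind [pot_run]
            simp_all
        · by_cases hg1 : ∃ l g₁, g = .run b l :: g₁
          · obtain ⟨l, g₁, rfl⟩ := hg1
            have hl := hg b l (by simp)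
            obtain ⟨g', h1, h2, h3, h4⟩ := ih (tk (b, l - 1) ++ g₁) (by
              grind [items_append, items_tk, items_run, items_nil]) ((pos_tk _).append hg.cons.cons)
            simp only [items_append, items_tk] at h2
            refine ⟨tk (x, k - 1) ++ .run c 1 :: g', ?_, ?_, ?_, ?_⟩
            · rw [← List.singleton_append]
              exact (pos_tk _).append ((pos_run (by omega)).append h1)
            · grind [items_run, RS.repl_cross, items_append, items_tk]
            · have h5 := pot_tk_le (x := b) (y := b) (show l - 1 ≤ l by omega) g₁
              have h6 : Nat.size (k - 1) ≤ Nat.size k := Nat.size_le_size (by omega)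
              have h7 : bigH (.run c 1 :: g') = false := by simp [bigH, bigT]
              rw [pot_tk_append, pot_run c, if_neg (by simp [h7]), if_neg (by omega), pot_run x,
                Nat.size_one]
              simp only
              by_cases hk1 : k = 1
              · subst hk1
                simp only [Nat.sub_self, Nat.size_zero, Nat.size_one]
                omega
              · by_cases hl1 : l = 1
                · subst hl1
                  rw [pot_run, if_neg (by omega : ¬(2 ≤ 1 ∧ _)), Nat.size_one]
                  rw [pot_tk_append] at h3
                  simp only [Nat.sub_self, Nat.size_zero, show ¬(2 ≤ 0) by omega, false_and,
                    if_false] at h3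
                  omega
                grind [bigH, bigT]
            grind [bigH_tk_append, bigH, bigT]
          simp_all

theorem Gh.repl {a b c B : ℕ} {u : List (ℕ ⊕ ℕ)} (h : Gh u B) :
    Gh (repl (.inl a) (.inl b) (.inl c) u) B := by
  obtain ⟨g, h1, rfl, h3⟩ := h
  obtain ⟨g', h4, h5, h6, -⟩ := Gh.step (a := a) (b := b) (c := c) _ g le_rfl h1
  exact ⟨g', h4, h5, h6.trans h3⟩

/-- The number of maximal blocks of equal letters, with every variable as a block of its own: the
least number of tokens for the given expansion. -/
def blk : List (ℕ ⊕ ℕ) → ℕ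
  | [] => 0
  | t :: u => blk u + if t.isLeft = true ∧ u.head? = some t then 0 else 1

theorem blk_append (u v : List (ℕ ⊕ ℕ)) : blk (u ++ v) ≤ blk u + blk v := by
  induction u with
  | nil => simp [blk]
  | cons t u ih => grind [blk]

theorem blk_replicate (x : ℕ) : ∀ k, blk (List.replicate k (.inl x)) = if k = 0 then 0 else 1
  | 0 => rfl
  | 1 => rfl
  | k + 2 => by
    rw [List.replicate_succ, blk, blk_replicate x (k + 1)]
    simp [List.replicate_succ]

theorem blk_run_append {x : ℕ} {u : List (ℕ ⊕ ℕ)} (h : u.head? ≠ some (.inl x)) :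
    ∀ k, 0 < k → blk (List.replicate k (.inl x) ++ u) = blk u + 1
  | 0, hk => absurd hk (lt_irrefl _)
  | 1, _ => by simp [blk, h]
  | k + 2, _ => by
    rw [List.replicate_succ, List.cons_append, blk, blk_run_append h (k + 1) (by omega)]
    simp [List.replicate_succ]

theorem length_eq_blk {r : List Tk} (h : US.Can r) : r.length = blk (items r) := by
  obtain ⟨hp, hc⟩ := h
  induction r with
  | nil => rfl
  | cons t r ih =>
    have ih := ih (fun x k hx => hp x k (by simp [hx])) (List.isChain_cons.1 hc).2
    cases t with
    | var j => simp [items_var, blk, ih]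
    | run x k =>
      rw [items_run, blk_run_append _ k (hp x k (by simp)), ← ih, List.length_cons]
      cases r with
      | nil => simp
      | cons t r =>
        cases t with
        | var j => simp [items_var]
        | run y l =>
          have hl := hp y l (by simp)
          obtain ⟨l, rfl⟩ := Nat.exists_eq_succ_of_ne_zero hl.ne'
          have := (List.isChain_cons_cons.1 hc).1
          simp only [items_run, Nat.succ_eq_add_one, List.replicate_succ, List.cons_append,
            List.head?_cons, ne_eq, Option.some.injEq, Sum.inl.injEq]
          exact fun h => this h.symm

/-- A canonical list is the shortest one with its expansion, so the potential of any list with the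
same expansion bounds its length. The detour through another list is needed because merging equal
neighbouring runs can raise the potential, by creating new pairs of long runs. -/
theorem Gh.length_le {r : List Tk} {B : ℕ} (h : Gh (items r) B) (hc : US.Can r) : r.length ≤ B := by
  obtain ⟨g, h1, h2, h3⟩ := h
  rw [length_eq_blk hc, ← h2]
  refine le_trans ?_ h3
  clear h2 h3
  induction g with
  | nil => simp [blk, pot]
  | cons t g ih =>
    have ih := ih h1.cons
    cases t with
    | var j => grind [blk_append, items, blk, items_var, pot, wt]
    | run x k => grind [blk_append, items, size_pos', blk_replicate, items_run, pot, wt]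

theorem Gh.tail {x B : ℕ} {u : List (ℕ ⊕ ℕ)} (h : Gh (.inl x :: u) B) : Gh u B := by
  obtain ⟨g, h1, h2, h3⟩ := h
  cases g with
  | nil => simp at h2
  | cons t g =>
    cases t with
    | var j => simp [items_var] at h2
    | run y k =>
      have hk := h1 y k (by simp)
      obtain ⟨k, rfl⟩ := Nat.exists_eq_succ_of_ne_zero hk.ne'
      simp only [items_run, Nat.succ_eq_add_one, List.replicate_succ, List.cons_append,
        List.cons.injEq] at h2
      refine ⟨tk (y, k) ++ g, (pos_tk _).append h1.cons, by simp [items_tk, h2.2], ?_⟩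
      exact (pot_tk_le (Nat.le_succ k) g).trans h3

/-- The runs that a rule hands upwards are removed at no cost; only the runs that it receives
increase its potential. -/
theorem Gh.dropRun {x k B : ℕ} {u : List (ℕ ⊕ ℕ)} (h : Gh (List.replicate k (.inl x) ++ u) B) :
    Gh u B := by
  induction k with
  | zero => exact h
  | succ k ih => exact ih (Gh.tail h)

theorem Gh.init_aux {x : ℕ} (g : List Tk) : ∀ {u : List (ℕ ⊕ ℕ)}, Pos g → items g = u ++ [.inl x] →
    ∃ g', Pos g' ∧ items g' = u ∧ pot g' ≤ pot g ∧ (bigH g' = true → bigH g = true) := by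
  induction g with
  | nil => intro u _ h; simp at h
  | cons t g ih =>
    intro u hp h
    rcases List.eq_nil_or_concat (items g) with h0 | ⟨v, z, h0⟩
    · have hg : g = [] := (items_eq_nil hp.cons).1 h0
      subst hg
      cases t with
      | var j => 
        rw [items_var, items_nil] at h
        rcases u with _ | ⟨y, u⟩ <;> simp at h
      | run y k =>
        have hk := hp y k (by simp)
        obtain ⟨k, rfl⟩ := Nat.exists_eq_succ_of_ne_zero hk.ne'
        simp only [items_run, items_nil, List.append_nil, Nat.succ_eq_add_one,
          List.replicate_succ'] at h
        have h2 := (List.append_inj' h rfl).1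
        refine ⟨tk (y, k) ++ [], (pos_tk _).append pos_nil, by simp [items_tk, h2], ?_, ?_⟩
        · rw [pot_tk_append]
          simp only [pot, wt, bigT, bigH, Bool.false_eq_true, and_false, if_false]
          have h5 : Nat.size k ≤ Nat.size k.succ := Nat.size_le_size (by omega)
          simpa using h5
        grind [bigH_tk_append, bigH, bigT]
    · rw [List.concat_eq_append] at h0
      have e : items (t :: g) = items [t] ++ items g := by rw [← items_append]; rfl
      rw [e, h0, ← List.append_assoc] at h
      obtain ⟨h2, h4⟩ := List.append_inj' h rfl
      rw [h4] at h0
      obtain ⟨g', h5, h6, h7, h8⟩ := ih hp.cons h0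
      refine ⟨t :: g', ?_, ?_, ?_, fun h => h⟩
      · intro y l hy
        rcases List.mem_cons.1 hy with hy | hy
        · exact hp y l (by simp [hy])
        · exact h5 y l hy
      · rw [← h2, ← h6, ← items_append]; rfl
      grind [pot, bigT, bigH]

theorem Gh.dropEnd {x k B : ℕ} {u : List (ℕ ⊕ ℕ)} (h : Gh (u ++ List.replicate k (.inl x)) B) :
    Gh u B := by
  induction k with
  | zero => simpa using h
  | succ k ih =>
    rw [List.replicate_succ', ← List.append_assoc] at h
    obtain ⟨g, h1, h2, h3⟩ := h
    obtain ⟨g', h4, h5, h6, -⟩ := Gh.init_aux g h1 h2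
    exact ih ⟨g', h4, h5, h6.trans h3⟩

/-- Each variable receives two runs of binary length at most `M`, with at most three new adjacency
charges: before the left run, between the two runs when the variable vanishes, and after the right
run. The second inequality accounts for a charge with a preceding token and serves the induction. -/
theorem pot_expand {P : ℕ → Res} {M : ℕ} (g : List Tk)
    (hM : ∀ j, Tk.var j ∈ g → Nat.size (P j).L.2 ≤ M ∧ Nat.size (P j).R.2 ≤ M) (hg : Pos g) :
    ∃ g', Pos g' ∧ items g' = US.expand P (items g) ∧
      pot g' ≤ pot g + (2 * M + 3) * (vars (items g)).length ∧
      pot g' + (if bigH g' = true then 1 else 0) ≤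
        pot g + (if bigH g = true then 1 else 0) + (2 * M + 3) * (vars (items g)).length := by
  induction g with
  | nil => exact ⟨[], hg, rfl, by simp [pot], by omega⟩
  | cons t g ih =>
    obtain ⟨g', h1, h2, h3, h4⟩ := ih (fun j hj => hM j (by simp [hj])) hg.cons
    cases t with
    | run x k =>
      refine ⟨.run x k :: g', ?_, ?_, ?_, ?_⟩
      · rw [← List.singleton_append]
        exact (pos_run (hg x k (by simp))).append h1
      · grind [items_run, US.expand_append, US.expand_replicate]
      all_goals
        grind [pot_run, items_run, vars_append, vars_replicate, bigH]
    | var j =>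
      obtain ⟨hL, hR⟩ := hM j (by simp)
      refine ⟨tk (P j).L ++ ((if (P j).mid = [] then [] else [.var j]) ++ (tk (P j).R ++ g')),
        ?_, ?_, ?_⟩
      · grind [pos_tk, Pos.append, pos_nil, pos_var]
      · grind [items_var, items, US.expand_append, items_append, items_tk, US.expand]
      · have e : (vars (items (.var j :: g))).length = (vars (items g)).length + 1 := by
          simp [items_var]
        rw [e, mul_add, mul_one]
        have h6 : pot (tk (P j).R ++ g') ≤ M + 1 + pot g' := by grind [pot_tk_append]
        grind [pot, tk, wt, bigT, bigH, pot_tk_append]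

theorem Gh.expand {P : ℕ → Res} {M B : ℕ} {u : List (ℕ ⊕ ℕ)} (h : Gh u B)
    (hM : ∀ j, .inr j ∈ u → Nat.size (P j).L.2 ≤ M ∧ Nat.size (P j).R.2 ≤ M) :
    Gh (US.expand P u) (B + (2 * M + 3) * (vars u).length) := by
  obtain ⟨g, h1, rfl, h3⟩ := h
  obtain ⟨g', h4, h5, h6, -⟩ := pot_expand g (fun j hj => hM j (mem_items_var.2 hj)) h1
  exact ⟨g', h4, h5, by omega⟩

end RP

namespace RP

/-! ### The invariant of the grammar -/

def inls (u : List (ℕ ⊕ ℕ)) : ℕ := (u.filter Sum.isLeft).length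

@[simp] theorem inls_inl (x : ℕ) (u : List (ℕ ⊕ ℕ)) : inls (.inl x :: u) = inls u + 1 := by
  simp [inls, List.filter_cons]

@[simp] theorem inls_inr (j : ℕ) (u : List (ℕ ⊕ ℕ)) : inls (.inr j :: u) = inls u := by
  simp [inls]

theorem length_eq_inls (u : List (ℕ ⊕ ℕ)) : u.length = inls u + (vars u).length := by
  induction u with
  | nil => rfl
  | cons t u ih => cases t <;> simp <;> omega

theorem length_iev (V : ℕ → List ℕ) (u : List (ℕ ⊕ ℕ)) :
    (iev V u).length = inls u + ((vars u).map fun j => (V j).length).sum := by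
  induction u with
  | nil => rfl
  | cons t u ih => cases t <;> simp [iv] <;> omega

theorem cnt_iev_le (V : ℕ → List ℕ) (x y : ℕ) (u : List (ℕ ⊕ ℕ)) :
    ((vars u).map fun j => cnt x y (V j)).sum ≤ cnt x y (iev V u) := by
  induction u with
  | nil => simp
  | cons t u ih =>
    rw [iev_cons]
    have := cnt_append_le (a := x) (b := y) (iv V t) (iev V u)
    grind [vars_inl, vars_inr, iv]

/-- The multiplicities `occ` and the bounds `rf` for the variables per rule stay fixed during the
whole computation, whereas the bounds `B` for the potentials grow. `two` is arranged by the set-up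
and forces the grammar to collapse when no bigram repeats. `S` bounds the symbol numbers in use. -/
structure Gm (n N S : ℕ) (occ rf B : ℕ → ℕ) (U : ℕ → List (ℕ ⊕ ℕ)) (V : ℕ → List ℕ) : Prop where
  pos : 0 < n
  wf : Wf n U V
  bal : Bal n occ U V
  two : ∀ i < n - 1, V i ≠ [] → 2 ≤ occ i
  ref : ∀ i < n, (vars (U i)).length ≤ rf i
  gh : ∀ i < n, Gh (U i) (B i)
  len : (V (n - 1)).length ≤ N
  sym : ∀ i < n, ∀ x, .inl x ∈ U i → x < S

section
variable {n N S : ℕ} {occ rf B : ℕ → ℕ} {U : ℕ → List (ℕ ⊕ ℕ)} {V : ℕ → List ℕ}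

/-- All copies of the string fit side by side into the text. This keeps the weights of the bigrams
within a machine word. -/
theorem Gm.occ_mul_le (g : Gm n N S occ rf B U V) {i : ℕ} (hi : i < n) :
    occ i * (V i).length ≤ N := by
  by_cases h : i = n - 1
  · rw [h, g.bal.one, one_mul]; exact g.len
  · refine (g.bal.mul_le g.wf (μ := fun j => (V j).length) (by simp) (fun i hi => ?_)
      (by omega : i < n - 1)).trans g.len
    rw [g.wf.val i hi, length_iev]
    omega

theorem Gm.occ_pos (g : Gm n N S occ rf B U V) {i : ℕ} (hi : i < n) (h : V i ≠ []) :
    0 < occ i := by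
  by_cases h1 : i = n - 1
  · rw [h1, g.bal.one]; exact one_pos
  · have := g.two i (by omega) h; omega

theorem Gm.length_le (g : Gm n N S occ rf B U V) {i : ℕ} (hi : i < n) : (V i).length ≤ N := by
  by_cases h : V i = []
  · simp [h]
  · exact (Nat.le_mul_of_pos_left _ (g.occ_pos hi h)).trans (g.occ_mul_le hi)

theorem Gm.cnt_mul_le (g : Gm n N S occ rf B U V) {i : ℕ} (hi : i < n - 1) (x y : ℕ) :
    occ i * cnt x y (V i) ≤ cnt x y (V (n - 1)) := by
  refine g.bal.mul_le g.wf (μ := fun j => cnt x y (V j)) (fun k hk => by simp [hk, cnt])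
    (fun i hi => ?_) hi
  rw [g.wf.val i hi]
  exact cnt_iev_le _ _ _ _

theorem exists_cnt_pos {w : List ℕ} (h : 2 ≤ w.length) : ∃ x y, 1 ≤ cnt x y w := by
  rcases w with _ | ⟨x, _ | ⟨y, w⟩⟩
  · simp at h
  · simp at h
  · exact ⟨x, y, by simp [cnt]⟩

/-- A string with two letters contains a bigram, and an inner variable has two disjoint copies of
its string in the text. -/
theorem Gm.exists_two_le (g : Gm n N S occ rf B U V) {i : ℕ} (hi : i < n - 1)
    (h : 2 ≤ (V i).length) : ∃ x y, 2 ≤ cnt x y (V (n - 1)) := by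
  obtain ⟨x, y, hxy⟩ := exists_cnt_pos h
  have h1 := g.cnt_mul_le hi x y
  have h2 := g.two i hi (by rintro h0; simp [h0] at h)
  exact ⟨x, y, by nlinarith⟩

/-- Only the potential changes. The multiplicities need no update: the only variables whose
occurrences disappear are the emptied ones, for which balance is not required. -/
theorem Gm.unc {pl pr : ℕ → ℕ → Bool} {G : ℕ → List Tk} {P : ℕ → Res}
    (g : Gm n N S occ rf B (fun i => items (G i)) V) (h : Unc n pl pr G P) :
    (∀ x, pl (n - 1) x = false ∧ pr (n - 1) x = false) →
    Gm n N S occ rf (fun i => B i + (2 * Nat.size N + 3) * rf i) (fun i => items (P i).mid)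
      (trim V P) ∧ trim V P (n - 1) = V (n - 1) := by
  intro htop
  have hn := g.pos
  have hv := h.vals g.wf
  have htr := h.top g.wf (i := n - 1) (by omega) (fun x => (htop x).1) fun x => (htop x).2
  have hne : ∀ i < n, trim V P i ≠ [] → V i ≠ [] := fun i hi h0 h1 => h0 (by
    have := (hv i hi).split
    simp_all)
  have hcnt : ∀ i < n, ∀ k, trim V P k ≠ [] → k < n →
      (vars (items (P i).mid)).count k = (vars (items (G i))).count k := by
    intro i hi k hk hkn
    rw [h.vars_mid hi, List.count_filter]
    have : (P k).mid ≠ [] := fun h0 => hk ((hv k hkn).nil.1 h0)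
    simpa using this
  have hsize : ∀ j < n, Nat.size (P j).L.2 ≤ Nat.size N ∧ Nat.size (P j).R.2 ≤ Nat.size N := by
    intro j hj
    have h1 := g.length_le hj
    rw [(hv j hj).split] at h1
    simp only [List.length_append, rep, List.length_replicate] at h1
    exact ⟨Nat.size_le_size (by omega), Nat.size_le_size (by omega)⟩
  refine ⟨⟨hn, h.wf g.wf, ⟨g.bal.one, fun k hk h0 => ?_⟩, fun i hi h0 => g.two i hi (hne i (by omega) h0),
    fun i hi => ?_, fun i hi => ?_, by rw [htr]; exact g.len, ?_⟩, htr⟩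
  · rw [g.bal.bal k hk (hne k (by omega) h0)]
    refine Finset.sum_congr rfl fun i hi => ?_
    grind
  · rw [h.vars_mid hi]
    exact (List.length_filter_le _ _).trans (g.ref i hi)
  · have h1 := (g.gh i hi).expand (P := P) (M := Nat.size N) fun j hj =>
      hsize j (by have := (g.wf.ord i hi j hj).1; omega)
    rw [← (h.split_items hi).1, List.append_assoc] at h1
    obtain ⟨g', h2, h3, h4⟩ := h1.dropRun.dropEnd
    exact ⟨g', h2, h3, h4.trans (Nat.add_le_add_left (Nat.mul_le_mul_left _ (g.ref i hi)) _)⟩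
  · have hall : ∀ i, i < n → ∀ x, .inl x ∈ List.replicate (P i).L.2 (.inl (P i).L.1 : ℕ ⊕ ℕ) ++
        items (P i).mid ++ List.replicate (P i).R.2 (.inl (P i).R.1) → x < S := by
      intro i
      induction i using Nat.strong_induction_on with
      | _ i ih =>
        intro hi x hx
        rw [(h.split_items hi).1, US.expand, List.mem_flatMap] at hx
        obtain ⟨t, ht, hx⟩ := hx
        cases t with
        | inl y =>
          simp only [List.mem_singleton, Sum.inl.injEq] at hx
          exact hx ▸ g.sym i hi y ht
        | inr j =>
          have hj := (g.wf.ord i hi j ht).1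
          grind
    grind

theorem vars_repl {a b c : ℕ} (u : List (ℕ ⊕ ℕ)) :
    vars (repl (.inl a) (.inl b) (.inl c) u) = vars u := by
  induction u using cnt.induct (.inl a : ℕ ⊕ ℕ) (.inl b) with
  | case1 => rfl
  | case2 x => rfl
  | case3 x y t hxy ih => grind [repl_cons_cons, vars_inl]
  | case4 x y t hxy ih =>
    have e : repl (.inl a) (.inl b) (.inl c) (x :: y :: t) =
        x :: repl (.inl a : ℕ ⊕ ℕ) (.inl b) (.inl c) (y :: t) := by simp [repl, hxy]
    rw [e]
    cases x <;> simp [ih]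

theorem repl_eq_nil {α : Type*} [DecidableEq α] {a b c : α} {u : List α} :
    repl a b c u = [] ↔ u = [] := by
  rcases u with _ | ⟨x, _ | ⟨y, u⟩⟩
  · simp [repl]
  · simp [repl]
  grind [repl]

theorem Gm.repl (g : Gm n N S occ rf B U V) {a b c S' : ℕ} (hS : S ≤ S') (hc : c < S')
    (h : ∀ i < n - 1, (V i).head? ≠ some b ∧ (V i).getLast? ≠ some a) :
    Gm n N S' occ rf B (fun i => RP.repl (.inl a) (.inl b) (.inl c) (U i))
      fun i => RP.repl a b c (V i) := by
  refine ⟨g.pos, ⟨fun i hi => ?_, fun i hi j hj => ?_⟩, ⟨g.bal.one, fun k hk h0 => ?_⟩,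
    fun i hi h0 => g.two i hi (by simpa [repl_eq_nil] using h0), fun i hi => ?_,
    fun i hi => (g.gh i hi).repl, ?_, fun i hi x hx => ?_⟩
  · rw [g.wf.val i hi]
    refine repl_iev fun j hj => ?_
    have hj' := g.wf.ord i hi j hj
    grind
  · rw [← mem_vars, vars_repl, mem_vars] at hj
    have := g.wf.ord i hi j hj
    grind [repl_eq_nil]
  · rw [g.bal.bal k hk (by simpa [repl_eq_nil] using h0)]
    simp only [vars_repl]
  · rw [vars_repl]; exact g.ref i hi
  · have := length_repl (a := a) (b := b) (c := c) (V (n - 1))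
    have := g.len
    omega
  · rcases mem_repl hx with hx | hx
    · simp_all
    · have := g.sym i hi x hx; omega

/-- A letter in rule `i` accounts for `occ i` letters of the text. This is at least one unless the
variable derives the empty string, and then its rule is empty. -/
theorem inls_sum_le (g : Gm n N S occ rf B U V) : ∑ i ∈ Finset.range n, inls (U i) ≤ N := by
  have h1 := g.bal.sum g.pos g.wf (μ := fun i => (V i).length) (w := fun i => inls (U i)) (by simp)
    fun i hi => by rw [g.wf.val i hi, length_iev]
  refine le_trans (Finset.sum_le_sum fun i hi => ?_) (h1.symm.le.trans g.len)
  rw [Finset.mem_range] at hi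
  by_cases h : V i = []
  · rw [g.wf.val i hi] at h
    have := (iev_eq_nil fun j hj => (g.wf.ord i hi j hj).2).1 h
    simp [this, inls]
  · exact Nat.le_mul_of_pos_left _ (g.occ_pos hi h)

theorem length_le_items {r : List Tk} (h : Pos r) : r.length ≤ (items r).length := by
  induction r with
  | nil => simp
  | cons t r ih =>
    have ih := ih h.cons
    cases t with
    | run x k =>
      have := h x k (by simp)
      grind [items_run]
    | var j => grind [items_var]

/-- The two sides of the minimum in the space bound: tokens are letters or variables, or they are
paid for by the potential. -/
theorem Gm.tokens (g : Gm n N S occ rf B U V) {r : ℕ → List Tk}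
    (h : ∀ i < n, US.Can (r i) ∧ items (r i) = U i) :
    ∑ i ∈ Finset.range n, (r i).length ≤ N + ∑ i ∈ Finset.range n, rf i ∧
      ∑ i ∈ Finset.range n, (r i).length ≤ ∑ i ∈ Finset.range n, B i := by
  constructor
  · refine le_trans ?_ (Nat.add_le_add_right (inls_sum_le g) _)
    rw [← Finset.sum_add_distrib]
    refine Finset.sum_le_sum fun i hi => ?_
    rw [Finset.mem_range] at hi
    have h1 := length_le_items (h i hi).1.1
    have h2 := g.ref i hi
    grind [length_eq_inls]
  · refine Finset.sum_le_sum fun i hi => ?_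
    rw [Finset.mem_range] at hi
    exact Gh.length_le ((h i hi).2 ▸ g.gh i hi) (h i hi).1

/-- `Bal.sum` for the count as `μ`, where the own contribution of a rule is what `tot_ents` finds in
it with unit weight. -/
theorem Gm.tot_eq (g : Gm n N S occ rf B U V) {r : ℕ → List Tk} {f l : ℕ → ℕ}
    (h : ∀ i < n, US.Can (r i) ∧ items (r i) = U i) (hc : ∀ i < n, (r i).IsChain (VR V))
    (hf : ∀ j < n, V j ≠ [] → (V j).head? = some (f j) ∧ (V j).getLast? = some (l j)) (x y : ℕ) :
    ∑ i ∈ Finset.range n, tot x y (ents f l (occ i) none (r i)) = cnt x y (V (n - 1)) := by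
  have key : ∀ i < n, ∀ o, tot x y (ents f l o none (r i)) +
      o * ((vars (U i)).map fun j => cnt x y (V j)).sum = o * cnt x y (V i) := by
    intro i hi o
    have := tot_ents (V := V) (o := o) (x := x) (y := y) (h i hi).1.1 (fun j hj => ?_) (hc i hi)
      (f := f) (l := l) none
    · rw [(h i hi).2, ← g.wf.val i hi] at this
      simpa using this
    · have hj' := g.wf.ord i hi j (by grind [mem_items_var])
      exact hf j (by omega) hj'.2
  rw [g.bal.sum g.pos g.wf (μ := fun i => cnt x y (V i))
    (w := fun i => tot x y (ents f l 1 none (r i))) (fun k hk => by simp [hk, cnt])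
    (fun i hi => by grind)]
  refine Finset.sum_congr rfl fun i hi => ?_
  grind

end

end RP

namespace RP
open WordRAM

abbrev Exp.add (e f : Exp) : Exp := .op .add e f
abbrev Exp.sub (e f : Exp) : Exp := .op .sub e f
abbrev Exp.mul (e f : Exp) : Exp := .op .mul e f
abbrev Exp.div (e f : Exp) : Exp := .op .div e f
abbrev Exp.mod (e f : Exp) : Exp := .op .mod e f
abbrev Exp.eq (e f : Exp) : Exp := .op .eq e f
abbrev Exp.lt (e f : Exp) : Exp := .op .lt e f
abbrev Cmd.inc (x : Vr) : Cmd := .asg x (.add (.v x) (.c 1))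
infixr:60 " ;; " => Cmd.seq

/-! ### Stored token lists -/

/-- Runs have a non-zero second component and variables do not. The shift by one makes every token
differ from `(0, 0)`, which ends a rule. -/
def enc : Tk → ℕ × ℕ
  | .run x k => (x, k)
  | .var j => (j + 1, 0)

def flat (r : List Tk) : List (ℕ × ℕ) := r.map enc ++ [(0, 0)]

def flats (G : ℕ → List Tk) (n : ℕ) : List (ℕ × ℕ) := (List.range n).flatMap fun i => flat (G i)

theorem flats_succ (G : ℕ → List Tk) (n : ℕ) : flats G (n + 1) = flats G n ++ flat (G n) := by
  simp [flats, List.range_succ]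

theorem length_flat (r : List Tk) : (flat r).length = r.length + 1 := by simp [flat]

theorem length_flats (G : ℕ → List Tk) (n : ℕ) :
    (flats G n).length = ∑ i ∈ Finset.range n, ((G i).length + 1) := by
  induction n with
  | zero => rfl
  | succ n ih => rw [flats_succ, List.length_append, ih, Finset.sum_range_succ, length_flat]

/-- The pairs `L` are stored in two arrays from the index `o` on. -/
def Seg (f g : ℕ → ℕ) : ℕ → List (ℕ × ℕ) → Prop
  | _, [] => True
  | o, p :: L => f o = p.1 ∧ g o = p.2 ∧ Seg f g (o + 1) L

theorem Seg.append {f g : ℕ → ℕ} {L M : List (ℕ × ℕ)} : ∀ {o : ℕ},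
    Seg f g o (L ++ M) ↔ Seg f g o L ∧ Seg f g (o + L.length) M := by
  induction L with
  | nil => intro o; simp [Seg]
  | cons p L ih => grind [Seg]

theorem Seg.update {f g : ℕ → ℕ} {L : List (ℕ × ℕ)} {q x y : ℕ} : ∀ {o : ℕ},
    o + L.length ≤ q → (Seg (Function.update f q x) (Function.update g q y) o L ↔ Seg f g o L) := by
  induction L with
  | nil => intro o _; simp [Seg]
  | cons p L ih => grind [Seg]

theorem Seg.snoc {f g : ℕ → ℕ} {L : List (ℕ × ℕ)} {q x y : ℕ} (h : Seg f g 0 L)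
    (hq : q = L.length) :
    Seg (Function.update f q x) (Function.update g q y) 0 (L ++ [(x, y)]) := by
  grind [Seg.append, Seg.update, Seg]

/-! ### Passes over the rules -/

theorem Frame.refl (c : Cmd) (s : St) : Frame c s s := ⟨fun _ _ => rfl, fun _ _ => rfl⟩

theorem Frame.trans {c d : Cmd} {s s₁ s₂ : St} (h : Frame c s s₁) (h' : Frame d s₁ s₂)
    (hv : ∀ x, c.modV x = false → d.modV x = false)
    (ha : ∀ k, c.modA k = false → d.modA k = false) : Frame c s s₂ :=
  ⟨fun x hx => (h'.v x (hv x hx)).trans (h.v x hx), fun k hk => (h'.a k (ha k hk)).trans (h.a k hk)⟩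

/-- The inner guard adds the two components of a pair; the sum vanishes only at the end marker of a
rule. -/
def rulePass (sv sc : Ar) (pre body post : Cmd) : Cmd :=
  .asg .i (.c 0) ;; .asg .p (.c 0) ;;
  .wh (.lt (.v .i) (.v .n))
    (pre ;; .wh (.add (.rd sv (.v .p)) (.rd sc (.v .p))) (body ;; .inc .p) ;; post ;; .inc .p ;;
      .inc .i)

theorem W.strengthen {C : Ctx} {c : Cmd} {s : St} {t : ℕ} {Q : St → Prop} (h : W C c s t Q) :
    W C c s t fun s' => Frame c s s' ∧ Q s' := h.mono le_rfl fun _ hf hq => ⟨hf, hq⟩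

theorem W.bind {C : Ctx} {c d : Cmd} {s : St} {t₁ t₂ t : ℕ} {P Q : St → Prop} (h : W C c s t₁ P)
    (ht : t₁ + t₂ + 1 ≤ t) (h' : ∀ s₁, Frame c s s₁ → P s₁ → W C d s₁ t₂ Q) :
    W C (c ;; d) s t Q :=
  (W.seq (h.mono le_rfl fun s₁ _ hp hf => h' s₁ hf hp)).mono ht fun _ _ hq => hq

theorem W.inc {C : Ctx} {x : Vr} {s : St} (h : s.v x + 1 < 2 ^ C.w) :
    W C (.inc x) s 7 fun s' => s' = s.setv x (s.v x + 1) :=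
  W.basic ⟨trivial, by simp only [Exp.ok]; omega, h⟩ (by simp [Cmd.cost, Exp.cost]) rfl

section
variable {C : Ctx} {sv sc : Ar} {pre body post : Cmd} {n T : ℕ} {G : ℕ → List Tk}
  {R : ℕ → St → Prop} {Q : ℕ → List Tk → St → Prop} {s₀ : St}

theorem flats_split (hk : k < n) : ∃ L, flats G n = flats G k ++ flat (G k) ++ L := by
  induction n with
  | zero => omega
  | succ n ih =>
    rw [flats_succ]
    by_cases h : k = n
    · simp_all
    grind

/-- `R k` holds between rules and `Q k r` after the prefix `r` of rule `k`. Both must be insensitive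
to the cursor `p`, and `R` also to `i`, since the pass itself moves these. The time is linear in the
number of tokens and end markers. -/
theorem W.rulePass (hC : C.Valid)
    (hm : ∀ c, c = pre ∨ c = body ∨ c = post → c.modV .i = false ∧ c.modV .p = false ∧
      c.modV .n = false ∧ c.modA sv = false ∧ c.modA sc = false)
    (hI : (flats G n).length ≤ C.I) (hpos : ∀ k < n, Pos (G k))
    (hT : ∀ k < n, ∀ t ∈ G k, (enc t).1 + (enc t).2 < 2 ^ C.w)
    (hs : Seg (s₀.a sv) (s₀.a sc) 0 (flats G n)) (hn : s₀.v .n = n) (h0 : R 0 s₀)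
    (hpre : ∀ k < n, ∀ s, Frame (rulePass sv sc pre body post) s₀ s → s.v .i = k → R k s →
      W C pre s T (Q k []))
    (hbody : ∀ k < n, ∀ r t r', G k = r ++ t :: r' → ∀ s,
      Frame (rulePass sv sc pre body post) s₀ s → s.v .i = k →
      s.a sv (s.v .p) = (enc t).1 → s.a sc (s.v .p) = (enc t).2 → s.v .p < C.I → Q k r s →
      W C body s T (Q k (r ++ [t])))
    (hpost : ∀ k < n, ∀ s, Frame (rulePass sv sc pre body post) s₀ s → s.v .i = k → Q k (G k) s →
      W C post s T (R (k + 1)))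
    (hRp : ∀ k s x, R k s → R k (s.setv .p x)) (hRi : ∀ k s x, R k s → R k (s.setv .i x))
    (hQp : ∀ k r s x, Q k r s → Q k r (s.setv .p x)) :
    W C (rulePass sv sc pre body post) s₀
      ((∑ i ∈ Finset.range n, ((G i).length + 1) + 1) * (2 * T + 100))
      fun s => R n s := by
  have hsm := hC.small
  have hbd := hC.bound
  obtain ⟨⟨hm1, hm2, hm3, hm4, hm5⟩, ⟨hm6, hm7, hm8, hm9, hm10⟩, hm11, hm12, hm13, hm14, hm15⟩ :=
    And.intro (hm pre (by simp)) (And.intro (hm body (by simp)) (hm post (by simp)))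
  set c := RP.rulePass sv sc pre body post with hc
  have hcv : ∀ x, c.modV x = false → pre.modV x = false ∧ body.modV x = false ∧
      post.modV x = false ∧ x ≠ .i ∧ x ≠ .p := by grind [RP.rulePass, Cmd.modV]
  have hca : ∀ x, c.modA x = false → pre.modA x = false ∧ body.modA x = false ∧
      post.modA x = false := by grind [RP.rulePass, Cmd.modA]
  have hcn : c.modV .n = false := by
    simp [hc, RP.rulePass, Cmd.modV, hm3, hm8, hm13]
  have hcs : c.modA sv = false ∧ c.modA sc = false := by
    simp [hc, RP.rulePass, Cmd.modA, hm4, hm5, hm9, hm10, hm14, hm15]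
  have fpre : ∀ {s s'}, Frame c s₀ s → Frame pre s s' → Frame c s₀ s' := fun h h' =>
    h.trans h' (fun x hx => (hcv x hx).1) fun x hx => (hca x hx).1
  have fbody : ∀ {s s'}, Frame c s₀ s → Frame body s s' → Frame c s₀ s' := fun h h' =>
    h.trans h' (fun x hx => (hcv x hx).2.1) fun x hx => (hca x hx).2.1
  have fpost : ∀ {s s'}, Frame c s₀ s → Frame post s s' → Frame c s₀ s' := fun h h' =>
    h.trans h' (fun x hx => (hcv x hx).2.2.1) fun x hx => (hca x hx).2.2
  have fp : ∀ {s x}, Frame c s₀ s → Frame c s₀ (s.setv .p x) := fun {s x} h =>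
    ⟨fun y hy => by
      rw [← h.v y hy]
      exact Function.update_of_ne (hcv y hy).2.2.2.2 _ _, h.a⟩
  have fi : ∀ {s x}, Frame c s₀ s → Frame c s₀ (s.setv .i x) := fun {s x} h =>
    ⟨fun y hy => by
      rw [← h.v y hy]
      exact Function.update_of_ne (hcv y hy).2.2.2.1 _ _, h.a⟩
  have hin : ∀ k < n, ∀ s, Frame c s₀ s → s.v .i = k → s.v .p = (flats G k).length → Q k [] s →
      W C (.wh (.add (.rd sv (.v .p)) (.rd sc (.v .p))) (body ;; .inc .p)) s
        ((G k).length * (T + 8 + 29 + 2) + 29 + 2) fun s' =>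
        Frame c s₀ s' ∧ s'.v .i = k ∧ s'.v .p = (flats G k).length + (G k).length ∧
          Q k (G k) s' := by
    intro k hk s hf hsi hsp hq
    obtain ⟨L, hL⟩ := flats_split (G := G) hk
    have hlen : (flats G k).length + (G k).length + 1 ≤ C.I := by grind [length_flat]
    have hseg : Seg (s₀.a sv) (s₀.a sc) (flats G k).length (flat (G k)) := by grind [Seg.append]
    have h1 := W.loop (C := C) (e := .add (.rd sv (.v .p)) (.rd sc (.v .p)))
      (c := body ;; .inc .p)
      (fun m s => Frame c s₀ s ∧ s.v .i = k ∧ ∃ r r', G k = r ++ r' ∧ r'.length = m ∧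
        s.v .p = (flats G k).length + r.length ∧ Q k r s) (T + 8) ?_ ?_ (G k).length s
        ⟨hf, hsi, [], G k, by simp, rfl, by omega, hq⟩
    · refine h1.mono (by simp [Exp.cost]) ?_
      grind
    · rintro s ⟨hf', hi', r, r', h2, h3, h4, h5⟩
      have : r' = [] := List.length_eq_zero_iff.1 h3
      subst this
      rw [List.append_nil] at h2
      subst h2
      rw [flat, Seg.append] at hseg
      have h6 := hseg.2
      simp only [List.length_map, Seg, and_true, ← h4, ← hf'.a sv hcs.1, ← hf'.a sc hcs.2] at h6
      grind [Exp.ok, Exp.eval, okOp, idl]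
    · rintro m s ⟨hf', hi', r, r', h2, h3, h4, h5⟩
      rcases r' with _ | ⟨t, r'⟩
      · simp at h3
      rw [List.length_cons, Nat.add_right_cancel_iff] at h3
      rw [flat, h2, List.map_append, List.append_assoc, Seg.append] at hseg
      have h6 := hseg.2
      simp only [List.length_map, List.map_cons, List.cons_append, Seg, ← h4, ← hf'.a sv hcs.1,
        ← hf'.a sc hcs.2] at h6
      have h7 := hT k hk t (by simp [h2])
      have h8 : (enc t).1 + (enc t).2 ≠ 0 := by
        cases t with
        | run x l => have := hpos k hk x l (by simp [h2]); simp only [enc]; omega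
        | var j => simp [enc]
      have hpI : s.v .p + 1 < C.I := by grind
      refine ⟨?_, ?_, ?_⟩
      · grind [Exp.ok, Exp.eval, okOp, idl]
      · grind [Exp.eval, idl]
      · have hb := (hbody k hk r t r' h2 s hf' hi' h6.1 h6.2.1 (by omega) h5).strengthen
        refine (W.seq (t₂ := 7) (hb.mono le_rfl ?_)).mono (by omega) fun s' _ h => h
        rintro s₁ - ⟨f1, q1⟩ -
        have hp1 := f1.v .p hm7
        refine (W.inc (by omega)).mono le_rfl ?_
        rintro s₂ - rfl
        refine ⟨fp (fbody hf' f1), (f1.v .i hm6).trans hi', r ++ [t], r', by simp [h2], h3, ?_,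
          hQp _ _ _ _ q1⟩
        rw [hp1, h4, List.length_append, List.length_singleton, ← add_assoc]
        simp [St.setv]
  have hrule : ∀ k < n, ∀ s, Frame c s₀ s → s.v .i = k → s.v .p = (flats G k).length → R k s →
      W C (pre ;; .wh (.add (.rd sv (.v .p)) (.rd sc (.v .p))) (body ;; .inc .p) ;; post ;;
        .inc .p ;; .inc .i) s (T + ((G k).length * (T + 8 + 29 + 2) + 29 + 2 + (T + (7 + 7 + 1) + 1)
          + 1) + 1) fun s' =>
        Frame c s₀ s' ∧ s'.v .i = k + 1 ∧ s'.v .p = (flats G (k + 1)).length ∧ R (k + 1) s' := by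
    intro k hk s hf hsi hsp hr
    obtain ⟨L, hL⟩ := flats_split (G := G) hk
    have hlen : (flats G k).length + (G k).length + 1 ≤ C.I := by grind [length_flat]
    have hkI : k ≤ (flats G k).length := by
      rw [length_flats, Finset.sum_add_distrib]
      simp
    refine W.seq ((hpre k hk s hf hsi hr).strengthen.mono le_rfl ?_)
    rintro s₁ - ⟨f1, q1⟩ -
    refine W.seq ((hin k hk s₁ (fpre hf f1) ((f1.v .i hm1).trans hsi) ((f1.v .p hm2).trans hsp)
      q1).mono le_rfl ?_)
    rintro s₂ - ⟨f2, i2, p2, q2⟩ -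
    refine W.seq ((hpost k hk s₂ f2 i2 q2).strengthen.mono le_rfl ?_)
    rintro s₃ - ⟨f3, q3⟩ -
    have p3 := f3.v .p hm12
    have i3 := f3.v .i hm11
    have e3 := W.inc (C := C) (x := .p) (s := s₃) (by omega)
    refine W.seq (t₂ := 7) (e3.mono le_rfl ?_)
    rintro s₄ - rfl -
    have i4 : (s₃.setv .p (s₃.v .p + 1)).v .i = k := i3.trans i2
    have e4 := W.inc (C := C) (x := .i) (s := s₃.setv .p (s₃.v .p + 1)) (by rw [i4]; omega)
    refine e4.mono le_rfl ?_
    rintro s₅ - rfl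
    refine ⟨fi (fp (fpost f2 f3)), ?_, ?_, hRi _ _ _ (hRp _ _ _ q3)⟩
    · rw [i4]; rfl
    · rw [flats_succ, List.length_append, length_flat, ← add_assoc, ← p2, ← p3]; rfl
  -- The invariant is indexed by the time reserved for the remaining rules, since their lengths
  -- differ.
  have hw := W.wh (C := C) (e := .lt (.v .i) (.v .n))
    (c := (pre ;; .wh (.add (.rd sv (.v .p)) (.rd sc (.v .p))) (body ;; .inc .p) ;; post ;;
        .inc .p ;; .inc .i))
    (fun m s => Frame c s₀ s ∧ ∃ k ≤ n, s.v .i = k ∧ s.v .p = (flats G k).length ∧ R k s ∧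
      m = ∑ j ∈ Finset.Ico k n, ((G j).length + 1) * (2 * T + 60)) ?_
    (∑ j ∈ Finset.range n, ((G j).length + 1) * (2 * T + 60)) ((s₀.setv .i 0).setv .p 0)
    ⟨fp (fi (Frame.refl _ _)), 0, Nat.zero_le _, rfl, rfl, hRp _ _ _ (hRi _ _ _ h0), by simp⟩
  · have h1 : W C (.asg .i (.c 0)) s₀ 3 fun s => s = s₀.setv .i 0 :=
      W.basic (by grind [Cmd.ok, Exp.ok]) (by decide) rfl
    have h2 : W C (.asg .p (.c 0)) (s₀.setv .i 0) 3 fun s => s = (s₀.setv .i 0).setv .p 0 :=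
      W.basic (by grind [Cmd.ok, Exp.ok]) (by decide) rfl
    refine W.bind h1 ?_ fun s _ hs' => hs' ▸ W.bind h2 le_rfl fun s _ hs' => hs' ▸ hw.mono le_rfl ?_
    swap
    · rintro s - ⟨h3, m, -, hf, k, hk, hi, hp, hr, -⟩
      have hn' := hf.v .n hcn
      grind [Exp.eval, idl, ltn_eq_zero]
    · simp only [Exp.cost, add_mul, one_mul]
      have : ∑ x ∈ Finset.range n, ((G x).length * (2 * T + 60) + (2 * T + 60)) ≤
          ∑ x ∈ Finset.range n, ((G x).length * (2 * T + 100) + (2 * T + 100)) :=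
        Finset.sum_le_sum fun x _ => Nat.add_le_add (Nat.mul_le_mul_left _ (by omega)) (by omega)
      simp only [← Finset.sum_mul, ← Nat.succ_mul] at this ⊢
      grind
  · rintro m s ⟨hf, k, hk, hi, hp, hr, rfl⟩
    have hn' := hf.v .n hcn
    refine ⟨by simp [Exp.ok, okOp], fun h3 => ?_⟩
    simp only [Exp.eval, idl, hi, hn', hn] at h3
    rw [ne_eq, ltn_eq_zero] at h3
    have hk : k < n := by omega
    refine ⟨_, ∑ j ∈ Finset.Ico (k + 1) n, ((G j).length + 1) * (2 * T + 60), ?_,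
      (hrule k hk s hf hi hp hr).mono le_rfl ?_⟩
    · rw [Finset.sum_eq_sum_Ico_succ_bot hk]
      grind [Exp.cost]
    grind

end

end RP

namespace RP
open WordRAM

/-! ### The pass that pops runs -/

namespace US

theorem length_flush (pl : ℕ → Bool) (u : US) : u.em.length ≤ (flush pl u).em.length := by
  grind [flush]

theorem length_feedR (pl : ℕ → Bool) (u : US) (x k : ℕ) :
    u.em.length ≤ (feedR pl u x k).em.length := by grind [feedR, length_flush]

theorem length_feedV (pl : ℕ → Bool) (u : US) (j : ℕ) :
    (flush pl u).em.length + 1 = (feedV pl u j).em.length := by simp [feedV]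

theorem length_feed (pl : ℕ → Bool) (P : ℕ → Res) (u : US) (t : Tk) :
    u.em.length ≤ (feed pl P u t).em.length := by
  cases t with
  | run x k => exact length_feedR pl u x k
  | var j => grind [length_feedR, feed, length_feedV, feedR, length_flush]

theorem length_foldl (pl : ℕ → Bool) (P : ℕ → Res) (r : List Tk) : ∀ u : US,
    u.em.length ≤ (r.foldl (feed pl P) u).em.length := by
  induction r with
  | nil => exact fun u => le_rfl
  | cons t r ih => grind [length_feed]

theorem length_fin (pl pr : ℕ → Bool) (u : US) : u.em.length ≤ (fin pl pr u).mid.length := by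
  grind [fin]

end US

theorem uncRule_congr {pl pr : ℕ → Bool} {P P' : ℕ → Res} {r : List Tk}
    (h : ∀ j, Tk.var j ∈ r → P j = P' j) : uncRule pl pr P r = uncRule pl pr P' r := by
  unfold uncRule
  congr 1
  refine List.foldl_ext _ _ _ fun u t ht => ?_
  cases t with
  | run x k => rfl
  | var j => simp only [US.feed, h j ht]

/-- The defining equation refers only to the results of smaller variables, so the results can be
added one by one. -/
theorem Unc.exists {n : ℕ} {pl pr : ℕ → ℕ → Bool} {G : ℕ → List Tk}
    (h : ∀ i < n, ∀ j, Tk.var j ∈ G i → j < i) : ∃ P, Unc n pl pr G P := by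
  induction n with
  | zero => exact ⟨fun _ => ⟨(0, 0), (0, 0), []⟩, ⟨fun i hi => absurd hi (by omega)⟩⟩
  | succ n ih =>
    obtain ⟨P, hP⟩ := ih fun i hi => h i (by omega)
    refine ⟨Function.update P n (uncRule (pl n) (pr n) P (G n)), ⟨fun i hi => ?_⟩⟩
    have hc : uncRule (pl i) (pr i) (Function.update P n (uncRule (pl n) (pr n) P (G n))) (G i) =
        uncRule (pl i) (pr i) P (G i) := uncRule_congr fun j hj => by grind
    rw [hc]
    by_cases hin : i = n
    · simp_all
    · rw [Function.update_of_ne hin]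
      exact hP.eq i (by omega)

/-- The flag `al` switches between popping every run and popping only runs of the symbol in `a`; the
first factor exempts the start variable. Only whether the value is zero matters, as the sum may be
two. -/
def popE (a : Vr) : Exp := .mul (.lt (.add (.v .i) (.c 1)) (.v .n)) (.add (.v .al) (.eq (.v .ps) (.v a)))

def emitC (e f : Exp) : Cmd := .put .bv (.v .q) e ;; .put .bc (.v .q) f ;; .inc .q

def flushC : Cmd :=
  .ite (.v .pc)
    (.ite (.mul (.eq (.v .sf) (.c 0)) (popE .b))
      (.put .lx (.v .i) (.v .ps) ;; .put .lc (.v .i) (.v .pc))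
      (emitC (.v .ps) (.v .pc)) ;;
      .asg .pc (.c 0) ;; .asg .sf (.c 1))
    .skip

def feedRC : Cmd :=
  .ite (.v .k)
    (.ite (.mul (.lt (.c 0) (.v .pc)) (.eq (.v .ps) (.v .x)))
      (.asg .pc (.add (.v .pc) (.v .k)))
      (flushC ;; .asg .ps (.v .x) ;; .asg .pc (.v .k)))
    .skip

def feedVC : Cmd := flushC ;; emitC (.add (.v .j) (.c 1)) (.c 0) ;; .asg .sf (.c 1)

/-- `e` remembers where the output of the rule begins, so that `uncPost` can record whether any
token was emitted. -/
def uncPre : Cmd :=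
  .put .lx (.v .i) (.c 0) ;; .put .lc (.v .i) (.c 0) ;; .asg .ps (.c 0) ;; .asg .pc (.c 0) ;;
    .asg .sf (.c 0) ;; .asg .e (.v .q)

def uncBody : Cmd :=
  .ite (.rd .ac (.v .p))
    (.asg .x (.rd .av (.v .p)) ;; .asg .k (.rd .ac (.v .p)) ;; feedRC)
    (.asg .j (.sub (.rd .av (.v .p)) (.c 1)) ;;
      .asg .x (.rd .lx (.v .j)) ;; .asg .k (.rd .lc (.v .j)) ;; feedRC ;;
      .ite (.rd .ne (.v .j)) feedVC .skip ;;
      .asg .x (.rd .rx (.v .j)) ;; .asg .k (.rd .rc (.v .j)) ;; feedRC)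

/-- The right run is zero by default and is overwritten only in the one branch that pops to the
right. Whether the rule is non-empty is decided before the end marker is emitted. -/
def uncPost : Cmd :=
  .put .rx (.v .i) (.c 0) ;; .put .rc (.v .i) (.c 0) ;;
  .ite (.v .pc)
    (.ite (.mul (.eq (.v .sf) (.c 0)) (popE .b))
      (.put .lx (.v .i) (.v .ps) ;; .put .lc (.v .i) (.v .pc))
      (.ite (popE .a)
        (.put .rx (.v .i) (.v .ps) ;; .put .rc (.v .i) (.v .pc))
        (emitC (.v .ps) (.v .pc))))
    .skip ;;
  .put .ne (.v .i) (.lt (.v .e) (.v .q)) ;; emitC (.c 0) (.c 0)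

/-- The results of the rules below `k` are stored. -/
def UOld (P : ℕ → Res) (k : ℕ) (s : St) : Prop :=
  ∀ j < k, s.a .lx j = (P j).L.1 ∧ s.a .lc j = (P j).L.2 ∧ s.a .rx j = (P j).R.1 ∧
    s.a .rc j = (P j).R.2 ∧ (s.a .ne j = 0 ↔ (P j).mid = [])

/-- The machine counterpart of the state `u` within rule `k`; `O` is the output of the earlier
rules. -/
structure UM (O : List (ℕ × ℕ)) (P : ℕ → Res) (k : ℕ) (u : US) (s : St) : Prop where
  ps : s.v .ps = u.p.1
  pc : s.v .pc = u.p.2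
  sf : s.v .sf = if u.sf = true then 1 else 0
  lx : s.a .lx k = u.D.1
  lc : s.a .lc k = u.D.2
  seg : Seg (s.a .bv) (s.a .bc) 0 (O ++ u.em.map enc)
  q : s.v .q = (O ++ u.em.map enc).length
  e : s.v .e = O.length
  old : UOld P k s

/-- The environment of the pass. -/
structure UE (C : Ctx) (n al a b k : ℕ) (s : St) : Prop where
  hi : s.v .i = k
  hn : s.v .n = n
  hal : s.v .al = al
  ha : s.v .a = a
  hb : s.v .b = b
  al1 : al ≤ 1
  kn : k < n
  nI : n ≤ C.I

def popP (n al b k x : ℕ) : Bool := decide (k + 1 < n ∧ (al ≠ 0 ∨ x = b))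

section
variable {C : Ctx} {n al a b k : ℕ} {s : St} {O : List (ℕ × ℕ)} {P : ℕ → Res} {u : US}

theorem UE.frame {c : Cmd} {s' : St} (h : UE C n al a b k s) (hf : Frame c s s')
    (hi : c.modV .i = false) (hn : c.modV .n = false) (ha : c.modV .al = false)
    (hp : c.modV .a = false) (hq : c.modV .b = false) : UE C n al a b k s' :=
  ⟨(hf.v _ hi).trans h.hi, (hf.v _ hn).trans h.hn, (hf.v _ ha).trans h.hal, (hf.v _ hp).trans h.ha,
    (hf.v _ hq).trans h.hb, h.al1, h.kn, h.nI⟩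

theorem Ctx.Valid.lt (hC : C.Valid) : 32 * C.I + 32 < 2 ^ C.w := by
  have := hC.small; have := hC.bound; omega

theorem popE_le (h : UE C n al a b k s) (y : Vr) : (popE y).eval C s ≤ 2 := by
  have h3 := h.al1
  have h1 := ltn_le (s.v .i + 1) (s.v .n)
  have h2 := eqn_le (s.v .ps) (s.v y)
  simp only [popE, Exp.eval, idl, h.hal]
  nlinarith

theorem Exp.mul_ok {e f : Exp} (he : e.ok C s) (hf : f.ok C s)
    (h : e.eval C s * f.eval C s < 2 ^ C.w) : (Exp.mul e f).ok C s := ⟨he, hf, h⟩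

theorem popE_ok (hC : C.Valid) (h : UE C n al a b k s) (y : Vr) : (popE y).ok C s := by
  have := hC.lt
  have h1 := h.kn
  have h2 := h.nI
  have h3 := h.al1
  have h4 := eqn_le (s.v .ps) (s.v y)
  refine Exp.mul_ok ?_ ?_ (lt_of_le_of_lt (popE_le h y) (by omega))
  · simp only [Exp.ok, Exp.eval, okOp, h.hi, true_and, and_true]
    omega
  · simp only [Exp.ok, Exp.eval, okOp, idl, h.hal, true_and, and_true]
    omega

theorem popE_eval (h : UE C n al a b k s) (y : Vr) :
    (popE y).eval C s ≠ 0 ↔ popP n al (s.v y) k (s.v .ps) = true := by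
  simp only [popE, Exp.eval, idl, h.hi, h.hn, h.hal, popP, decide_eq_true_eq, ne_eq,
    mul_eq_zero, ltn_eq_zero, Nat.add_eq_zero_iff, eqn_eq_zero]
  omega

theorem sfE (hC : C.Valid) (hm : UM O P k u s) (h : UE C n al a b k s) :
    (Exp.mul (.eq (.v .sf) (.c 0)) (popE .b)).ok C s ∧
    ((Exp.mul (.eq (.v .sf) (.c 0)) (popE .b)).eval C s ≠ 0 ↔
      u.sf = false ∧ popP n al b k u.p.1 = true) := by
  have h1 := popE_ok hC h .b
  have h2 := popE_le h .b
  have h3 := popE_eval h .b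
  have := hC.lt
  rw [h.hb, hm.ps] at h3
  constructor
  · refine Exp.mul_ok ⟨trivial, by simp only [Exp.ok]; omega, trivial⟩ h1 ?_
    have := eqn_le (s.v .sf) 0
    simp only [Exp.eval, idl] at h2 ⊢
    nlinarith
  · rw [← h3]
    simp only [Exp.eval, idl, hm.sf]
    cases u.sf <;> simp

/-- The effect of emitting a token. -/
theorem emitC_W (hC : C.Valid) {e f : Exp} {L : List (ℕ × ℕ)} (he : e.ok C s)
    (hf : f.ok C s) (hseg : Seg (s.a .bv) (s.a .bc) 0 L) (hq : s.v .q = L.length)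
    (hl : L.length < C.I) (hc : e.cost + f.cost ≤ 20)
    (hff : ∀ x, f.eval C (s.seta .bv (s.v .q) x) = f.eval C s ∧ (f.ok C (s.seta .bv (s.v .q) x) ↔ f.ok C s)) :
    W C (emitC e f) s 70 fun s' =>
      s' = ((s.seta .bv (s.v .q) (e.eval C s)).seta .bc (s.v .q) (f.eval C s)).setv .q (s.v .q + 1) ∧
      Seg (s'.a .bv) (s'.a .bc) 0 (L ++ [(e.eval C s, f.eval C s)]) ∧ s'.v .q = L.length + 1 := by
  have := hC.lt
  refine W.basic ?_ ?_ ⟨?_, ?_, ?_⟩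
  · simp only [emitC, Cmd.ok, Cmd.exec, Exp.ok, Exp.eval, okOp, St.seta, he, true_and]
    refine ⟨by omega, ⟨(hff _).2.2 hf, by omega⟩, ?_⟩
    omega
  · simp only [emitC, Cmd.cost, Exp.cost]; omega
  · simp only [emitC, Cmd.exec, Exp.eval, idl]
    rw [(hff _).1]
    rfl
  · simp only [emitC, Cmd.exec, Exp.eval, idl]
    rw [(hff _).1]
    exact Seg.snoc hseg hq
  simp_all [emitC, Cmd.exec, Exp.eval, idl, St.setv, St.seta]

end

end RP

namespace RP
open WordRAM

section
variable {C : Ctx} {n al a b k : ℕ} {s : St} {O : List (ℕ × ℕ)} {P : ℕ → Res} {u : US}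

theorem Ctx.Valid.one_lt (hC : C.Valid) : 32 < 2 ^ C.w := by
  have := hC.lt; omega

theorem flushC_W (hC : C.Valid) (he : UE C n al a b k s) (hm : UM O P k u s)
    (hl : O.length + (US.flush (popP n al b k) u).em.length ≤ C.I) :
    W C flushC s 170 (UM O P k (US.flush (popP n al b k) u)) := by
  have hw := hC.one_lt
  have hkI : k < C.I := lt_of_lt_of_le he.kn he.nI
  obtain ⟨ho, hev⟩ := sfE hC hm he
  unfold US.flush at hl ⊢
  refine (W.ite (t := 160) (e := .v .pc) trivial (fun h0 => ?_) fun h0 => ?_).mono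
    (by simp [Exp.cost]) fun _ _ h => h
  swap
  · simp only [Exp.eval, hm.pc] at h0
    rw [if_pos h0]
    exact W.basic trivial (by decide) hm
  simp only [Exp.eval, hm.pc] at h0
  rw [if_neg h0] at hl ⊢
  split_ifs at hl ⊢ with h1
  · refine W.bind (t₁ := 140) (P := fun s' => s' = (s.seta .lx k u.p.1).seta .lc k u.p.2) (t₂ := 7)
      ?_ (by omega) ?_
    · refine (W.ite (t := 70) ho (fun _ => ?_) fun h2 => absurd h2 (hev.2 h1)).mono (by decide)
        fun _ _ h => h
      refine W.basic ?_ (by decide) ?_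
      · simp [Cmd.ok, Exp.ok, Exp.eval, Cmd.exec, St.seta, he.hi, hkI]
      · simp [Exp.eval, Cmd.exec, St.seta, he.hi, hm.ps, hm.pc]
    · rintro s' - rfl
      refine W.basic ?_ (by decide) ⟨?_, ?_, ?_, ?_, ?_, ?_, ?_, ?_, ?_⟩
      · grind [Cmd.ok, Exp.ok]
      all_goals simp only [Cmd.exec, Exp.eval]
      · simpa [St.setv, St.seta] using hm.ps
      · simp [St.setv]
      · simp [St.setv]
      · simp [St.setv, St.seta]
      · simp [St.setv, St.seta]
      · simpa [St.setv, St.seta] using hm.seg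
      · simpa [St.setv, St.seta] using hm.q
      · simpa [St.setv, St.seta] using hm.e
      · intro j hj
        simpa [St.setv, St.seta, hj.ne] using hm.old j hj
  · simp only [List.length_append, List.length_singleton] at hl
    have hE := emitC_W hC (e := .v .ps) (f := .v .pc) trivial trivial hm.seg hm.q
      (by simp; omega) (by decide) fun _ => ⟨rfl, Iff.rfl⟩
    refine W.bind (t₁ := 140) (P := fun s' => s' = ((s.seta .bv (s.v .q) (s.v .ps)).seta .bc
      (s.v .q) (s.v .pc)).setv .q (s.v .q + 1) ∧ Seg (s'.a .bv) (s'.a .bc) 0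
      (O ++ u.em.map enc ++ [(s.v .ps, s.v .pc)]) ∧ s'.v .q = (O ++ u.em.map enc).length + 1)
      (t₂ := 7) ?_ (by omega) ?_
    · exact (W.ite ho (fun h2 => absurd (hev.1 h2) h1) fun h2 => hE).mono (by decide)
        fun _ _ h => h
    · rintro s' - ⟨rfl, h2, h3⟩
      refine W.basic ?_ (by decide) ⟨?_, ?_, ?_, ?_, ?_, ?_, ?_, ?_, ?_⟩
      · grind [Cmd.ok, Exp.ok]
      all_goals simp only [Cmd.exec, Exp.eval]
      · simpa [St.setv, St.seta] using hm.ps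
      · simp [St.setv]
      · simp [St.setv]
      · simpa [St.setv, St.seta] using hm.lx
      · simpa [St.setv, St.seta] using hm.lc
      · simp only [List.map_append, List.map_cons, List.map_nil, enc, ← hm.ps, ← hm.pc,
          ← List.append_assoc]
        simpa only [St.setv] using h2
      · simp only [List.map_append, List.map_cons, List.map_nil, enc, ← List.append_assoc,
          List.length_append (bs := [_]), List.length_singleton]
        simpa [St.setv] using h3
      · simpa [St.setv, St.seta] using hm.e
      · intro j hj
        simpa [St.setv, St.seta, hj.ne] using hm.old j hj

theorem feedRC_W (hC : C.Valid) (he : UE C n al a b k s) (hm : UM O P k u s) {x l : ℕ}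
    (hx : s.v .x = x) (hk : s.v .k = l) (hw : u.p.2 + l < 2 ^ C.w)
    (hl : O.length + (US.feedR (popP n al b k) u x l).em.length ≤ C.I) :
    W C feedRC s 220 (UM O P k (US.feedR (popP n al b k) u x l)) := by
  have hw1 := hC.one_lt
  unfold US.feedR at hl ⊢
  refine (W.ite (t := 210) (e := .v .k) trivial (fun h0 => ?_) fun h0 => ?_).mono
    (by simp [Exp.cost]) fun _ _ h => h
  swap
  · simp only [Exp.eval, hk] at h0
    rw [if_pos h0]
    exact W.basic trivial (by decide) hm
  simp only [Exp.eval, hk] at h0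
  rw [if_neg h0] at hl ⊢
  have hg : (Exp.mul (.lt (.c 0) (.v .pc)) (.eq (.v .ps) (.v .x))).ok C s := by
    refine Exp.mul_ok ⟨by simp only [Exp.ok]; omega, trivial, trivial⟩ ⟨trivial, trivial, trivial⟩ ?_
    have h1 := ltn_le 0 (s.v .pc)
    have h2 := eqn_le (s.v .ps) (s.v .x)
    simp only [Exp.eval, idl]
    nlinarith
  have hev : (Exp.mul (.lt (.c 0) (.v .pc)) (.eq (.v .ps) (.v .x))).eval C s ≠ 0 ↔
      u.p.2 ≠ 0 ∧ u.p.1 = x := by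
    simp only [Exp.eval, idl, ne_eq, mul_eq_zero, ltn_eq_zero, eqn_eq_zero, hm.pc, hm.ps, hx]
    omega
  refine (W.ite (t := 190) hg (fun h1 => ?_) fun h1 => ?_).mono (by decide) fun _ _ h => h
  · rw [hev] at h1
    rw [if_pos h1]
    refine W.basic ?_ (by decide) ⟨?_, ?_, ?_, ?_, ?_, ?_, ?_, ?_, ?_⟩
    · simp only [Cmd.ok, Exp.ok, Exp.eval, okOp, hm.pc, hk, true_and]; exact hw
    all_goals simp only [Cmd.exec, Exp.eval, idl]
    · simpa [St.setv, h1.2] using hm.ps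
    · simp [St.setv, hm.pc, hk]
    · simpa [St.setv] using hm.sf
    · simpa [St.setv, St.seta] using hm.lx
    · simpa [St.setv, St.seta] using hm.lc
    · simpa [St.setv, St.seta] using hm.seg
    · simpa [St.setv, St.seta] using hm.q
    · simpa [St.setv, St.seta] using hm.e
    · exact hm.old
  · have h1 : ¬(u.p.2 ≠ 0 ∧ u.p.1 = x) := fun h => hev.2 h h1
    rw [if_neg h1] at hl ⊢
    refine W.bind (t₂ := 9) (flushC_W hC he hm hl) (by omega) fun s₁ f1 h2 => ?_
    have hx' := f1.v .x rfl
    have hk' := f1.v .k rfl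
    refine W.basic ?_ (by decide) ⟨?_, ?_, ?_, ?_, ?_, ?_, ?_, ?_, ?_⟩
    · grind [Cmd.ok, Exp.ok]
    all_goals simp only [Cmd.exec, Exp.eval]
    · simp [St.setv, hx', hx]
    · simp [St.setv, hk', hk]
    · simpa [St.setv] using h2.sf
    · simpa [St.setv, St.seta] using h2.lx
    · simpa [St.setv, St.seta] using h2.lc
    · simpa [St.setv, St.seta] using h2.seg
    · simpa [St.setv, St.seta] using h2.q
    · simpa [St.setv, St.seta] using h2.e
    · exact h2.old

theorem feedVC_W (hC : C.Valid) (he : UE C n al a b k s) (hm : UM O P k u s) {j : ℕ}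
    (hj : s.v .j = j) (hw : j + 1 < 2 ^ C.w)
    (hl : O.length + (US.feedV (popP n al b k) u j).em.length ≤ C.I) :
    W C feedVC s 250 (UM O P k (US.feedV (popP n al b k) u j)) := by
  have hw1 := hC.one_lt
  rw [← US.length_feedV] at hl
  refine W.bind (t₂ := 75) (flushC_W hC he hm (by omega)) (by omega) fun s₁ f1 h2 => ?_
  have hj' := (f1.v .j rfl).trans hj
  have hE := emitC_W hC (e := .add (.v .j) (.c 1)) (f := .c 0) (s := s₁)
    ⟨trivial, by simp only [Exp.ok]; omega, by grind [Exp.eval, okOp]⟩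
    (by simp only [Exp.ok]; omega) h2.seg h2.q
    (by simp; omega) (by decide) fun _ => ⟨rfl, Iff.rfl⟩
  refine W.bind (t₂ := 3) hE (by omega) ?_
  rintro s' - ⟨rfl, h3, h4⟩
  simp only [Exp.eval, idl, hj'] at h3 h4
  refine W.basic ?_ (by decide) ⟨?_, ?_, ?_, ?_, ?_, ?_, ?_, ?_, ?_⟩
  · grind [Cmd.ok, Exp.ok]
  all_goals simp only [Cmd.exec, Exp.eval, idl, hj', US.feedV]
  · simpa [St.setv, St.seta] using h2.ps
  · simpa [St.setv, St.seta] using h2.pc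
  · simp [St.setv]
  · simpa [St.setv, St.seta] using h2.lx
  · simpa [St.setv, St.seta] using h2.lc
  · grind [enc, St.setv]
  · simp only [List.map_append, List.map_cons, List.map_nil, enc, ← List.append_assoc,
      List.length_append (bs := [_]), List.length_singleton]
    simpa [St.setv] using h4
  · simpa [St.setv, St.seta] using h2.e
  · intro i hi
    simpa [St.setv, St.seta] using h2.old i hi

/-- The pass variables `x`, `k`, `j` do not matter. -/
theorem UM.setv (hm : UM O P k u s) {y : Vr} {c : ℕ} (hy : y = .x ∨ y = .k ∨ y = .j ∨ y = .p) :
    UM O P k u (s.setv y c) := by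
  rcases hy with rfl | rfl | rfl | rfl <;>
  exact ⟨hm.ps, hm.pc, hm.sf, hm.lx, hm.lc, hm.seg, hm.q, hm.e, hm.old⟩

theorem uncBody_W (hC : C.Valid) (he : UE C n al a b k s) (hm : UM O P k u s) {t : Tk}
    (h1 : s.a .av (s.v .p) = (enc t).1) (h2 : s.a .ac (s.v .p) = (enc t).2) (hp : s.v .p < C.I)
    (ht : ∀ x l, t = .run x l → 0 < l) (htj : ∀ j, t = .var j → j < k)
    (hA : US.Inv (popP n al b k) u)
    (hw : (items u.A).length + (US.expand P (items [t])).length < 2 ^ C.w)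
    (hl : O.length + (US.feed (popP n al b k) P u t).em.length ≤ C.I) :
    W C uncBody s 900 (UM O P k (US.feed (popP n al b k) P u t)) := by
  have hw1 := hC.lt
  -- The pending run is part of the expanded prefix, so its length cannot overflow.
  have hpA : ∀ v : US, v.p.2 ≤ (items v.A).length := fun v => by
    grind [US.A, items_append, items_tk]
  have hup := hpA u
  cases t with
  | run x l =>
    have hl0 := ht x l rfl
    simp only [enc] at h1 h2
    refine (W.ite (t := 270) (e := .rd .ac (.v .p)) ⟨trivial, hp⟩ (fun _ => ?_) fun h0 => ?_).mono
      (by decide) fun _ _ h => h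
    swap
    · grind [Exp.eval]
    refine W.bind (t₁ := 20) (t₂ := 240) (P := fun s' => s' = s.setv .x x) (W.basic ⟨trivial, hp⟩
      (by decide) (by simp [Cmd.exec, Exp.eval, h1])) (by omega) ?_
    rintro s₁ - rfl
    refine W.bind (t₁ := 16) (t₂ := 220) (P := fun s' => s' = (s.setv .x x).setv .k l)
      (W.basic ⟨trivial, hp⟩
      (by decide) (by
        have : (s.setv .x x).a .ac ((s.setv .x x).v .p) = l := h2
        simp [Cmd.exec, Exp.eval, this])) (by omega) ?_
    rintro s₂ f2 rfl
    refine (feedRC_W hC (s := (s.setv .x x).setv .k l) ⟨he.hi, he.hn, he.hal, he.ha, he.hb, he.al1, he.kn, he.nI⟩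
      ((hm.setv (by simp)).setv (by simp)) rfl rfl ?_ hl)
    grind [items_run, items_nil, US.expand_replicate]
  | var j =>
    have hjk := htj j rfl
    have hjI : j < C.I := by have := he.kn; have := he.nI; omega
    simp only [enc] at h1 h2
    have hold := hm.old j hjk
    refine (W.ite (t := 880) (e := .rd .ac (.v .p)) ⟨trivial, hp⟩ (fun h0 => ?_) fun _ => ?_).mono
      (by decide) fun _ _ h => h
    · grind [Exp.eval]
    refine W.bind (t₁ := 20) (t₂ := 850) (P := fun s' => s' = s.setv .j j) (W.basic ?_
      (by decide) (by simp [Cmd.exec, Exp.eval, h1, idl])) (by omega) ?_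
    · grind [Cmd.ok, Exp.ok, Exp.eval, okOp]
    rintro s₁ - rfl
    have ej : (s.setv .j j).v .j = j := rfl
    refine W.bind (t₁ := 20) (t₂ := 820) (P := fun s' => s' = (s.setv .j j).setv .x (P j).L.1)
      (W.basic ⟨trivial, hjI⟩ (by decide) ?_) (by omega) ?_
    · have : (s.setv .j j).a .lx j = (P j).L.1 := hold.1
      grind [Cmd.exec, Exp.eval]
    rintro s₂ f2 rfl
    refine W.bind (t₁ := 20) (t₂ := 790) (P := fun s' => s' = ((s.setv .j j).setv .x (P j).L.1).setv
      .k (P j).L.2) (W.basic ⟨trivial, hjI⟩ (by decide) ?_) (by omega) ?_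
    · have : ((s.setv .j j).setv .x (P j).L.1).a .lc (((s.setv .j j).setv .x (P j).L.1).v .j) =
        (P j).L.2 := hold.2.1
      simp [Cmd.exec, Exp.eval, this]
    rintro s₃ - rfl
    set s₃ := ((s.setv .j j).setv .x (P j).L.1).setv .k (P j).L.2 with hs₃
    have he3 : UE C n al a b k s₃ :=
      ⟨he.hi, he.hn, he.hal, he.ha, he.hb, he.al1, he.kn, he.nI⟩
    have hm3 : UM O P k u s₃ := ((hm.setv (by simp)).setv (by simp)).setv (by simp)
    have hj3 : s₃.v .j = j := rfl
    have hexp : (US.expand P (items [.var j])).length = (P j).L.2 +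
        (if (P j).mid = [] then 0 else 1) + (P j).R.2 := by grind [US.expand, items_var, items_nil]
    rw [hexp] at hw
    simp only [US.feed] at hl ⊢
    have hA1 := hA.feedR (P j).L.1 (P j).L.2
    have e1 := congrArg List.length (US.items_feedR hA (P j).L.1 (P j).L.2)
    rw [List.length_append, List.length_replicate] at e1
    have hl1 := US.length_feedR (popP n al b k) u (P j).L.1 (P j).L.2
    have hl2 := US.length_flush (popP n al b k) (US.feedR (popP n al b k) u (P j).L.1 (P j).L.2)
    have hl3 := US.length_feedV (popP n al b k) (US.feedR (popP n al b k) u (P j).L.1 (P j).L.2) j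
    generalize hv : US.feedR (popP n al b k) u (P j).L.1 (P j).L.2 = v at *
    generalize hv2 : (if (P j).mid = [] then v else US.feedV (popP n al b k) v j) = v2 at *
    have hl4 := US.length_feedR (popP n al b k) v2 (P j).R.1 (P j).R.2
    have hl5 : v.em.length ≤ v2.em.length := by grind
    have hA2 : (items v2.A).length = (items v.A).length + if (P j).mid = [] then 0 else 1 := by
      rw [← hv2]
      split_ifs
      · rfl
      · rw [US.A_feedV hA1]; simp [items_append, items_var]
    have hfr := feedRC_W hC he3 hm3 (x := (P j).L.1) (l := (P j).L.2) rfl rfl (by omega)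
      (by rw [hv]; omega)
    rw [hv] at hfr
    refine W.bind (t₂ := 560) hfr (by omega) fun s₄ f4 hm4 => ?_
    have he4 := he3.frame f4 rfl rfl rfl rfl rfl
    have hj4 : s₄.v .j = j := (f4.v .j rfl).trans hj3
    have hold4 := hm4.old j hjk
    refine W.bind (t₁ := 270) (t₂ := 280) (P := UM O P k v2) ?_ (by omega) fun s₅ f5 hm5 => ?_
    · refine (W.ite (t := 250) (e := .rd .ne (.v .j)) ⟨trivial, by grind [Exp.eval]⟩ (fun h0 => ?_) fun h0 => ?_).mono
        (by decide) fun _ _ h => h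
      · grind [Exp.eval, feedVC_W]
      · simp only [Exp.eval, hj4, hold4.2.2.2.2] at h0
        rw [if_pos h0] at hv2
        subst hv2
        exact W.basic trivial (by decide) hm4
    have he5 := he4.frame f5 rfl rfl rfl rfl rfl
    have hj5 : s₅.v .j = j := (f5.v .j rfl).trans hj4
    have hold5 := hm5.old j hjk
    refine W.bind (t₁ := 20) (t₂ := 250) (P := fun s' => s' = s₅.setv .x (P j).R.1)
      (W.basic ⟨trivial, by grind [Exp.eval]⟩ (by decide) ?_) (by omega) ?_
    · grind [Cmd.exec, Exp.eval]
    rintro s₆ - rfl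
    have ej6 : (s₅.setv .x (P j).R.1).v .j = j := hj5
    have hold6 : (s₅.setv .x (P j).R.1).a .rc j = (P j).R.2 := hold5.2.2.2.1
    refine W.bind (t₁ := 20) (t₂ := 220) (P := fun s' => s' = (s₅.setv .x (P j).R.1).setv .k (P j).R.2)
      (W.basic ⟨trivial, by grind [Exp.eval]⟩ (by decide) ?_) (by omega) ?_
    · grind [Cmd.exec, Exp.eval]
    rintro s₇ - rfl
    have hpv := hpA v2
    exact feedRC_W hC (u := v2) (s := (s₅.setv .x (P j).R.1).setv .k (P j).R.2)
      ⟨he5.hi, he5.hn, he5.hal, he5.ha, he5.hb, he5.al1, he5.kn, he5.nI⟩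
      ((hm5.setv (Or.inl rfl)).setv (Or.inr (Or.inl rfl))) rfl rfl (by omega) hl

theorem uncPre_W (hC : C.Valid) (he : UE C n al a b k s)
    (hseg : Seg (s.a .bv) (s.a .bc) 0 O) (hq : s.v .q = O.length) (hold : UOld P k s) :
    W C uncPre s 60 (UM O P k US.init) := by
  have hw := hC.lt
  have hkI : k < C.I := lt_of_lt_of_le he.kn he.nI
  refine W.basic ?_ (by decide) ⟨?_, ?_, ?_, ?_, ?_, ?_, ?_, ?_, ?_⟩
  · simp [uncPre, Cmd.ok, Exp.ok, Exp.eval, Cmd.exec, St.seta, he.hi, hkI]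
  all_goals simp only [uncPre, Cmd.exec, Exp.eval, US.init, he.hi]
  · simp [St.setv]
  · simp [St.setv]
  · simp [St.setv]
  · simp [St.setv, St.seta, he.hi]
  · simp [St.setv, St.seta, he.hi]
  · simp_all [St.setv, St.seta]
  · simp_all [St.setv, St.seta]
  · simp_all [St.setv, St.seta]
  · intro j hj
    simpa [St.setv, St.seta, hj.ne, he.hi] using hold j hj

theorem uncPost_W (hC : C.Valid) (he : UE C n al a b k s) (hm : UM O P k u s)
    (hP : P k = US.fin (popP n al b k) (popP n al a k) u)
    (hl : O.length + (P k).mid.length < C.I) :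
    W C uncPost s 500 fun s' => Seg (s'.a .bv) (s'.a .bc) 0 (O ++ flat (P k).mid) ∧
      s'.v .q = (O ++ flat (P k).mid).length ∧ UOld P (k + 1) s' := by
  have hw := hC.lt
  have hkI : k < C.I := lt_of_lt_of_le he.kn he.nI
  have hup : u.p.2 = s.v .pc := hm.pc.symm
  let Q1 : St → Prop := fun s' => Seg (s'.a .bv) (s'.a .bc) 0 (O ++ (P k).mid.map enc) ∧
    s'.v .q = (O ++ (P k).mid.map enc).length ∧ s'.v .e = O.length ∧ UOld P k s' ∧
    s'.a .lx k = (P k).L.1 ∧ s'.a .lc k = (P k).L.2 ∧ s'.a .rx k = (P k).R.1 ∧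
    s'.a .rc k = (P k).R.2
  refine W.bind (t₁ := 17) (t₂ := 450) (P := fun s' => s' = s.seta .rx k 0) (W.basic ?_ (by decide)
    (by simp [Cmd.exec, Exp.eval, he.hi])) (by omega) ?_
  · simp only [Cmd.ok, Exp.ok, Exp.eval, he.hi, true_and]; omega
  rintro s₁ - rfl
  have e1 : (s.seta .rx k 0).v .i = k := he.hi
  refine W.bind (t₁ := 17) (t₂ := 420) (P := fun s' => s' = (s.seta .rx k 0).seta .rc k 0)
    (W.basic ?_ (by decide) (by simp [Cmd.exec, Exp.eval, e1])) (by omega) ?_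
  · grind [Cmd.ok, Exp.ok, Exp.eval]
  rintro s₂ - rfl
  set s₂ := (s.seta .rx k 0).seta .rc k 0 with hs₂
  have he2 : UE C n al a b k s₂ := ⟨he.hi, he.hn, he.hal, he.ha, he.hb, he.al1, he.kn, he.nI⟩
  have hm2 : UM O P k u s₂ := ⟨hm.ps, hm.pc, hm.sf, hm.lx, hm.lc, hm.seg, hm.q, hm.e, by
    intro j hj
    simpa [hs₂, St.seta, hj.ne] using hm.old j hj⟩
  have hrx : s₂.a .rx k = 0 := by simp [hs₂, St.seta]
  have hrc : s₂.a .rc k = 0 := by simp [hs₂, St.seta]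
  obtain ⟨ho, hev⟩ := sfE hC hm2 he2
  have hev' := popE_eval (C := C) he2 .a
  rw [he2.ha, hm2.ps] at hev'
  refine W.bind (t₁ := 250) (t₂ := 150) (P := Q1) ?_ (by omega) ?_
  · refine (W.ite (t := 230) (e := .v .pc) trivial (fun h0 => ?_) fun h0 => ?_).mono
      (by decide) fun _ _ h => h
    swap
    · simp only [Exp.eval, hm2.pc] at h0
      refine W.basic trivial (by decide) ?_
      simp only [US.fin, if_pos h0] at hP
      simp only [Q1, hP, Cmd.exec]
      exact ⟨hm2.seg, hm2.q, hm2.e, hm2.old, hm2.lx, hm2.lc, hrx, hrc⟩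
    simp only [Exp.eval, hm2.pc] at h0
    simp only [US.fin, if_neg h0] at hP
    refine (W.ite (t := 190) ho (fun h1 => ?_) fun h1 => ?_).mono (by decide) fun _ _ h => h
    · rw [if_pos (hev.1 h1)] at hP
      refine W.basic ?_ (by decide) ?_
      · simp_all [Cmd.ok, Exp.ok, Exp.eval, Cmd.exec, St.seta]
      · simp only [Q1, hP, Cmd.exec, Exp.eval, he2.hi, hm2.ps]
        refine ⟨?_, ?_, ?_, ?_, ?_, ?_, ?_, ?_⟩
        · simpa [St.seta] using hm2.seg
        · simpa [St.seta] using hm2.q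
        · simpa [St.seta] using hm2.e
        · intro j hj
          simpa [St.seta, hj.ne, he2.hi] using hm2.old j hj
        · simp [St.seta, he2.hi]
        · simp_all [St.seta]
        · simpa [St.seta] using hrx
        · simpa [St.seta] using hrc
    · rw [if_neg fun h => hev.2 h h1] at hP
      refine (W.ite (t := 140) (popE_ok hC he2 .a) (fun h2 => ?_) fun h2 => ?_).mono (by decide)
        fun _ _ h => h
      · rw [if_pos (hev'.1 h2)] at hP
        refine W.basic ?_ (by decide) ?_
        · simp_all [Cmd.ok, Exp.ok, Exp.eval, Cmd.exec, St.seta]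
        · simp only [Q1, hP, Cmd.exec, Exp.eval, he2.hi, hm2.ps]
          refine ⟨?_, ?_, ?_, ?_, ?_, ?_, ?_, ?_⟩
          · simpa [St.seta] using hm2.seg
          · simpa [St.seta] using hm2.q
          · simpa [St.seta] using hm2.e
          · intro j hj
            simpa [St.seta, hj.ne, he2.hi] using hm2.old j hj
          · simpa [St.seta, he2.hi] using hm2.lx
          · simpa [St.seta, he2.hi] using hm2.lc
          · simp [St.seta, he2.hi]
          simp_all [St.seta]
      · rw [if_neg fun h => hev'.2 h h2] at hP
        have hE := emitC_W hC (e := .v .ps) (f := .v .pc) trivial trivial hm2.seg hm2.q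
          (by grind) (by decide) fun _ => ⟨rfl, Iff.rfl⟩
        refine hE.mono (by omega) ?_
        rintro s₃ - ⟨rfl, h3, h4⟩
        simp only [Exp.eval, hm2.ps, hm2.pc] at h3 h4
        simp only [Q1, hP, List.map_append, List.map_cons, List.map_nil, enc, ← List.append_assoc,
          List.length_append (bs := [_]), List.length_singleton]
        refine ⟨?_, ?_, ?_, ?_, ?_, ?_, ?_, ?_⟩
        · simpa [St.seta, St.setv, Exp.eval, hm2.ps, hm2.pc] using h3
        · exact h4
        · simpa [St.seta, St.setv] using hm2.e
        · intro j hj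
          simpa [St.seta, St.setv] using hm2.old j hj
        · simpa [St.seta, St.setv] using hm2.lx
        · simpa [St.seta, St.setv] using hm2.lc
        · simp_all [St.seta, St.setv]
        simp_all [St.seta, St.setv]
  · rintro s₃ f3 ⟨h1, h2, h3, h4, h5, h6, h7, h8⟩
    have hi3 : s₃.v .i = k := (f3.v .i rfl).trans he2.hi
    refine W.bind (t₁ := 30) (t₂ := 75) (P := fun s' => s' = s₃.seta .ne k (ltn (s₃.v .e) (s₃.v .q)))
      (W.basic ?_ (by decide) (by simp [Cmd.exec, Exp.eval, hi3, idl])) (by omega) ?_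
    · grind [Cmd.ok, Exp.ok, Exp.eval, okOp]
    rintro s₄ - rfl
    have hE := emitC_W hC (e := .c 0) (f := .c 0) (s := s₃.seta .ne k (ltn (s₃.v .e) (s₃.v .q)))
      (L := O ++ (P k).mid.map enc)
      (by simp only [Exp.ok]; omega) (by simp only [Exp.ok]; omega) h1 h2
      (by simpa using hl) (by decide) fun _ => ⟨rfl, Iff.rfl⟩
    refine hE.mono (by omega) ?_
    rintro s₅ - ⟨rfl, h9, h10⟩
    simp only [Exp.eval] at h9 h10
    refine ⟨?_, ?_, fun j hj => ?_⟩
    · rw [flat, ← List.append_assoc]; exact h9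
    · rw [flat, ← List.append_assoc, List.length_append, List.length_singleton]; exact h10
    · by_cases hjk : j = k
      · simp_all [St.seta, St.setv]
      · simpa [St.seta, St.setv, hjk] using h4 j (by omega)

end

end RP

namespace RP
open WordRAM

/-! ### Copying a result back, and the complete popping pass -/

theorem Seg.congr {f g f' g' : ℕ → ℕ} {L : List (ℕ × ℕ)} : ∀ {o : ℕ},
    (∀ i, o ≤ i → i < o + L.length → f' i = f i ∧ g' i = g i) → Seg f g o L → Seg f' g' o L := by
  induction L with
  | nil => exact fun _ _ => trivial
  | cons p L ih =>
    rintro o h ⟨h1, h2, h3⟩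
    have := h o le_rfl (by simp)
    refine ⟨this.1.trans h1, this.2.trans h2, ih (fun i hi hi' => h i (by omega) ?_) h3⟩
    grind

/-- Passes write to a second buffer, because their output can be longer than what has been read. -/
def copyC : Cmd :=
  .asg .p (.c 0) ;; .wh (.lt (.v .p) (.v .q))
    (.put .av (.v .p) (.rd .bv (.v .p)) ;; .put .ac (.v .p) (.rd .bc (.v .p)) ;; .inc .p)

section
variable {C : Ctx} {s : St}

theorem copyC_W (hC : C.Valid) {L : List (ℕ × ℕ)} (hs : Seg (s.a .bv) (s.a .bc) 0 L)
    (hq : s.v .q = L.length) (hI : L.length ≤ C.I) :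
    W C copyC s (80 * (C.I + 1)) fun s' => Seg (s'.a .av) (s'.a .ac) 0 L := by
  have hw := hC.lt
  have h1 := W.loop (C := C) (e := .lt (.v .p) (.v .q)) (c := .put .av (.v .p) (.rd .bv (.v .p)) ;;
    .put .ac (.v .p) (.rd .bc (.v .p)) ;; .inc .p) (fun m s' => s'.a .bv = s.a .bv ∧
      s'.a .bc = s.a .bc ∧ s'.v .q = L.length ∧ ∃ p, p + m = L.length ∧ s'.v .p = p ∧
      ∀ i < p, s'.a .av i = s.a .bv i ∧ s'.a .ac i = s.a .bc i) 63 ?_ ?_ L.length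
      (s.setv .p 0) ⟨rfl, rfl, hq, 0, by simp, rfl, by simp⟩
  · refine W.bind (t₁ := 3) (t₂ := L.length * (63 + 5 + 2) + 5 + 2)
      (P := fun s' => s' = s.setv .p 0) (W.basic ?_ (by decide) rfl) (by omega) ?_
    · exact Nat.pos_of_ne_zero (by positivity)
    · rintro _ - rfl
      refine h1.mono le_rfl ?_
      grind [Seg.congr]
  · grind [Exp.ok, okOp, Exp.eval, idl, ltn_eq_zero]
  · rintro m s' ⟨h1, h2, h3, p, h4, h5, h6⟩
    refine ⟨by simp [Exp.ok, okOp], by grind [Exp.eval, idl, ltn_eq_zero], ?_⟩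
    refine W.basic ?_ (by decide) ⟨?_, ?_, ?_, p + 1, by omega, ?_, fun i hi => ?_⟩
    · simp only [Cmd.ok, Exp.ok, Exp.eval, okOp, Cmd.exec, St.seta, true_and, h5]
      omega
    · simp_all [Cmd.exec, St.seta, St.setv]
    · simp_all [Cmd.exec, St.seta, St.setv]
    · simp_all [Cmd.exec, St.seta, St.setv]
    · simp [Cmd.exec, St.seta, St.setv, Exp.eval, idl, h5]
    · by_cases hip : i = p
      · simp_all [Cmd.exec, St.seta, St.setv, Exp.eval, idl]
      · have := h6 i (by omega)
        simp_all [Cmd.exec, St.seta, St.setv, Exp.eval, idl]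

def uncC : Cmd := .asg .q (.c 0) ;; rulePass .av .ac uncPre uncBody uncPost ;; copyC

/-- A grammar that is stored in the buffer. -/
structure Stored (C : Ctx) (n : ℕ) (G : ℕ → List Tk) (s : St) : Prop where
  nn : s.v .n = n
  seg : Seg (s.a .av) (s.a .ac) 0 (flats G n)
  len : (flats G n).length ≤ C.I
  pos : ∀ i < n, Pos (G i)
  lt : ∀ i < n, ∀ t ∈ G i, (enc t).1 + (enc t).2 < 2 ^ C.w

theorem Stored.le {n : ℕ} {G : ℕ → List Tk} (h : Stored C n G s) : n ≤ C.I := by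
  have := h.len
  rw [length_flats, Finset.sum_add_distrib] at this
  simp at this
  omega

theorem length_flats_mono {G : ℕ → List Tk} {k n : ℕ} (h : k < n) :
    (flats G k).length + (G k).length + 1 ≤ (flats G n).length := by
  obtain ⟨L, hL⟩ := flats_split (G := G) h
  grind [length_flat]

theorem uncC_W (hC : C.Valid) {n al a b : ℕ} {G : ℕ → List Tk} {P : ℕ → Res} {V : ℕ → List ℕ}
    (h : Stored C n G s) (hw : Wf n (fun i => items (G i)) V)
    (hP : Unc n (popP n al b) (popP n al a) G P) (hal : s.v .al = al) (ha : s.v .a = a)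
    (hb : s.v .b = b) (hal1 : al ≤ 1) (hI : (flats (fun i => (P i).mid) n).length ≤ C.I)
    (hN : ∀ i < n, (US.expand P (items (G i))).length < 2 ^ C.w) :
    W C uncC s (2100 * (C.I + 1)) fun s' =>
      Seg (s'.a .av) (s'.a .ac) 0 (flats (fun i => (P i).mid) n) := by
  have hlt := hC.lt
  let F := flats fun i => (P i).mid
  have hmono : ∀ k < n, (F k).length + (P k).mid.length < C.I := fun k hk => by
    have := length_flats_mono (G := fun i => (P i).mid) hk
    simp only [F]; omega
  -- Emitted tokens are never withdrawn, so every intermediate output fits if the final one does.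
  have hsu : ∀ (k : ℕ) (r r' : List Tk), k < n → G k = r ++ r' →
      (r.foldl (US.feed (popP n al b k) P) US.init).em.length ≤ (P k).mid.length := by
    intro k r r' hk hg
    rw [hP.eq k hk, uncRule, hg, List.foldl_append]
    grind [US.length_foldl, US.length_fin]
  have key := W.rulePass (T := 900) (R := fun k s => Seg (s.a .bv) (s.a .bc) 0 (F k) ∧
      s.v .q = (F k).length ∧ UOld P k s)
    (Q := fun k r s => UM (F k) P k (r.foldl (US.feed (popP n al b k) P) US.init) s)
    (s₀ := s.setv .q 0) (sv := .av) (sc := .ac) (pre := uncPre) (body := uncBody) (post := uncPost)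
    (n := n) (G := G) hC ?_ h.len h.pos h.lt h.seg h.nn ?_ ?_ ?_ ?_ ?_ ?_ ?_
  · refine W.bind (t₁ := 3) (t₂ := (∑ i ∈ Finset.range n, ((G i).length + 1) + 1) * (2 * 900 + 100) +
      80 * (C.I + 1) + 1) (P := fun s' => s' = s.setv .q 0) (W.basic ?_ (by decide) rfl) ?_ ?_
    · exact Nat.pos_of_ne_zero (by positivity)
    pick_goal 2
    · rintro _ - rfl
      refine W.bind (t₂ := 80 * (C.I + 1)) key le_rfl ?_
      grind [copyC_W]
    · have := h.len
      grind [length_flats]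
  · rintro c (rfl | rfl | rfl) <;> exact ⟨rfl, rfl, rfl, rfl, rfl⟩
  · exact ⟨trivial, rfl, fun j hj => absurd hj (by omega)⟩
  · rintro k hk s' hf hi ⟨h1, h2, h3⟩
    exact (uncPre_W hC ⟨hi, (hf.v .n rfl).trans h.nn, (hf.v .al rfl).trans hal,
      (hf.v .a rfl).trans ha, (hf.v .b rfl).trans hb, hal1, hk, h.le⟩ h1 h2 h3).mono (by omega)
      fun _ _ h => h
  · intro k hk r t r' hg s' hf hi h1 h2 h3 hm
    rw [List.foldl_append]
    have hinv := US.Inv.foldl (P := P) r (US.Inv.init (popP n al b k))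
    refine uncBody_W hC ⟨hi, (hf.v .n rfl).trans h.nn, (hf.v .al rfl).trans hal,
      (hf.v .a rfl).trans ha, (hf.v .b rfl).trans hb, hal1, hk, h.le⟩ hm h1 h2 h3 ?_ ?_ hinv.1 ?_ ?_
    · rintro x l rfl
      exact h.pos k hk x l (by simp [hg])
    · rintro j rfl
      exact (hw.ord k hk j (mem_items_var.2 (by simp [hg]))).1
    · have h4 := hN k hk
      rw [hg, items_append, US.expand_append, List.length_append, ← List.singleton_append,
        items_append, US.expand_append, List.length_append] at h4
      rw [hinv.2]
      have : (items US.init.A).length = 0 := rfl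
      grind
    · have h4 := hsu k (r ++ [t]) r' hk (by simp [hg])
      grind
  · intro k hk s' hf hi hm
    refine (uncPost_W hC ⟨hi, (hf.v .n rfl).trans h.nn, (hf.v .al rfl).trans hal,
      (hf.v .a rfl).trans ha, (hf.v .b rfl).trans hb, hal1, hk, h.le⟩ hm (hP.eq k hk)
      (hmono k hk)).mono (by omega) ?_
    grind [flat, flats_succ]
  · exact fun k s x h => h
  · exact fun k s x h => h
  · exact fun k r s x h => h.setv (by simp)

/-! ### The pass that replaces a bigram -/

def flushRC : Cmd := .ite (.v .pc) (emitC (.v .ps) (.v .pc)) .skip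

def replBody : Cmd :=
  .ite (.rd .ac (.v .p))
    (.asg .x (.rd .av (.v .p)) ;; .asg .k (.rd .ac (.v .p)) ;;
      .ite (.eq (.v .a) (.v .b))
        (flushRC ;;
          .ite (.eq (.v .x) (.v .a))
            (.ite (.div (.v .k) (.c 2)) (emitC (.v .c) (.div (.v .k) (.c 2))) .skip ;;
              .asg .pc (.mod (.v .k) (.c 2)))
            (.asg .pc (.v .k)))
        (.ite (.mul (.lt (.c 0) (.v .pc)) (.mul (.eq (.v .ps) (.v .a)) (.eq (.v .x) (.v .b))))
          (.asg .pc (.sub (.v .pc) (.c 1)) ;; flushRC ;; emitC (.v .c) (.c 1) ;;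
            .asg .pc (.sub (.v .k) (.c 1)))
          (flushRC ;; .asg .pc (.v .k))) ;;
      .asg .ps (.v .x))
    (flushRC ;; emitC (.rd .av (.v .p)) (.c 0) ;; .asg .ps (.c 0) ;; .asg .pc (.c 0))

/-- The machine counterpart of the state `u` of the replacement; `O` is the output of the earlier
rules. -/
structure RM (O : List (ℕ × ℕ)) (u : RS) (s : St) : Prop where
  ps : s.v .ps = u.p.1
  pc : s.v .pc = u.p.2
  seg : Seg (s.a .bv) (s.a .bc) 0 (O ++ u.em.map enc)
  q : s.v .q = (O ++ u.em.map enc).length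

theorem RM.setv {O : List (ℕ × ℕ)} {u : RS} (h : RM O u s) {y : Vr} {x : ℕ}
    (hy : y = .x ∨ y = .k ∨ y = .p) : RM O u (s.setv y x) := by
  rcases hy with rfl | rfl | rfl <;> exact ⟨h.ps, h.pc, h.seg, h.q⟩

theorem RM.setpc {O : List (ℕ × ℕ)} {u : RS} (h : RM O u s) {c : ℕ} :
    RM O ⟨(u.p.1, c), u.em⟩ (s.setv .pc c) := ⟨h.ps, rfl, h.seg, h.q⟩

theorem RM.setps {O : List (ℕ × ℕ)} {u : RS} (h : RM O u s) {c : ℕ} :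
    RM O ⟨(c, u.p.2), u.em⟩ (s.setv .ps c) := ⟨rfl, h.pc, h.seg, h.q⟩

variable {O : List (ℕ × ℕ)} {u : RS}

theorem flushRC_W (hC : C.Valid) (hm : RM O u s) (hl : O.length + u.em.length < C.I) :
    W C flushRC s 80 (RM O ⟨u.p, u.em ++ tk u.p⟩) := by
  refine (W.ite (t := 70) (e := .v .pc) trivial (fun h0 => ?_) fun h0 => ?_).mono
    (by decide) fun _ _ h => h
  · simp only [Exp.eval, hm.pc] at h0
    refine (emitC_W hC (e := .v .ps) (f := .v .pc) trivial trivial hm.seg hm.q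
      (by simpa using hl) (by decide) fun _ => ⟨rfl, Iff.rfl⟩).mono le_rfl ?_
    rintro s' - ⟨rfl, h1, h2⟩
    refine ⟨hm.ps, hm.pc, ?_, ?_⟩
    · rw [show tk u.p = [.run u.p.1 u.p.2] from if_neg h0]
      simp only [List.map_append, List.map_cons, List.map_nil, enc,
        ← List.append_assoc, ← hm.ps, ← hm.pc]
      exact h1
    grind [tk, enc]
  · simp only [Exp.eval, hm.pc] at h0
    refine W.basic trivial (by decide) ?_
    simp only [tk, if_pos h0, List.append_nil]
    exact ⟨hm.ps, hm.pc, hm.seg, hm.q⟩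

theorem emitRC_W (hC : C.Valid) (hm : RM O u s) (hl : O.length + u.em.length < C.I) {t : Tk}
    {e f : Exp} (he : e.ok C s) (hf : f.ok C s) (hc : e.cost + f.cost ≤ 20)
    (hff : ∀ x, f.eval C (s.seta .bv (s.v .q) x) = f.eval C s ∧
      (f.ok C (s.seta .bv (s.v .q) x) ↔ f.ok C s))
    (ht : enc t = (e.eval C s, f.eval C s)) :
    W C (emitC e f) s 70 (RM O ⟨u.p, u.em ++ [t]⟩) := by
  refine (emitC_W hC he hf hm.seg hm.q (by simpa using hl) hc hff).mono le_rfl ?_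
  rintro s' - ⟨rfl, h1, h2⟩
  refine ⟨hm.ps, hm.pc, ?_, ?_⟩
  · simp_all
  grind

theorem replBody_W (hC : C.Valid) {a b c : ℕ} (ha : s.v .a = a) (hb : s.v .b = b) (hc : s.v .c = c)
    (hm : RM O u s) {t : Tk} (h1 : s.a .av (s.v .p) = (enc t).1) (h2 : s.a .ac (s.v .p) = (enc t).2)
    (hp : s.v .p < C.I) (ht : ∀ x l, t = .run x l → 0 < l)
    (hl : O.length + u.em.length + 3 ≤ C.I) :
    W C replBody s 500 (RM O (RS.feed a b c u t)) := by
  have hw := hC.lt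
  cases t with
  | var j =>
    simp only [enc] at h1 h2
    refine (W.ite (t := 200) (e := .rd .ac (.v .p)) ⟨trivial, hp⟩ (fun h0 => ?_) fun _ => ?_).mono
      (by decide) fun _ _ h => h
    · grind [Exp.eval]
    refine W.bind (t₂ := 110) (flushRC_W hC hm (by omega)) (by omega) fun s₁ f1 hm1 => ?_
    have hp1 : s₁.v .p = s.v .p := f1.v .p rfl
    have hl1 := RS.length_tk u.p
    refine W.bind (t₁ := 70) (t₂ := 7) (emitRC_W hC (t := .var j) hm1 (by simp; omega)
      ⟨trivial, by grind [Exp.eval]⟩ (by simp only [Exp.ok]; omega)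
      (by decide) (fun _ => ⟨rfl, Iff.rfl⟩) ?_) (by omega) fun s₂ f2 hm2 => ?_
    · simp only [enc, Exp.eval, hp1, f1.a .av rfl, h1]
    refine W.basic ?_ (by decide) ⟨rfl, rfl, ?_, ?_⟩
    · grind [Cmd.ok, Exp.ok]
    · exact hm2.seg
    · exact hm2.q
  | run x l =>
    have hl0 := ht x l rfl
    simp only [enc] at h1 h2
    refine (W.ite (t := 480) (e := .rd .ac (.v .p)) ⟨trivial, hp⟩ (fun _ => ?_) fun h0 => ?_).mono
      (by decide) fun _ _ h => h
    swap
    · grind [Exp.eval]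
    refine W.bind (t₁ := 20) (t₂ := 450) (P := fun s' => s' = s.setv .x x) (W.basic ⟨trivial, hp⟩
      (by decide) (by simp [Cmd.exec, Exp.eval, h1])) (by omega) ?_
    rintro s₁ - rfl
    refine W.bind (t₁ := 16) (t₂ := 420) (P := fun s' => s' = (s.setv .x x).setv .k l)
      (W.basic ⟨trivial, hp⟩
      (by decide) (by
        have : (s.setv .x x).a .ac ((s.setv .x x).v .p) = l := h2
        simp [Cmd.exec, Exp.eval, this])) (by omega) ?_
    rintro s₂ - rfl
    have hm2 : RM O u ((s.setv .x x).setv .k l) := (hm.setv (by simp)).setv (by simp)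
    have ea2 : ((s.setv .x x).setv .k l).v .a = a := ha
    have eb2 : ((s.setv .x x).setv .k l).v .b = b := hb
    have ec2 : ((s.setv .x x).setv .k l).v .c = c := hc
    have ex2 : ((s.setv .x x).setv .k l).v .x = x := rfl
    have ek2 : ((s.setv .x x).setv .k l).v .k = l := rfl
    generalize (s.setv .x x).setv .k l = s₂ at *
    have hl1 := RS.length_tk u.p
    refine W.bind (t₁ := 400) (t₂ := 3) (P := fun s' => ∃ y,
      RM O ⟨(y, (RS.feed a b c u (.run x l)).p.2), (RS.feed a b c u (.run x l)).em⟩ s') ?_ (by omega) ?_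
    swap
    · rintro s₃ f3 ⟨y, hy⟩
      have hx3 := (f3.v .x rfl).trans ex2
      refine W.basic trivial (by decide) ?_
      have := hy.setps (c := x)
      grind [RS.feed, Cmd.exec, Exp.eval]
    refine (W.ite (t := 380) (e := .eq (.v .a) (.v .b)) ⟨trivial, trivial, trivial⟩ (fun h0 => ?_)
      fun h0 => ?_).mono (by decide) fun _ _ h => h
    · simp only [Exp.eval, idl, ne_eq, eqn_eq_zero, ea2, eb2, not_not] at h0
      subst h0
      refine W.bind (t₂ := 220) (flushRC_W hC hm2 (by omega)) (by omega) fun s₃ f3 hm3 => ?_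
      have ea3 := (f3.v .a rfl).trans ea2
      have ec3 := (f3.v .c rfl).trans ec2
      have ex3 := (f3.v .x rfl).trans ex2
      have ek3 := (f3.v .k rfl).trans ek2
      refine (W.ite (t := 200) (e := .eq (.v .x) (.v .a)) ⟨trivial, trivial, trivial⟩ (fun h0 => ?_)
        fun h0 => ?_).mono (by decide) fun _ _ h => h
      · simp only [Exp.eval, idl, ne_eq, eqn_eq_zero, ea3, ex3, not_not] at h0
        have e : RS.feed a a c u (.run x l) = ⟨(x, l % 2), u.em ++ tk u.p ++ tk (c, l / 2)⟩ := by
          simp [RS.feed, h0]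
        rw [e]
        refine W.bind (t₁ := 90) (t₂ := 9) (P := RM O ⟨u.p, u.em ++ tk u.p ++ tk (c, l / 2)⟩) ?_
          (by omega) fun s₄ f4 hm4 => ?_
        · refine (W.ite (t := 70) (e := .div (.v .k) (.c 2)) ⟨trivial, by simp only [Exp.ok]; omega,
            trivial⟩ (fun h1 => ?_) fun h1 => ?_).mono (by decide) fun _ _ h => h
          · simp only [Exp.eval, idl, ek3] at h1
            have e2 : tk (c, l / 2) = [.run c (l / 2)] := by grind [tk]
            rw [e2]
            refine emitRC_W hC hm3 (by simp; omega) trivial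
              ⟨trivial, by simp only [Exp.ok]; omega, trivial⟩
              (by decide) (fun _ => ⟨rfl, Iff.rfl⟩) ?_
            grind [enc, Exp.eval, idl]
          · simp only [Exp.eval, idl, ek3] at h1
            have e2 : tk (c, l / 2) = [] := by grind [tk]
            rw [e2, List.append_nil]
            exact W.basic trivial (by decide) hm3
        · have ek4 := (f4.v .k rfl).trans ek3
          refine W.basic ⟨trivial, by simp only [Exp.ok]; omega, trivial⟩ (by decide) ⟨u.p.1, ?_⟩
          simp only [Cmd.exec, Exp.eval, idl, ek4]
          exact hm4.setpc
      · simp only [Exp.eval, idl, ne_eq, eqn_eq_zero, ea3, ex3] at h0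
        have e : RS.feed a a c u (.run x l) = ⟨(x, l), u.em ++ tk u.p⟩ := by
          simp [RS.feed, h0]
        rw [e]
        refine W.basic trivial (by decide) ⟨u.p.1, ?_⟩
        simp only [Cmd.exec, Exp.eval, ek3]
        exact hm3.setpc
    · simp only [Exp.eval, idl, eqn_eq_zero, ea2, eb2] at h0
      have hev : (Exp.mul (.lt (.c 0) (.v .pc)) (.mul (.eq (.v .ps) (.v .a)) (.eq (.v .x) (.v .b)))).eval C
          s₂ ≠ 0 ↔ u.p.2 ≠ 0 ∧ u.p.1 = a ∧ x = b := by
        simp only [Exp.eval, idl, ne_eq, mul_eq_zero, ltn_eq_zero, eqn_eq_zero, hm2.pc, hm2.ps, ea2,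
          eb2, ex2]
        omega
      have hok : (Exp.mul (.lt (.c 0) (.v .pc)) (.mul (.eq (.v .ps) (.v .a))
          (.eq (.v .x) (.v .b)))).ok C s₂ := by
        grind [ltn_le, eqn_le, eqn, Exp.ok, Exp.eval, okOp, idl]
      refine (W.ite (t := 350) hok (fun h1 => ?_) fun h1 => ?_).mono (by decide) fun _ _ h => h
      · rw [hev] at h1
        have e : RS.feed a b c u (.run x l) =
            ⟨(x, l - 1), u.em ++ tk (u.p.1, u.p.2 - 1) ++ [.run c 1]⟩ := by grind [RS.feed]
        rw [e]
        refine W.bind (t₁ := 9) (t₂ := 300) (P := RM O ⟨(u.p.1, u.p.2 - 1), u.em⟩)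
          (W.basic ⟨trivial, by simp only [Exp.ok]; omega, by
            simp only [Exp.eval, okOp, hm2.pc]; omega⟩ (by decide) ?_) (by omega)
          fun s₃ f3 hm3 => ?_
        · simp only [Cmd.exec, Exp.eval, idl, hm2.pc]
          exact hm2.setpc
        refine W.bind (t₂ := 200) (flushRC_W hC hm3 (by simp only; omega)) (by omega) fun s₄ f4 hm4 => ?_
        have ec4 := (f4.v .c rfl).trans ((f3.v .c rfl).trans ec2)
        have ek4 := (f4.v .k rfl).trans ((f3.v .k rfl).trans ek2)
        have hl2 := RS.length_tk (u.p.1, u.p.2 - 1)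
        refine W.bind (t₂ := 9) (emitRC_W hC (t := .run c 1) hm4 (by grind) trivial
          (by simp only [Exp.ok]; omega) (by decide) (fun _ => ⟨rfl, Iff.rfl⟩) ?_) (by omega)
          fun s₅ f5 hm5 => ?_
        · grind [enc, Exp.eval]
        have ek5 := (f5.v .k rfl).trans ek4
        refine W.basic ⟨trivial, by simp only [Exp.ok]; omega, by grind [Exp.eval, okOp]⟩ (by decide) ⟨u.p.1, ?_⟩
        simp only [Cmd.exec, Exp.eval, idl, ek5]
        exact hm5.setpc
      · have h1' : ¬(u.p.2 ≠ 0 ∧ u.p.1 = a ∧ x = b) := fun h => hev.2 h h1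
        have e : RS.feed a b c u (.run x l) = ⟨(x, l), u.em ++ tk u.p⟩ := by grind [RS.feed]
        rw [e]
        refine W.bind (t₂ := 9) (flushRC_W hC hm2 (by omega)) (by omega) fun s₃ f3 hm3 => ?_
        have ek3 := (f3.v .k rfl).trans ek2
        refine W.basic trivial (by decide) ⟨u.p.1, ?_⟩
        simp only [Cmd.exec, Exp.eval, ek3]
        exact hm3.setpc

end

end RP

namespace RP
open WordRAM

def replC : Cmd := .asg .q (.c 0) ;;
  rulePass .av .ac (.asg .ps (.c 0) ;; .asg .pc (.c 0)) replBody (flushRC ;; emitC (.c 0) (.c 0)) ;;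
  copyC

section
variable {C : Ctx} {s : St} {n : ℕ} {G : ℕ → List Tk}

theorem length_flats_replTk (a b c k : ℕ) :
    (flats (fun i => replTk a b c (G i)) k).length ≤ 2 * (flats G k).length := by
  rw [length_flats, length_flats, Finset.mul_sum]
  exact Finset.sum_le_sum fun i _ => by grind [length_replTk]

theorem replC_W (hC : C.Valid) {a b c : ℕ} (h : Stored C n G s) (ha : s.v .a = a) (hb : s.v .b = b)
    (hc : s.v .c = c) (hI : 2 * (flats G n).length + 3 ≤ C.I) :
    W C replC s (1300 * (C.I + 1)) fun s' =>
      Seg (s'.a .av) (s'.a .ac) 0 (flats (fun i => replTk a b c (G i)) n) := by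
  have hlt := hC.lt
  let F := flats fun i => replTk a b c (G i)
  have hF : ∀ k < n, ∀ r r', G k = r ++ r' →
      (F k).length + (r.foldl (RS.feed a b c) ⟨(0, 0), []⟩).fin.length + 3 ≤ C.I := by
    intro k hk r r' hg
    have h1 := length_flats_mono (G := G) hk
    have h2 := length_flats_replTk (G := G) a b c k
    have h3 := length_replTk a b c r
    grind [replTk]
  have hfin : ∀ u : RS, u.fin.length = u.em.length + (tk u.p).length := fun u => by
    simp [RS.fin]
  have key := W.rulePass (T := 500) (R := fun k s => Seg (s.a .bv) (s.a .bc) 0 (F k) ∧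
      s.v .q = (F k).length)
    (Q := fun k r s => RM (F k) (r.foldl (RS.feed a b c) ⟨(0, 0), []⟩) s)
    (s₀ := s.setv .q 0) (sv := .av) (sc := .ac) (pre := .asg .ps (.c 0) ;; .asg .pc (.c 0))
    (body := replBody) (post := flushRC ;; emitC (.c 0) (.c 0))
    (n := n) (G := G) hC ?_ h.len h.pos h.lt h.seg h.nn ?_ ?_ ?_ ?_ ?_ ?_ ?_
  · refine W.bind (t₁ := 3) (t₂ := (∑ i ∈ Finset.range n, ((G i).length + 1) + 1) * (2 * 500 + 100) +
      80 * (C.I + 1) + 1) (P := fun s' => s' = s.setv .q 0) (W.basic ?_ (by decide) rfl) ?_ ?_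
    · exact Nat.pos_of_ne_zero (by positivity)
    pick_goal 2
    · rintro _ - rfl
      refine W.bind (t₂ := 80 * (C.I + 1)) key le_rfl ?_
      rintro s₁ f1 ⟨h1, h2⟩
      refine copyC_W hC h1 h2 ?_
      exact (length_flats_replTk (G := G) a b c n).trans (by omega)
    grind [length_flats]
  · rintro c (rfl | rfl | rfl) <;> exact ⟨rfl, rfl, rfl, rfl, rfl⟩
  · exact ⟨trivial, rfl⟩
  · rintro k hk s' hf hi ⟨h1, h2⟩
    refine W.basic ?_ (by decide) ⟨rfl, rfl, ?_, ?_⟩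
    · grind [Cmd.ok, Exp.ok]
    · grind [Cmd.exec, St.setv]
    simp_all [Cmd.exec, St.setv]
  · intro k hk r t r' hg s' hf hi h1 h2 h3 hm
    rw [List.foldl_append]
    refine replBody_W hC ((hf.v .a rfl).trans ha) ((hf.v .b rfl).trans hb) ((hf.v .c rfl).trans hc)
      hm h1 h2 h3 ?_ ?_
    · rintro x l rfl
      exact h.pos k hk x l (by simp [hg])
    grind
  · intro k hk s' hf hi hm
    have h4 := hF k hk (G k) [] (by simp)
    rw [hfin] at h4
    refine W.bind (t₂ := 70) (flushRC_W hC hm (by omega)) (by omega) fun s₁ f1 hm1 => ?_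
    refine (emitC_W hC (e := .c 0) (f := .c 0) (by simp only [Exp.ok]; omega)
      (by simp only [Exp.ok]; omega) hm1.seg hm1.q (by grind) (by decide) fun _ =>
        ⟨rfl, Iff.rfl⟩).mono le_rfl ?_
    grind [flat, replTk, flats_succ, RS.fin, Exp.eval]
  · exact fun k s x h => h
  · exact fun k s x h => h
  · exact fun k r s x h => h.setv (by simp)

/-! ### Chained lists of entries -/

/-- Linked lists with links `cn` in the cells below `m`. Cell 0 plays the role of the empty list. -/
def Chn (cn cy cw : ℕ → ℕ) (m : ℕ) : ℕ → List (ℕ × ℕ) → Prop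
  | p, [] => p = 0
  | p, e :: L => 0 < p ∧ p < m ∧ cy p = e.1 ∧ cw p = e.2 ∧ Chn cn cy cw m (cn p) L

theorem Chn.update {cn cy cw : ℕ → ℕ} {m x y z : ℕ} {L : List (ℕ × ℕ)} : ∀ {p : ℕ},
    Chn cn cy cw m p L → Chn (Function.update cn m x) (Function.update cy m y)
      (Function.update cw m z) (m + 1) p L := by
  induction L with
  | nil => exact fun h => h
  | cons e L ih =>
    rintro p ⟨h1, h2, h3, h4, h5⟩
    refine ⟨h1, by omega, ?_, ?_, ?_⟩
    · grind
    · grind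
    grind

def sel (x : ℕ) (E : List (ℕ × ℕ × ℕ)) : List (ℕ × ℕ) :=
  (E.filter fun e => e.1 = x).map fun e => e.2

/-- There is one chain per first symbol. The free cell is `E.length + 1` because cell 0 is not used.
-/
structure Chains (E : List (ℕ × ℕ × ℕ)) (s : St) : Prop where
  m : s.v .m = E.length + 1
  ch : ∀ x, Chn (s.a .cn) (s.a .cy) (s.a .cw) (s.v .m) (s.a .ch x) (sel x E)

/-- Add the entry `(z, x, t)`. -/
def addC : Cmd := .put .cn (.v .m) (.rd .ch (.v .z)) ;; .put .cy (.v .m) (.v .x) ;;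
  .put .cw (.v .m) (.v .t) ;; .put .ch (.v .z) (.v .m) ;; .inc .m

theorem addC_W (hC : C.Valid) {E : List (ℕ × ℕ × ℕ)} (h : Chains E s) (hz : s.v .z < C.I)
    (hI : E.length + 1 < C.I) :
    W C addC s 110 (Chains ((s.v .z, s.v .x, s.v .t) :: E)) := by
  have hlt := hC.lt
  have h1 := h.m
  refine W.basic ?_ (by decide) ⟨?_, fun x => ?_⟩
  · simp only [addC, Cmd.ok, Exp.ok, Exp.eval, okOp, Cmd.exec, St.seta, true_and, h1]
    omega
  · simp [addC, Cmd.exec, St.seta, St.setv, Exp.eval, idl, h1]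
  · have h2 := (h.ch x).update (x := s.a .ch (s.v .z)) (y := s.v .x) (z := s.v .t)
    simp only [addC, Cmd.exec, St.seta, St.setv, Exp.eval, idl]
    simp only [Function.update_self, ne_eq, reduceCtorEq, not_false_eq_true, Function.update_of_ne]
    by_cases hx : x = s.v .z
    · subst hx
      rw [Function.update_self]
      simp only [sel, List.filter_cons, decide_true, if_true, List.map_cons]
      refine ⟨by omega, by omega, by simp, by simp, ?_⟩
      rw [Function.update_self]
      exact h2
    grind [sel]

/-! ### The pass that collects the weighted bigrams -/

def lastv (l : ℕ → ℕ) (q : Option ℕ) (r : List Tk) : Option ℕ :=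
  r.foldl (fun _ t => some (thd l t)) q

theorem ents_snoc (f l : ℕ → ℕ) (o : ℕ) (t : Tk) (r : List Tk) : ∀ q,
    ents f l o q (r ++ [t]) = ents f l o q r ++ ents f l o (lastv l q r) [t] := by
  induction r with
  | nil => intro q; simp [ents, lastv]
  | cons u r ih => intro q; simp only [List.cons_append, ents, ih, List.append_assoc]; rfl

theorem length_ents (f l : ℕ → ℕ) (o : ℕ) (r : List Tk) : ∀ q,
    (ents f l o q r).length ≤ 2 * r.length := by
  induction r with
  | nil => intro q; simp [ents]
  | cons u r ih =>
    intro q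
    have := ih (some (thd l u))
    simp only [ents, List.length_append, List.length_cons]
    grind

/-- `u` tells whether a token precedes. If so, the pair with the preceding symbol is recorded; if
not, `x` is the first symbol that the rule derives and is kept in `fs`. -/
def linkC : Cmd := .ite (.v .u) (.asg .z (.v .pv) ;; .asg .t (.v .d) ;; addC)
  (.put .fs (.v .i) (.v .x))

/-- A run yields a pair with its predecessor and, with weight `d * (k / 2)`, the square of its
symbol. For a variable the first and last derived symbols are looked up; its inner bigrams are
counted in its own rule. -/
def countBody : Cmd :=
  .asg .d (.rd .occ (.v .i)) ;;
  .ite (.rd .ac (.v .p))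
    (.asg .x (.rd .av (.v .p)) ;; .asg .y (.v .x) ;; linkC ;;
      .asg .z (.v .x) ;; .asg .t (.mul (.v .d) (.div (.rd .ac (.v .p)) (.c 2))) ;; addC)
    (.asg .j (.sub (.rd .av (.v .p)) (.c 1)) ;; .asg .x (.rd .fs (.v .j)) ;;
      .asg .y (.rd .ls (.v .j)) ;; linkC) ;;
  .asg .pv (.v .y) ;; .asg .u (.c 1)

def countC : Cmd :=
  .asg .m (.c 1) ;; rulePass .av .ac (.asg .u (.c 0)) countBody (.put .ls (.v .i) (.v .pv))

def allEnts (f l occ : ℕ → ℕ) (G : ℕ → List Tk) (k : ℕ) : List (ℕ × ℕ × ℕ) :=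
  (List.range k).flatMap fun i => ents f l (occ i) none (G i)

theorem allEnts_succ (f l occ : ℕ → ℕ) (G : ℕ → List Tk) (k : ℕ) :
    allEnts f l occ G (k + 1) = allEnts f l occ G k ++ ents f l (occ k) none (G k) := by
  simp [allEnts, List.range_succ]

theorem length_allEnts (f l occ : ℕ → ℕ) (G : ℕ → List Tk) (k : ℕ) :
    (allEnts f l occ G k).length ≤ 2 * (flats G k).length := by
  induction k with
  | zero => simp [allEnts]
  | succ k ih => grind [length_ents, allEnts_succ, flats_succ, length_flat]

def linkE (x o : ℕ) : Option ℕ → List (ℕ × ℕ × ℕ)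
  | none => []
  | some p => [(p, x, o)]

/-- Chains grow at their heads, hence the entries are known only up to a permutation, which does not
affect the sums. First and last symbols are meaningful for non-empty rules only. -/
structure CM (f l : ℕ → ℕ) (G : ℕ → List Tk) (k : ℕ) (q : Option ℕ) (hd : ℕ)
    (E : List (ℕ × ℕ × ℕ)) (s : St) : Prop where
  lst : s.v .u = 0 ∧ q = none ∨ s.v .u = 1 ∧ q = some (s.v .pv)
  fst : q ≠ none → s.a .fs k = hd
  ch : ∃ E', E'.Perm E ∧ Chains E' s
  old : ∀ j < k, G j ≠ [] → s.a .fs j = f j ∧ s.a .ls j = l j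

theorem linkC_W (hC : C.Valid) {f l : ℕ → ℕ} {k hd x o : ℕ} {q : Option ℕ}
    {E : List (ℕ × ℕ × ℕ)} (hm : CM f l G k q hd E s) (hi : s.v .i = k) (hkI : k < C.I)
    (hx : s.v .x = x) (hd' : s.v .d = o) (hq : ∀ p, q = some p → p < C.I) (hI : E.length + 1 < C.I)
    (hdx : q = none → hd = x) :
    W C linkC s 130 fun s' => s'.a .fs k = hd ∧ (∃ E', E'.Perm (E ++ linkE x o q) ∧ Chains E' s') ∧
      ∀ j < k, G j ≠ [] → s'.a .fs j = f j ∧ s'.a .ls j = l j := by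
  have hlt := hC.lt
  obtain ⟨E', hE, hch⟩ := hm.ch
  refine (W.ite (e := .v .u) (t := 120) trivial (fun h0 => ?_) fun h0 => ?_).mono (by decide)
    fun _ _ h => h
  · rcases hm.lst with ⟨h1, -⟩ | ⟨h1, h2⟩
    · exact absurd h1 h0
    refine W.bind (t₁ := 3) (P := fun s' => s' = s.setv .z (s.v .pv)) (t₂ := 114)
      (W.basic trivial (by decide) rfl) (by omega) ?_
    rintro _ - rfl
    refine W.bind (t₁ := 3) (P := fun s' => s' = (s.setv .z (s.v .pv)).setv .t o) (t₂ := 110)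
      (W.basic trivial (by decide) (by subst hd'; rfl)) (by omega) ?_
    rintro _ - rfl
    refine (addC_W hC (s := (s.setv .z (s.v .pv)).setv .t o) (E := E') ⟨hch.m, hch.ch⟩ (show s.v .pv < C.I from hq _ h2) (by rw [hE.length_eq]; exact hI)).mono
      le_rfl ?_
    rintro s' hf h3
    refine ⟨(congrFun (hf.a .fs rfl) k).trans (hm.fst (by simp [h2])), ⟨_, ?_, h3⟩, fun j hj hg => ?_⟩
    · rw [h2]
      refine (List.Perm.trans ?_ (List.perm_append_comm (l₁ := [(s.v .pv, x, o)]))) 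
      subst hx
      exact hE.cons _
    · exact ⟨(congrFun (hf.a .fs rfl) j).trans (hm.old j hj hg).1,
        (congrFun (hf.a .ls rfl) j).trans (hm.old j hj hg).2⟩
  · rcases hm.lst with ⟨h1, h2⟩ | ⟨h1, -⟩
    swap
    · grind [Exp.eval]
    refine W.basic ?_ (by decide) ⟨?_, ⟨E', ?_, ?_⟩, fun j hj hg => ?_⟩
    · grind [Cmd.ok, Exp.ok, Exp.eval]
    · simp_all [Cmd.exec, Exp.eval, St.seta]
    · grind [linkE]
    · exact ⟨hch.m, hch.ch⟩
    · have := hm.old j hj hg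
      simp only [Cmd.exec, Exp.eval, St.seta, hi, Function.update_self]
      rw [Function.update_of_ne (by omega)]
      exact this

theorem countBody_W (hC : C.Valid) {f l : ℕ → ℕ} {k hd o : ℕ} {q : Option ℕ}
    {E : List (ℕ × ℕ × ℕ)} (hm : CM f l G k q hd E s) (hi : s.v .i = k) (hkI : k < C.I)
    {t : Tk} (h1 : s.a .av (s.v .p) = (enc t).1) (h2 : s.a .ac (s.v .p) = (enc t).2)
    (hp : s.v .p < C.I) (ht : ∀ x l, t = .run x l → 0 < l ∧ x < C.I ∧ o * (l / 2) < 2 ^ C.w)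
    (htv : ∀ j, t = .var j → j < k ∧ G j ≠ []) (ho : s.a .occ k = o)
    (hq : ∀ p, q = some p → p < C.I) (hI : E.length + 2 < C.I) (hdx : q = none → hd = thd f t) :
    W C countBody s 400 (CM f l G k (some (thd l t)) hd (E ++ ents f l o q [t])) := by
  have hlt := hC.lt
  refine W.bind (t₁ := 20) (t₂ := 370) (P := fun s' => s' = s.setv .d o)
    (W.basic ⟨trivial, by rw [Exp.eval, hi]; exact hkI⟩ (by decide)
      (by grind [Cmd.exec, Exp.eval])) (by omega) ?_
  rintro _ - rfl
  have hm0 : CM f l G k q hd E (s.setv .d o) := ⟨hm.lst, hm.fst, by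
    obtain ⟨E', hE, hch⟩ := hm.ch
    exact ⟨E', hE, hch.m, hch.ch⟩, hm.old⟩
  have hi0 : (s.setv .d o).v .i = k := hi
  have hd0 : (s.setv .d o).v .d = o := rfl
  have g1 : (s.setv .d o).a .av ((s.setv .d o).v .p) = (enc t).1 := h1
  have g2 : (s.setv .d o).a .ac ((s.setv .d o).v .p) = (enc t).2 := h2
  have gp : (s.setv .d o).v .p < C.I := hp
  generalize s.setv .d o = s₀ at *
  refine W.bind (t₁ := 350) (t₂ := 12) (P := fun s' => s'.v .y = thd l t ∧ s'.a .fs k = hd ∧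
    (∃ E', E'.Perm (E ++ ents f l o q [t]) ∧ Chains E' s') ∧
      ∀ j < k, G j ≠ [] → s'.a .fs j = f j ∧ s'.a .ls j = l j) ?_ (by omega) ?_
  · refine (W.ite (t := 330) (e := .rd .ac (.v .p)) ⟨trivial, gp⟩ (fun h0 => ?_)
      fun h0 => ?_).mono (by decide) fun _ _ h => h
    · rw [Exp.eval, Exp.eval, g2] at h0
      cases t with
      | var j => exact absurd rfl h0
      | run x a =>
        simp only [enc] at g1 g2
        obtain ⟨-, hx, hoa⟩ := ht x a rfl
        simp only [thd] at hdx ⊢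
        refine W.bind (t₁ := 20) (t₂ := 305) (P := fun s' => s' = s₀.setv .x x)
          (W.basic ⟨trivial, gp⟩ (by decide) (by simp [Cmd.exec, Exp.eval, g1])) (by omega) ?_
        rintro _ - rfl
        refine W.bind (t₁ := 3) (t₂ := 300) (P := fun s' => s' = (s₀.setv .x x).setv .y x)
          (W.basic trivial (by decide) rfl) (by omega) ?_
        rintro _ - rfl
        have hm2 : CM f l G k q hd E ((s₀.setv .x x).setv .y x) := ⟨hm0.lst, hm0.fst, by
          obtain ⟨E', hE, hch⟩ := hm0.ch
          exact ⟨E', hE, hch.m, hch.ch⟩, hm0.old⟩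
        refine W.bind (t₂ := 160) (linkC_W hC hm2 hi0 hkI (x := x) (o := o) rfl hd0 hq (by omega)
          hdx) (by omega) ?_
        rintro s₃ f3 ⟨h4, ⟨E', hE, hch⟩, hold⟩
        have ex : s₃.v .x = x := (f3.v .x rfl).trans rfl
        have ey : s₃.v .y = x := (f3.v .y rfl).trans rfl
        have ed : s₃.v .d = o := (f3.v .d rfl).trans hd0
        have ep : s₃.v .p = s₀.v .p := (f3.v .p rfl).trans rfl
        have eac : s₃.a .ac (s₃.v .p) = a := by rw [ep, f3.a .ac rfl]; exact g2
        refine W.bind (t₁ := 3) (t₂ := 150) (P := fun s' => s' = s₃.setv .z x)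
          (W.basic trivial (by decide) (by subst ex; rfl)) (by omega) ?_
        rintro _ - rfl
        refine W.bind (t₁ := 30) (t₂ := 110) (P := fun s' => s' = (s₃.setv .z x).setv .t (o * (a / 2)))
          (W.basic ?_ (by decide) ?_) (by omega) ?_
        · have e1 : (s₃.setv .z x).v .d = o := ed
          have e2 : (s₃.setv .z x).a .ac ((s₃.setv .z x).v .p) = a := eac
          have e3 : (s₃.setv .z x).v .p < C.I := ep.trans_lt gp
          grind [Cmd.ok, Exp.ok, Exp.eval, okOp, idl]
        · have e1 : (s₃.setv .z x).v .d = o := ed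
          have e2 : (s₃.setv .z x).a .ac ((s₃.setv .z x).v .p) = a := eac
          grind [Cmd.exec, Exp.eval, idl]
        rintro _ - rfl
        have hlen : E'.length + 1 < C.I := by
          have := hE.length_eq
          rw [List.length_append] at this
          rcases q <;> simp [linkE] at this <;> omega
        refine (addC_W hC (s := (s₃.setv .z x).setv .t (o * (a / 2))) (E := E') ⟨hch.m, hch.ch⟩ hx hlen).mono le_rfl ?_
        rintro s' hf h5
        refine ⟨(hf.v .y rfl).trans ey, (congrFun (hf.a .fs rfl) k).trans h4, ⟨_, ?_, h5⟩,
          fun j hj hg => ?_⟩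
        · have : (((s₃.setv .z x).setv .t (o * (a / 2))).v .x) = x := ex
          rw [this]
          refine ((hE.cons _).trans (List.perm_append_comm (l₁ := [(x, x, o * (a / 2))]))).trans ?_
          rw [List.append_eq, List.append_assoc]
          cases q <;> exact List.Perm.refl _
        · exact ⟨(congrFun (hf.a .fs rfl) j).trans (hold j hj hg).1,
            (congrFun (hf.a .ls rfl) j).trans (hold j hj hg).2⟩
    · rw [Exp.eval, Exp.eval, g2] at h0
      cases t with
      | run x a => grind [enc]
      | var j =>
        simp only [enc] at g1 g2
        obtain ⟨hjk, hgj⟩ := htv j rfl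
        obtain ⟨hfj, hlj⟩ := hm0.old j hjk hgj
        simp only [thd] at hdx ⊢
        refine W.bind (t₁ := 20) (t₂ := 300) (P := fun s' => s' = s₀.setv .j j)
          (W.basic ?_ (by decide) ?_) (by omega) ?_
        · grind [Cmd.ok, Exp.ok, Exp.eval, okOp]
        · simp [Cmd.exec, Exp.eval, idl, g1]
        rintro _ - rfl
        refine W.bind (t₁ := 20) (t₂ := 270) (P := fun s' => s' = (s₀.setv .j j).setv .x (f j))
          (W.basic ⟨trivial, show j < C.I by omega⟩ (by decide) ?_) (by omega) ?_
        · have : (s₀.setv .j j).a .fs ((s₀.setv .j j).v .j) = f j := hfj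
          grind [Cmd.exec, Exp.eval]
        rintro _ - rfl
        refine W.bind (t₁ := 20) (t₂ := 240)
          (P := fun s' => s' = ((s₀.setv .j j).setv .x (f j)).setv .y (l j))
          (W.basic ⟨trivial, show j < C.I by omega⟩ (by decide) ?_) (by omega) ?_
        · have : ((s₀.setv .j j).setv .x (f j)).a .ls (((s₀.setv .j j).setv .x (f j)).v .j) = l j :=
            hlj
          grind [Cmd.exec, Exp.eval]
        rintro _ - rfl
        have hm2 : CM f l G k q hd E (((s₀.setv .j j).setv .x (f j)).setv .y (l j)) :=
          ⟨hm0.lst, hm0.fst, by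
          obtain ⟨E', hE, hch⟩ := hm0.ch
          exact ⟨E', hE, hch.m, hch.ch⟩, hm0.old⟩
        refine (linkC_W hC hm2 hi0 hkI (x := f j) (o := o) rfl hd0 hq (by omega) hdx).mono
          (by omega) ?_
        rintro s' hf ⟨h4, ⟨E', hE, hch⟩, hold⟩
        refine ⟨hf.v .y rfl, h4, ⟨E', ?_, hch⟩, hold⟩
        cases q <;> grind [ents, thd, linkE]
  · rintro s₁ f1 ⟨h3, h4, ⟨E', hE, hch⟩, hold⟩
    refine W.basic ?_ (by decide) ⟨Or.inr ⟨rfl, ?_⟩, fun _ => h4, ⟨E', hE, hch.m, hch.ch⟩, hold⟩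
    · grind [Cmd.ok, Exp.ok]
    · rw [← h3]; rfl

theorem lastv_eq (l : ℕ → ℕ) (r : List Tk) (t : Tk) (q : Option ℕ) :
    lastv l q (r ++ [t]) = some (thd l t) := by simp [lastv]

theorem countC_W (hC : C.Valid) (h : Stored C n G s) {f l occ : ℕ → ℕ}
    (hord : ∀ i < n, ∀ j, Tk.var j ∈ G i → j < i ∧ G j ≠ [])
    (hf : ∀ i < n, ∀ t r, G i = t :: r → f i = thd f t)
    (hl : ∀ i < n, ∀ r t, G i = r ++ [t] → l i = thd l t)
    (hlI : ∀ i < n, G i ≠ [] → l i < C.I)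
    (hocc : ∀ i < n, s.a .occ i = occ i) (hch : ∀ x, s.a .ch x = 0)
    (hrun : ∀ i < n, ∀ x k, Tk.run x k ∈ G i → x < C.I ∧ occ i * (k / 2) < 2 ^ C.w)
    (hI : 2 * (flats G n).length + 3 ≤ C.I) :
    W C countC s (1000 * (C.I + 1)) fun s' =>
      ∃ E, E.Perm (allEnts f l occ G n) ∧ Chains E s' := by
  have hlt := hC.lt
  have key := W.rulePass (T := 400) (R := fun k s =>
      (∃ E', E'.Perm (allEnts f l occ G k) ∧ Chains E' s) ∧
        ∀ j < k, G j ≠ [] → s.a .fs j = f j ∧ s.a .ls j = l j)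
    (Q := fun k r s => CM f l G k (lastv l none r) (f k)
      (allEnts f l occ G k ++ ents f l (occ k) none r) s)
    (s₀ := s.setv .m 1) (sv := .av) (sc := .ac) (pre := .asg .u (.c 0))
    (body := countBody) (post := .put .ls (.v .i) (.v .pv))
    (n := n) (G := G) hC ?_ h.len h.pos h.lt h.seg h.nn ?_ ?_ ?_ ?_ ?_ ?_ ?_
  · refine W.bind (t₁ := 3) (t₂ := (∑ i ∈ Finset.range n, ((G i).length + 1) + 1) * (2 * 400 + 100))
      (P := fun s' => s' = s.setv .m 1) (W.basic ?_ (by decide) rfl) ?_ ?_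
    · grind [Cmd.ok, Exp.ok]
    pick_goal 2
    · rintro _ - rfl
      exact key.mono le_rfl fun s₁ f1 h1 => h1.1
    grind [length_flats]
  · rintro c (rfl | rfl | rfl) <;> exact ⟨rfl, rfl, rfl, rfl, rfl⟩
  · exact ⟨⟨[], List.Perm.refl _, rfl, fun x => hch x⟩, by simp⟩
  · rintro k hk s' hf' hi ⟨⟨E', hE, hch'⟩, h2⟩
    refine W.basic ?_ (by decide) ⟨Or.inl ⟨rfl, rfl⟩, fun h => absurd rfl h, ⟨E', ?_, ?_⟩, ?_⟩
    · grind [Cmd.ok, Exp.ok]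
    · simpa [ents] using hE
    · exact ⟨hch'.m, hch'.ch⟩
    · exact h2
  · intro k hk r t r' hg s' hf' hi h1 h2 h3 hm
    have hlen := length_flats_mono (G := G) hk
    have h4 := length_allEnts f l occ G k
    have h5 := length_ents f l (occ k) r none
    rw [hg, List.length_append, List.length_cons] at hlen
    rw [lastv_eq, ents_snoc, ← List.append_assoc]
    refine countBody_W hC hm hi (by have := h.le; omega) h1 h2 h3 ?_ ?_ ?_ ?_ ?_ ?_
    · rintro x a rfl
      exact ⟨h.pos k hk x a (by simp [hg]), hrun k hk x a (by simp [hg])⟩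
    · grind
    · rw [hf'.a .occ rfl]; exact hocc k hk
    · intro p hp
      rcases List.eq_nil_or_concat r with rfl | ⟨r₁, u, rfl⟩
      · simp [lastv] at hp
      rw [List.concat_eq_append] at hp hg
      rw [lastv_eq, Option.some_inj] at hp
      subst hp
      cases u with
      | run x a => exact (hrun k hk x a (by simp [hg])).1
      | var j =>
        have := hord k hk j (by simp [hg])
        exact hlI j (by omega) this.2
    · grind
    · intro hq
      rcases List.eq_nil_or_concat r with rfl | ⟨r₁, u, rfl⟩
      · exact hf k hk t r' hg
      grind [lastv_eq]
  · intro k hk s' hf' hi hm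
    obtain ⟨E', hE, hch'⟩ := hm.ch
    refine W.basic ⟨trivial, trivial, ?_⟩ (by decide) ⟨⟨E', ?_, ?_⟩, ?_⟩
    · rw [Exp.eval, hi]; have := h.le; omega
    · rw [allEnts_succ]; exact hE
    · exact ⟨hch'.m, hch'.ch⟩
    · intro j hj hg
      simp only [Cmd.exec, Exp.eval, hi, St.seta]
      by_cases hjk : j = k
      · subst hjk
        rcases List.eq_nil_or_concat (G j) with h0 | ⟨r₁, u, h0⟩
        · exact absurd h0 hg
        rw [List.concat_eq_append] at h0
        have hq := hm.lst
        have hhd := hm.fst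
        rw [h0, lastv_eq, ← hl j hk _ _ h0] at hq hhd
        simp_all
      · have := hm.old j (by omega) hg
        simp [hjk, this]
  · exact fun k s x h => ⟨⟨h.1.choose, h.1.choose_spec.1, h.1.choose_spec.2.m, h.1.choose_spec.2.ch⟩, h.2⟩
  · exact fun k s x h => ⟨⟨h.1.choose, h.1.choose_spec.1, h.1.choose_spec.2.m, h.1.choose_spec.2.ch⟩, h.2⟩
  · exact fun k r s x h => ⟨h.lst, h.fst, ⟨h.ch.choose, h.ch.choose_spec.1, h.ch.choose_spec.2.m,
      h.ch.choose_spec.2.ch⟩, h.old⟩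

end

end RP

namespace RP
open WordRAM

/-! ### The choice of a bigram -/

/-- The pair `ab` is the best one in `D` with respect to the weights `F`; the weight is `d`. -/
def BestIn (D : ℕ → ℕ → Prop) (F : ℕ → ℕ → ℕ) (d a b : ℕ) : Prop :=
  d = 1 ∧ b = 0 ∧ (∀ x y, D x y → F x y ≤ 1) ∨ 2 ≤ d ∧ D a b ∧ F a b = d ∧
    ∀ x y, D x y → F x y ≤ d ∧ (F x y = d → a < x ∨ a = x ∧ b ≤ y)

theorem BestIn.congr {D D' : ℕ → ℕ → Prop} {F : ℕ → ℕ → ℕ} {d a b : ℕ} (h : BestIn D F d a b)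
    (h1 : ∀ x y, D x y → D' x y) (h2 : ∀ x y, D' x y → D x y ∨ F x y = 0) : BestIn D' F d a b := by
  rcases h with ⟨rfl, h0, h⟩ | ⟨hd, h3, h4, h⟩
  · refine Or.inl ⟨rfl, h0, fun x y hxy => ?_⟩
    grind
  · refine Or.inr ⟨hd, h1 _ _ h3, h4, fun x y hxy => ?_⟩
    grind

/-- First symbols are processed in increasing order, so among equal weights an earlier first symbol
wins by itself and only second symbols need a comparison. The alternative `t = 0` is a bigram met
again after its counter was cleared. While nothing has weight two, `b = 0` makes the tie test fail.
-/
theorem BestIn.step {D : ℕ → ℕ → Prop} {F : ℕ → ℕ → ℕ} {d a b x y t : ℕ} (h : BestIn D F d a b)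
    (hD : ∀ x' y', D x' y' → x' ≤ x) (ht : t = F x y ∨ t = 0 ∧ D x y) :
    BestIn (fun x' y' => D x' y' ∨ x' = x ∧ y' = y) F (if d < t then t else d)
      (if d < t then x else a) (if d < t ∨ t = d ∧ x = a ∧ y < b then y else b) := by
  rcases ht with rfl | ⟨rfl, hxy⟩
  · rcases h with ⟨rfl, rfl, h⟩ | ⟨hd, h3, h4, h⟩
    · split_ifs with h1 h2 h2
      · refine Or.inr ⟨by omega, Or.inr ⟨rfl, rfl⟩, rfl, ?_⟩
        grind
      · omega
      · omega
      · refine Or.inl ⟨rfl, rfl, ?_⟩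
        grind
    · have h6 := hD a b h3
      split_ifs with h1 h2 h2
      · refine Or.inr ⟨by omega, Or.inr ⟨rfl, rfl⟩, rfl, ?_⟩
        grind
      · omega
      · have h7 : F x y = d ∧ x = a ∧ y < b := by omega
        obtain ⟨h7, rfl, h8⟩ := h7
        refine Or.inr ⟨hd, Or.inr ⟨rfl, rfl⟩, h7, ?_⟩
        grind
      · refine Or.inr ⟨hd, Or.inl h3, h4, ?_⟩
        grind
  · have h1 : ¬d < 0 := by omega
    have h2 : ¬(0 = d ∧ x = a ∧ y < b) := by
      rcases h with ⟨h, -⟩ | ⟨h, -⟩ <;> omega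
    simp only [h1, h2, or_self, if_false]
    exact h.congr (fun _ _ h => Or.inl h) fun x' y' h => Or.inl (by grind)

/-- The total weight of `y` in a chain. -/
def wsum (y : ℕ) (L : List (ℕ × ℕ)) : ℕ := ((L.filter fun e => e.1 = y).map fun e => e.2).sum

theorem wsum_cons (y : ℕ) (e : ℕ × ℕ) (L : List (ℕ × ℕ)) :
    wsum y (e :: L) = (if e.1 = y then e.2 else 0) + wsum y L := by grind [wsum]

theorem wsum_append (y : ℕ) (L M : List (ℕ × ℕ)) : wsum y (L ++ M) = wsum y L + wsum y M := by
  simp [wsum]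

theorem wsum_sel (x y : ℕ) (E : List (ℕ × ℕ × ℕ)) : wsum y (sel x E) = tot x y E := by
  induction E with
  | nil => rfl
  | cons e E ih => grind [tot, tot_append, tot_singleton, sel, wsum_cons]

theorem sum_length_sel (E : List (ℕ × ℕ × ℕ)) (S : ℕ) :
    ∑ x ∈ Finset.range S, (sel x E).length ≤ E.length := by
  induction E with
  | nil => simp [sel]
  | cons e E ih =>
    have : ∀ x, (sel x (e :: E)).length = (if e.1 = x then 1 else 0) + (sel x E).length := by
      grind [sel]
    simp only [this, Finset.sum_add_distrib, List.length_cons, Finset.sum_ite_eq]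
    split_ifs <;> omega

/-- The weights in the chain of `x` are added up per second symbol in the counters `ct`, which are
zero beforehand. -/
def sumC : Cmd := .asg .p (.rd .ch (.v .x)) ;;
  .wh (.v .p) (.asg .t (.rd .cy (.v .p)) ;;
    .put .ct (.v .t) (.add (.rd .ct (.v .t)) (.rd .cw (.v .p))) ;; .asg .p (.rd .cn (.v .p)))

def updC : Cmd :=
  .ite (.lt (.v .d) (.v .t)) (.asg .d (.v .t) ;; .asg .a (.v .x) ;; .asg .b (.v .y))
    (.ite (.mul (.eq (.v .t) (.v .d)) (.mul (.eq (.v .x) (.v .a)) (.lt (.v .y) (.v .b))))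
      (.asg .b (.v .y)) .skip)

/-- The second traversal reads each counter and clears it, so the counters are zero again after time
linear in the chain. -/
def maxC : Cmd := .asg .p (.rd .ch (.v .x)) ;;
  .wh (.v .p) (.asg .y (.rd .cy (.v .p)) ;; .asg .t (.rd .ct (.v .y)) ;; .put .ct (.v .y) (.c 0) ;;
    updC ;; .asg .p (.rd .cn (.v .p)))

/-- The start value `d = 1` lets only bigrams of weight at least two be selected. The chains are
emptied on the way for the next round. -/
def selectC : Cmd := .asg .d (.c 1) ;; .asg .a (.c 0) ;; .asg .b (.c 0) ;; .asg .x (.c 0) ;;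
  .wh (.lt (.v .x) (.v .r)) (sumC ;; maxC ;; .put .ch (.v .x) (.c 0) ;; .inc .x)

section
variable {C : Ctx} {s : St}

theorem sumC_W (hC : C.Valid) {m : ℕ} {L : List (ℕ × ℕ)} (hm : m ≤ C.I)
    (h : Chn (s.a .cn) (s.a .cy) (s.a .cw) m (s.a .ch (s.v .x)) L) (hx : s.v .x < C.I)
    (hL : ∀ e ∈ L, e.1 < C.I) (hw : ∀ y, wsum y L < 2 ^ C.w) (h0 : ∀ y, s.a .ct y = 0) :
    W C sumC s (100 * L.length + 30) fun s' => ∀ y, s'.a .ct y = wsum y L := by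
  have hlt := hC.lt
  have key := W.loop (C := C) (e := .v .p) (c := .asg .t (.rd .cy (.v .p)) ;;
    .put .ct (.v .t) (.add (.rd .ct (.v .t)) (.rd .cw (.v .p))) ;; .asg .p (.rd .cn (.v .p)))
    (fun k s' => s'.a .cn = s.a .cn ∧ s'.a .cy = s.a .cy ∧ s'.a .cw = s.a .cw ∧
      ∃ L₁ L₂, L = L₁ ++ L₂ ∧ L₂.length = k ∧
        Chn (s.a .cn) (s.a .cy) (s.a .cw) m (s'.v .p) L₂ ∧ ∀ y, s'.a .ct y = wsum y L₁)
    90 ?_ ?_ L.length (s.setv .p (s.a .ch (s.v .x)))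
    ⟨rfl, rfl, rfl, [], L, rfl, rfl, h, fun y => h0 y⟩
  · refine W.bind (t₁ := 20) (t₂ := 100 * L.length + 9) (P := fun s' => s' = s.setv .p (s.a .ch (s.v .x)))
      (W.basic ⟨trivial, hx⟩ (by decide) rfl) ?_ ?_
    pick_goal 2
    · rintro _ - rfl
      refine key.mono (by simp only [Exp.cost]; omega) ?_
      simp_all
    · omega
  · rintro s' ⟨-, -, -, L₁, L₂, h1, h2, h3, -⟩
    rw [List.length_eq_zero_iff] at h2
    subst h2
    exact ⟨trivial, h3⟩
  · rintro k s' ⟨e1, e2, e3, L₁, L₂, h1, h2, h3, h4⟩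
    rcases L₂ with _ | ⟨e, L₂⟩
    · simp at h2
    obtain ⟨g1, g2, g3, g4, g5⟩ := h3
    have he : e.1 < C.I := hL e (by simp [h1])
    have hws := hw e.1
    rw [h1, wsum_append, wsum_cons, if_pos rfl] at hws
    refine ⟨trivial, by simp only [Exp.eval]; omega, W.basic ?_ (by decide)
      ⟨e1, e2, e3, L₁ ++ [e], L₂, by simp [h1], by simpa using h2, ?_, ?_⟩⟩
    · simp only [Cmd.ok, Exp.ok, Exp.eval, okOp, Cmd.exec, St.setv, St.seta, true_and,
        Function.update_self, ne_eq, reduceCtorEq, not_false_eq_true, Function.update_of_ne, e2, e3,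
        g3, g4, h4]
      omega
    · simp_all [Cmd.exec, Exp.eval, St.setv, St.seta]
    · intro y
      rw [wsum_append, wsum_cons]
      simp only [Cmd.exec, Exp.eval, idl, St.setv, St.seta, Function.update_self, ne_eq, reduceCtorEq,
        not_false_eq_true, Function.update_of_ne, e2, e3, g3, g4, h4]
      grind [wsum]

theorem updC_W (hC : C.Valid) {d a b x y t : ℕ} (hd : s.v .d = d) (ha : s.v .a = a)
    (hb : s.v .b = b) (hx : s.v .x = x) (hy : s.v .y = y) (ht : s.v .t = t) :
    W C updC s 100 fun s' => s'.v .d = (if d < t then t else d) ∧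
      s'.v .a = (if d < t then x else a) ∧
      s'.v .b = (if d < t ∨ t = d ∧ x = a ∧ y < b then y else b) := by
  have hlt := hC.lt
  refine (W.ite (t := 80) (e := .lt (.v .d) (.v .t)) ⟨trivial, trivial, trivial⟩ (fun h0 => ?_)
    fun h0 => ?_).mono (by decide) fun _ _ h => h
  · simp only [Exp.eval, idl, ne_eq, ltn_eq_zero, hd, ht, not_le] at h0
    simp only [h0, true_or, if_true]
    exact W.basic ⟨trivial, trivial, trivial⟩ (by decide) ⟨ht, hx, hy⟩
  · simp only [Exp.eval, idl, ltn_eq_zero, hd, ht] at h0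
    simp only [not_lt.2 h0, false_or, if_false]
    have hle : eqn (s.v .x) (s.v .a) * ltn (s.v .y) (s.v .b) ≤ 1 := by
      have h5 := eqn_le (s.v .x) (s.v .a)
      have h6 := ltn_le (s.v .y) (s.v .b)
      nlinarith
    refine (W.ite (t := 20) (e := .mul (.eq (.v .t) (.v .d)) (.mul (.eq (.v .x) (.v .a))
      (.lt (.v .y) (.v .b)))) ?_ (fun h1 => ?_)
      fun h1 => ?_).mono (by decide) fun _ _ h => h
    · have h4 := eqn_le (s.v .t) (s.v .d)
      simp only [Exp.ok, Exp.eval, okOp, idl, and_true, true_and]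
      refine ⟨by omega, ?_⟩
      nlinarith
    · simp only [Exp.eval, idl, ne_eq, mul_eq_zero, ltn_eq_zero, eqn_eq_zero, hd, ht, hx, hy, ha,
        hb] at h1
      rw [if_pos (by omega)]
      exact W.basic trivial (by decide) ⟨hd, ha, hy⟩
    · simp only [Exp.eval, idl, ne_eq, mul_eq_zero, ltn_eq_zero, eqn_eq_zero, hd, ht, hx, hy, ha,
        hb] at h1
      rw [if_neg (by omega)]
      exact W.basic trivial (by decide) ⟨hd, ha, hb⟩

theorem maxC_W (hC : C.Valid) {m x : ℕ} {L : List (ℕ × ℕ)} {D : ℕ → ℕ → Prop} {F : ℕ → ℕ → ℕ}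
    (hm : m ≤ C.I) (hx : s.v .x = x) (hxI : x < C.I)
    (h : Chn (s.a .cn) (s.a .cy) (s.a .cw) m (s.a .ch x) L)
    (hL : ∀ e ∈ L, e.1 < C.I) (hF : ∀ y, F x y = wsum y L) (h0 : ∀ y, s.a .ct y = wsum y L)
    (hD : ∀ x' y', D x' y' → x' < x) (hb : BestIn D F (s.v .d) (s.v .a) (s.v .b)) :
    W C maxC s (200 * L.length + 30) fun s' => (∀ y, s'.a .ct y = 0) ∧
      BestIn (fun x' y' => D x' y' ∨ x' = x) F (s'.v .d) (s'.v .a) (s'.v .b) := by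
  have hlt := hC.lt
  have key := W.loop (C := C) (e := .v .p) (c := .asg .y (.rd .cy (.v .p)) ;;
      .asg .t (.rd .ct (.v .y)) ;; .put .ct (.v .y) (.c 0) ;; updC ;; .asg .p (.rd .cn (.v .p)))
    (fun k s' => s'.a .cn = s.a .cn ∧ s'.a .cy = s.a .cy ∧ s'.a .cw = s.a .cw ∧ s'.v .x = x ∧
      ∃ L₁ L₂, L = L₁ ++ L₂ ∧ L₂.length = k ∧
        Chn (s.a .cn) (s.a .cy) (s.a .cw) m (s'.v .p) L₂ ∧
        (∀ y, s'.a .ct y = if y ∈ L₁.map Prod.fst then 0 else wsum y L) ∧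
        BestIn (fun x' y' => D x' y' ∨ x' = x ∧ y' ∈ L₁.map Prod.fst) F (s'.v .d) (s'.v .a)
          (s'.v .b))
    190 ?_ ?_ L.length (s.setv .p (s.a .ch x))
    ⟨rfl, rfl, rfl, hx, [], L, rfl, rfl, h, fun y => by simpa [St.setv] using h0 y,
      by simpa [St.setv] using hb⟩
  · refine W.bind (t₁ := 20) (t₂ := 200 * L.length + 9) (P := fun s' => s' = s.setv .p (s.a .ch x))
      (W.basic ⟨trivial, hx.trans_lt hxI⟩ (by decide) (by subst hx; rfl)) ?_ ?_
    pick_goal 2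
    · rintro _ - rfl
      refine key.mono (by simp only [Exp.cost]; omega) ?_
      rintro s' - ⟨-, -, -, -, L₁, L₂, h1, h2, -, h4, h5⟩
      rw [List.length_eq_zero_iff] at h2
      subst h2
      rw [List.append_nil] at h1
      subst h1
      have hz : ∀ y, y ∉ L.map Prod.fst → wsum y L = 0 := by
        intro y hy
        have : (L.filter fun e => e.1 = y) = [] := by
          rw [List.filter_eq_nil_iff]
          grind
        simp [wsum, this]
      refine ⟨fun y => ?_, h5.congr ?_ ?_⟩
      · grind
      · grind
      grind
    · omega
  · rintro s' ⟨-, -, -, -, L₁, L₂, h1, h2, h3, -⟩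
    rw [List.length_eq_zero_iff] at h2
    subst h2
    exact ⟨trivial, h3⟩
  · rintro k s' ⟨e1, e2, e3, e4, L₁, L₂, h1, h2, h3, h4, h5⟩
    rcases L₂ with _ | ⟨e, L₂⟩
    · simp at h2
    obtain ⟨g1, g2, g3, g4, g5⟩ := h3
    have he : e.1 < C.I := hL e (by simp [h1])
    refine ⟨trivial, by simp only [Exp.eval]; omega, ?_⟩
    refine W.bind (t₁ := 20) (t₂ := 169) (P := fun s₁ => s₁ = s'.setv .y e.1)
      (W.basic ⟨trivial, by simp only [Exp.eval]; omega⟩ (by decide)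
        (by grind [Cmd.exec, Exp.eval])) (by omega) ?_
    rintro _ - rfl
    refine W.bind (t₁ := 20) (t₂ := 148)
      (P := fun s₁ => s₁ = (s'.setv .y e.1).setv .t (s'.a .ct e.1))
      (W.basic ⟨trivial, he⟩ (by decide) rfl) (by omega) ?_
    rintro _ - rfl
    refine W.bind (t₁ := 20) (t₂ := 127)
      (P := fun s₁ => s₁ = ((s'.setv .y e.1).setv .t (s'.a .ct e.1)).seta .ct e.1 0)
      (W.basic ⟨trivial, by simp only [Exp.ok]; omega, he⟩ (by decide) rfl) (by omega) ?_
    rintro _ - rfl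
    refine W.bind (t₂ := 20) (updC_W hC rfl rfl rfl rfl rfl rfl) (by omega) ?_
    rintro s₄ f4 ⟨k1, k2, k3⟩
    have ep : s₄.v .p = s'.v .p := f4.v .p rfl
    have ecn : s₄.a .cn = s.a .cn := (f4.a .cn rfl).trans e1
    have hstep := h5.step (x := x) (y := e.1) (t := s'.a .ct e.1) ?_ ?_
    · refine W.basic ⟨trivial, by grind [Exp.eval]⟩ (by decide) ⟨ecn,
        (f4.a .cy rfl).trans e2, (f4.a .cw rfl).trans e3, (f4.v .x rfl).trans e4, L₁ ++ [e], L₂,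
        by simp [h1], by simpa using h2, ?_, fun y => ?_, ?_⟩
      · have : (Cmd.exec C (.asg .p (.rd .cn (.v .p))) s₄).v .p = s.a .cn (s'.v .p) := by
          simp [Cmd.exec, Exp.eval, St.setv, ep, ecn]
        rw [this]; exact g5
      · have : (Cmd.exec C (.asg .p (.rd .cn (.v .p))) s₄).a .ct y =
            Function.update (s'.a .ct) e.1 0 y := congrFun (f4.a .ct rfl) y
        grind
      · have hdd : (Cmd.exec C (.asg .p (.rd .cn (.v .p))) s₄).v .d = s₄.v .d := rfl
        have haa : (Cmd.exec C (.asg .p (.rd .cn (.v .p))) s₄).v .a = s₄.v .a := rfl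
        have hbb : (Cmd.exec C (.asg .p (.rd .cn (.v .p))) s₄).v .b = s₄.v .b := rfl
        have kx : (((s'.setv .y e.1).setv .t (s'.a .ct e.1)).seta .ct e.1 0).v .x = x := e4
        rw [hdd, haa, hbb, k1, k2, k3, kx]
        refine hstep.congr ?_ ?_
        · grind
        grind
    · grind
    grind

theorem selectC_W (hC : C.Valid) {S : ℕ} {E : List (ℕ × ℕ × ℕ)} (h : Chains E s)
    (hr : s.v .r = S) (hS : S ≤ C.I) (hE : E.length + 1 ≤ C.I)
    (hES : ∀ e ∈ E, e.1 < S ∧ e.2.1 < S) (hw : ∀ x y, tot x y E < 2 ^ C.w)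
    (h0 : ∀ y, s.a .ct y = 0) :
    W C selectC s (1000 * (C.I + 1)) fun s' => (∀ y, s'.a .ct y = 0) ∧ (∀ x, s'.a .ch x = 0) ∧
      BestIn (fun _ _ => True) (fun x y => tot x y E) (s'.v .d) (s'.v .a) (s'.v .b) := by
  have hlt := hC.lt
  have hm := h.m
  have hw0 := W.wh (C := C) (e := .lt (.v .x) (.v .r))
    (c := sumC ;; maxC ;; .put .ch (.v .x) (.c 0) ;; .inc .x)
    (fun k s' => s'.a .cn = s.a .cn ∧ s'.a .cy = s.a .cy ∧ s'.a .cw = s.a .cw ∧ s'.v .r = S ∧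
      (∀ y, s'.a .ct y = 0) ∧ s'.v .x ≤ S ∧
      (∀ x, s'.a .ch x = if x < s'.v .x then 0 else s.a .ch x) ∧
      BestIn (fun x _ => x < s'.v .x) (fun x y => tot x y E) (s'.v .d) (s'.v .a) (s'.v .b) ∧
      k = ∑ x ∈ Finset.Ico (s'.v .x) S, (300 * (sel x E).length + 150)) ?_
    (∑ x ∈ Finset.range S, (300 * (sel x E).length + 150))
    ((((s.setv .d 1).setv .a 0).setv .b 0).setv .x 0)
    ⟨rfl, rfl, rfl, hr, h0, Nat.zero_le _, fun x => rfl, Or.inl ⟨rfl, rfl, fun x y h => by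
      exact absurd h (Nat.not_lt_zero _)⟩, by simp [St.setv]⟩
  · refine W.bind (t₁ := 3) (t₂ := 990 * (C.I + 1)) (P := fun s' => s' = s.setv .d 1)
      (W.basic ?_ (by decide) rfl) (by omega) ?_
    · grind [Cmd.ok, Exp.ok]
    rintro _ - rfl
    refine W.bind (t₁ := 3) (t₂ := 980 * (C.I + 1)) (P := fun s' => s' = (s.setv .d 1).setv .a 0)
      (W.basic ?_ (by decide) rfl) (by omega) ?_
    · grind [Cmd.ok, Exp.ok]
    rintro _ - rfl
    refine W.bind (t₁ := 3) (t₂ := 970 * (C.I + 1))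
      (P := fun s' => s' = ((s.setv .d 1).setv .a 0).setv .b 0)
      (W.basic ?_ (by decide) rfl) (by omega) ?_
    · grind [Cmd.ok, Exp.ok]
    rintro _ - rfl
    refine W.bind (t₁ := 3) (t₂ := 960 * (C.I + 1))
      (P := fun s' => s' = (((s.setv .d 1).setv .a 0).setv .b 0).setv .x 0)
      (W.basic ?_ (by decide) rfl) (by omega) ?_
    · grind [Cmd.ok, Exp.ok]
    rintro _ - rfl
    refine hw0.mono ?_ ?_
    · have := sum_length_sel E S
      rw [Finset.sum_add_distrib, ← Finset.mul_sum]
      simp only [Exp.cost, Finset.sum_const, Finset.card_range, smul_eq_mul]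
      omega
    · rintro s' - ⟨h1, -, -, -, -, -, hr', hct, hxS, hch, hb, -⟩
      simp only [Exp.eval, idl, ltn_eq_zero, hr'] at h1
      have hx : s'.v .x = S := by omega
      rw [hx] at hch hb
      refine ⟨hct, fun x => ?_, hb.congr (fun _ _ _ => trivial) fun x y _ => ?_⟩
      · rw [hch]
        split_ifs with h2
        · rfl
        · have h3 := h.ch x
          have h4 : sel x E = [] := by
            rw [sel, List.map_eq_nil_iff, List.filter_eq_nil_iff]
            grind
          rw [h4] at h3
          exact h3
      · by_cases h2 : x < S
        · omega
        · right
          have h4 : sel x E = [] := by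
            rw [sel, List.map_eq_nil_iff, List.filter_eq_nil_iff]
            grind
          rw [← wsum_sel, h4]; rfl
  · rintro k s' ⟨e1, e2, e3, hr', hct, hxS, hch, hb, rfl⟩
    refine ⟨⟨trivial, trivial, trivial⟩, fun h1 => ?_⟩
    simp only [Exp.eval, idl, ne_eq, ltn_eq_zero, hr', not_le] at h1
    generalize hx : s'.v .x = x at *
    have hsel : ∀ e ∈ sel x E, e.1 < C.I := by grind [sel]
    have hchn : Chn (s.a .cn) (s.a .cy) (s.a .cw) (s.v .m) (s.a .ch x) (sel x E) := h.ch x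
    have hchx : s'.a .ch x = s.a .ch x := by rw [hch, if_neg (by omega)]
    refine ⟨300 * (sel x E).length + 140, ∑ x ∈ Finset.Ico (x + 1) S, (300 * (sel x E).length + 150),
      ?_, ?_⟩
    · rw [Finset.sum_eq_sum_Ico_succ_bot h1]
      grind [Exp.cost]
    refine W.bind (t₂ := 200 * (sel x E).length + 100) (sumC_W hC (m := s.v .m) (L := sel x E)
      (by omega) ?_ (by omega) hsel (fun y => by rw [wsum_sel]; exact hw x y) hct) (by omega) ?_
    · simp_all
    intro s₁ f1 hct1
    have ex1 : s₁.v .x = x := (f1.v .x rfl).trans hx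
    refine W.bind (t₂ := 40) (maxC_W hC (m := s.v .m) (L := sel x E) (D := fun x' _ => x' < x)
      (F := fun x y => tot x y E) (by omega) ex1 (by omega) ?_ hsel
      (fun y => (wsum_sel x y E).symm) hct1 (fun _ _ h => h) ?_) (by omega) ?_
    · rw [f1.a .cn rfl, f1.a .cy rfl, f1.a .cw rfl, f1.a .ch rfl, e1, e2, e3, hchx]; exact hchn
    · rw [f1.v .d rfl, f1.v .a rfl, f1.v .b rfl]; exact hb
    rintro s₂ f2 ⟨hct2, hb2⟩
    have ex2 : s₂.v .x = x := (f2.v .x rfl).trans ex1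
    refine W.basic ?_ (by decide) ⟨?_, ?_, ?_, ?_, ?_, ?_, ?_, ?_, ?_⟩
    · simp only [Cmd.ok, Exp.ok, Exp.eval, okOp, Cmd.exec, St.seta, true_and, ex2]
      omega
    · exact (f2.a .cn rfl).trans ((f1.a .cn rfl).trans e1)
    · exact (f2.a .cy rfl).trans ((f1.a .cy rfl).trans e2)
    · exact (f2.a .cw rfl).trans ((f1.a .cw rfl).trans e3)
    · exact (f2.v .r rfl).trans ((f1.v .r rfl).trans hr')
    · exact hct2
    · simp_all [Cmd.exec, Exp.eval, idl, St.setv, St.seta]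
    · intro y
      simp only [Cmd.exec, Exp.eval, idl, St.setv, St.seta, Function.update_self, ex2]
      rw [f2.a .ch rfl, f1.a .ch rfl]
      grind
    · have k1 : (Cmd.exec C (.put .ch (.v .x) (.c 0) ;; .inc .x) s₂).v .x = x + 1 := by
        simp [Cmd.exec, Exp.eval, idl, St.setv, St.seta, ex2]
      have k2 : ∀ y, y ≠ .x → (Cmd.exec C (.put .ch (.v .x) (.c 0) ;; .inc .x) s₂).v y = s₂.v y := by
        simp_all [Cmd.exec, St.setv, St.seta]
      grind
    simp_all [Cmd.exec, Exp.eval, idl, St.setv, St.seta]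

end

end RP

namespace RP
open WordRAM

/-! ### One pass over a grammar with the invariant -/

section
variable {n N S : ℕ} {occ rf B : ℕ → ℕ} {U : ℕ → List (ℕ ⊕ ℕ)} {V : ℕ → List ℕ}

theorem length_le_sum {l : List ℕ} {g : ℕ → ℕ} (h : ∀ j ∈ l, 0 < g j) :
    l.length ≤ (l.map g).sum := by
  induction l with
  | nil => simp
  | cons a l ih => grind

theorem length_le_iev {u : List (ℕ ⊕ ℕ)} (h : ∀ j, .inr j ∈ u → V j ≠ []) :
    u.length ≤ (iev V u).length := by
  rw [length_iev, length_eq_inls]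
  exact Nat.add_le_add_left (length_le_sum fun j hj =>
    List.length_pos_iff.2 (h j (mem_vars.1 hj))) _

theorem Wf.length_le (h : Wf n U V) {i : ℕ} (hi : i < n) : (U i).length ≤ (V i).length := by
  rw [h.val i hi]
  exact length_le_iev fun j hj => (h.ord i hi j hj).2

theorem mem_iev {x : ℕ} {u : List (ℕ ⊕ ℕ)} (h : x ∈ iev V u) :
    .inl x ∈ u ∨ ∃ j, .inr j ∈ u ∧ x ∈ V j := by grind [iev, iv]

theorem Gm.mem_lt (g : Gm n N S occ rf B U V) : ∀ i, i < n → ∀ x ∈ V i, x < S := by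
  intro i
  induction i using Nat.strong_induction_on with
  | _ i ih =>
    intro hi x hx
    rw [g.wf.val i hi] at hx
    rcases mem_iev hx with h | ⟨j, hj, h⟩
    · exact g.sym i hi x h
    · have := (g.wf.ord i hi j hj).1
      grind

end

section
variable {C : Ctx} {s : St} {n N S : ℕ} {occ rf B : ℕ → ℕ} {G : ℕ → List Tk} {V : ℕ → List ℕ}

theorem run_le_length {r : List Tk} {x k : ℕ} (h : Tk.run x k ∈ r) : k ≤ (items r).length := by
  induction r with
  | nil => simp at h
  | cons t r ih =>
    rcases List.mem_cons.1 h with h | h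
    · subst h; simp [items_run]
    · have := ih h
      cases t <;> simp [items_run, items_var] <;> omega

theorem mem_items_run {r : List Tk} {x k : ℕ} (h : Tk.run x k ∈ r) (hk : 0 < k) :
    .inl x ∈ items r := by grind [items]

theorem Gm.run (g : Gm n N S occ rf B (fun i => items (G i)) V) {i x k : ℕ} (hi : i < n)
    (hp : Pos (G i)) (h : Tk.run x k ∈ G i) :
    x < S ∧ k ≤ (V i).length ∧ V i ≠ [] := by
  have h1 := run_le_length h
  have h2 := g.wf.length_le hi
  refine ⟨g.sym i hi x (mem_items_run h (hp x k h)), h1.trans h2, fun h0 => ?_⟩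
  have := hp x k h
  simp_all

theorem Gm.stored (g : Gm n N S occ rf B (fun i => items (G i)) V) (hp : ∀ i < n, Pos (G i))
    (hn : s.v .n = n) (hs : Seg (s.a .av) (s.a .ac) 0 (flats G n)) (hI : (flats G n).length ≤ C.I)
    (hS : S + N < 2 ^ C.w) (hnw : n < 2 ^ C.w) : Stored C n G s := by
  refine ⟨hn, hs, hI, hp, fun i hi t ht => ?_⟩
  cases t with
  | run x k =>
    have h1 := g.run hi (hp i hi) ht
    have h2 := g.length_le hi
    simp only [enc]; omega
  | var j =>
    have := (g.wf.ord i hi j (mem_items_var.2 ht)).1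
    simp only [enc]; omega

theorem length_flats_eq (G : ℕ → List Tk) (n : ℕ) :
    (flats G n).length = ∑ i ∈ Finset.range n, (G i).length + n := by
  rw [length_flats, Finset.sum_add_distrib]; simp

/-- The grammar that a pass leaves behind, with the mathematical facts about it. -/
structure Unced (n N S : ℕ) (al a b : ℕ) (occ rf B : ℕ → ℕ) (G : ℕ → List Tk) (V : ℕ → List ℕ)
    (P : ℕ → Res) : Prop where
  unc : Unc n (popP n al b) (popP n al a) G P
  gm : Gm n N S occ rf (fun i => B i + (2 * Nat.size N + 3) * rf i) (fun i => items (P i).mid)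
    (trim V P)
  top : trim V P (n - 1) = V (n - 1)
  can : ∀ i < n, US.Can (P i).mid

theorem Gm.unced (g : Gm n N S occ rf B (fun i => items (G i)) V) (al a b : ℕ) :
    ∃ P, Unced n N S al a b occ rf B G V P := by
  obtain ⟨P, hP⟩ := Unc.exists (pl := popP n al b) (pr := popP n al a) (G := G)
    fun i hi j hj => (g.wf.ord i hi j (mem_items_var.2 hj)).1
  have hn := g.pos
  have h1 := g.unc hP fun x => by grind [popP]
  exact ⟨P, hP, h1.1, h1.2, fun i hi => (hP.split_items hi).2.of_infix⟩

theorem Unced.length (u : Unced n N S al a b occ rf B G V P) :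
    (flats (fun i => (P i).mid) n).length ≤ N + ∑ i ∈ Finset.range n, rf i + n ∧
    (flats (fun i => (P i).mid) n).length ≤ ∑ i ∈ Finset.range n, B i +
      (2 * Nat.size N + 3) * ∑ i ∈ Finset.range n, rf i + n := by
  have := u.gm.tokens (r := fun i => (P i).mid) fun i hi => ⟨u.can i hi, rfl⟩
  rw [Finset.sum_add_distrib, ← Finset.mul_sum] at this
  rw [length_flats_eq]
  omega

theorem Unced.W (hC : C.Valid) (g : Gm n N S occ rf B (fun i => items (G i)) V)
    (u : Unced n N S al a b occ rf B G V P) (h : Stored C n G s) (hal : s.v .al = al)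
    (ha : s.v .a = a) (hb : s.v .b = b) (hal1 : al ≤ 1)
    (hI : (flats (fun i => (P i).mid) n).length ≤ C.I) (hS : S + N < 2 ^ C.w) :
    W C uncC s (2100 * (C.I + 1)) fun s' => Stored C n (fun i => (P i).mid) s' := by
  have hlt := hC.lt
  have hle := h.le
  refine (uncC_W hC h g.wf u.unc hal ha hb hal1 hI fun i hi => ?_).mono le_rfl ?_
  · rw [← (u.unc.split_items hi).1]
    have h1 := (u.unc.vals g.wf i hi).split
    have h2 := u.gm.wf.length_le hi
    have h3 := congrArg List.length h1
    have h4 := g.length_le hi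
    grind [rep]
  · intro s' hf hs
    exact u.gm.stored (fun i hi => (u.can i hi).1) ((hf.v .n rfl).trans h.nn) hs hI hS (by omega)

theorem mem_ents {f l : ℕ → ℕ} {o : ℕ} {r : List Tk} (h : ∀ t ∈ r, thd f t < S ∧ thd l t < S) :
    ∀ q : Option ℕ, (∀ p, q = some p → p < S) → ∀ e ∈ ents f l o q r, e.1 < S ∧ e.2.1 < S := by
  induction r with
  | nil => grind [ents]
  | cons t r ih =>
    intro q hq e he
    have ht := h t (by simp)
    simp only [ents, List.mem_append] at he
    rcases he with (he | he) | he
    · grind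
    · rcases t with ⟨x, k⟩ | j
      · simp only [List.mem_singleton] at he
        subst he
        exact ⟨ht.1, ht.1⟩
      · simp at he
    · refine ih (fun t ht => h t (by simp [ht])) _ ?_ e he
      grind

theorem tot_perm {x y : ℕ} {E F : List (ℕ × ℕ × ℕ)} (h : E.Perm F) : tot x y E = tot x y F :=
  ((h.filter _).map _).sum_eq

theorem tot_allEnts (x y : ℕ) (f l occ : ℕ → ℕ) (G : ℕ → List Tk) (k : ℕ) :
    tot x y (allEnts f l occ G k) = ∑ i ∈ Finset.range k, tot x y (ents f l (occ i) none (G i)) := by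
  induction k with
  | zero => rfl
  | succ k ih => rw [allEnts_succ, tot_append, ih, Finset.sum_range_succ]

/-- Counting, and the choice of the bigram. -/
theorem count_select_W (hC : C.Valid) (g : Gm n N S occ rf B (fun i => items (G i)) V)
    (h : Stored C n G s) (hc : ∀ i < n, US.Can (G i)) (hV : ∀ i < n, (G i).IsChain (VR V))
    (hnil : ∀ i < n, G i = [] ↔ V i = []) (hocc : ∀ i < n, s.a .occ i = occ i)
    (hch : ∀ x, s.a .ch x = 0) (hct : ∀ x, s.a .ct x = 0) (hr : s.v .r = S) (hS : S ≤ C.I)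
    (hI : 2 * (flats G n).length + 3 ≤ C.I) (hN : N < 2 ^ C.w) :
    W C (countC ;; selectC) s (2001 * (C.I + 1)) fun s' => (∀ x, s'.a .ct x = 0) ∧
      (∀ x, s'.a .ch x = 0) ∧
      BestIn (fun _ _ => True) (fun x y => cnt x y (V (n - 1))) (s'.v .d) (s'.v .a) (s'.v .b) := by
  have hlt := hC.lt
  -- The default value belongs to empty variables, which occur in no rule.
  let f : ℕ → ℕ := fun i => (V i).headD 0
  let l : ℕ → ℕ := fun i => (V i).getLastD 0
  have hfl : ∀ j < n, V j ≠ [] → (V j).head? = some (f j) ∧ (V j).getLast? = some (l j) := by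
    intro j _ h0
    constructor
    · simp only [f]
      rcases hv : V j with _ | ⟨x, v⟩
      · exact absurd hv h0
      · rfl
    · simp only [l, List.getLastD_eq_getLast?]
      rw [List.getLast?_eq_some_getLast h0]; rfl
  have hflS : ∀ j < n, V j ≠ [] → f j < S ∧ l j < S := fun j hj h0 =>
    ⟨g.mem_lt j hj _ (List.mem_of_mem_head? (hfl j hj h0).1),
      g.mem_lt j hj _ (List.mem_of_mem_getLast? (hfl j hj h0).2)⟩
  have hord : ∀ i < n, ∀ j, Tk.var j ∈ G i → j < i ∧ V j ≠ [] := fun i hi j hj =>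
    g.wf.ord i hi j (mem_items_var.2 hj)
  have htS : ∀ i < n, ∀ t ∈ G i, thd f t < S ∧ thd l t < S := by
    intro i hi t ht
    cases t with
    | run x k =>
      have := (g.run hi (hc i hi).1 ht).1
      exact ⟨this, this⟩
    | var j =>
      have := hord i hi j ht
      exact hflS j (by omega) this.2
  refine W.bind (t₁ := 1000 * (C.I + 1)) (t₂ := 1000 * (C.I + 1)) (countC_W hC h (f := f) (l := l)
    (occ := occ) (fun i hi j hj => ?_) (fun i hi t r hg => ?_) (fun i hi r t hg => ?_)
    (fun i hi h0 => ?_) hocc hch (fun i hi x k hx => ?_) hI) (by omega) ?_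
  · grind
  · have h1 := head?_iev (V := V) (hc i hi).1 fun j hj => (hord i hi j hj).2
    have h2 : V i ≠ [] := fun h0 => by grind
    rw [← g.wf.val i hi, (hfl i hi h2).1, hg] at h1
    simp only [List.head?_cons, Option.bind_some] at h1
    cases t with
    | run x k => simpa [hdv, thd] using h1
    | var j =>
      have h3 := hord i hi j (by simp [hg])
      simp only [hdv, (hfl j (by omega) h3.2).1, Option.some_inj] at h1
      exact h1
  · have h1 := getLast?_iev (V := V) (hc i hi).1 fun j hj => (hord i hi j hj).2
    have h2 : V i ≠ [] := fun h0 => by grind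
    rw [← g.wf.val i hi, (hfl i hi h2).2, hg] at h1
    simp only [List.getLast?_append, List.getLast?_singleton, Option.some_or, Option.bind_some] at h1
    cases t with
    | run x k => simpa [lsv, thd] using h1
    | var j =>
      have h3 := hord i hi j (by simp [hg])
      simp only [lsv, (hfl j (by omega) h3.2).2, Option.some_inj] at h1
      exact h1
  · grind
  · have h1 := g.run hi (hc i hi).1 hx
    have h2 := g.occ_mul_le hi
    have h3 : occ i * (k / 2) ≤ occ i * (V i).length := Nat.mul_le_mul_left _ (by omega)
    omega
  · rintro s₁ f1 ⟨E, hE, hch1⟩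
    have htot : ∀ x y, tot x y E = cnt x y (V (n - 1)) := fun x y => by
      rw [tot_perm hE, tot_allEnts]
      exact g.tot_eq (r := G) (fun i hi => ⟨hc i hi, rfl⟩) hV hfl x y
    have hEl := hE.length_eq
    have hal := length_allEnts f l occ G n
    refine (selectC_W hC hch1 ((f1.v .r rfl).trans hr) hS (by omega) (fun e he => ?_)
      (fun x y => ?_) fun y => ?_).mono le_rfl ?_
    · have he := hE.mem_iff.1 he
      rw [allEnts, List.mem_flatMap] at he
      obtain ⟨i, hi, he⟩ := he
      exact mem_ents (htS i (List.mem_range.1 hi)) none (by simp) e he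
    · rw [htot]
      have := length_repl (a := x) (b := y) (c := 0) (V (n - 1))
      have := g.len
      omega
    · rw [f1.a .ct rfl]; exact hct y
    simp_all

end

/-! ### Symbols and their numbers -/

/-- The symbol with number `x`, where `K` is the number of letters. -/
def symOf (K : ℕ) (lt : ℕ → ℕ) (x : ℕ) : Symb := if x < K then .letter (lt x) else .var (x - K)

/-- Letters are numbered increasingly and new variables follow them, so comparing numbers realises
the canonical resolution of ties. -/
theorem symOf_lt {K : ℕ} {lt : ℕ → ℕ} (hlt : ∀ x y, x < y → y < K → lt x < lt y) {x y : ℕ}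
    (h : x < y) : skey (symOf K lt x) < skey (symOf K lt y) := by
  unfold symOf
  split_ifs with h1 h2 h2
  · simp only [skey, Prod.Lex.toLex_lt_toLex]
    simp_all
  · simp [skey, Prod.Lex.toLex_lt_toLex]
  · omega
  · simp only [skey, Prod.Lex.toLex_lt_toLex]
    grind

theorem symOf_inj {K : ℕ} {lt : ℕ → ℕ} (hlt : ∀ x y, x < y → y < K → lt x < lt y) {x y : ℕ} :
    symOf K lt x = symOf K lt y ↔ x = y := by
  refine ⟨fun h => ?_, fun h => h ▸ rfl⟩
  rcases lt_trichotomy x y with h1 | h1 | h1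
  · exact absurd (symOf_lt hlt h1) (by rw [h]; exact lt_irrefl _)
  · exact h1
  · exact absurd (symOf_lt hlt h1) (by rw [h]; exact lt_irrefl _)

section
variable {K : ℕ} {lt : ℕ → ℕ} {w : List ℕ} {d a b : ℕ}

/-- A bigram of symbols that are not images of numbers does not occur in the string, so only
numbered bigrams compete. -/
theorem BestIn.best (hlt : ∀ x y, x < y → y < K → lt x < lt y)
    (h : BestIn (fun _ _ => True) (fun x y => cnt x y w) d a b) (hd : 2 ≤ d) :
    Best (w.map (symOf K lt)) (symOf K lt a) (symOf K lt b) := by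
  have hi := fun {x y} => symOf_inj hlt (x := x) (y := y)
  have hcm : ∀ x y, cnt (symOf K lt x) (symOf K lt y) (w.map (symOf K lt)) = cnt x y w :=
    fun x y => cnt_map (fun _ _ => hi) fun _ _ => hi
  rcases h with ⟨h, -⟩ | ⟨-, -, h1, h2⟩
  · omega
  refine ⟨by simp_all, fun a' b' => ?_⟩
  rw [hcm]
  simp only at h1
  by_cases h0 : cnt a' b' (w.map (symOf K lt)) = 0
  · omega
  · obtain ⟨ha, hb⟩ := mem_of_cnt_ne_zero h0
    rw [List.mem_map] at ha hb
    obtain ⟨x, -, rfl⟩ := ha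
    obtain ⟨y, -, rfl⟩ := hb
    rw [hcm, h1]
    have h3 := h2 x y trivial
    refine ⟨h3.1, fun h4 => ?_⟩
    rcases h3.2 h4 with h5 | ⟨rfl, h5⟩
    · grind [symOf_lt]
    · refine Or.inr ⟨rfl, ?_⟩
      rcases Nat.lt_or_eq_of_le h5 with h6 | rfl
      · exact (symOf_lt hlt h6).le
      · exact le_rfl

theorem BestIn.small (h : BestIn (fun _ _ => True) (fun x y => cnt x y w) d a b) (hd : d < 2)
    (x y : ℕ) : cnt x y w ≤ 1 := by
  rcases h with ⟨-, -, h⟩ | ⟨h, -⟩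
  · exact h x y trivial
  · omega

theorem cnt_map_symOf_lt (hlt : ∀ x y, x < y → y < K → lt x < lt y)
    (h : ∀ x y, cnt x y w ≤ 1) (a' b' : Symb) : cnt a' b' (w.map (symOf K lt)) < 2 := by
  have hi := fun {x y} => symOf_inj hlt (x := x) (y := y)
  by_contra h0
  obtain ⟨ha, hb⟩ := mem_of_cnt_ne_zero (a := a') (b := b') (w := w.map (symOf K lt)) (by omega)
  rw [List.mem_map] at ha hb
  obtain ⟨x, -, rfl⟩ := ha
  obtain ⟨y, -, rfl⟩ := hb
  simp_all [cnt_map]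

theorem map_repl_symOf (hlt : ∀ x y, x < y → y < K → lt x < lt y) (h : ℕ) :
    (repl a b (K + h) w).map (symOf K lt) =
      repl (symOf K lt a) (symOf K lt b) (.var h) (w.map (symOf K lt)) := by
  grind [symOf_inj, repl_map, symOf]

end

end RP

namespace RP
open WordRAM

/-! ### The main loop -/

/-- `nm` maps symbol numbers to output codes, and `2h + 1` is the code of the new variable `h`.
Clearing `al` prepares the next pass for uncrossing. -/
def recordC : Cmd := .put .ra (.v .h) (.rd .nm (.v .a)) ;; .put .rb (.v .h) (.rd .nm (.v .b)) ;;
  .put .nm (.v .r) (.add (.add (.v .h) (.v .h)) (.c 1)) ;; .asg .al (.c 0)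

def stepC : Cmd := recordC ;; uncC ;; .asg .c (.v .r) ;; replC ;; .inc .h ;; .inc .r

/-- All runs are popped for counting; the popping for the chosen bigram follows in `stepC`, when
that bigram is known. -/
def roundC : Cmd := .asg .al (.c 1) ;; uncC ;; (countC ;; selectC) ;;
  .ite (.lt (.v .d) (.c 2)) (.asg .nz (.c 0)) stepC

def mainC : Cmd := .asg .nz (.c 1) ;; .wh (.v .nz) roundC

/-- The tables for the symbols and the rules that exist so far. -/
structure Tables (K : ℕ) (lt : ℕ → ℕ) (done : List (Symb × Symb)) (s : St) : Prop where
  vh : s.v .h = done.length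
  vr : s.v .r = K + done.length
  nm : ∀ x < K + done.length, s.a .nm x = (symOf K lt x).code
  rules : ∀ j r, done[j]? = some r → s.a .ra j = r.1.code ∧ s.a .rb j = r.2.code

/-- The factor 2 in the bound for the potentials comes from the two popping passes per round; `Y` is
the initial potential. `w` is the current RePair string over actual symbols. -/
structure LoopInv (C : Ctx) (n N K : ℕ) (lt occ rf : ℕ → ℕ) (Y : ℕ) (done : List (Symb × Symb))
    (w : List Symb) (s : St) : Prop where
  ex : ∃ G V B, Stored C n G s ∧ Gm n N (K + done.length) occ rf B (fun i => items (G i)) V ∧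
    (V (n - 1)).map (symOf K lt) = w ∧ ∑ i ∈ Finset.range n, B i ≤
      Y + 2 * done.length * ((2 * Nat.size N + 3) * ∑ i ∈ Finset.range n, rf i)
  tab : Tables K lt done s
  occs : ∀ i < n, s.a .occ i = occ i
  ch : ∀ x, s.a .ch x = 0
  ct : ∀ x, s.a .ct x = 0

/-- What the main loop leaves behind. -/
structure LoopEnd (C : Ctx) (n K : ℕ) (lt : ℕ → ℕ) (done : List (Symb × Symb)) (w : List Symb)
    (s : St) : Prop where
  ex : ∃ (G : ℕ → List Tk) (v : List ℕ), Stored C n G s ∧ (∀ i < n - 1, G i = []) ∧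
    (∀ t ∈ G (n - 1), ∃ x k, t = .run x k ∧ x < K + done.length ∧ k ≤ 3) ∧
    items (G (n - 1)) = v.map .inl ∧ v.map (symOf K lt) = w ∧ 2 * (flats G n).length + 3 ≤ C.I
  tab : Tables K lt done s

/-- In the final rule this bounds runs by three, so writing them out symbol by symbol stays linear
in the number of tokens. -/
theorem half_le_cnt {V : ℕ → List ℕ} {r : List Tk} {x k : ℕ} (h : Tk.run x k ∈ r) :
    k / 2 ≤ cnt x x (iev V (items r)) := by
  induction r with
  | nil => simp at h
  | cons t r ih =>
    have e : items (t :: r) = items [t] ++ items r := by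
      rw [← items_append]; rfl
    have h1 := cnt_append_le (a := x) (b := x) (iev V (items [t])) (iev V (items r))
    grind [iev_append, iev, items, items_run, items_nil, iev_replicate, cnt_replicate]

theorem exists_map_inl {u : List (ℕ ⊕ ℕ)} (h : ∀ j, .inr j ∉ u) :
    ∃ v : List ℕ, u = v.map .inl := by
  induction u with
  | nil => exact ⟨[], rfl⟩
  | cons t u ih =>
    obtain ⟨v, hv⟩ := ih fun j hj => h j (by simp [hj])
    cases t with
    | inl x => exact ⟨x :: v, by simp [hv]⟩
    | inr j => exact absurd (by simp) (h j)

theorem iev_map_inl (V : ℕ → List ℕ) (v : List ℕ) : iev V (v.map .inl) = v := by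
  induction v with
  | nil => rfl
  | cons x v ih => simp [iv, ih]

section
variable {n N S : ℕ} {occ rf B : ℕ → ℕ} {G : ℕ → List Tk} {V : ℕ → List ℕ} {P : ℕ → Res}

/-- When no bigram occurs twice, the grammar has collapsed to its last rule. -/
theorem Unced.collapse {a b : ℕ} (u : Unced n N S 1 a b occ rf B G V P)
    (g : Gm n N S occ rf B (fun i => items (G i)) V) (h : ∀ x y, cnt x y (V (n - 1)) ≤ 1) :
    (∀ i < n - 1, (P i).mid = []) ∧
    (∀ t ∈ (P (n - 1)).mid, ∃ x k, t = .run x k ∧ x < S ∧ k ≤ 3) ∧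
    ∃ v, items (P (n - 1)).mid = v.map .inl ∧ V (n - 1) = v := by
  have hn := g.pos
  have hv := u.unc.vals g.wf
  have hpa := u.unc.popAll g.wf fun i hi x => by simp [popP, hi]
  have hnil : ∀ i < n - 1, trim V P i = [] := by
    intro i hi
    by_contra h0
    obtain ⟨h1, h2, -⟩ := (hpa i (by omega)).2 (by omega) h0
    have h3 := congrArg List.length (hv i (by omega)).split
    simp only [rep, List.length_append, List.length_replicate] at h3
    -- Two non-empty popped runs and a non-empty rest: the string before the pass was long enough to
    -- contain a bigram.
    obtain ⟨x, y, hxy⟩ := g.exists_two_le hi (by omega)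
    have := h x y
    omega
  have hvars : ∀ j, .inr j ∉ items (P (n - 1)).mid := by
    intro j hj
    have := u.gm.wf.ord (n - 1) (by omega) j hj
    exact this.2 (hnil j this.1)
  refine ⟨fun i hi => (hv i (by omega)).nil.2 (hnil i hi), fun t ht => ?_, ?_⟩
  · cases t with
    | var j => simp_all [mem_items_var]
    | run x k =>
      refine ⟨x, k, rfl, (u.gm.run (i := n - 1) (by omega) (u.can _ (by omega)).1 ht).1, ?_⟩
      have h1 := half_le_cnt (V := trim V P) ht
      have h2 := u.gm.wf.val (n - 1) (by omega)
      rw [← h2, u.top] at h1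
      have := h x x
      omega
  · obtain ⟨v, h1⟩ := exists_map_inl hvars
    refine ⟨v, h1, ?_⟩
    have h2 := u.gm.wf.val (n - 1) (by omega)
    rw [← u.top, h2, h1, iev_map_inl]

variable {C : Ctx} {s : St} {K Y m₀ : ℕ} {lt : ℕ → ℕ} {done rs : List (Symb × Symb)}
  {w start : List Symb}

theorem recordC_W (hC : C.Valid) {a b : ℕ} (ht : Tables K lt done s) (ha : s.v .a = a)
    (hb : s.v .b = b) (haS : a < K + done.length) (hbS : b < K + done.length)
    (hI : K + done.length < C.I) :
    W C recordC s 100 fun s' => s'.v .al = 0 ∧ s'.a .nm (K + done.length) = 2 * done.length + 1 ∧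
      (∀ x < K + done.length, s'.a .nm x = (symOf K lt x).code) ∧
      ∀ j r, (done ++ [(symOf K lt a, symOf K lt b)])[j]? = some r →
        s'.a .ra j = r.1.code ∧ s'.a .rb j = r.2.code := by
  have hlt := hC.lt
  have h1 := ht.vh
  have h2 := ht.vr
  refine W.basic ?_ (by decide) ⟨rfl, ?_, fun x hx => ?_, fun j r hj => ?_⟩
  · simp only [recordC, Cmd.ok, Exp.ok, Exp.eval, okOp, idl, Cmd.exec, St.seta, true_and,
      h1, h2, ha, hb]
    omega
  · simp only [recordC, Cmd.exec, Exp.eval, idl, St.seta, St.setv, h1, h2, Function.update_self]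
    omega
  · simp only [recordC, Cmd.exec, Exp.eval, idl, St.seta, St.setv, h1, h2, Function.update_self]
    rw [Function.update_of_ne (by omega)]
    exact ht.nm x hx
  · have hj' : j < done.length + 1 := by grind
    simp only [recordC, Cmd.exec, Exp.eval, idl, St.seta, St.setv, h1, h2, Function.update_self,
      ne_eq, reduceCtorEq, not_false_eq_true, Function.update_of_ne, ha, hb, ht.nm a haS,
      ht.nm b hbS]
    by_cases hjl : j = done.length
    · grind
    · rw [Function.update_of_ne hjl, Function.update_of_ne hjl]
      rw [List.getElem?_append_left (by omega)] at hj
      exact ht.rules j r hj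

/-- `hX` is the space requirement in abstract form: any size that obeys both token bounds must fit,
with the factor 2 and the slack that the replacement needs. -/
theorem stepC_W (hC : C.Valid) {a b : ℕ} (hlt : ∀ x y, x < y → y < K → lt x < lt y)
    (g : Gm n N (K + done.length) occ rf B (fun i => items (G i)) V) (h : Stored C n G s)
    (ht : Tables K lt done s) (ha : s.v .a = a) (hb : s.v .b = b)
    (haS : a < K + done.length) (hbS : b < K + done.length)
    (hw : (V (n - 1)).map (symOf K lt) = w)
    (hB : ∑ i ∈ Finset.range n, B i ≤
      Y + (2 * done.length + 1) * ((2 * Nat.size N + 3) * ∑ i ∈ Finset.range n, rf i))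
    (hm : done.length < m₀) (hKI : K + m₀ < C.I) (hN : C.I + N < 2 ^ C.w)
    (hX : ∀ Z, Z ≤ N + ∑ i ∈ Finset.range n, rf i + n →
      Z ≤ Y + (2 * m₀ + 1) * ((2 * Nat.size N + 3) * ∑ i ∈ Finset.range n, rf i) + n →
      2 * Z + 3 ≤ C.I)
    (hocc : ∀ i < n, s.a .occ i = occ i) (hch : ∀ x, s.a .ch x = 0) (hct : ∀ x, s.a .ct x = 0) :
    W C stepC s (3600 * (C.I + 1)) fun s' =>
      LoopInv C n N K lt occ rf Y (done ++ [(symOf K lt a, symOf K lt b)])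
        (repl (symOf K lt a) (symOf K lt b) (.var done.length) w) s' := by
  have hl := hC.lt
  have hle := h.le
  obtain ⟨P, u⟩ := g.unced 0 a b
  have hlen := u.length
  have hZ : 2 * (flats (fun i => (P i).mid) n).length + 3 ≤ C.I := by
    refine hX _ hlen.1 (hlen.2.trans (Nat.add_le_add_right ?_ _))
    refine (Nat.add_le_add_right hB _).trans ?_
    rw [add_assoc, ← Nat.succ_mul]
    exact Nat.add_le_add_left (Nat.mul_le_mul_right _ (by omega)) _
  refine W.bind (t₂ := 3500 * (C.I + 1)) (recordC_W hC ht ha hb haS hbS (by omega)) (by omega) ?_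
  rintro s₁ f1 ⟨hal, hnm1, hnm2, hru⟩
  have st1 : Stored C n G s₁ := ⟨(f1.v .n rfl).trans h.nn, by
    rw [f1.a .av rfl, f1.a .ac rfl]; exact h.seg, h.len, h.pos, h.lt⟩
  refine W.bind (t₂ := 1390 * (C.I + 1)) (Unced.W hC g u st1 hal ((f1.v .a rfl).trans ha)
    ((f1.v .b rfl).trans hb) (by omega) (by omega) (by omega)) (by omega) fun s₂ f2 st2 => ?_
  have vr2 : s₂.v .r = K + done.length := (f2.v .r rfl).trans ((f1.v .r rfl).trans ht.vr)
  refine W.bind (t₁ := 3) (t₂ := 1350 * (C.I + 1))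
    (P := fun s' => s' = s₂.setv .c (K + done.length)) (W.basic trivial (by decide) (by
      grind [Cmd.exec, Exp.eval])) (by omega) ?_
  rintro _ - rfl
  have st3 : Stored C n (fun i => (P i).mid) (s₂.setv .c (K + done.length)) :=
    ⟨st2.nn, st2.seg, st2.len, st2.pos, st2.lt⟩
  refine W.bind (t₂ := 40 * (C.I + 1)) (replC_W hC (c := K + done.length) st3
    ((f2.v .a rfl).trans ((f1.v .a rfl).trans ha))
    ((f2.v .b rfl).trans ((f1.v .b rfl).trans hb)) rfl hZ) (by omega) fun s₄ f4 h4 => ?_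
  have vh4 : s₄.v .h = done.length :=
    (f4.v .h rfl).trans ((f2.v .h rfl).trans ((f1.v .h rfl).trans ht.vh))
  have vr4 : s₄.v .r = K + done.length := (f4.v .r rfl).trans vr2
  have vn4 : s₄.v .n = n := (f4.v .n rfl).trans st2.nn
  have a4 : ∀ x, x = .nm ∨ x = .ra ∨ x = .rb → s₄.a x = s₁.a x := by
    rintro x (rfl | rfl | rfl) <;> exact (f4.a _ rfl).trans (f2.a _ rfl)
  have a4' : ∀ x, x = .occ ∨ x = .ch ∨ x = .ct → s₄.a x = s.a x := by
    rintro x (rfl | rfl | rfl) <;> exact (f4.a _ rfl).trans ((f2.a _ rfl).trans (f1.a _ rfl))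
  have hcross := u.unc.uncross (a := a) (b := b) g.wf fun i hi x => by simp [popP, hi]
  have g2 := u.gm.repl (a := a) (b := b) (c := K + done.length)
    (S' := K + (done.length + 1)) (by omega) (by omega) fun i hi => hcross i (by omega)
  have hitems : ∀ i < n, items (replTk a b (K + done.length) (P i).mid) =
      repl (.inl a) (.inl b) (.inl (K + done.length)) (items (P i).mid) := fun i hi =>
    items_replTk (u.can i hi)
  have g3 : Gm n N (K + (done.length + 1)) occ rf (fun i => B i + (2 * Nat.size N + 3) * rf i)
      (fun i => items (replTk a b (K + done.length) (P i).mid))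
      (fun i => repl a b (K + done.length) (trim V P i)) :=
    ⟨g2.pos, ⟨fun i hi => by rw [hitems i hi]; exact g2.wf.val i hi, fun i hi => by
      rw [hitems i hi]; exact g2.wf.ord i hi⟩, ⟨g2.bal.one, fun k hk h0 => by
      rw [g2.bal.bal k hk h0]
      exact Finset.sum_congr rfl fun i hi => by grind⟩, g2.two,
      fun i hi => by rw [hitems i hi]; exact g2.ref i hi, fun i hi => by
      rw [hitems i hi]; exact g2.gh i hi, g2.len, fun i hi => by
      rw [hitems i hi]; exact g2.sym i hi⟩
  refine W.basic (c := .inc .h ;; .inc .r) ?_ (le_trans (b := 15) (by decide) (by omega))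
    ⟨?_, ⟨?_, ?_, ?_, ?_⟩, ?_, ?_, ?_⟩
  · simp only [Cmd.ok, Exp.ok, Exp.eval, okOp, idl, Cmd.exec, St.setv, true_and, ne_eq,
      reduceCtorEq, not_false_eq_true, Function.update_of_ne, vh4, vr4]
    omega
  · refine ⟨fun i => replTk a b (K + done.length) (P i).mid,
      fun i => repl a b (K + done.length) (trim V P i),
      fun i => B i + (2 * Nat.size N + 3) * rf i, ?_, ?_, ?_, ?_⟩
    · refine g3.stored (fun i hi => pos_replTk _ _ _ _) vn4 h4 ?_ (by omega) (by omega)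
      exact (length_flats_replTk _ _ _ _).trans (by omega)
    · simpa using g3
    · rw [map_repl_symOf hlt, u.top, hw]
    · rw [Finset.sum_add_distrib, ← Finset.mul_sum, List.length_append, List.length_singleton]
      grind
  · simp [Cmd.exec, Exp.eval, idl, St.setv, vh4]
  · simp [Cmd.exec, Exp.eval, idl, St.setv, vr4, add_assoc]
  · intro x hx
    have e : (Cmd.exec C (.inc .h ;; .inc .r) s₄).a .nm x = s₁.a .nm x :=
      congrFun (a4 .nm (by simp)) x
    rw [e]
    rw [List.length_append, List.length_singleton] at hx
    by_cases hxl : x = K + done.length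
    · subst hxl
      rw [hnm1]
      simp [symOf, Symb.code]
    · exact hnm2 x (by omega)
  · intro j r hj
    have e : (Cmd.exec C (.inc .h ;; .inc .r) s₄).a .ra j = s₁.a .ra j :=
      congrFun (a4 .ra (by simp)) j
    have e' : (Cmd.exec C (.inc .h ;; .inc .r) s₄).a .rb j = s₁.a .rb j :=
      congrFun (a4 .rb (by simp)) j
    grind
  · intro i hi
    exact (congrFun (a4' .occ (by simp)) i).trans (hocc i hi)
  · intro x
    exact (congrFun (a4' .ch (by simp)) x).trans (hch x)
  · intro x
    exact (congrFun (a4' .ct (by simp)) x).trans (hct x)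

theorem Tables.frame {c : Cmd} {s' : St} (ht : Tables K lt done s) (hf : Frame c s s')
    (h1 : c.modV .h = false) (h2 : c.modV .r = false) (h3 : c.modA .nm = false)
    (h4 : c.modA .ra = false) (h5 : c.modA .rb = false) : Tables K lt done s' :=
  ⟨(hf.v _ h1).trans ht.vh, (hf.v _ h2).trans ht.vr, by rw [hf.a _ h3]; exact ht.nm, by
    rw [hf.a _ h4, hf.a _ h5]; exact ht.rules⟩

theorem roundC_W (hC : C.Valid) (hlt : ∀ x y, x < y → y < K → lt x < lt y)
    (hinv : LoopInv C n N K lt occ rf Y done w s) (hcan : Canon done.length w rs start)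
    (hm : done.length + rs.length = m₀) (hKI : K + m₀ < C.I) (hN : C.I + N < 2 ^ C.w)
    (hX : ∀ Z, Z ≤ N + ∑ i ∈ Finset.range n, rf i + n →
      Z ≤ Y + (2 * m₀ + 1) * ((2 * Nat.size N + 3) * ∑ i ∈ Finset.range n, rf i) + n →
      2 * Z + 3 ≤ C.I) (hnz : s.v .nz = 1) :
    W C roundC s (8000 * (C.I + 1)) fun s' =>
      (s'.v .nz = 0 ∧ rs = [] ∧ LoopEnd C n K lt done start s') ∨
      (s'.v .nz = 1 ∧ ∃ r rs' w', rs = r :: rs' ∧ LoopInv C n N K lt occ rf Y (done ++ [r]) w' s' ∧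
        Canon (done ++ [r]).length w' rs' start) := by
  have hl := hC.lt
  obtain ⟨G, V, B, st, g, hw, hB⟩ := hinv.ex
  have hle := st.le
  obtain ⟨P, u⟩ := g.unced 1 (s.v .a) (s.v .b)
  have hlen := u.length
  have hZ : 2 * (flats (fun i => (P i).mid) n).length + 3 ≤ C.I := by
    refine hX _ hlen.1 (hlen.2.trans (Nat.add_le_add_right ?_ _))
    refine (Nat.add_le_add_right hB _).trans ?_
    rw [add_assoc, ← Nat.succ_mul]
    exact Nat.add_le_add_left (Nat.mul_le_mul_right _ (by omega)) _
  refine W.bind (t₁ := 3) (t₂ := 7990 * (C.I + 1)) (P := fun s' => s' = s.setv .al 1)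
    (W.basic (by grind [Cmd.ok, Exp.ok]) (by decide) rfl) (by omega) ?_
  rintro _ - rfl
  have st1 : Stored C n G (s.setv .al 1) := ⟨st.nn, st.seg, st.len, st.pos, st.lt⟩
  have tab1 : Tables K lt done (s.setv .al 1) :=
    ⟨hinv.tab.vh, hinv.tab.vr, hinv.tab.nm, hinv.tab.rules⟩
  refine W.bind (t₂ := 5700 * (C.I + 1)) (Unced.W hC g u st1 rfl rfl rfl le_rfl (by omega)
    (by omega)) (by omega) fun s₂ f2 st2 => ?_
  have tab2 := tab1.frame f2 rfl rfl rfl rfl rfl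
  have hpa := u.unc.popAll g.wf fun i hi x => by simp [popP, hi]
  refine W.bind (t₂ := 3650 * (C.I + 1)) (count_select_W hC u.gm st2 u.can (fun i hi => (hpa i hi).1)
    (fun i hi => (u.unc.vals g.wf i hi).nil) (fun i hi => by
      rw [f2.a .occ rfl]; exact hinv.occs i hi) (fun x => by rw [f2.a .ch rfl]; exact hinv.ch x)
    (fun x => by rw [f2.a .ct rfl]; exact hinv.ct x) tab2.vr (by omega) hZ (by omega)) (by omega) ?_
  rintro s₃ f3 ⟨hct, hch, hbest⟩
  rw [u.top] at hbest
  have tab3 := tab2.frame f3 rfl rfl rfl rfl rfl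
  have st3 : Stored C n (fun i => (P i).mid) s₃ := ⟨(f3.v .n rfl).trans st2.nn, by
    rw [f3.a .av rfl, f3.a .ac rfl]; exact st2.seg, st2.len, st2.pos, st2.lt⟩
  have nz3 : s₃.v .nz = 1 := (f3.v .nz rfl).trans ((f2.v .nz rfl).trans hnz)
  refine (W.ite (t := 3600 * (C.I + 1)) (e := .lt (.v .d) (.c 2)) ⟨trivial, by
    simp only [Exp.ok]; omega, trivial⟩ (fun h0 => ?_) fun h0 => ?_).mono
    (by simp only [Exp.cost]; omega) fun _ _ h => h
  · simp only [Exp.eval, idl, ne_eq, ltn_eq_zero, not_le] at h0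
    have hsm := hbest.small h0
    obtain ⟨h1, h2, v, h3, h4⟩ := u.collapse g hsm
    have hdone : Canon done.length w [] w := .done fun a' b' => by
      rw [← hw]; exact cnt_map_symOf_lt hlt hsm a' b'
    obtain ⟨rfl, rfl⟩ := hcan.unique hdone
    refine W.basic (by grind [Cmd.ok, Exp.ok]) (le_trans (b := 3) (by decide)
      (by omega)) (Or.inl ⟨rfl, rfl, ⟨fun i => (P i).mid, v, ?_, h1, h2, h3, ?_, hZ⟩, ?_⟩)
    · exact ⟨st3.nn, st3.seg, st3.len, st3.pos, st3.lt⟩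
    · rw [← hw, h4]
    · exact ⟨tab3.vh, tab3.vr, tab3.nm, tab3.rules⟩
  · simp only [Exp.eval, idl, ltn_eq_zero] at h0
    have hb := hbest.best hlt h0
    have hcnt : cnt (s₃.v .a) (s₃.v .b) (V (n - 1)) ≠ 0 := by
      rcases hbest with ⟨h1, -⟩ | ⟨-, -, h1, -⟩
      · omega
      · simp only at h1; omega
    obtain ⟨ha, hbm⟩ := mem_of_cnt_ne_zero hcnt
    have hn := g.pos
    have haS := g.mem_lt (n - 1) (by omega) _ ha
    have hbS := g.mem_lt (n - 1) (by omega) _ hbm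
    rw [hw] at hb
    cases hcan with
    | done h1 => exact absurd hb.1 (by simp_all)
    | @step _ _ a b rs' _ hb' hc =>
      obtain ⟨rfl, rfl⟩ := hb'.unique hb
      rw [List.length_cons] at hm
      refine (stepC_W (m₀ := m₀) hC hlt u.gm st3 tab3 rfl rfl haS hbS (by rw [u.top, hw]) ?_
        (by omega) hKI hN hX (fun i hi => by
          rw [f3.a .occ rfl, f2.a .occ rfl]; exact hinv.occs i hi) hch hct).mono le_rfl ?_
      · rw [Finset.sum_add_distrib, ← Finset.mul_sum]
        grind
      · intro s' hf h5
        refine Or.inr ⟨(hf.v .nz rfl).trans nz3, _, rs', _, rfl, h5, ?_⟩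
        simp_all

/-- There is one round per rule and a last one that finds no frequent bigram. The rules still to
come, which the canonical run determines, serve as the loop counter. -/
theorem mainC_W (hC : C.Valid) (hlt : ∀ x y, x < y → y < K → lt x < lt y)
    (hinv : LoopInv C n N K lt occ rf Y [] w s) (hcan : Canon 0 w rs start)
    (hKI : K + rs.length < C.I) (hN : C.I + N < 2 ^ C.w)
    (hX : ∀ Z, Z ≤ N + ∑ i ∈ Finset.range n, rf i + n →
      Z ≤ Y + (2 * rs.length + 1) * ((2 * Nat.size N + 3) * ∑ i ∈ Finset.range n, rf i) + n →
      2 * Z + 3 ≤ C.I) :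
    W C mainC s (9000 * (C.I + 1) * (rs.length + 1)) fun s' => LoopEnd C n K lt rs start s' := by
  have hl := hC.lt
  have key := W.loop (C := C) (e := .v .nz) (c := roundC) (fun k s' =>
    (k = 0 ∧ s'.v .nz = 0 ∧ LoopEnd C n K lt rs start s') ∨
    (s'.v .nz = 1 ∧ ∃ done rs' w', k = rs'.length + 1 ∧ rs = done ++ rs' ∧
      LoopInv C n N K lt occ rf Y done w' s' ∧ Canon done.length w' rs' start))
    (8000 * (C.I + 1)) ?_ ?_ (rs.length + 1) (s.setv .nz 1)
    (Or.inr ⟨rfl, [], rs, w, rfl, rfl, ⟨?_, ⟨hinv.tab.vh, hinv.tab.vr, hinv.tab.nm,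
      hinv.tab.rules⟩, hinv.occs, hinv.ch, hinv.ct⟩, hcan⟩)
  · refine W.bind (t₁ := 3) (t₂ := 8990 * (C.I + 1) * (rs.length + 1)) (P := fun s' => s' = s.setv .nz 1)
      (W.basic (by grind [Cmd.ok, Exp.ok]) (by decide) rfl) (by nlinarith) ?_
    rintro _ - rfl
    refine key.mono (by grind [Exp.cost]) ?_
    simp_all
  · rintro s' (⟨-, h1, h⟩ | ⟨-, _, _, _, h, -⟩)
    · exact ⟨trivial, h1⟩
    · omega
  · rintro k s' (⟨h, -⟩ | ⟨h1, done, rs', w', h2, h3, h4, h5⟩)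
    · omega
    refine ⟨trivial, by simp only [Exp.eval]; omega, ?_⟩
    refine (roundC_W hC hlt h4 h5 (m₀ := rs.length) (by rw [h3, List.length_append]) hKI hN hX
      h1).mono le_rfl ?_
    grind
  · obtain ⟨G, V, B, h1, h2⟩ := hinv.ex
    exact ⟨G, V, B, ⟨h1.nn, h1.seg, h1.len, h1.pos, h1.lt⟩, h2⟩

end

end RP

namespace RP
open WordRAM

/-! ### The output -/

/-- All rules but the last are empty and occupy one end marker each, so the last rule begins at
index `n - 1`. The output is placed behind a number of records that exceeds every array index still
needed: tokens, rules and symbol names. -/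
def scanC : Cmd := .asg .p (.sub (.v .n) (.c 1)) ;; .asg .l (.c 0) ;;
  .wh (.rd .ac (.v .p)) (.asg .l (.add (.v .l) (.rd .ac (.v .p))) ;; .inc .p) ;;
  .asg .o (.add (.add (.add (.v .n) (.v .n)) (.c 1))
    (.mul (.c 32) (.add (.add (.v .p) (.v .h)) (.add (.v .r) (.c 1)))))

def pokeC (e : Exp) : Cmd := .poke (.v .q) e ;; .inc .q

def outC : Cmd := .asg .q (.v .o) ;; pokeC (.v .h) ;; .asg .i (.c 0) ;;
  .wh (.lt (.v .i) (.v .h)) (pokeC (.rd .ra (.v .i)) ;; pokeC (.rd .rb (.v .i)) ;; .inc .i) ;;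
  pokeC (.v .l) ;; .asg .p (.sub (.v .n) (.c 1)) ;;
  .wh (.rd .ac (.v .p))
    (.asg .k (.rd .ac (.v .p)) ;;
      .wh (.v .k) (pokeC (.rd .nm (.rd .av (.v .p))) ;; .asg .k (.sub (.v .k) (.c 1))) ;; .inc .p)

section
variable {C : Ctx} {s : St} {n : ℕ} {G : ℕ → List Tk}

theorem flats_of_nil (h : ∀ i < n, G i = []) : flats G n = List.replicate n (0, 0) := by
  induction n with
  | zero => rfl
  | succ n ih =>
    rw [flats_succ, ih fun i hi => h i (by omega), h n (by omega), List.replicate_succ']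
    rfl

theorem Stored.last (h : Stored C n G s) (hn : 0 < n) (h0 : ∀ i < n - 1, G i = []) :
    Seg (s.a .av) (s.a .ac) (n - 1) ((G (n - 1)).map enc ++ [(0, 0)]) ∧
      (flats G n).length = n - 1 + (G (n - 1)).length + 1 := by
  have e : flats G n = List.replicate (n - 1) (0, 0) ++ flat (G (n - 1)) := by
    rw [show flats G n = flats G (n - 1 + 1) by rw [Nat.sub_add_cancel hn], flats_succ,
      flats_of_nil h0]
  have := h.seg
  grind [Seg.append, flat, length_flat]

/-- The entries of a stored list of runs. -/
theorem Seg.get {f g : ℕ → ℕ} {o : ℕ} {r₁ r₂ : List Tk} {t : Tk}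
    (h : Seg f g o ((r₁ ++ t :: r₂).map enc ++ [(0, 0)])) :
    f (o + r₁.length) = (enc t).1 ∧ g (o + r₁.length) = (enc t).2 := by
  rw [List.map_append, List.append_assoc, Seg.append] at h
  have h2 := h.2
  rw [List.length_map] at h2
  exact ⟨h2.1, h2.2.1⟩

theorem Seg.get_last {f g : ℕ → ℕ} {o : ℕ} {r : List Tk}
    (h : Seg f g o (r.map enc ++ [(0, 0)])) : g (o + r.length) = 0 := by grind [Seg.append, Seg]

theorem length_items_le {r : List Tk} (h : ∀ t ∈ r, ∃ x k, t = .run x k ∧ k ≤ 3) :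
    (items r).length ≤ 3 * r.length := by
  induction r with
  | nil => simp
  | cons t r ih =>
    have := ih fun t ht => h t (by simp [ht])
    obtain ⟨x, k, rfl, hk⟩ := h t (by simp)
    grind [items_run]

theorem scanC_W (hC : C.Valid) {r : List Tk} (hn : s.v .n = n) (hn0 : 0 < n)
    (hs : Seg (s.a .av) (s.a .ac) (n - 1) (r.map enc ++ [(0, 0)]))
    (hr : ∀ t ∈ r, ∃ x k, t = .run x k ∧ 0 < k ∧ k ≤ 3) (hI : n + 3 * r.length ≤ 2 * C.I)
    (hb : C.b = 2 * n + 1)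
    (hI' : 32 * (n - 1 + r.length + s.v .h + s.v .r + 1) ≤ 32 * C.I) :
    W C scanC s (100 * (C.I + 1)) fun s' => s'.v .l = (items r).length ∧
      s'.v .o = C.b + 32 * (n - 1 + r.length + s.v .h + s.v .r + 1) := by
  have hlt := hC.lt
  have hsm := hC.small
  have hbd := hC.bound
  have hli := length_items_le fun t ht => by
    obtain ⟨x, k, h1, -, h2⟩ := hr t ht
    exact ⟨x, k, h1, h2⟩
  have key := W.loop (C := C) (e := .rd .ac (.v .p)) (c := .asg .l (.add (.v .l) (.rd .ac (.v .p))) ;;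
    .inc .p) (fun k s' => s'.a .ac = s.a .ac ∧ s'.v .n = n ∧ s'.v .h = s.v .h ∧ s'.v .r = s.v .r ∧
      ∃ r₁ r₂, r = r₁ ++ r₂ ∧ r₂.length = k ∧ s'.v .p = n - 1 + r₁.length ∧
        s'.v .l = (items r₁).length) 35 ?_ ?_ r.length ((s.setv .p (n - 1)).setv .l 0)
    ⟨rfl, hn, rfl, rfl, [], r, rfl, rfl, rfl, rfl⟩
  · refine W.bind (t₁ := 20) (t₂ := 90 * (C.I + 1) - 20) (P := fun s' => s' = s.setv .p (n - 1))
      (W.basic ?_ (by decide) (by grind [Cmd.exec, Exp.eval, idl])) (by omega) ?_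
    · grind [Cmd.ok, Exp.ok, Exp.eval, okOp]
    rintro _ - rfl
    refine W.bind (t₁ := 3) (t₂ := 90 * (C.I + 1) - 30)
      (P := fun s' => s' = (s.setv .p (n - 1)).setv .l 0)
      (W.basic (by grind [Cmd.ok, Exp.ok]) (by decide) rfl) (by omega) ?_
    rintro _ - rfl
    refine W.bind (t₂ := 40) key (by simp only [Exp.cost]; omega) ?_
    rintro s₁ - ⟨-, e1, e2, e3, r₁, r₂, h1, h2, h3, h4⟩
    rw [List.length_eq_zero_iff] at h2
    subst h2
    rw [List.append_nil] at h1
    subst h1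
    refine W.basic ?_ (by decide) ⟨h4, ?_⟩
    · grind [Cmd.ok, Exp.ok, Exp.eval, okOp, idl]
    · simp only [Cmd.exec, Exp.eval, idl, St.setv, Function.update_self, e1, e2, e3, h3]
      omega
  · rintro s' ⟨e0, e1, e2, e3, r₁, r₂, h1, h2, h3, h4⟩
    rw [List.length_eq_zero_iff] at h2
    subst h2
    rw [List.append_nil] at h1
    subst h1
    refine ⟨⟨trivial, by simp only [Exp.eval]; omega⟩, ?_⟩
    simp only [Exp.eval, e0, h3, hs.get_last]
  · rintro k s' ⟨e0, e1, e2, e3, r₁, r₂, h1, h2, h3, h4⟩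
    rcases r₂ with _ | ⟨t, r₂⟩
    · simp at h2
    obtain ⟨x, l, rfl, hl0, hl3⟩ := hr t (by simp [h1])
    have hlen := congrArg List.length h1
    simp only [List.length_append, List.length_cons] at hlen
    rw [h1] at hs
    have hac : s'.a .ac (s'.v .p) = l := by rw [e0, h3]; exact hs.get.2
    have hli' := congrArg (fun r => (items r).length) h1
    simp only [items_append, List.length_append, items_run, List.length_replicate] at hli'
    refine ⟨⟨trivial, by simp only [Exp.eval]; omega⟩, by grind [Exp.eval],
      W.basic ?_ (by decide) ⟨e0, e1, e2, e3, r₁ ++ [.run x l], r₂, by simp [h1], by simpa using h2,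
        ?_, ?_⟩⟩
    · simp only [Cmd.ok, Exp.ok, Exp.eval, okOp, Cmd.exec, St.setv, true_and, ne_eq,
        reduceCtorEq, not_false_eq_true, Function.update_of_ne, hac, h4]
      omega
    · simp [Cmd.exec, Exp.eval, idl, St.setv, h3, add_assoc]
    simp_all [Cmd.exec, Exp.eval, idl, St.setv, items_run]

structure OutInv (C : Ctx) (L : List ℕ) (s : St) : Prop where
  q : s.v .q = C.b + 32 * C.I + L.length
  out : ∀ i (h : i < L.length), s.o i = L[i]

theorem pokeC_W (hC : C.Valid) {L : List ℕ} (h : OutInv C L s) (hJ : L.length < C.J) {e : Exp} {x : ℕ}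
    (he : e.ok C s) (hx : e.eval C s = x) (hc : e.cost ≤ 30) :
    W C (pokeC e) s 50 fun s' => s' = (s.seto L.length x).setv .q (s.v .q + 1) ∧
      OutInv C (L ++ [x]) s' := by
  have hsm := hC.small
  have hbd := hC.bound
  have hq := h.q
  have e1 : (Cmd.exec C (pokeC e) s) = (s.seto L.length x).setv .q (s.v .q + 1) := by
    simp only [pokeC, Cmd.exec, Exp.eval, hx, hq, Nat.add_sub_cancel_left, idl]
    rw [show (s.seto L.length x).v .q = s.v .q from rfl, hq]
  refine W.basic ?_ ?_ ⟨e1, ?_⟩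
  · simp only [pokeC, Cmd.ok, Exp.ok, Exp.eval, okOp, Cmd.exec, true_and, he, hq, St.seto]
    omega
  · grind [pokeC, Cmd.cost, Exp.cost]
  · rw [e1]
    constructor
    · simp [St.setv, hq, add_assoc]
    · intro i hi
      simp only [St.setv, St.seto]
      by_cases hil : i = L.length
      · subst hil; simp
      · rw [Function.update_of_ne hil, List.getElem_append_left]
        exact h.out i (by simp at hi; omega)

theorem OutInv.setv {L : List ℕ} (h : OutInv C L s) {y : Vr} {x : ℕ} (hy : y ≠ .q) :
    OutInv C L (s.setv y x) :=
  ⟨by simp only [St.setv]; rw [Function.update_of_ne hy.symm]; exact h.q, h.out⟩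

theorem encodeRules_append (a b : List (Symb × Symb)) :
    encodeRules (a ++ b) = encodeRules a ++ encodeRules b := by simp [encodeRules]

theorem length_encodeRules (a : List (Symb × Symb)) : (encodeRules a).length = 2 * a.length := by
  induction a with
  | nil => rfl
  | cons r a ih =>
    rw [show r :: a = [r] ++ a from rfl, encodeRules_append, List.length_append, ih]
    simp [encodeRules]; omega

theorem outC_W (hC : C.Valid) {K : ℕ} {lt : ℕ → ℕ} {done : List (Symb × Symb)} {w : List Symb}
    {v : List ℕ} {r : List Tk} (ht : Tables K lt done s) (hn : s.v .n = n) (hn0 : 0 < n)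
    (hs : Seg (s.a .av) (s.a .ac) (n - 1) (r.map enc ++ [(0, 0)]))
    (hr : ∀ t ∈ r, ∃ x k, t = .run x k ∧ x < K + done.length ∧ 0 < k ∧ k ≤ 3)
    (hv : items r = v.map .inl) (hw : v.map (symOf K lt) = w)
    (hl : s.v .l = (items r).length) (ho : s.v .o = C.b + 32 * C.I)
    (hI : C.I = n - 1 + r.length + s.v .h + s.v .r + 1)
    (hJ : 2 * done.length + 2 + w.length ≤ C.J) :
    W C outC s (400 * (C.I + 1)) fun s' => s'.v .o = C.b + 32 * C.I ∧
      ∀ i (h : i < (done.length :: encodeRules done ++ w.length :: w.map Symb.code).length),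
        s'.o i = (done.length :: encodeRules done ++ w.length :: w.map Symb.code)[i] := by
  have hlt := hC.lt
  have vh := ht.vh
  have vr := ht.vr
  have hwl : w.length = (items r).length := by rw [← hw, hv]; simp
  set L₁ := done.length :: encodeRules done with hL₁
  have hL₁l : L₁.length = 2 * done.length + 1 := by grind [length_encodeRules]
  refine W.bind (t₁ := 3) (t₂ := 400 * (C.I + 1) - 10) (P := fun s' => s' = s.setv .q (C.b + 32 * C.I))
    (W.basic trivial (by decide) (by grind [Cmd.exec, Exp.eval])) (by omega) ?_
  rintro _ - rfl
  have o1 : OutInv C [] (s.setv .q (C.b + 32 * C.I)) := ⟨rfl, fun i hi => absurd hi (by simp)⟩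
  refine W.bind (t₂ := 400 * (C.I + 1) - 70) (pokeC_W hC o1 (by simp; omega) (x := done.length)
    trivial vh (by decide)) (by omega) ?_
  rintro s₂ f2 ⟨-, o2⟩
  refine W.bind (t₁ := 3) (t₂ := 400 * (C.I + 1) - 80) (P := fun s' => s' = s₂.setv .i 0)
    (W.basic (by grind [Cmd.ok, Exp.ok]) (by decide) rfl) (by omega) ?_
  rintro _ - rfl
  have k1 := W.loop (C := C) (e := .lt (.v .i) (.v .h)) (c := pokeC (.rd .ra (.v .i)) ;;
    pokeC (.rd .rb (.v .i)) ;; .inc .i) (fun k s' => s'.a = s.a ∧ s'.v .h = done.length ∧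
      s'.v .l = s.v .l ∧ s'.v .n = n ∧ s'.v .o = s.v .o ∧
      ∃ d₁ d₂, done = d₁ ++ d₂ ∧ d₂.length = k ∧ s'.v .i = d₁.length ∧
        OutInv C (done.length :: encodeRules d₁) s') 110 ?_ ?_ done.length (s₂.setv .i 0)
    ⟨?_, (f2.v .h rfl).trans vh, (f2.v .l rfl), (f2.v .n rfl).trans hn, f2.v .o rfl, [], done, rfl,
      rfl, rfl, o2.setv (by decide)⟩
  rotate_left
  · rintro s' ⟨e0, e1, -, -, -, d₁, d₂, h1, h2, h3, -⟩
    rw [List.length_eq_zero_iff] at h2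
    subst h2
    rw [List.append_nil] at h1
    subst h1
    exact ⟨⟨trivial, trivial, trivial⟩, by simp [Exp.eval, idl, e1, h3]⟩
  · rintro k s' ⟨e0, e1, e2, e3, e4, d₁, d₂, h1, h2, h3, h4⟩
    rcases d₂ with _ | ⟨⟨y, z⟩, d₂⟩
    · simp at h2
    have hlen := congrArg List.length h1
    simp only [List.length_append, List.length_cons] at hlen
    have hru := ht.rules d₁.length (y, z) (by simp [h1])
    have hl1 := length_encodeRules d₁
    refine ⟨⟨trivial, trivial, trivial⟩, by grind [Exp.eval, idl, ltn_eq_zero], ?_⟩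
    refine W.bind (t₂ := 59) (pokeC_W hC h4 (by grind) (x := y.code)
      ⟨trivial, by grind [Exp.eval]⟩ (by grind [Exp.eval])
      (by decide)) (by omega) ?_
    rintro s₄ f4 ⟨rfl, h5⟩
    refine W.bind (t₂ := 7) (pokeC_W hC h5 (by grind) (x := z.code)
      ⟨trivial, by simp only [Exp.eval]; exact h3.trans_lt (by omega)⟩ ?_ (by decide)) (by omega) ?_
    · have a1 : ((s'.seto (done.length :: encodeRules d₁).length y.code).setv .q (s'.v .q + 1)).v .i =
        d₁.length := h3
      simp only [Exp.eval, a1]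
      have a2 : ((s'.seto (done.length :: encodeRules d₁).length y.code).setv .q (s'.v .q + 1)).a =
        s.a := e0
      rw [a2, hru.2]
    rintro s₅ f5 ⟨rfl, h6⟩
    refine (W.inc ?_).mono le_rfl ?_
    · exact lt_of_le_of_lt (Nat.succ_le_succ (le_of_eq h3)) (by omega)
    rintro s₆ - rfl
    refine ⟨e0, e1, e2, e3, e4, d₁ ++ [(y, z)], d₂, by simp [h1], by simpa using h2, ?_, ?_⟩
    · exact (congrArg (· + 1) h3).trans (by simp)
    · have := h6.setv (y := .i) (x := s'.v .i + 1) (by decide)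
      have e : done.length :: encodeRules (d₁ ++ [(y, z)]) =
          done.length :: encodeRules d₁ ++ [y.code] ++ [z.code] := by
        rw [encodeRules_append]; simp [encodeRules]
      rw [e]; exact this
  · have := f2.a
    funext k
    exact this k rfl
  refine W.bind (t₂ := 260 * (C.I + 1)) k1 (by simp only [Exp.cost]; omega) ?_
  rintro s₃ - ⟨e0, e1, e2, e3, e4, d₁, d₂, h1, h2, -, o3⟩
  rw [List.length_eq_zero_iff] at h2
  subst h2
  rw [List.append_nil] at h1
  subst h1
  rw [← hL₁] at o3
  refine W.bind (t₂ := 260 * (C.I + 1) - 60) (pokeC_W hC o3 (by omega) (x := w.length) trivial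
    (by grind [Exp.eval]) (by decide)) (by omega) ?_
  rintro s₄ f4 ⟨rfl, o4⟩
  have g1 : ((s₃.seto L₁.length w.length).setv .q (s₃.v .q + 1)).v .n = n := e3
  have g2 : ((s₃.seto L₁.length w.length).setv .q (s₃.v .q + 1)).a = s.a := e0
  have g3 : ((s₃.seto L₁.length w.length).setv .q (s₃.v .q + 1)).v .o = s.v .o := e4
  generalize (s₃.seto L₁.length w.length).setv .q (s₃.v .q + 1) = s₄ at *
  refine W.bind (t₁ := 20) (t₂ := 260 * (C.I + 1) - 90) (P := fun s' => s' = s₄.setv .p (n - 1))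
    (W.basic ?_ (by decide) (by grind [Cmd.exec, Exp.eval, idl])) (by omega) ?_
  · grind [Cmd.ok, Exp.ok, Exp.eval, okOp]
  rintro _ - rfl
  have k2 := W.loop (C := C) (e := .rd .ac (.v .p)) (c := .asg .k (.rd .ac (.v .p)) ;;
      .wh (.v .k) (pokeC (.rd .nm (.rd .av (.v .p))) ;; .asg .k (.sub (.v .k) (.c 1))) ;; .inc .p)
    (fun m s' => s'.a = s.a ∧ s'.v .o = s.v .o ∧
      ∃ r₁ r₂ v₁, r = r₁ ++ r₂ ∧ r₂.length = m ∧ s'.v .p = n - 1 + r₁.length ∧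
        items r₁ = v₁.map .inl ∧
        OutInv C (L₁ ++ w.length :: (v₁.map (symOf K lt)).map Symb.code) s') 230 ?_ ?_ r.length
    (s₄.setv .p (n - 1))
    ⟨g2, g3, [], r, [], rfl, rfl, rfl, rfl, by simpa using o4.setv (by decide)⟩
  · refine k2.mono (by simp only [Exp.cost]; omega) ?_
    rintro s₅ - ⟨-, h2, r₁, r₂, v₁, h3, h4, -, h5, h6⟩
    rw [List.length_eq_zero_iff] at h4
    subst h4
    rw [List.append_nil] at h3
    subst h3
    have : v = v₁ := by
      have := hv.symm.trans h5
      exact (List.map_injective_iff.2 Sum.inl_injective) this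
    subst this
    rw [hw] at h6
    exact ⟨h2.trans ho, h6.out⟩
  · rintro s' ⟨a0, -, r₁, r₂, v₁, h3, h4, h5, -, -⟩
    rw [List.length_eq_zero_iff] at h4
    subst h4
    rw [List.append_nil] at h3
    subst h3
    refine ⟨⟨trivial, by simp only [Exp.eval]; omega⟩, ?_⟩
    simp only [Exp.eval, a0, h5, hs.get_last]
  · rintro m s' ⟨a0, a1, r₁, r₂, v₁, h3, h4, h5, h6, h7⟩
    rcases r₂ with _ | ⟨t, r₂⟩
    · simp at h4
    obtain ⟨x, l, rfl, hx, hl0, hl3⟩ := hr t (by simp [h3])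
    have hlen := congrArg List.length h3
    simp only [List.length_append, List.length_cons] at hlen
    have hil := congrArg (fun r => (items r).length) h3
    simp only [items_append, items_run, h6, List.length_append, List.length_replicate,
      List.length_map] at hil
    rw [h3] at hs
    have hav : s.a .av (s'.v .p) = x := by rw [h5]; exact hs.get.1
    have hac : s.a .ac (s'.v .p) = l := by rw [h5]; exact hs.get.2
    refine ⟨⟨trivial, by simp only [Exp.eval]; omega⟩, by grind [Exp.eval], ?_⟩
    refine W.bind (t₁ := 20) (t₂ := 200) (P := fun s₁ => s₁ = s'.setv .k l)
      (W.basic ⟨trivial, by simp only [Exp.eval]; omega⟩ (by decide)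
        (by grind [Cmd.exec, Exp.eval])) (by omega) ?_
    rintro _ - rfl
    have k3 := W.loop (C := C) (e := .v .k) (c := pokeC (.rd .nm (.rd .av (.v .p))) ;;
        .asg .k (.sub (.v .k) (.c 1))) (fun m s₁ => s₁.a = s.a ∧ s₁.v .o = s.v .o ∧
        s₁.v .p = s'.v .p ∧ s₁.v .k = m ∧ m ≤ l ∧ 
        OutInv C (L₁ ++ w.length :: ((v₁ ++ List.replicate (l - m) x).map (symOf K lt)).map
          Symb.code) s₁) 58 ?_ ?_ l (s'.setv .k l) ⟨a0, a1, rfl, rfl, le_rfl, by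
            simpa using h7.setv (by decide)⟩
    · refine W.bind (t₂ := 7) k3 (by simp only [Exp.cost]; omega) ?_
      rintro s₂ - ⟨b0, b1, b2, b3, -, b5⟩
      refine (W.inc (by rw [b2]; omega)).mono le_rfl ?_
      rintro s₃ - rfl
      refine ⟨b0, b1, r₁ ++ [.run x l], r₂, v₁ ++ List.replicate l x, by simp [h3],
        by simpa using h4, ?_, ?_, ?_⟩
      · simp only [St.setv, Function.update_self, b2, h5, List.length_append, List.length_singleton,
          add_assoc]
      · simp [items_run, h6]
      · exact b5.setv (by decide)
    · rintro s₁ ⟨b0, b1, b2, b3, b4, b5⟩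
      exact ⟨trivial, b3⟩
    · rintro m s₁ ⟨b0, b1, b2, b3, b4, b5⟩
      refine ⟨trivial, by simp only [Exp.eval]; omega, ?_⟩
      refine W.bind (t₂ := 7) (pokeC_W hC b5 ?_ (x := (symOf K lt x).code) ?_ ?_ (by decide))
        (by omega) ?_
      · grind
      · refine ⟨⟨trivial, by grind [Exp.eval]⟩, ?_⟩
        grind [Exp.eval]
      · simp only [Exp.eval, b0, b2, hav]
        exact ht.nm x hx
      rintro s₂ f2' ⟨rfl, b6⟩
      refine W.basic ?_ (by decide) ⟨b0, b1, b2, ?_, by omega, ?_⟩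
      · simp only [Cmd.ok, Exp.ok, Exp.eval, okOp, St.setv, St.seto, true_and, ne_eq, reduceCtorEq,
          not_false_eq_true, Function.update_of_ne, b3]
        omega
      · simp [Cmd.exec, Exp.eval, idl, St.setv, St.seto, b3]
      · have := b6.setv (y := .k) (x := s₁.v .k - 1) (by decide)
        have e : L₁ ++ w.length :: ((v₁ ++ List.replicate (l - m) x).map (symOf K lt)).map Symb.code =
            L₁ ++ w.length :: ((v₁ ++ List.replicate (l - (m + 1)) x).map (symOf K lt)).map
              Symb.code ++ [(symOf K lt x).code] := by
          rw [show l - m = l - (m + 1) + 1 by omega, List.replicate_succ']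
          simp
        rw [e]
        exact this

end

end RP

namespace RP
open WordRAM

/-! ### The initial grammar -/

/-- Course-of-values recursion by iteration: the value at `i` is stable from iterate `i + 1` on. -/
theorem exists_rec {β : Type} [Inhabited β] (Φ : (ℕ → β) → ℕ → β)
    (h : ∀ i f g, (∀ j < i, f j = g j) → Φ f i = Φ g i) : ∃ f : ℕ → β, ∀ i, f i = Φ f i := by
  have key : ∀ i m k, i < m → i < k → Φ^[m] (fun _ => default) i = Φ^[k] (fun _ => default) i := by
    intro i
    induction i using Nat.strong_induction_on with
    | _ i ih =>
      intro m k hm hk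
      obtain ⟨m, rfl⟩ := Nat.exists_eq_succ_of_ne_zero (by omega : m ≠ 0)
      obtain ⟨k, rfl⟩ := Nat.exists_eq_succ_of_ne_zero (by omega : k ≠ 0)
      rw [Function.iterate_succ_apply', Function.iterate_succ_apply']
      grind
  refine ⟨fun i => Φ^[i + 1] (fun _ => default) i, fun i => ?_⟩
  change Φ^[i + 1] _ i = _
  rw [Function.iterate_succ_apply']
  grind

theorem sum_pairs (x : ℕ → ℕ) (n : ℕ) :
    ∑ i ∈ Finset.range n, (x (2 * i) + x (2 * i + 1)) = ∑ p ∈ Finset.range (2 * n), x p := by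
  induction n with
  | zero => rfl
  | succ n ih =>
    rw [Finset.sum_range_succ, ih, show 2 * (n + 1) = 2 * n + 1 + 1 by ring, Finset.sum_range_succ,
      Finset.sum_range_succ]
    omega

section
variable {n N K : ℕ} {cd idf occ : ℕ → ℕ} {V : ℕ → List ℕ} {F : ℕ → List Tk} {sz : ℕ → ℕ}

/-- The codes of the symbols on the right-hand sides, at positions `2 * i` and `2 * i + 1`. -/
def Ord (n : ℕ) (cd : ℕ → ℕ) : Prop := ∀ p < 2 * n, cd p % 2 = 1 → cd p / 2 < p / 2

/-- The numbers of occurrences in the derivation tree. -/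
def Occ (n : ℕ) (cd occ : ℕ → ℕ) : Prop := ∀ j < n, occ j = (if j + 1 = n then 1 else 0) +
  ∑ p ∈ Finset.range (2 * n), if cd p = 2 * j + 1 then occ (p / 2) else 0

theorem exists_occ (h : Ord n cd) : ∃ occ, Occ n cd occ := by
  -- The indices are reversed, since multiplicities flow from larger variables to smaller ones.
  obtain ⟨f, hf⟩ := exists_rec (fun (f : ℕ → ℕ) i => (if i = 0 then 1 else 0) +
    ∑ p ∈ Finset.range (2 * n), if cd p = 2 * (n - 1 - i) + 1 ∧ n - 1 - p / 2 < i then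
      f (n - 1 - p / 2) else 0) fun i f g hfg => by simp_all
  refine ⟨fun j => f (n - 1 - j), fun j hj => ?_⟩
  simp only
  rw [hf]
  congr 1
  · split_ifs <;> omega
  · refine Finset.sum_congr rfl fun p hp => ?_
    rw [Finset.mem_range] at hp
    have := h p hp
    grind

/-- A variable with a single occurrence passes its accumulated value `g` to the rules that contain
it, whose weights add up to its own by `ho`. Hence dropping such variables and summing the
accumulated values of the others loses nothing. Taking `occ` for `u` gives balance, and taking its
minimum with 1 gives size bounds without unreachable rules. -/
theorem inline_sum {u g a : ℕ → ℕ} (ho : ∀ j < n, occ j = 1 ∧ j + 1 ≠ n →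
      ∑ p ∈ Finset.range (2 * n), (if cd p = 2 * j + 1 then u (p / 2) else 0) = u j)
    (hord : Ord n cd)
    (hg : ∀ i < n, g i = a i + ((if cd (2 * i) % 2 = 1 ∧ occ (cd (2 * i) / 2) = 1 then
      g (cd (2 * i) / 2) else 0) + if cd (2 * i + 1) % 2 = 1 ∧ occ (cd (2 * i + 1) / 2) = 1 then
      g (cd (2 * i + 1) / 2) else 0)) :
    ∑ i ∈ Finset.range n, (if occ i = 1 ∧ i + 1 ≠ n then 0 else u i * g i) =
      ∑ i ∈ Finset.range n, u i * a i := by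
  have h1 : ∑ i ∈ Finset.range n, u i * g i = ∑ i ∈ Finset.range n, u i * a i +
      ∑ p ∈ Finset.range (2 * n), u (p / 2) * (if cd p % 2 = 1 ∧ occ (cd p / 2) = 1 then
        g (cd p / 2) else 0) := by
    rw [← sum_pairs, ← Finset.sum_add_distrib]
    refine Finset.sum_congr rfl fun i hi => ?_
    rw [hg i (Finset.mem_range.1 hi), show 2 * i / 2 = i by omega,
      show (2 * i + 1) / 2 = i by omega]
    ring
  have h2 : ∑ p ∈ Finset.range (2 * n), u (p / 2) * (if cd p % 2 = 1 ∧ occ (cd p / 2) = 1 then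
      g (cd p / 2) else 0) =
      ∑ j ∈ Finset.range n, if occ j = 1 ∧ j + 1 ≠ n then u j * g j else 0 := by
    have h3 : ∀ p ∈ Finset.range (2 * n), u (p / 2) * (if cd p % 2 = 1 ∧ occ (cd p / 2) = 1 then
        g (cd p / 2) else 0) = ∑ j ∈ Finset.range n, if occ j = 1 ∧ j + 1 ≠ n then
          (if cd p = 2 * j + 1 then u (p / 2) else 0) * g j else 0 := by
      intro p hp
      rw [Finset.mem_range] at hp
      have ho' := hord p hp
      split_ifs with h4
      · rw [Finset.sum_eq_single (cd p / 2)]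
        · grind
        · grind
        grind
      · rw [mul_zero, eq_comm]
        refine Finset.sum_eq_zero fun j _ => ?_
        split_ifs with h5 h6
        · exact absurd ⟨by omega, by rw [show cd p / 2 = j by omega]; exact h5.1⟩ h4
        · simp
        · rfl
    rw [Finset.sum_congr rfl h3, Finset.sum_comm]
    refine Finset.sum_congr rfl fun j hj => ?_
    split_ifs with h4
    · rw [← Finset.sum_mul, ho j (Finset.mem_range.1 hj) h4]
    · simp
  have h3 : ∑ i ∈ Finset.range n, u i * g i = ∑ i ∈ Finset.range n,
      (if occ i = 1 ∧ i + 1 ≠ n then 0 else u i * g i) +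
      ∑ j ∈ Finset.range n, if occ j = 1 ∧ j + 1 ≠ n then u j * g j else 0 := by
    rw [← Finset.sum_add_distrib]
    exact Finset.sum_congr rfl fun i _ => by split_ifs <;> omega
  omega

/-- The initial grammar, with the variables that occur once expanded. -/
structure Ini (n N K : ℕ) (cd idf occ : ℕ → ℕ) (V : ℕ → List ℕ) : Prop where
  pos : 0 < n
  ord : Ord n cd
  eq : Occ n cd occ
  val : ∀ i < n, V i = (if cd (2 * i) % 2 = 1 then V (cd (2 * i) / 2) else [idf (2 * i)]) ++
    (if cd (2 * i + 1) % 2 = 1 then V (cd (2 * i + 1) / 2) else [idf (2 * i + 1)])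
  len : (V (n - 1)).length = N
  idK : ∀ p < 2 * n, idf p < K

/-- The tokens that stand for a position. -/
def tkp (cd idf occ : ℕ → ℕ) (F : ℕ → List Tk) (p : ℕ) : List Tk :=
  if cd p % 2 = 1 then (if occ (cd p / 2) = 1 then F (cd p / 2) else [.var (cd p / 2)])
  else [.run (idf p) 1]

/-- The number of positions that are visited for a position. -/
def szp (cd occ sz : ℕ → ℕ) (p : ℕ) : ℕ :=
  1 + if cd p % 2 = 1 ∧ occ (cd p / 2) = 1 then sz (cd p / 2) else 0

def IsF (n : ℕ) (cd idf occ : ℕ → ℕ) (F : ℕ → List Tk) : Prop :=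
  ∀ i < n, F i = tkp cd idf occ F (2 * i) ++ tkp cd idf occ F (2 * i + 1)

def IsSz (n : ℕ) (cd occ sz : ℕ → ℕ) : Prop :=
  ∀ i < n, sz i = szp cd occ sz (2 * i) + szp cd occ sz (2 * i + 1)

theorem exists_F (h : Ord n cd) (idf occ : ℕ → ℕ) : ∃ F, IsF n cd idf occ F := by
  obtain ⟨F, hF⟩ := exists_rec (fun (F : ℕ → List Tk) i => if i < n then
    tkp cd idf occ F (2 * i) ++ tkp cd idf occ F (2 * i + 1) else []) fun i f g hfg => by
    split_ifs with hi
    · have h1 := h (2 * i) (by omega)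
      have h2 := h (2 * i + 1) (by omega)
      grind [tkp]
    · rfl
  exact ⟨F, fun i hi => by rw [hF, if_pos hi]⟩

theorem exists_sz (h : Ord n cd) (occ : ℕ → ℕ) : ∃ sz, IsSz n cd occ sz := by
  obtain ⟨F, hF⟩ := exists_rec (fun (F : ℕ → ℕ) i => if i < n then
    szp cd occ F (2 * i) + szp cd occ F (2 * i + 1) else 0) fun i f g hfg => by
    split_ifs with hi
    · have h1 := h (2 * i) (by omega)
      have h2 := h (2 * i + 1) (by omega)
      grind [szp]
    · rfl
  exact ⟨F, fun i hi => by rw [hF, if_pos hi]⟩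

theorem exists_V (h : Ord n cd) (idf : ℕ → ℕ) : ∃ V : ℕ → List ℕ, ∀ i < n,
    V i = (if cd (2 * i) % 2 = 1 then V (cd (2 * i) / 2) else [idf (2 * i)]) ++
    (if cd (2 * i + 1) % 2 = 1 then V (cd (2 * i + 1) / 2) else [idf (2 * i + 1)]) := by
  obtain ⟨V, hV⟩ := exists_rec (fun (V : ℕ → List ℕ) i => if i < n then
    (if cd (2 * i) % 2 = 1 then V (cd (2 * i) / 2) else [idf (2 * i)]) ++
    (if cd (2 * i + 1) % 2 = 1 then V (cd (2 * i + 1) / 2) else [idf (2 * i + 1)]) else [])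
    fun i f g hfg => by
    split_ifs with hi h1 h2 h2 <;> try rfl
    all_goals
      have h3 := h (2 * i) (by omega)
      have h4 := h (2 * i + 1) (by omega)
      grind
  exact ⟨V, fun i hi => by grind⟩

theorem Ini.ne_nil (h : Ini n N K cd idf occ V) : ∀ i < n, V i ≠ [] := by
  intro i
  induction i using Nat.strong_induction_on with
  | _ i ih =>
    intro hi
    have := h.ord (2 * i) (by omega)
    rw [h.val i hi]
    split_ifs <;> simp <;> grind

theorem Ini.top (h : Ini n N K cd idf occ V) : occ (n - 1) = 1 := by
  have hn := h.pos
  rw [h.eq (n - 1) (by omega), if_pos (by omega)]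
  refine congrArg (1 + ·) (Finset.sum_eq_zero fun p hp => ?_)
  rw [Finset.mem_range] at hp
  have := h.ord p hp
  rw [if_neg (by omega)]

/-- Every variable occurs at most `N` times. -/
theorem Ini.occ_le (h : Ini n N K cd idf occ V) : ∀ j < n, occ j ≤ N := by
  have hn := h.pos
  let tok : ℕ → ℕ ⊕ ℕ := fun p => if cd p % 2 = 1 then .inr (cd p / 2) else .inl (idf p)
  let U : ℕ → List (ℕ ⊕ ℕ) := fun i => [tok (2 * i), tok (2 * i + 1)]
  have htv : ∀ p, iv V (tok p) = if cd p % 2 = 1 then V (cd p / 2) else [idf p] := fun p => by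
    simp only [tok]; split_ifs <;> rfl
  have hwf : Wf n U V := by
    refine ⟨fun i hi => ?_, fun i hi j hj => ?_⟩
    · rw [h.val i hi]; simp [U, htv]
    · have h1 := h.ord (2 * i) (by omega)
      have h2 := h.ord (2 * i + 1) (by omega)
      have h3 : j < i := by grind
      exact ⟨h3, h.ne_nil j (by omega)⟩
  have hc : ∀ k i, (vars (U i)).count k = (if cd (2 * i) = 2 * k + 1 then 1 else 0) +
      if cd (2 * i + 1) = 2 * k + 1 then 1 else 0 := by
    have h1 : ∀ k p, (vars [tok p]).count k = if cd p = 2 * k + 1 then 1 else 0 := by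
      intro k p
      simp only [tok]
      by_cases h2 : cd p % 2 = 1
      · rw [if_pos h2]
        by_cases h3 : cd p = 2 * k + 1
        · rw [if_pos h3, show cd p / 2 = k by omega]; simp
        · rw [if_neg h3]
          exact List.count_eq_zero.2 (by simp; omega)
      · rw [if_neg h2, if_neg (by omega)]; rfl
    intro k i
    rw [← h1, ← h1, ← List.count_append, ← vars_append]; rfl
  have h1 := h.top
  have hb : Bal n occ U V := by
    refine ⟨h1, fun k hk _ => ?_⟩
    rw [h.eq k (by omega), if_neg (by omega), zero_add, ← sum_pairs]
    grind
  have hN : 0 < N := by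
    rw [← h.len]; exact List.length_pos_iff.2 (h.ne_nil _ (by omega))
  intro j hj
  by_cases hjn : j = n - 1
  · rw [hjn, h1]; exact hN
  · have h2 := hb.mul_le hwf (μ := fun j => (V j).length) (by simp) (fun i hi => by
      rw [hwf.val i hi, length_iev]; omega) (by omega : j < n - 1)
    rw [h.len] at h2
    exact (Nat.le_mul_of_pos_right _ (List.length_pos_iff.2 (h.ne_nil j hj))).trans h2

/-- The variables that are kept. -/
def root (n : ℕ) (occ : ℕ → ℕ) (i : ℕ) : Prop := 2 ≤ occ i ∨ i + 1 = n

instance (i : ℕ) : Decidable (root n occ i) := inferInstanceAs (Decidable (_ ∨ _))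

/-- Each position is visited in the expansion of at most one kept variable, so expansion does not
enlarge the grammar. -/
theorem Ini.sum_sz (h : Ini n N K cd idf occ V) (hz : IsSz n cd occ sz) :
    ∑ i ∈ Finset.range n, (if root n occ i then sz i else 0) ≤ 2 * n := by
  have h1 := inline_sum (n := n) (cd := cd) (occ := occ) (u := fun i => min (occ i) 1) (g := sz)
    (a := fun _ => 2) (fun j hj hj' => ?_) h.ord fun i hi => by
      rw [hz i hi]; simp only [szp]; omega
  · refine le_trans (Finset.sum_le_sum fun i hi => ?_) (h1.le.trans
      ((Finset.sum_le_sum (g := fun _ => 2) fun i _ => ?_).trans (by simp; omega)))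
    · have := h.top
      grind [root]
    omega
  · have h2 := h.eq j hj
    rw [if_neg hj'.2, zero_add, hj'.1] at h2
    simp only [hj'.1, min_self]
    refine Eq.trans (Finset.sum_congr rfl fun p hp => ?_) h2.symm
    split_ifs with h3
    · have h4 := Finset.single_le_sum (f := fun p => if cd p = 2 * j + 1 then occ (p / 2) else 0)
        (fun _ _ => Nat.zero_le _) hp
      grind
    · rfl

theorem pot_of_ones {r : List Tk} (h : ∀ x k, Tk.run x k ∈ r → k = 1) : pot r = r.length := by
  induction r with
  | nil => rfl
  | cons t r ih =>
    rw [pot, ih fun x k hx => h x k (by simp [hx])]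
    cases t with
    | run x k => rw [h x k (by simp)]; simp [wt, bigT]; omega
    | var j => simp [wt, bigT]; omega

theorem vars_items_le (r : List Tk) : (vars (items r)).length ≤ r.length := by
  induction r with
  | nil => simp
  | cons t r ih => cases t <;> simp [items_run, items_var, vars_append] <;> omega

/-- The tokens of expanded rules. -/
theorem Ini.mem_F (h : Ini n N K cd idf occ V) (hF : IsF n cd idf occ F) : ∀ i < n, ∀ t ∈ F i,
    (∃ x, t = .run x 1 ∧ x < K) ∨ ∃ j, t = .var j ∧ j < i ∧ (0 < occ i → 2 ≤ occ j) := by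
  intro i
  induction i using Nat.strong_induction_on with
  | _ i ih =>
    intro hi t ht
    have hp : ∀ p, p = 2 * i ∨ p = 2 * i + 1 → t ∈ tkp cd idf occ F p →
        (∃ x, t = .run x 1 ∧ x < K) ∨ ∃ j, t = .var j ∧ j < i ∧ (0 < occ i → 2 ≤ occ j) := by
      intro p hp ht
      have h1 := h.ord p (by omega)
      have hle : ∀ j < n, cd p = 2 * j + 1 → occ i ≤ occ j := fun j hj hc => by
        rw [h.eq j hj]
        have h4 := Finset.single_le_sum (f := fun p => if cd p = 2 * j + 1 then occ (p / 2) else 0)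
          (fun _ _ => Nat.zero_le _) (Finset.mem_range.2 (show p < 2 * n by omega))
        grind
      unfold tkp at ht
      split_ifs at ht with h2 h3
      · grind
      · have h4 := hle (cd p / 2) (by omega) (by omega)
        exact Or.inr ⟨_, List.mem_singleton.1 ht, by omega, fun _ => by omega⟩
      · exact Or.inl ⟨_, List.mem_singleton.1 ht, h.idK p (by omega)⟩
    rw [hF i hi, List.mem_append] at ht
    grind

theorem Ini.length_F (h : Ini n N K cd idf occ V) (hF : IsF n cd idf occ F)
    (hz : IsSz n cd occ sz) : ∀ i < n, (F i).length ≤ sz i := by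
  intro i
  induction i using Nat.strong_induction_on with
  | _ i ih =>
    intro hi
    have h1 : ∀ p, p = 2 * i ∨ p = 2 * i + 1 → (tkp cd idf occ F p).length ≤ szp cd occ sz p := by
      intro p hp
      have h1 := h.ord p (by omega)
      grind [tkp, szp]
    rw [hF i hi, hz i hi, List.length_append]
    grind

/-- Variables that are not kept get an empty rule and an empty string, about which the invariant
demands nothing. All runs have length one, so the potential is the number of tokens. Balance is
`inline_sum` applied to the multiplicity of a fixed variable. -/
theorem Ini.gm (h : Ini n N K cd idf occ V) (hF : IsF n cd idf occ F) :
    Gm n N K occ (fun i => if root n occ i then (F i).length else 0)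
      (fun i => if root n occ i then (F i).length else 0)
      (fun i => items (if root n occ i then F i else []))
      (fun i => if root n occ i then V i else []) := by
  have hn := h.pos
  have htop := h.top
  have hroot : ∀ i, root n occ i → 0 < occ i := by
    rintro i (h1 | h1)
    · omega
    grind
  have hval : ∀ i < n, 0 < occ i →
      V i = iev (fun i => if root n occ i then V i else []) (items (F i)) := by
    intro i
    induction i using Nat.strong_induction_on with
    | _ i ih =>
      intro hi ho
      have hp : ∀ p, p = 2 * i ∨ p = 2 * i + 1 →
          (if cd p % 2 = 1 then V (cd p / 2) else [idf p]) =
            iev (fun i => if root n occ i then V i else []) (items (tkp cd idf occ F p)) := by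
        intro p hp
        have h1 := h.ord p (by omega)
        have hm := h.mem_F hF i hi
        unfold tkp
        split_ifs with h2 h3
        · grind
        · have h4 : Tk.var (cd p / 2) ∈ F i := by
            have : Tk.var (cd p / 2) ∈ tkp cd idf occ F p := by simp [tkp, h2, h3]
            rw [hF i hi]
            grind
          rcases hm _ h4 with ⟨x, h5, -⟩ | ⟨j, h5, -, h6⟩
          · cases h5
          simp_all [root, items_var, iv]
        · simp [items_run, iv]
      rw [h.val i hi, hF i hi, items_append, iev_append, hp _ (Or.inl rfl), hp _ (Or.inr rfl)]
  refine ⟨hn, ⟨fun i hi => ?_, fun i hi j hj => ?_⟩, ⟨htop, fun k hk h0 => ?_⟩, fun i hi h0 => ?_,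
    fun i hi => ?_, fun i hi => ?_, ?_, fun i hi x hx => ?_⟩
  · split_ifs with h1
    · exact hval i hi (hroot i h1)
    · rfl
  · split_ifs at hj with h1
    · rcases h.mem_F hF i hi _ (mem_items_var.1 hj) with ⟨x, h5, -⟩ | ⟨j', h5, h7, h6⟩
      · cases h5
      · cases h5
        rw [if_pos (show root n occ j from Or.inl (h6 (hroot i h1)))]
        exact ⟨h7, h.ne_nil j (by omega)⟩
    · simp at hj
  · have hk2 : 2 ≤ occ k := by
      simp only [ne_eq, ite_eq_right_iff, not_forall] at h0
      obtain ⟨h1 | h1, -⟩ := h0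
      · exact h1
      · omega
    have hone : ∀ p < 2 * n, (vars (items (tkp cd idf occ F p))).count k =
        (if cd p = 2 * k + 1 then 1 else 0) + if cd p % 2 = 1 ∧ occ (cd p / 2) = 1 then
          (vars (items (F (cd p / 2)))).count k else 0 := by
      intro p hp
      unfold tkp
      by_cases h1 : cd p % 2 = 1
      · rw [if_pos h1]
        by_cases h2 : occ (cd p / 2) = 1
        · grind
        · simp only [h2, and_false, if_false, add_zero]
          by_cases h3 : cd p = 2 * k + 1
          · rw [if_pos h3, show cd p / 2 = k by omega]; simp [items_var, vars]
          · rw [if_neg h3]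
            exact List.count_eq_zero.2 (by simp [items_var, vars]; omega)
      · have h3 : ¬cd p = 2 * k + 1 := by omega
        simp [h1, h3, items_run]
    have h1 := inline_sum (n := n) (cd := cd) (occ := occ) (u := occ)
      (g := fun i => (vars (items (F i))).count k)
      (a := fun i => (if cd (2 * i) = 2 * k + 1 then 1 else 0) +
        if cd (2 * i + 1) = 2 * k + 1 then 1 else 0)
      (fun j hj hj' => by
        have := h.eq j hj
        simp_all) h.ord fun i hi => by
          rw [hF i hi, items_append, vars_append, List.count_append, hone _ (by omega),
            hone _ (by omega)]; omega
    have h2 : occ k = ∑ i ∈ Finset.range n, occ i * ((if cd (2 * i) = 2 * k + 1 then 1 else 0) +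
        if cd (2 * i + 1) = 2 * k + 1 then 1 else 0) := by
      rw [h.eq k (by omega), if_neg (by omega), zero_add, ← sum_pairs]
      refine Finset.sum_congr rfl fun i _ => ?_
      grind
    grind [root, items_nil, vars_nil]
  · simp only [ne_eq, ite_eq_right_iff, not_forall] at h0
    obtain ⟨h1 | h1, -⟩ := h0
    · exact h1
    · omega
  · grind [vars_items_le]
  · split_ifs with h1
    · have hone : ∀ x k, Tk.run x k ∈ F i → k = 1 := fun x k hx => by
        rcases h.mem_F hF i hi _ hx with ⟨y, h5, -⟩ | ⟨j, h5, -⟩ <;> cases h5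
        rfl
      exact ⟨F i, fun x k hx => by grind, rfl, (pot_of_ones hone).le⟩
    · exact ⟨[], pos_nil, rfl, le_rfl⟩
  · rw [if_pos (show root n occ (n - 1) from Or.inr (by omega)), h.len]
  · split_ifs at hx with h1
    · simp only [items, List.mem_flatMap] at hx
      obtain ⟨t, ht, hx⟩ := hx
      rcases h.mem_F hF i hi t ht with ⟨y, rfl, hy⟩ | ⟨j, rfl, -⟩
      · simp at hx; omega
      · simp at hx
    · simp at hx

end

end RP

namespace RP
open WordRAM

/-! ### Reading the input -/

/-- The code of the letter at a position, and `0` if there is a variable. -/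
def ky (cd : ℕ → ℕ) (p : ℕ) : ℕ := cd p * (1 - cd p % 2)

theorem ky_le (cd : ℕ → ℕ) (p : ℕ) : ky cd p ≤ cd p := by
  unfold ky
  rcases Nat.mod_two_eq_zero_or_one (cd p) with h | h <;> simp [h]

/-- Strings derived by the variables. -/
def IsV (n : ℕ) (cd idf : ℕ → ℕ) (V : ℕ → List ℕ) : Prop := ∀ i < n,
  V i = (if cd (2 * i) % 2 = 1 then V (cd (2 * i) / 2) else [idf (2 * i)]) ++
    (if cd (2 * i + 1) % 2 = 1 then V (cd (2 * i + 1) / 2) else [idf (2 * i + 1)])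

/-- A program with `n` rules, whose codes are at most `X`, for a string of length `N`. -/
structure Src (C : Ctx) (n N X : ℕ) (cd : ℕ → ℕ) : Prop where
  pos : 0 < n
  ord : Ord n cd
  inp : ∀ p < 2 * n, C.inp (1 + p) = cd p
  base : C.b = 2 * n + 1
  room : 3 * n ≤ C.I
  le : ∀ p < 2 * n, cd p ≤ X
  small : 2 * n * (2 * n * (X + 1)) < 2 ^ C.w
  fits : N < 2 ^ C.w
  len : ∀ idf V, IsV n cd idf V → (V (n - 1)).length = N

/-- Branch-free handling of letters and variables through the parity of the code; a letter adds zero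
to `occ 0`. The sum `e` of the keys serves as an upper bound for the largest key. -/
def prepB : Cmd :=
  .asg .p (.sub (.v .p) (.c 1)) ;; .asg .c (.inp (.add (.c 1) (.v .p))) ;;
  .put .ord (.v .p) (.v .p) ;; .put .q (.v .p) (.mul (.v .c) (.sub (.c 1) (.mod (.v .c) (.c 2)))) ;;
  .asg .e (.add (.v .e) (.rd .q (.v .p))) ;; .asg .c (.mul (.v .c) (.mod (.v .c) (.c 2))) ;;
  .put .occ (.div (.v .c) (.c 2)) (.add (.rd .occ (.div (.v .c) (.c 2)))
    (.mul (.mod (.v .c) (.c 2)) (.rd .occ (.div (.v .p) (.c 2)))))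

def prepC : Cmd :=
  (.asg .m (.add (.v .n) (.v .n)) ;; .put .occ (.sub (.v .n) (.c 1)) (.c 1) ;; .asg .p (.v .m)) ;;
  .wh (.v .p) prepB

section
variable {C : Ctx} {s : St} {n N X : ℕ} {cd occ : ℕ → ℕ}

theorem Src.occ_le (h : Src C n N X cd) (ho : Occ n cd occ) : ∀ j < n, occ j ≤ N := by
  obtain ⟨V, hV⟩ := exists_V h.ord fun _ => 0
  exact Ini.occ_le (K := 1) (idf := fun _ => 0) (V := V)
    ⟨h.pos, h.ord, ho, hV, h.len (fun _ => 0) V hV, fun _ _ => one_pos⟩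

theorem prepC_W (hC : C.Valid) (h : Src C n N X cd) (ho : Occ n cd occ) (hn : s.v .n = n)
    (he : s.v .e = 0) (hz : ∀ j, s.a .occ j = 0) :
    W C prepC s (500 * (C.I + 1)) fun s' => s'.v .m = 2 * n ∧ (∀ j < n, s'.a .occ j = occ j) ∧
      s'.v .e ≤ 2 * n * X ∧
      ∀ p < 2 * n, s'.a .ord p = p ∧ s'.a .q p = ky cd p ∧ ky cd p ≤ s'.v .e := by
  have hl := hC.lt
  have hn0 := h.pos
  have hI := h.room
  have hb := h.base
  have hbI := hC.bound
  have hsm := hC.small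
  have hX : 2 * n * X < 2 ^ C.w := lt_of_le_of_lt (Nat.mul_le_mul_left _ (by nlinarith)) h.small
  have key := W.loop (C := C) (e := .v .p) (c := prepB)
    (fun k s' => k ≤ 2 * n ∧ s'.v .p = k ∧ s'.v .m = 2 * n ∧ s'.v .e ≤ (2 * n - k) * X ∧
      (∀ p < 2 * n, k ≤ p → s'.a .ord p = p ∧ s'.a .q p = ky cd p ∧ ky cd p ≤ s'.v .e) ∧
      ∀ j < n, s'.a .occ j = (if j + 1 = n then 1 else 0) +
        ∑ p ∈ Finset.Ico k (2 * n), if cd p = 2 * j + 1 then occ (p / 2) else 0) 300 ?_ ?_ (2 * n)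
    (((s.setv .m (n + n)).seta .occ (n - 1) 1).setv .p (n + n)) ⟨le_rfl, by simp [St.setv]; omega,
      by simp [St.setv, St.seta]; omega, by simp [St.setv, St.seta, he], fun p _ _ => by omega, ?_⟩
  · refine W.bind (t₁ := 60) (t₂ := 2 * n * (300 + 1 + 2) + 3)
      (P := fun s' => s' = ((s.setv .m (n + n)).seta .occ (n - 1) 1).setv .p (n + n))
      (W.basic ?_ (by decide) ?_) (by omega) ?_
    · simp only [Cmd.ok, Exp.ok, Exp.eval, okOp, Cmd.exec, idl, St.setv, hn, true_and, and_true,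
        ne_eq, reduceCtorEq, not_false_eq_true, Function.update_of_ne]
      omega
    · simp [Cmd.exec, Exp.eval, idl, hn, St.setv, St.seta]
    rintro _ - rfl
    refine key.mono (by simp only [Exp.cost]; omega) ?_
    rintro s' - ⟨-, -, h3, h4, h5, h6⟩
    refine ⟨h3, fun j hj => ?_, h4, fun p hp => h5 p hp (Nat.zero_le _)⟩
    rw [h6 j hj, ho j hj, Finset.range_eq_Ico]
  · rintro s' ⟨-, h1, -⟩
    exact ⟨trivial, h1⟩
  · rintro k s' ⟨h1, h2, h3, h4, h5, h6⟩
    have ha := h.inp k (by omega)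
    have hck := h.le k (by omega)
    have hord := h.ord k (by omega)
    have hoN := h.occ_le ho
    have hsum : s'.v .e + ky cd k ≤ (2 * n - k) * X := by
      have := ky_le cd k
      have : (2 * n - k) * X = (2 * n - (k + 1)) * X + X := by
        rw [← Nat.succ_mul]; congr 1; omega
      omega
    have hsX : (2 * n - k) * X ≤ 2 * n * X := Nat.mul_le_mul_right _ (Nat.sub_le _ _)
    have hcw : cd k < 2 ^ C.w := ha ▸ hC.inp _
    -- Positions up to `k` refer only to variables below `k / 2`, so the multiplicity of `k / 2` is
    -- already final.
    have hok : s'.a .occ (k / 2) = occ (k / 2) := by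
      rw [h6 _ (by omega), ho _ (by omega), Finset.range_eq_Ico,
        ← Finset.sum_Ico_consecutive _ (Nat.zero_le (k + 1)) (by omega : k + 1 ≤ 2 * n),
        Finset.sum_eq_zero (s := Finset.Ico 0 (k + 1)), zero_add]
      intro p hp
      rw [Finset.mem_Ico] at hp
      have := h.ord p (by omega)
      rw [if_neg (by omega)]
    have hle : ∀ j < n, (if j + 1 = n then 1 else 0) +
        ∑ p ∈ Finset.Ico k (2 * n), (if cd p = 2 * j + 1 then occ (p / 2) else 0) < 2 ^ C.w := by
      intro j hj
      refine lt_of_le_of_lt (le_trans (Nat.add_le_add_left ?_ _) ((ho j hj).ge.trans (hoN j hj)))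
        h.fits
      rw [Finset.range_eq_Ico]
      exact Finset.sum_le_sum_of_subset (Finset.Ico_subset_Ico_left (Nat.zero_le _))
    have hIco : ∀ f : ℕ → ℕ, ∑ p ∈ Finset.Ico k (2 * n), f p =
        f k + ∑ p ∈ Finset.Ico (k + 1) (2 * n), f p :=
      fun f => Finset.sum_eq_sum_Ico_succ_bot (by omega) f
    have hfull : ∀ j < n, s'.a .occ j + (if cd k = 2 * j + 1 then occ (k / 2) else 0) =
        (if j + 1 = n then 1 else 0) +
          ∑ p ∈ Finset.Ico k (2 * n), if cd p = 2 * j + 1 then occ (p / 2) else 0 := fun j hj => by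
      rw [h6 j hj, hIco]; omega
    refine ⟨trivial, by simp only [Exp.eval]; omega, W.basic ?_ (by decide) ⟨by omega, ?_, ?_, ?_, ?_,
      ?_⟩⟩
    all_goals rcases Nat.mod_two_eq_zero_or_one (cd k) with hm | hm
    all_goals simp only [prepB, Cmd.ok, Exp.ok, Exp.eval, okOp, Cmd.exec, idl, St.setv, St.seta, true_and,
        and_true, ne_eq, reduceCtorEq, not_false_eq_true, Function.update_of_ne, Function.update_self, h2, ha,
        hm, hok, Nat.add_sub_cancel, Nat.sub_zero, mul_one, mul_zero, Nat.sub_self, Nat.zero_div, Nat.zero_mod, zero_mul, one_mul, add_zero]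
    · have := hle 0 hn0
      have := hfull 0 hn0
      have : ky cd k = cd k := by simp [ky, hm]
      omega
    · have := hle (cd k / 2) (by omega)
      have h7 := hfull (cd k / 2) (by omega)
      rw [if_pos (by omega)] at h7
      omega
    · exact h3
    · exact h3
    · grind [ky]
    · omega
    · grind [ky]
    · grind [ky]
    · grind
    grind
  · intro j hj
    rw [Finset.Ico_self, Finset.sum_empty, add_zero]
    by_cases hjn : j = n - 1
    · subst hjn; simp [St.setv, St.seta]; omega
    · simp [St.setv, St.seta, hjn, hz]; omega

/-! ### Sorting the letters -/

/-- Linked lists of positions. -/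
def Lk (f : ℕ → ℕ) : ℕ → List ℕ → Prop
  | h, [] => h = 0
  | h, p :: L => h = p + 1 ∧ Lk f (f p) L

theorem Lk.update {f : ℕ → ℕ} {p x : ℕ} {L : List ℕ} (hp : p ∉ L) :
    ∀ {h}, Lk f h L → Lk (Function.update f p x) h L := by
  induction L with
  | nil => exact fun h => h
  | cons q L ih =>
    rintro h ⟨h1, h2⟩
    simp only [List.mem_cons, not_or] at hp
    exact ⟨h1, by grind⟩

/-- A list of all the positions, stored in an array. -/
structure Arr (n : ℕ) (f : ℕ → ℕ) (L : List ℕ) : Prop where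
  nodup : L.Nodup
  mem : ∀ p, p ∈ L ↔ p < 2 * n
  get : ∀ t p, L[t]? = some p → f t = p

theorem Arr.length {f : ℕ → ℕ} {L : List ℕ} (h : Arr n f L) : L.length = 2 * n := by
  have : L.Perm (List.range (2 * n)) :=
    (List.perm_ext_iff_of_nodup h.nodup List.nodup_range).2 fun p => by simp [h.mem]
  simpa using this.length_eq

/-- One pass of radix sort. -/
def pass (n z : ℕ) (ky : ℕ → ℕ) (L : List ℕ) : List ℕ :=
  (List.range (2 * n)).flatMap fun d => L.filter fun p => decide (ky p / z % (2 * n) = d)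

theorem pass_mem {z : ℕ} {ky : ℕ → ℕ} {L : List ℕ} (hn : 0 < n) {p : ℕ} :
    p ∈ pass n z ky L ↔ p ∈ L := by
  simp only [pass, List.mem_flatMap, List.mem_range, List.mem_filter, decide_eq_true_eq]
  exact ⟨fun ⟨_, _, h, _⟩ => h, fun h => ⟨_, Nat.mod_lt _ (by omega), h, rfl⟩⟩

theorem pass_nodup {z : ℕ} {ky : ℕ → ℕ} {L : List ℕ} (h : L.Nodup) : (pass n z ky L).Nodup := by
  refine List.nodup_flatMap.2 ⟨fun d _ => h.filter _, List.nodup_range.imp fun hab => ?_⟩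
  intro p hp hp'
  simp_all

/-- The digit handled by the pass is the leading one modulo `z * (2n)`; buckets keep the order of
their elements, which settles equal digits. -/
theorem pass_sorted {z : ℕ} {ky : ℕ → ℕ} {L : List ℕ}
    (h : L.Pairwise fun p q => ky p % z ≤ ky q % z) (hz : 0 < z) :
    (pass n z ky L).Pairwise fun p q => ky p % (z * (2 * n)) ≤ ky q % (z * (2 * n)) := by
  have e : ∀ x, x % (z * (2 * n)) = x % z + z * (x / z % (2 * n)) := fun x => Nat.mod_mul
  refine List.pairwise_flatMap.2 ⟨fun d _ => ?_, List.pairwise_lt_range.imp fun {a b} hab p hp q hq => ?_⟩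
  · refine (List.pairwise_filter.2 (h.imp fun {p q} hpq hp hq => ?_))
    simp_all
  · simp only [List.mem_filter, decide_eq_true_eq] at hp hq
    rw [e, e, hp.2, hq.2]
    have := Nat.mod_lt (ky p) hz
    have : z * (a + 1) ≤ z * b := Nat.mul_le_mul_left _ hab
    grind

/-- The list is read from its end and elements are prepended to their buckets, which makes the pass
stable. -/
def distC : Cmd :=
  .asg .t (.v .m) ;; .wh (.v .t) (.asg .t (.sub (.v .t) (.c 1)) ;; .asg .p (.rd .ord (.v .t)) ;;
    .asg .d (.mod (.div (.rd .q (.v .p)) (.v .z)) (.v .m)) ;; .put .nx (.v .p) (.rd .hd (.v .d)) ;;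
    .put .hd (.v .d) (.add (.v .p) (.c 1)))

/-- Each iteration either takes one element from the current bucket or moves to the next bucket,
`4n` iterations in all. The buckets are left empty for the next pass. -/
def collB : Cmd :=
  .ite (.rd .hd (.v .d)) (.asg .p (.sub (.rd .hd (.v .d)) (.c 1)) ;; .put .ord (.v .t) (.v .p) ;;
    .inc .t ;; .put .hd (.v .d) (.rd .nx (.v .p))) (.inc .d)

def collC : Cmd :=
  (.asg .t (.c 0) ;; .asg .d (.c 0)) ;; .wh (.lt (.v .d) (.v .m)) collB

def sortC : Cmd :=
  .asg .z (.c 1) ;; .wh (.lt (.v .z) (.add (.v .e) (.c 1)))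
    (distC ;; collC ;; .asg .z (.mul (.v .z) (.v .m)))

theorem distC_W (hC : C.Valid) {z : ℕ} {ky : ℕ → ℕ} {L : List ℕ} (hn : 0 < n) (hI : 3 * n ≤ C.I)
    (hm : s.v .m = 2 * n) (hz : s.v .z = z) (hL : Arr n (s.a .ord) L)
    (hk : ∀ p < 2 * n, s.a .q p = ky p) (h0 : ∀ d < 2 * n, s.a .hd d = 0) :
    W C distC s (300 * n) fun s' => ∀ d < 2 * n, Lk (s'.a .nx) (s'.a .hd d)
      (L.filter fun p => decide (ky p / z % (2 * n) = d)) := by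
  have hl := hC.lt
  have hlen := hL.length
  have key := W.loop (C := C) (e := .v .t) (c := .asg .t (.sub (.v .t) (.c 1)) ;;
    .asg .p (.rd .ord (.v .t)) ;;
    .asg .d (.mod (.div (.rd .q (.v .p)) (.v .z)) (.v .m)) ;; .put .nx (.v .p) (.rd .hd (.v .d)) ;;
    .put .hd (.v .d) (.add (.v .p) (.c 1))) (fun k s' => s'.v .t = k ∧ k ≤ 2 * n ∧ s'.v .m = 2 * n ∧
      s'.v .z = z ∧ s'.a .ord = s.a .ord ∧ s'.a .q = s.a .q ∧ ∀ d < 2 * n, Lk (s'.a .nx) (s'.a .hd d)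
      ((L.drop k).filter fun p => decide (ky p / z % (2 * n) = d))) 120 ?_ ?_ (2 * n)
    (s.setv .t (2 * n)) ⟨rfl, le_rfl, hm, hz, rfl, rfl, fun d hd => by
      rw [List.drop_of_length_le hlen.le]; exact h0 d hd⟩
  · refine W.bind (t₁ := 3) (t₂ := 2 * n * (120 + 1 + 2) + 3)
      (P := fun s' => s' = s.setv .t (2 * n)) (W.basic trivial (by decide)
        (by grind [Cmd.exec, Exp.eval])) (by omega) ?_
    rintro _ - rfl
    refine key.mono (by simp only [Exp.cost]; omega) ?_
    simp_all
  · rintro s' ⟨h, -⟩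
    exact ⟨trivial, h⟩
  · rintro k s' ⟨h1, h2, h3, h4, h5, h6, h7⟩
    have hkl : k < L.length := by omega
    have ho : s.a .ord k = L[k] := hL.get k _ (List.getElem?_eq_getElem hkl)
    have hp : L[k] < 2 * n := (hL.mem _).1 (List.getElem_mem hkl)
    have hd := Nat.mod_lt (ky L[k] / z) (by omega : 0 < 2 * n)
    have hnd : L[k] ∉ L.drop (k + 1) := fun hm => by
      have := hL.nodup
      rw [← List.take_append_drop (k + 1) L] at this
      exact List.disjoint_of_nodup_append this (List.mem_take_iff_getElem.2 ⟨k, by omega, rfl⟩) hm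
    refine ⟨trivial, by simp only [Exp.eval]; omega, W.basic ?_ (by decide) ⟨?_, by omega, h3, h4, h5, h6,
      fun d hd' => ?_⟩⟩
    · simp only [Cmd.ok, Exp.ok, Exp.eval, okOp, Cmd.exec, idl, St.setv, St.seta, true_and, and_true, ne_eq,
        reduceCtorEq, not_false_eq_true, Function.update_of_ne, Function.update_self, h1, h3, h4, h5, h6,
        Nat.add_sub_cancel, ho, hk _ hp]
      omega
    · simp [Cmd.exec, Exp.eval, idl, St.setv, St.seta, h1]
    · simp only [Exp.eval, Cmd.exec, idl, St.setv, St.seta, ne_eq,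
        reduceCtorEq, not_false_eq_true, Function.update_of_ne, Function.update_self, h1, h3, h4, h5, h6,
        Nat.add_sub_cancel, ho, hk _ hp]
      rw [List.drop_eq_getElem_cons hkl, List.filter_cons]
      by_cases he : ky L[k] / z % (2 * n) = d
      · simp only [he, decide_true, if_true, Function.update_self]
        refine ⟨rfl, ?_⟩
        rw [Function.update_self]
        exact (h7 d hd').update (fun h => hnd (List.mem_of_mem_filter h))
      · simp only [he, decide_false, Bool.false_eq_true, if_false, Function.update_of_ne (Ne.symm he)]
        exact (h7 d hd').update (fun h => hnd (List.mem_of_mem_filter h))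

theorem collC_W (hC : C.Valid) {ℓ : ℕ → List ℕ} (hn : 0 < n) (hI : 3 * n ≤ C.I) (hm : s.v .m = 2 * n)
    (h : ∀ d < 2 * n, Lk (s.a .nx) (s.a .hd d) (ℓ d))
    (hlen : ((List.range (2 * n)).flatMap ℓ).length = 2 * n)
    (hlt : ∀ p ∈ (List.range (2 * n)).flatMap ℓ, p < 2 * n) :
    W C collC s (600 * n) fun s' => (∀ d < 2 * n, s'.a .hd d = 0) ∧
      ∀ t p, ((List.range (2 * n)).flatMap ℓ)[t]? = some p → s'.a .ord t = p := by
  have hl := hC.lt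
  have key := W.loop (C := C) (e := .lt (.v .d) (.v .m)) (c := collB) (fun k s' => s'.v .m = 2 * n ∧
      s'.a .nx = s.a .nx ∧ ∃ O ℓ' d, s'.v .t = O.length ∧ s'.v .d = d ∧ d ≤ 2 * n ∧
      (List.range (2 * n)).flatMap ℓ = O ++ (List.range' d (2 * n - d)).flatMap ℓ' ∧
      (∀ e < 2 * n, d ≤ e → Lk (s.a .nx) (s'.a .hd e) (ℓ' e)) ∧ (∀ e < d, s'.a .hd e = 0) ∧
      (∀ i p, O[i]? = some p → s'.a .ord i = p) ∧
      k + O.length = 4 * n - d) 115 ?_ ?_ (4 * n)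
    ((s.setv .t 0).setv .d 0) ⟨hm, rfl, [], ℓ, 0, rfl, rfl, Nat.zero_le _,
      by rw [List.range_eq_range']; rfl, fun e he _ => h e he, by simp, by simp, by simp⟩
  · refine W.bind (t₁ := 10) (t₂ := 4 * n * (115 + 5 + 2) + 5 + 2)
      (P := fun s' => s' = (s.setv .t 0).setv .d 0) (W.basic ?_ (by decide)
        (by simp only [Cmd.exec, Exp.eval])) (by omega) ?_
    · grind [Cmd.ok, Exp.ok]
    rintro _ - rfl
    refine key.mono (by simp only [Exp.cost]; omega) ?_
    grind
  · rintro s' ⟨h0, -, O, ℓ', d, h1, h2, h3, h4, h5, h6, h7, h8⟩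
    have hO := congrArg List.length h4
    rw [List.length_append, hlen] at hO
    refine ⟨⟨trivial, trivial, trivial⟩, ?_⟩
    grind [Exp.eval, idl, ltn_eq_zero]
  · rintro k s' ⟨h0, hnx, O, ℓ', d, h1, h2, h3, h4, h5, h6, h7, h8⟩
    have hO := congrArg List.length h4
    rw [List.length_append, hlen] at hO
    have hd : d < 2 * n := by grind
    have h9 := h5 d hd le_rfl
    rw [show 2 * n - d = 2 * n - (d + 1) + 1 by omega, List.range'_succ, List.flatMap_cons] at h4
    refine ⟨⟨trivial, trivial, trivial⟩, by grind [Exp.eval, idl, ltn_eq_zero], ?_⟩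
    refine (W.ite (e := .rd .hd (.v .d)) (t := 99) ⟨trivial, by simp only [Exp.eval]; omega⟩ (fun h10 => ?_) fun h10 => ?_).mono
      (by decide) fun _ _ h => h
    · simp only [Exp.eval, h2] at h10
      rcases hℓ : ℓ' d with _ | ⟨p, L⟩
      · rw [hℓ] at h9; exact absurd h9 h10
      rw [hℓ] at h9 h4
      obtain ⟨h11, h12⟩ := h9
      have hp : p < 2 * n := hlt p (by rw [h4]; simp)
      have hOl := congrArg List.length h4
      simp only [List.length_append, List.length_cons, hlen] at hOl
      refine W.basic ?_ (by decide) ⟨h0, hnx, O ++ [p], Function.update ℓ' d L, d, ?_, h2, h3, ?_,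
        fun e he hde => ?_, fun e he => ?_, fun i x hx => ?_, ?_⟩
      · simp only [Cmd.ok, Exp.ok, Exp.eval, okOp, Cmd.exec, idl, St.setv, St.seta, true_and,
          ne_eq, reduceCtorEq, not_false_eq_true, Function.update_of_ne, Function.update_self, h1, h2, h11,
          Nat.add_sub_cancel]
        omega
      · simp [Cmd.exec, Exp.eval, idl, St.setv, St.seta, h1]
      · rw [show 2 * n - d = 2 * n - (d + 1) + 1 by omega, List.range'_succ, List.flatMap_cons,
          Function.update_self, h4, List.append_assoc]
        simp only [List.cons_append, List.nil_append]
        congr 3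
        refine List.flatMap_congr fun e he => ?_
        grind
      · simp only [Exp.eval, Cmd.exec, idl, St.setv, St.seta, ne_eq, reduceCtorEq, not_false_eq_true,
          Function.update_of_ne, Function.update_self, h2, h11, Nat.add_sub_cancel, hnx]
        grind
      · simp only [Exp.eval, Cmd.exec, idl, St.setv, St.seta, ne_eq, reduceCtorEq, not_false_eq_true,
          Function.update_of_ne, Function.update_self, h2]
        rw [Function.update_of_ne (by omega)]; exact h6 e he
      · simp only [Exp.eval, Cmd.exec, idl, St.setv, St.seta, ne_eq, reduceCtorEq, not_false_eq_true,
          Function.update_of_ne, Function.update_self, h2, h1, h11, Nat.add_sub_cancel]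
        by_cases hi : i < O.length
        · rw [List.getElem?_append_left hi] at hx
          rw [Function.update_of_ne (by omega)]; exact h7 i x hx
        · have : i < (O ++ [p]).length := (List.getElem?_eq_some_iff.1 hx).1
          rw [List.length_append, List.length_singleton] at this
          grind
      grind
    · simp only [Exp.eval, h2] at h10
      have hℓ : ℓ' d = [] := by
        rcases hℓ : ℓ' d with _ | ⟨p, L⟩
        · rfl
        · rw [hℓ] at h9; have := h9.1; omega
      rw [hℓ, List.nil_append] at h4
      refine (W.inc (x := .d) (by rw [h2]; omega)).mono (by decide) ?_
      rintro _ - rfl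
      refine ⟨h0, hnx, O, ℓ', d + 1, h1, by simp [St.setv, h2], hd, h4, fun e he hde => h5 e he (by omega),
        fun e he => ?_, h7, by omega⟩
      rcases Nat.lt_succ_iff_lt_or_eq.1 he with he | rfl
      · exact h6 e he
      · exact h10

theorem sortC_W (hC : C.Valid) {κ : ℕ → ℕ} {E R : ℕ} (hn : 0 < n) (hI : 3 * n ≤ C.I)
    (hm : s.v .m = 2 * n) (he : s.v .e = E) (hR : E < (2 * n) ^ R) (hE : 2 * n * (E + 1) < 2 ^ C.w)
    (hk : ∀ p < 2 * n, s.a .ord p = p ∧ s.a .q p = κ p ∧ κ p ≤ E) (h0 : ∀ d, s.a .hd d = 0) :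
    W C sortC s (1000 * n * (R + 1)) fun s' =>
      ∃ L, Arr n (s'.a .ord) L ∧ L.Pairwise fun p q => κ p ≤ κ q := by
  have hl := hC.lt
  have hE' : E + 1 < 2 ^ C.w := lt_of_le_of_lt (Nat.le_mul_of_pos_left _ (by omega)) hE
  have key := W.wh (C := C) (e := .lt (.v .z) (.add (.v .e) (.c 1)))
    (c := distC ;; collC ;; .asg .z (.mul (.v .z) (.v .m))) (fun k s' => s'.v .m = 2 * n ∧ s'.v .e = E ∧
      s'.a .q = s.a .q ∧ (∀ d < 2 * n, s'.a .hd d = 0) ∧ ∃ r L, s'.v .z = (2 * n) ^ r ∧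
      Arr n (s'.a .ord) L ∧ (L.Pairwise fun p q => κ p % (2 * n) ^ r ≤ κ q % (2 * n) ^ r) ∧
      k = (R - r) * (1000 * n)) ?_ (R * (1000 * n)) (s.setv .z 1)
    ⟨hm, he, rfl, fun d _ => h0 d, 0, List.range (2 * n), by simp [St.setv],
      ⟨List.nodup_range, by simp, fun t p h => ?_⟩, by simp [Nat.mod_one, List.pairwise_iff_getElem], rfl⟩
  · refine W.bind (t₁ := 3) (t₂ := R * (1000 * n) + 20) (P := fun s' => s' = s.setv .z 1)
      (W.basic ?_ (by decide) rfl) (by nlinarith) ?_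
    · exact lt_of_le_of_lt (by omega : 1 ≤ 32 * C.I + 32) hl
    rintro _ - rfl
    refine key.mono (by simp only [Exp.cost]; omega) ?_
    rintro s' - ⟨h1, -, -, h2, h3, -, -, r, L, h4, h5, h6, -⟩
    simp only [Exp.eval, idl, ltn_eq_zero, h3, h4] at h1
    rw [Nat.succ_le_iff] at h1
    refine ⟨L, h5, h6.imp_of_mem fun {p q} hp hq h => ?_⟩
    rw [Nat.mod_eq_of_lt ((hk p ((h5.mem p).1 hp)).2.2.trans_lt h1),
      Nat.mod_eq_of_lt ((hk q ((h5.mem q).1 hq)).2.2.trans_lt h1)] at h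
    exact h
  · rintro k s' ⟨h1, h2, h3, h4, r, L, h5, h6, h7, h8⟩
    refine ⟨⟨trivial, ⟨trivial, by simp only [Exp.ok]; omega, by grind [okOp, Exp.eval]⟩,
      trivial⟩, fun h9 => ?_⟩
    simp only [Exp.eval, idl, ne_eq, ltn_eq_zero, h2, h5, not_le] at h9
    have hr : r < R := by
      by_contra hr
      have := Nat.pow_le_pow_right (by omega : 0 < 2 * n) (not_lt.1 hr)
      omega
    refine ⟨970 * n, (R - (r + 1)) * (1000 * n), ?_, ?_⟩
    · rw [h8, show R - r = (R - (r + 1)).succ by omega, Nat.succ_mul (R - (r + 1))]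
      simp only [Exp.cost]; omega
    refine W.bind (t₂ := 650 * n) (distC_W hC (ky := κ) hn hI h1 h5 h6
      (fun p hp => by rw [h3]; exact (hk p hp).2.1) h4) (by omega) ?_
    intro s₁ f1 h10
    have hP : ((List.range (2 * n)).flatMap fun d => L.filter fun p =>
      decide (κ p / (2 * n) ^ r % (2 * n) = d)) = pass n ((2 * n) ^ r) κ L := rfl
    have hP' : ∀ f, (∀ t p, (pass n ((2 * n) ^ r) κ L)[t]? = some p → f t = p) →
        Arr n f (pass n ((2 * n) ^ r) κ L) := fun f hf =>
      ⟨pass_nodup h6.nodup, fun p => by rw [pass_mem hn, h6.mem], hf⟩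
    refine W.bind (t₂ := 10) (collC_W hC hn hI ((f1.v _ rfl).trans h1) h10
      (by rw [hP]; exact (hP' (fun t => ((pass n ((2 * n) ^ r) κ L)[t]?).getD 0)
        fun t p h => by simp [h]).length)
      fun p hp => by rw [hP, pass_mem hn, h6.mem] at hp; exact hp) (by omega) ?_
    rintro s₂ f2 ⟨h11, h12⟩
    have e1 : s₂.v .m = 2 * n := by rw [f2.v _ rfl, f1.v _ rfl, h1]
    have e2 : s₂.v .z = (2 * n) ^ r := by rw [f2.v _ rfl, f1.v _ rfl, h5]
    refine W.basic ⟨trivial, trivial, ?_⟩ (by decide) ⟨e1, by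
      simp only [Cmd.exec, St.setv, ne_eq, reduceCtorEq, not_false_eq_true, Function.update_of_ne]
      rw [f2.v _ rfl, f1.v _ rfl, h2], ?_, h11, r + 1, _, ?_, hP' _ h12, ?_, rfl⟩
    · simp only [okOp, Exp.eval, e1, e2]
      rw [mul_comm]
      exact lt_of_le_of_lt (Nat.mul_le_mul_left _ h9.le) hE
    · change s₂.a .q = _
      rw [f2.a _ rfl, f1.a _ rfl, h3]
    · simp only [Cmd.exec, Exp.eval, idl, St.setv, Function.update_self, e1, e2]
      rw [pow_succ]
    grind [pass_sorted]
  · obtain ⟨h1, h2⟩ := List.getElem?_eq_some_iff.1 h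
    rw [List.getElem_range] at h2
    subst h2
    exact (hk t (by simpa using h1)).1

/-! ### Ranking the letters -/

def rankB : Cmd :=
  .asg .p (.rd .ord (.v .t)) ;; .asg .x (.rd .q (.v .p)) ;;
  .ite (.eq (.v .x) (.v .y)) .skip (.put .nm (.v .r) (.v .x) ;; .asg .y (.v .x) ;; .inc .r) ;;
  .put .idp (.v .p) (.sub (.v .r) (.c 1)) ;; .inc .t

/-- Keys are even, so the initial value 1 of `y` differs from all of them and the first key counts
as new. Positions with variables contribute the key 0, which may number a letter that does not
occur; this is harmless. -/
def rankC : Cmd := (.asg .t (.c 0) ;; .asg .y (.c 1)) ;; .wh (.lt (.v .t) (.v .m)) rankB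

theorem rankC_W (hC : C.Valid) {κ : ℕ → ℕ} {L : List ℕ} (hn : 0 < n) (hI : 3 * n ≤ C.I)
    (hm : s.v .m = 2 * n) (hr : s.v .r = 0) (hk : ∀ p < 2 * n, s.a .q p = κ p ∧ κ p % 2 = 0)
    (hL : Arr n (s.a .ord) L) (hs : L.Pairwise fun p q => κ p ≤ κ q) :
    W C rankC s (300 * (C.I + 1)) fun s' => s'.v .r ≤ 2 * n ∧
      (∀ x y, x < y → y < s'.v .r → s'.a .nm x < s'.a .nm y) ∧
      (∀ x < s'.v .r, s'.a .nm x % 2 = 0) ∧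
      ∀ p < 2 * n, s'.a .idp p < s'.v .r ∧ s'.a .nm (s'.a .idp p) = κ p := by
  have hl := hC.lt
  have hlen := hL.length
  have key := W.loop (C := C) (e := .lt (.v .t) (.v .m)) (c := rankB) (fun k s' => s'.v .m = 2 * n ∧
      s'.a .q = s.a .q ∧ s'.a .ord = s.a .ord ∧ ∃ t, s'.v .t = t ∧ t + k = 2 * n ∧ s'.v .r ≤ t ∧
      (s'.v .r = 0 ∧ s'.v .y = 1 ∨ 0 < s'.v .r ∧ s'.a .nm (s'.v .r - 1) = s'.v .y) ∧
      (∀ x y, x < y → y < s'.v .r → s'.a .nm x < s'.a .nm y) ∧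
      (∀ x < s'.v .r, s'.a .nm x % 2 = 0 ∧ ∀ p ∈ L.drop t, s'.a .nm x ≤ κ p) ∧
      ∀ p ∈ L.take t, s'.a .idp p < s'.v .r ∧ s'.a .nm (s'.a .idp p) = κ p) 130 ?_ ?_ (2 * n)
    ((s.setv .t 0).setv .y 1) ⟨hm, rfl, rfl, 0, rfl, by simp, by simp [St.setv, hr],
      Or.inl ⟨hr, rfl⟩, by simp [St.setv, hr], by simp [St.setv, hr], by simp⟩
  · refine W.bind (t₁ := 10) (t₂ := 2 * n * (130 + 5 + 2) + 5 + 2)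
      (P := fun s' => s' = (s.setv .t 0).setv .y 1) (W.basic ?_ (by decide)
        (by simp only [Cmd.exec, Exp.eval])) (by omega) ?_
    · grind [Cmd.ok, Exp.ok]
    rintro _ - rfl
    refine key.mono (by simp only [Exp.cost]; omega) ?_
    rintro s' - ⟨-, -, -, t, -, h2, h3, -, h4, h5, h6⟩
    refine ⟨by omega, h4, fun x hx => (h5 x hx).1, fun p hp => h6 p ?_⟩
    rw [List.take_of_length_le (by omega)]
    exact (hL.mem p).2 hp
  · rintro s' ⟨h1, -, -, t, h2, h3, -⟩
    exact ⟨⟨trivial, trivial, trivial⟩, by grind [Exp.eval, idl, ltn_eq_zero]⟩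
  · rintro k s' ⟨h1, h2, h3, t, h4, h5, h6, h7, h8, h9, h10⟩
    have htl : t < L.length := by omega
    have ho : s.a .ord t = L[t] := hL.get t _ (List.getElem?_eq_getElem htl)
    have hp : L[t] < 2 * n := (hL.mem _).1 (List.getElem_mem htl)
    have hdr := List.drop_eq_getElem_cons htl
    obtain ⟨hq, hq2⟩ := hk _ hp
    have hsrt : ∀ p ∈ L.drop (t + 1), κ L[t] ≤ κ p := by
      have := hs.sublist (List.drop_sublist t L)
      rw [hdr, List.pairwise_cons] at this
      exact this.1
    have hnd : ∀ p ∈ L.take t, p ≠ L[t] := fun p hp' he => by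
      have := hL.nodup
      rw [← List.take_append_drop t L, hdr] at this
      grind
    refine ⟨⟨trivial, trivial, trivial⟩, by grind [Exp.eval, idl, ltn_eq_zero], ?_⟩
    have htk : ∀ p ∈ L.take (t + 1), p ∈ L.take t ∨ p = L[t] := fun p h => by grind
    have hdm : ∀ p ∈ L.drop (t + 1), p ∈ L.drop t := fun p h => by grind
    by_cases hxy : κ L[t] = s'.v .y
    · have h11 : 0 < s'.v .r ∧ s'.a .nm (s'.v .r - 1) = s'.v .y := by omega
      have he : eqn (κ L[t]) (s'.v .y) = 1 := if_pos hxy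
      refine W.basic ?_ (by decide) ⟨?_, ?_, ?_, t + 1, ?_, by omega, ?_⟩
      all_goals simp only [rankB, Cmd.ok, Exp.ok, Exp.eval, okOp, Cmd.exec, idl, St.setv, St.seta, true_and,
        and_true, ne_eq, reduceCtorEq, not_false_eq_true, Function.update_of_ne, Function.update_self, h1, h2,
        h3, h4, ho, hq, he, one_ne_zero, if_false]
      · omega
      · refine ⟨by omega, Or.inr h11, h8, fun x hx => ⟨(h9 x hx).1, fun p hp => (h9 x hx).2 p (hdm p hp)⟩,
          fun p hp => ?_⟩
        rcases htk p hp with hp | rfl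
        · grind
        grind
    · have he : eqn (κ L[t]) (s'.v .y) = 0 := if_neg hxy
      have hlt : ∀ x < s'.v .r, s'.a .nm x < κ L[t] := fun x hx => by
        rcases h7 with h7 | ⟨h7, h11⟩
        · omega
        · have h12 := (h9 (s'.v .r - 1) (by omega)).2 L[t] (by grind)
          rcases Nat.lt_or_ge x (s'.v .r - 1) with hx' | hx'
          · grind
          grind
      refine W.basic ?_ (by decide) ⟨?_, ?_, ?_, t + 1, ?_, by omega, ?_⟩
      all_goals simp only [rankB, Cmd.ok, Exp.ok, Exp.eval, okOp, Cmd.exec, idl, St.setv, St.seta, true_and,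
        and_true, ne_eq, reduceCtorEq, not_false_eq_true, Function.update_of_ne, Function.update_self, h1, h2,
        h3, h4, ho, hq, he, if_true, Nat.add_sub_cancel]
      · omega
      · refine ⟨by omega, Or.inr (by omega), fun x y hx hy => ?_, fun x hx => ?_, fun p hp => ?_⟩
        · rw [Function.update_of_ne (by omega)]
          by_cases hyr : y = s'.v .r
          · grind
          grind
        · by_cases hxr : x = s'.v .r
          · grind
          · rw [Function.update_of_ne hxr]
            exact ⟨(h9 x (by omega)).1, fun p hp => (h9 x (by omega)).2 p (hdm p hp)⟩
        · rcases htk p hp with hp | rfl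
          · have := h10 p hp
            rw [Function.update_of_ne (hnd p hp), Function.update_of_ne (by omega)]
            omega
          grind

end

end RP

namespace RP
open WordRAM

/-! ### Expanding the variables that occur once -/

/-- A stack, with its top first. -/
def Stk (f : ℕ → ℕ) : List ℕ → Prop
  | [] => True
  | p :: L => f L.length = p ∧ Stk f L

theorem Stk.update {f : ℕ → ℕ} {q x : ℕ} : ∀ {L : List ℕ}, L.length ≤ q → Stk f L →
    Stk (Function.update f q x) L
  | [], _, _ => trivial
  | p :: L, h, ⟨h1, h2⟩ => by
    simp only [List.length_cons] at h
    exact ⟨by grind, h2.update (by omega)⟩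

/-- The code `2j + 1` of variable `j` is at the same time the second position of its rule, and `2j`
is the first one; the first ends up on top. -/
def pushC : Cmd :=
  .put .stk (.v .sp) (.v .c) ;; .put .stk (.add (.v .sp) (.c 1)) (.sub (.v .c) (.c 1)) ;;
    .asg .sp (.add (.v .sp) (.c 2))

def dfsB : Cmd :=
  (.asg .sp (.sub (.v .sp) (.c 1)) ;; .asg .p (.rd .stk (.v .sp)) ;;
    .asg .c (.inp (.add (.c 1) (.v .p)))) ;;
  .ite (.mod (.v .c) (.c 2))
    (.ite (.eq (.rd .occ (.div (.v .c) (.c 2))) (.c 1)) pushC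
      (emitC (.add (.div (.v .c) (.c 2)) (.c 1)) (.c 0)))
    (emitC (.rd .idp (.v .p)) (.c 1))

/-- Only kept variables are expanded; the guard of the conditional is non-zero exactly for the
others, which receive just an end marker. -/
def dfsC : Cmd :=
  (.asg .i (.c 0) ;; .asg .q (.c 0) ;; .asg .sp (.c 0)) ;;
  .wh (.lt (.v .i) (.v .n)) (
    .ite (.mul (.lt (.rd .occ (.v .i)) (.c 2)) (.sub (.c 1) (.eq (.add (.v .i) (.c 1)) (.v .n)))) .skip
      (.asg .c (.add (.add (.v .i) (.v .i)) (.c 1)) ;; pushC) ;;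
    .wh (.v .sp) dfsB ;; emitC (.c 0) (.c 0) ;; .inc .i) ;; copyC

section
variable {C : Ctx} {s : St} {n N X K : ℕ} {cd occ idf sz : ℕ → ℕ} {F : ℕ → List Tk}

theorem pushC_W (hC : C.Valid) {j : ℕ} {L : List ℕ} (hc : s.v .c = 2 * j + 1)
    (hw : s.v .c < 2 ^ C.w) (hL : Stk (s.a .stk) L) (hsp : s.v .sp = L.length)
    (hI : L.length + 2 ≤ C.I) :
    W C pushC s 60 fun s' => Stk (s'.a .stk) (2 * j :: (2 * j + 1) :: L) ∧ s'.v .sp = L.length + 2 := by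
  have hl := hC.lt
  refine W.basic ?_ (by decide) ⟨⟨?_, ?_, ?_⟩, ?_⟩
  all_goals simp only [pushC, Cmd.ok, Exp.ok, Exp.eval, okOp, Cmd.exec, idl, St.setv, St.seta, true_and,
    Function.update_self, hc, hsp,
    List.length_cons, Nat.add_sub_cancel]
  · omega
  · simp_all
  · exact (hL.update le_rfl).update (by omega)

/-- The number of positions still to be visited is the loop counter. As every entry of the stack
counts at least once, it also bounds the height of the stack. -/
theorem dfsB_W (hC : C.Valid) (h : Src C n N X cd) (hF : IsF n cd idf occ F) (hz : IsSz n cd occ sz)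
    {A : List (ℕ × ℕ)} {L : List ℕ} (hL : Stk (s.a .stk) L) (hsp : s.v .sp = L.length)
    (hA : Seg (s.a .bv) (s.a .bc) 0 A) (hq : s.v .q = A.length) (hLn : ∀ p ∈ L, p < 2 * n)
    (hk : (L.map (szp cd occ sz)).sum ≤ 2 * n)
    (hI : A.length + (L.flatMap (tkp cd idf occ F)).length ≤ C.I)
    (ho : ∀ j < n, s.a .occ j = occ j) (hi : ∀ p < 2 * n, s.a .idp p = idf p) :
    W C (.wh (.v .sp) dfsB) s ((L.map (szp cd occ sz)).sum * 150 + 3) fun s' => s'.v .sp = 0 ∧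
      Seg (s'.a .bv) (s'.a .bc) 0 (A ++ (L.flatMap (tkp cd idf occ F)).map enc) ∧
      s'.v .q = A.length + (L.flatMap (tkp cd idf occ F)).length := by
  have hl := hC.lt
  have hb := h.base
  have hr := h.room
  have key := W.loop (C := C) (e := .v .sp) (c := dfsB) (fun k s' => s'.a .occ = s.a .occ ∧
      s'.a .idp = s.a .idp ∧ ∃ r L', (L'.map (szp cd occ sz)).sum = k ∧ k ≤ 2 * n ∧ Stk (s'.a .stk) L' ∧
      s'.v .sp = L'.length ∧ (∀ p ∈ L', p < 2 * n) ∧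
      r ++ L'.flatMap (tkp cd idf occ F) = L.flatMap (tkp cd idf occ F) ∧
      Seg (s'.a .bv) (s'.a .bc) 0 (A ++ r.map enc) ∧ s'.v .q = (A ++ r.map enc).length) 147 ?_ ?_ _ s
    ⟨rfl, rfl, [], L, rfl, hk, hL, hsp, hLn, rfl, by simpa using hA, by simpa using hq⟩
  · refine key.mono (by simp only [Exp.cost]; omega) ?_
    rintro s' - ⟨-, -, r, L', h1, -, -, h2, -, h3, h4, h5⟩
    rcases L' with _ | ⟨p, L'⟩
    · simp_all
    · simp [szp] at h1
  · rintro s' ⟨-, -, r, L', h1, -, -, h2, -⟩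
    rcases L' with _ | ⟨p, L'⟩
    · exact ⟨trivial, h2⟩
    · simp [szp] at h1
  · rintro k s' ⟨e1, e2, r, L', h1, h2, h3, h4, h5, h6, h7, h8⟩
    rcases L' with _ | ⟨p, L'⟩
    · simp at h1
    have hp := h5 p (by simp)
    have hpo := h.ord p hp
    have hpc := h.inp p hp
    have hpw : cd p < 2 ^ C.w := hpc ▸ hC.inp _
    have hlen := congrArg List.length h6
    simp only [List.length_append, List.flatMap_cons] at hlen
    have hLl : L'.length ≤ (L'.map (szp cd occ sz)).sum := by
      have := List.length_le_sum_of_one_le (L'.map (szp cd occ sz)) (by simp [szp])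
      simpa using this
    simp only [List.length_cons] at h4
    rw [List.map_cons, List.sum_cons] at h1
    refine ⟨trivial, by simp only [Exp.eval]; omega, ?_⟩
    refine W.bind (t₁ := 40) (t₂ := 106) (P := fun s₁ => s₁ = ((s'.setv .sp L'.length).setv .p p).setv .c (cd p))
      (W.basic ?_ (by decide) ?_) (by omega) ?_
    · simp only [Cmd.ok, Exp.ok, Exp.eval, okOp, Cmd.exec, idl, St.setv, true_and,
        Function.update_self, h4, h3.1,
        Nat.add_sub_cancel]
      omega
    · simp only [Exp.eval, Cmd.exec, idl, St.setv,
        Function.update_self, h4, h3.1, Nat.add_sub_cancel, hpc]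
    rintro _ - rfl
    refine (W.ite (e := .mod (.v .c) (.c 2)) (t := 98) ⟨trivial, by simp only [Exp.ok]; omega, trivial⟩
      (fun h9 => ?_) fun h9 => ?_).mono (by decide) fun _ _ h => h
    · change cd p % 2 ≠ 0 at h9
      have hodd : cd p % 2 = 1 := by omega
      have hoj := ho (cd p / 2) (by omega)
      refine (W.ite (e := .eq (.rd .occ (.div (.v .c) (.c 2))) (.c 1)) (t := 73) ⟨⟨⟨trivial,
        by simp only [Exp.ok]; omega, trivial⟩, ?_⟩, by simp only [Exp.ok]; omega, trivial⟩
        (fun h10 => ?_) fun h10 => ?_).mono (by decide) fun _ _ h => h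
      · change cd p / 2 < C.I
        omega
      · have h11 : occ (cd p / 2) = 1 := by
          change eqn (s'.a .occ (cd p / 2)) 1 ≠ 0 at h10
          simp_all
        have h12 : szp cd occ sz p = 1 + (szp cd occ sz (2 * (cd p / 2)) +
            szp cd occ sz (2 * (cd p / 2) + 1)) := by
          rw [← hz _ (by omega)]
          exact congrArg (1 + ·) (if_pos ⟨hodd, h11⟩)
        have h13 : tkp cd idf occ F p = F (cd p / 2) := by grind [tkp]
        refine (pushC_W hC (s := ((s'.setv .sp L'.length).setv .p p).setv .c (cd p)) (j := cd p / 2) (L := L') ?_ hpw h3.2 rfl (by omega)).mono (by decide) ?_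
        · change cd p = _
          omega
        rintro s₂ f2 ⟨h14, h15⟩
        refine ⟨(f2.a _ rfl).trans e1, (f2.a _ rfl).trans e2, r, _, ?_, by omega, h14, h15, ?_, ?_, ?_, ?_⟩
        · grind
        · grind
        · rw [← h6, List.flatMap_cons, List.flatMap_cons, List.flatMap_cons, h13, hF _ (by omega),
            List.append_assoc (tkp cd idf occ F (2 * (cd p / 2)))]
        · rw [f2.a _ rfl, f2.a _ rfl]; exact h7
        · rw [f2.v _ rfl]; exact h8
      · have h11 : occ (cd p / 2) ≠ 1 := by
          change eqn (s'.a .occ (cd p / 2)) 1 = 0 at h10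
          simp_all
        have h12 : szp cd occ sz p = 1 := congrArg (1 + ·) (if_neg fun h => h11 h.2)
        have h13 : tkp cd idf occ F p = [.var (cd p / 2)] := by grind [tkp]
        refine (emitC_W hC (s := ((s'.setv .sp L'.length).setv .p p).setv .c (cd p)) (e := .add (.div (.v .c) (.c 2)) (.c 1)) (f := .c 0) ⟨⟨trivial,
          by simp only [Exp.ok]; omega, trivial⟩, by simp only [Exp.ok]; omega, ?_⟩
          (by simp only [Exp.ok]; omega) (L := A ++ r.map enc) h7 h8 ?_ (by decide)
          fun x => ⟨rfl, Iff.rfl⟩).mono (by decide) ?_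
        · change cd p / 2 + 1 < 2 ^ C.w
          omega
        · grind
        rintro s₂ f2 ⟨-, h14, h15⟩
        refine ⟨(f2.a _ rfl).trans e1, (f2.a _ rfl).trans e2, r ++ [.var (cd p / 2)], L', by omega,
          by omega, by rw [f2.a _ rfl]; exact h3.2, (f2.v _ rfl).trans rfl,
          fun x hx => h5 x (by simp [hx]), ?_, ?_, ?_⟩
        · simp_all
        · simp_all [enc, Exp.eval, idl, St.setv]
        · simp [h15]; omega
    · change cd p % 2 = 0 at h9
      have h12 : szp cd occ sz p = 1 := congrArg (1 + ·) (if_neg fun h => by omega)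
      have h13 : tkp cd idf occ F p = [.run (idf p) 1] := by rw [tkp, if_neg (by omega)]
      refine (emitC_W hC (s := ((s'.setv .sp L'.length).setv .p p).setv .c (cd p)) (e := .rd .idp (.v .p)) (f := .c 1) ⟨trivial, ?_⟩
        (by simp only [Exp.ok]; omega) (L := A ++ r.map enc) h7 h8 ?_ (by decide)
        fun x => ⟨rfl, Iff.rfl⟩).mono (by decide) ?_
      · change p < C.I
        omega
      · grind
      rintro s₂ f2 ⟨-, h14, h15⟩
      refine ⟨(f2.a _ rfl).trans e1, (f2.a _ rfl).trans e2, r ++ [.run (idf p) 1], L', by omega,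
        by omega, by rw [f2.a _ rfl]; exact h3.2, (f2.v _ rfl).trans rfl,
        fun x hx => h5 x (by simp [hx]), ?_, ?_, ?_⟩
      · simp_all
      · simp_all [enc, Exp.eval, St.setv]
      · simp [h15]; omega

theorem dfsC_W (hC : C.Valid) (h : Src C n N X cd) (hF : IsF n cd idf occ F)
    (hz : IsSz n cd occ sz) (hn : s.v .n = n) (ho : ∀ j < n, s.a .occ j = occ j)
    (hi : ∀ p < 2 * n, s.a .idp p = idf p)
    (hS : ∑ i ∈ Finset.range n, (if root n occ i then sz i else 0) ≤ 2 * n)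
    (hlF : ∀ i < n, (F i).length ≤ sz i) :
    W C dfsC s (1500 * (C.I + 1)) fun s' => 
      Seg (s'.a .av) (s'.a .ac) 0 (flats (fun i => if root n occ i then F i else []) n) := by
  have hl := hC.lt
  have hr := h.room
  set G : ℕ → List Tk := fun i => if root n occ i then F i else [] with hG
  have hGs : ∀ i < n, (G i).length ≤ if root n occ i then sz i else 0 := fun i hi' => by grind
  have hfl : ∀ i ≤ n, (flats G i).length ≤ 2 * n + i := fun i hi' => by
    rw [length_flats, Finset.sum_add_distrib]
    have := (Finset.sum_le_sum_of_subset (f := fun i => (G i).length) (Finset.range_subset_range.2 hi')).trans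
      (Finset.sum_le_sum fun i hi => hGs i (Finset.mem_range.1 hi))
    simp only [Finset.sum_const, Finset.card_range, smul_eq_mul, mul_one]
    omega
  have hG0 : ∀ (i : ℕ) (k : ℕ), i < n → k = ∑ j ∈ Finset.Ico i n, ((if root n occ j then sz j else 0) * 150 + 250) →
      ∃ k', k = (if root n occ i then sz i else 0) * 150 + 250 + k' ∧
        k' = ∑ j ∈ Finset.Ico (i + 1) n, ((if root n occ j then sz j else 0) * 150 + 250) :=
    fun i k hi hk => ⟨_, by rw [hk, Finset.sum_eq_sum_Ico_succ_bot hi], rfl⟩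
  have key := W.wh (C := C) (e := .lt (.v .i) (.v .n)) (c :=
      .ite (.mul (.lt (.rd .occ (.v .i)) (.c 2)) (.sub (.c 1) (.eq (.add (.v .i) (.c 1)) (.v .n)))) .skip
      (.asg .c (.add (.add (.v .i) (.v .i)) (.c 1)) ;; pushC) ;;
    .wh (.v .sp) dfsB ;; emitC (.c 0) (.c 0) ;; .inc .i) (fun k s' => s'.v .n = n ∧ s'.a .occ = s.a .occ ∧
      s'.a .idp = s.a .idp ∧ s'.v .sp = 0 ∧ ∃ i ≤ n, s'.v .i = i ∧
      Seg (s'.a .bv) (s'.a .bc) 0 (flats G i) ∧ s'.v .q = (flats G i).length ∧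
      k = ∑ j ∈ Finset.Ico i n, ((if root n occ j then sz j else 0) * 150 + 250)) ?_ _
    (((s.setv .i 0).setv .q 0).setv .sp 0) ⟨hn, rfl, rfl, rfl, 0, Nat.zero_le _, rfl, trivial, rfl, rfl⟩
  · rw [← Finset.range_eq_Ico, Finset.sum_add_distrib, ← Finset.sum_mul] at key
    simp only [Finset.sum_const, Finset.card_range, smul_eq_mul] at key
    refine W.bind (t₁ := 15) (t₂ := 1500 * (C.I + 1) - 16)
      (P := fun s' => s' = ((s.setv .i 0).setv .q 0).setv .sp 0) (W.basic ?_ (by decide)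
        (by simp only [Cmd.exec, Exp.eval])) (by omega) ?_
    · grind [Cmd.ok, Exp.ok]
    rintro _ - rfl
    refine W.bind (t₂ := 80 * (C.I + 1)) key (by simp only [Exp.cost]; omega) ?_
    grind [Exp.eval, idl, ltn_eq_zero, copyC_W]
  · rintro k s' ⟨e0, e1, e2, e3, i, h1, h2, h3, h4, h5⟩
    refine ⟨⟨trivial, trivial, trivial⟩, fun h6 => ?_⟩
    simp only [Exp.eval, idl, ne_eq, ltn_eq_zero, h2, e0, not_le] at h6
    obtain ⟨k', rfl, hk'⟩ := hG0 i k h6 h5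
    have hGi : (flats G (i + 1)).length = (flats G i).length + ((G i).length + 1) := by
      grind [flats_succ, length_flat]
    have hfi := hfl (i + 1) h6
    refine ⟨(if root n occ i then sz i else 0) * 150 + 240, k', by simp only [Exp.cost]; omega, ?_⟩
    refine W.bind (t₁ := 110) (t₂ := (if root n occ i then sz i else 0) * 150 + 100) (P := fun s₁ =>
      ∃ L, Stk (s₁.a .stk) L ∧ s₁.v .sp = L.length ∧ (∀ p ∈ L, p < 2 * n) ∧
        (L.map (szp cd occ sz)).sum = (if root n occ i then sz i else 0) ∧
        L.flatMap (tkp cd idf occ F) = G i) ?_ (by omega) ?_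
    · have h8 := ltn_le (s'.a .occ i) 2
      have h9 := eqn_le (i + 1) n
      refine (W.ite (t := 75) (e := .mul (.lt (.rd .occ (.v .i)) (.c 2)) (.sub (.c 1)
        (.eq (.add (.v .i) (.c 1)) (.v .n)))) ?_ (fun h7 => ?_) fun h7 => ?_).mono (by decide) fun _ _ h => h
      · grind [Exp.ok, Exp.eval, okOp, idl, ltn, eqn]
      · simp only [Exp.eval, idl, h2, e0, e1, ho i h6, ne_eq, mul_eq_zero, ltn_eq_zero, not_or, not_le] at h7
        have hnr : ¬root n occ i := by
          rintro (hr | hr)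
          · omega
          grind [eqn]
        exact W.basic trivial (by decide) ⟨[], trivial, e3, by simp, by simp [hnr], by simp [hG, hnr]⟩
      · simp only [Exp.eval, idl, h2, e0, e1, ho i h6, mul_eq_zero, ltn_eq_zero] at h7
        have hrt : root n occ i := by
          rcases h7 with h7 | h7
          · exact Or.inl h7
          · refine Or.inr (by_contra fun hne => ?_)
            grind [eqn]
        refine W.bind (t₁ := 14) (t₂ := 60) (P := fun s₁ => s₁ = s'.setv .c (2 * i + 1))
          (W.basic ?_ (by decide) ?_) (by omega) ?_
        · grind [Cmd.ok, Exp.ok, Exp.eval, okOp, idl]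
        · grind [Cmd.exec, Exp.eval, idl]
        rintro _ - rfl
        refine (pushC_W hC (s := s'.setv .c (2 * i + 1)) (j := i) (L := []) rfl ?_ trivial e3 ?_).mono
          le_rfl ?_
        · change 2 * i + 1 < _
          omega
        · grind
        rintro s₂ - ⟨h10, h11⟩
        refine ⟨_, h10, h11, ?_, ?_, ?_⟩
        · grind
        · simp [hrt, hz i h6]
        · simp [hG, hrt, hF i h6]
    rintro s₁ f1 ⟨L, g1, g2, g3, g4, g5⟩
    have hk2 : (L.map (szp cd occ sz)).sum ≤ 2 * n := by
      rw [g4]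
      exact (Finset.single_le_sum (f := fun i => if root n occ i then sz i else 0)
        (fun _ _ => Nat.zero_le _) (Finset.mem_range.2 h6)).trans hS
    refine W.bind (t₂ := 80) (dfsB_W hC h hF hz (s := s₁) (A := flats G i) g1 g2 ?_ ?_ g3 hk2 ?_ ?_ ?_) ?_ ?_
    · rw [f1.a _ rfl, f1.a _ rfl]; exact h3
    · rw [f1.v _ rfl]; exact h4
    · rw [g5]; omega
    · intro j hj; rw [f1.a _ rfl, e1]; exact ho j hj
    · intro p hp; rw [f1.a _ rfl, e2]; exact hi p hp
    · rw [g4]; omega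
    rintro s₂ f2 ⟨g6, g7, g8⟩
    rw [g5] at g7 g8
    refine W.bind (t₂ := 7) (emitC_W hC (e := .c 0) (f := .c 0) (by simp only [Exp.ok]; omega)
      (by simp only [Exp.ok]; omega) g7 (by simpa using g8) (by simp; omega) (by decide)
      fun x => ⟨rfl, Iff.rfl⟩) (by omega) ?_
    rintro s₃ f3 ⟨-, g9, g10⟩
    have g11 : s₃.v .i = i := by rw [f3.v _ rfl, f2.v _ rfl, f1.v _ rfl, h2]
    refine (W.inc (by omega)).mono le_rfl ?_
    rintro _ - rfl
    refine ⟨?_, ?_, ?_, ?_, i + 1, h6, congrArg (· + 1) g11, ?_, ?_, hk'⟩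
    · exact ((f3.v _ rfl).trans ((f2.v _ rfl).trans (f1.v _ rfl))).trans e0
    · exact ((f3.a _ rfl).trans ((f2.a _ rfl).trans (f1.a _ rfl))).trans e1
    · exact ((f3.a _ rfl).trans ((f2.a _ rfl).trans (f1.a _ rfl))).trans e2
    · exact (f3.v _ rfl).trans g6
    · rw [flats_succ, flat, ← List.append_assoc]; exact g9
    · rw [hGi]
      refine Eq.trans g10 ?_
      simp; omega

/-! ### From the input to the first round -/

def setupC : Cmd := prepC ;; sortC ;; rankC ;; dfsC

/-- The result of the set-up. -/
structure Start (C : Ctx) (n N : ℕ) (cd : ℕ → ℕ) (K : ℕ) (idf lt occ rf : ℕ → ℕ) (V : ℕ → List ℕ)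
    (s : St) : Prop where
  le : K ≤ 2 * n
  mono : ∀ x y, x < y → y < K → lt x < lt y
  val : IsV n cd idf V
  letter : ∀ p < 2 * n, cd p % 2 = 0 → symOf K lt (idf p) = .letter (cd p / 2)
  sum : ∑ i ∈ Finset.range n, rf i ≤ 2 * n
  inv : LoopInv C n N K lt occ rf (2 * n) [] ((V (n - 1)).map (symOf K lt)) s

theorem setupC_W (hC : C.Valid) (h : Src C n N X cd) {R : ℕ} (hR : 2 * n * X < (2 * n) ^ R)
    (hn : s.v .n = n) (h0 : ∀ x, x ≠ .n → s.v x = 0) (ha : ∀ k i, s.a k i = 0) :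
    W C setupC s (4200 * (C.I + 1) + 1000 * n * (R + 1)) fun s' =>
      ∃ K idf lt occ rf V, Start C n N cd K idf lt occ rf V s' := by
  have hl := hC.lt
  have hn0 := h.pos
  have hr := h.room
  obtain ⟨occ, ho⟩ := exists_occ h.ord
  obtain ⟨sz, hz⟩ := exists_sz h.ord occ
  refine W.bind (t₂ := 3600 * (C.I + 1) + 1000 * n * (R + 1)) (prepC_W hC h ho hn (h0 _ (by decide)) (ha _))
    (by omega) ?_
  rintro s₁ f1 ⟨a1, a2, a3, a4⟩
  refine W.bind (t₂ := 2000 * (C.I + 1)) (sortC_W hC (κ := ky cd) hn0 hr a1 rfl (a3.trans_lt hR) ?_ a4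
    fun d => by rw [f1.a _ rfl]; exact ha _ d) (by omega) ?_
  · refine lt_of_le_of_lt (Nat.mul_le_mul_left _ ?_) h.small
    grind
  rintro s₂ f2 ⟨L, b1, b2⟩
  refine W.bind (t₂ := 1600 * (C.I + 1)) (rankC_W hC (κ := ky cd) hn0 hr ((f2.v _ rfl).trans a1) ?_ ?_ b1 b2)
    (by omega) ?_
  · rw [f2.v _ rfl, f1.v _ rfl]; exact h0 _ (by decide)
  · intro p hp
    refine ⟨by rw [f2.a _ rfl]; exact (a4 p hp).2.1, ?_⟩
    rcases Nat.mod_two_eq_zero_or_one (cd p) with hm | hm <;> simp [ky, hm]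
  rintro s₃ f3 ⟨c1, c2, c3, c4⟩
  have hidK : ∀ p < 2 * n, s₃.a .idp p < s₃.v .r := fun p hp => (c4 p hp).1
  obtain ⟨F, hF⟩ := exists_F h.ord (s₃.a .idp) occ
  obtain ⟨V, hV⟩ := exists_V h.ord (s₃.a .idp)
  have hini : Ini n N (s₃.v .r) cd (s₃.a .idp) occ V :=
    ⟨hn0, h.ord, ho, hV, h.len _ V hV, hidK⟩
  have hlF := hini.length_F hF hz
  have hS := hini.sum_sz hz
  have hocc : ∀ j < n, s₃.a .occ j = occ j := fun j hj => by
    rw [f3.a _ rfl, f2.a _ rfl]; exact a2 j hj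
  have hn3 : s₃.v .n = n := by rw [f3.v _ rfl, f2.v _ rfl, f1.v _ rfl, hn]
  refine (dfsC_W hC h hF hz hn3 hocc (fun p _ => rfl) hS hlF).mono (by omega) ?_
  intro s₄ f4 hseg
  have hgs : ∀ i < n, (if root n occ i then (F i).length else 0) ≤ if root n occ i then sz i else 0 :=
    fun i hi => by grind
  have hrf : ∑ i ∈ Finset.range n, (if root n occ i then (F i).length else 0) ≤ 2 * n :=
    (Finset.sum_le_sum fun i hi => hgs i (Finset.mem_range.1 hi)).trans hS
  have hmem : ∀ i < n, ∀ t ∈ (if root n occ i then F i else []),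
      (∃ x, t = .run x 1 ∧ x < s₃.v .r) ∨ ∃ j, t = .var j ∧ j < i := fun i hi t ht => by
    split_ifs at ht
    · exact (hini.mem_F hF i hi t ht).imp_right fun ⟨j, h1, h2, _⟩ => ⟨j, h1, h2⟩
    · simp at ht
  have hv : ∀ x, x ≠ .n → prepC.modV x = false → sortC.modV x = false → rankC.modV x = false →
      dfsC.modV x = false → s₄.v x = 0 := fun x h1 h2 h3 h4 h5 => by
    rw [f4.v x h5, f3.v x h4, f2.v x h3, f1.v x h2, h0 x h1]
  have har : ∀ k, prepC.modA k = false → sortC.modA k = false → rankC.modA k = false →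
      dfsC.modA k = false → s₄.a k = fun _ => 0 := fun k h2 h3 h4 h5 => by
    rw [f4.a k h5, f3.a k h4, f2.a k h3, f1.a k h2]; exact funext (ha k)
  -- The table holds codes of letters, which are even; half of a code is the letter.
  refine ⟨s₃.v .r, s₃.a .idp, fun x => s₃.a .nm x / 2, occ, _, V, c1, fun x y hxy hy => ?_, hV,
    fun p hp hp2 => ?_, hrf, ⟨_, _, _, ⟨?_, hseg, ?_, ?_, ?_⟩, hini.gm hF, ?_, ?_⟩, ⟨?_, ?_, ?_, ?_⟩, ?_, ?_, ?_⟩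
  · grind
  · refine (if_pos (hidK p hp)).trans (congrArg Symb.letter ?_)
    grind [ky]
  · rw [f4.v _ rfl, hn3]
  · rw [length_flats, Finset.sum_add_distrib]
    have : ∑ i ∈ Finset.range n, (if root n occ i then F i else []).length =
        ∑ i ∈ Finset.range n, if root n occ i then (F i).length else 0 :=
      Finset.sum_congr rfl fun i _ => by split_ifs <;> rfl
    rw [this]
    simp only [Finset.sum_const, Finset.card_range, smul_eq_mul, mul_one]
    omega
  · intro i hi x k hx
    rcases hmem i hi _ hx with ⟨y, h1, -⟩ | ⟨j, h1, -⟩ <;> cases h1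
    exact one_pos
  · intro i hi t ht
    rcases hmem i hi t ht with ⟨y, rfl, h1⟩ | ⟨j, rfl, h1⟩ <;> simp only [enc] <;> omega
  · grind [root]
  · omega
  · exact hv _ (by decide) rfl rfl rfl rfl
  · rw [f4.v _ rfl]; rfl
  · intro x hx
    have : x < s₃.v .r := hx
    rw [f4.a _ rfl, symOf, if_pos this, Symb.code]
    have := c3 x this
    omega
  · simp
  · intro i hi; rw [f4.a _ rfl]; exact hocc i hi
  · intro x; rw [har _ rfl rfl rfl rfl]
  · intro x; rw [har _ rfl rfl rfl rfl]

end

end RP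

namespace RP
open WordRAM

/-! ### Straight-line programs as input -/

theorem encodeRules_getD {rs : List (Symb × Symb)} {x y : Symb} : ∀ {i : ℕ}, rs[i]? = some (x, y) →
    (encodeRules rs).getD (2 * i) 0 = x.code ∧ (encodeRules rs).getD (2 * i + 1) 0 = y.code := by
  induction rs with
  | nil => intro i h; simp at h
  | cons r rs ih =>
    intro i h
    have e : encodeRules (r :: rs) = r.1.code :: r.2.code :: encodeRules rs := rfl
    grind

/-- The code at a position. -/
def codeAt (S : SLP) (p : ℕ) : ℕ := (encodeRules S.rules).getD p 0

theorem codeAt_eq {S : SLP} {p : ℕ} (hp : p < 2 * S.numVars) : ∃ x y, S.rules[p / 2]? = some (x, y) ∧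
    codeAt S p = if p % 2 = 0 then x.code else y.code := by
  have hi : p / 2 < S.rules.length := by unfold SLP.numVars at hp; omega
  obtain ⟨x, y, h⟩ : ∃ x y, S.rules[p / 2]? = some (x, y) := ⟨_, _, List.getElem?_eq_getElem hi⟩
  obtain ⟨h1, h2⟩ := encodeRules_getD h
  grind [codeAt]

theorem Symb.code_odd {x : Symb} (h : x.code % 2 = 1) : x = .var (x.code / 2) := by
  cases x with
  | letter a => simp [Symb.code] at h
  | var j => simp only [Symb.code]; congr 1; omega

theorem Symb.code_even {x : Symb} (h : x.code % 2 = 0) : x = .letter (x.code / 2) := by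
  cases x with
  | letter a => simp [Symb.code]
  | var j => simp only [Symb.code] at h; omega

theorem ord_codeAt (S : SLP) : Ord S.numVars (codeAt S) := by
  intro p hp ho
  obtain ⟨x, y, h1, h2⟩ := codeAt_eq hp
  refine S.ordered _ x y h1 _ ?_
  grind [Symb.code_odd]

theorem codeAt_le {S : SLP} {Y : ℕ} (h : S.LettersLE Y) {p : ℕ} (hp : p < 2 * S.numVars) :
    codeAt S p ≤ 2 * Y + 2 * S.numVars := by
  rcases Nat.mod_two_eq_zero_or_one (codeAt S p) with ho | ho
  · obtain ⟨x, y, h1, h2⟩ := codeAt_eq hp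
    have := h _ (List.mem_of_getElem? h1) (codeAt S p / 2) (by grind [Symb.code_even])
    omega
  · have := ord_codeAt S p hp ho
    omega

/-- The length is right for any numbering `idf`, as needed before letters have been ranked. The
images agree as soon as the numbering respects letters, which later identifies the text. -/
theorem Derives.eval {S : SLP} {β : Type} {idf : ℕ → ℕ} {V : ℕ → List ℕ} {g f : ℕ → β}
    (hV : IsV S.numVars (codeAt S) idf V) {x : Symb} {u : List ℕ} (h : Derives S.rules x u) :
    (∀ a, x = .letter a → u = [a]) ∧ ∀ j, x = .var j → (V j).length = u.length ∧
      ((∀ p < 2 * S.numVars, codeAt S p % 2 = 0 → g (idf p) = f (codeAt S p / 2)) →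
        (V j).map g = u.map f) := by
  induction h with
  | letter a => simp_all
  | @var i x y u v hr _ _ ih1 ih2 =>
    refine ⟨fun b hb => (by cases hb), fun j hj => ?_⟩
    cases hj
    have hi : i < S.numVars := (List.getElem?_eq_some_iff.1 hr).1
    obtain ⟨e1, e2⟩ := encodeRules_getD hr
    have hp : ∀ p < 2 * S.numVars, ∀ z w, codeAt S p = Symb.code z → ((∀ a, z = .letter a → w = [a]) ∧
        ∀ j, z = .var j → (V j).length = w.length ∧
        ((∀ p < 2 * S.numVars, codeAt S p % 2 = 0 → g (idf p) = f (codeAt S p / 2)) →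
          (V j).map g = w.map f)) →
        ((if codeAt S p % 2 = 1 then V (codeAt S p / 2) else [idf p]).length = w.length ∧
        ((∀ p < 2 * S.numVars, codeAt S p % 2 = 0 → g (idf p) = f (codeAt S p / 2)) →
          (if codeAt S p % 2 = 1 then V (codeAt S p / 2) else [idf p]).map g = w.map f)) := by
      rintro p hp z w hz ⟨h1, h2⟩
      by_cases ho : codeAt S p % 2 = 1
      · grind [Symb.code_odd]
      · rw [if_neg ho]
        have ho' : codeAt S p % 2 = 0 := by omega
        have := h1 (codeAt S p / 2) (by grind [Symb.code_even])
        grind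
    have h1 := hp (2 * i) (by omega) x u e1 ih1
    have h2 := hp (2 * i + 1) (by omega) y v e2 ih2
    rw [hV i hi, List.length_append, List.length_append, List.map_append, List.map_append]
    grind

theorem Derives.ne_nil {rules : List (Symb × Symb)} {x : Symb} {u : List ℕ} (h : Derives rules x u) :
    0 < u.length := by
  induction h with
  | letter => exact one_pos
  | var _ _ _ h1 _ => simp_all

theorem Derives.two_le {rules : List (Symb × Symb)} {i : ℕ} {u : List ℕ}
    (h : Derives rules (.var i) u) : 2 ≤ u.length := by
  cases h with
  | var _ h1 h2 => grind [ne_nil]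

/-! ### The program -/

/-- Register 0 is initially zero, so the first load fetches the number `n` of variables. Register 99
becomes `2n + 1`, the length of the input and the base of the arrays. -/
def loadP : Prog :=
  .seq (.load 1 0) (.seq (.op .add 99 1 1) (.seq (.const 100 1) (.op .add 99 99 100)))

/-- The program that computes `repair`. -/
def program : Prog := .seq loadP (.seq (setupC ;; mainC ;; scanC).comp outC.comp)

/-- Records that are no longer needed are turned into the output area, with whatever they contain.
This allows the size of the output area to be fixed after the main loop. -/
theorem Rel.shrink {C : Ctx} {s : St} {σ : Store} (h : Rel C s σ) {I J : ℕ} (hI : I ≤ C.I) :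
    Rel { C with I := I, J := J } { s with o := fun j => σ.mem (C.b + 32 * I + j) } σ :=
  ⟨h.reg, fun k i hi => h.mem k i (lt_of_lt_of_le hi hI), fun _ _ => rfl, h.inp, h.base, h.cells,
    h.bv, h.ba⟩

theorem loadP_runs {C : Ctx} (hC : C.Valid) {input : List ℕ} {n : ℕ} (ω : ℕ → Fin (2 ^ C.w))
    (hi : C.inp = fun j => input.getD j 0) (hn : input.getD 0 0 = n) (hb : C.b = 2 * n + 1)
    (hl : input.length = C.b) (P : Prog) :
    ∃ σ, Runs C.w ω loadP (init P input).2 σ 7 ∧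
      Rel C ⟨fun x => if x = .n then n else 0, fun _ _ => 0, fun _ => 0⟩ σ := by
  have hsm := hC.small
  have hbd := hC.bound
  have hN : n < 2 ^ C.w := by omega
  refine ⟨_, Runs.seq (t₁ := 1) (t₂ := 5) (Runs.one fun _ => rfl) (Runs.seq (t₁ := 1) (t₂ := 3)
    (Runs.one fun _ => rfl) (Runs.seq (t₁ := 1) (t₂ := 1) (Runs.one fun _ => rfl)
      (Runs.one fun _ => rfl))), ⟨fun x => ?_, fun k i _ => ?_, fun j _ => ?_, fun j _ => ?_, ?_, ?_, fun x => ?_,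
      fun _ _ => Nat.two_pow_pos _⟩⟩
  · have := x.idx_lt
    simp only [Store.setReg, init]
    rw [Function.update_of_ne (by omega), Function.update_of_ne (by omega), Function.update_of_ne (by omega)]
    by_cases hx : x = .n
    · subst hx
      exact (Function.update_self (1 : ℕ) _ _).trans hn
    · exact (Function.update_of_ne (fun h => hx (Vr.idx_inj (y := .n) h)) _ _).trans (if_neg hx).symm
  · exact List.getD_eq_default _ _ (by omega)
  · exact List.getD_eq_default _ _ (by omega)
  · rw [hi]; rfl
  · simp only [Store.setReg, init, Function.update_self, BinOp.eval]
    change ((input.getD 0 0 + input.getD 0 0) % 2 ^ C.w + 1 % 2 ^ C.w) % 2 ^ C.w = C.b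
    rw [hn, hb, Nat.mod_eq_of_lt (by omega : 1 < 2 ^ C.w), Nat.mod_eq_of_lt (by omega : n + n < 2 ^ C.w),
      Nat.mod_eq_of_lt (by omega : n + n + 1 < 2 ^ C.w)]
    omega
  · simp only [Store.setReg, init]
    omega
  grind

/-- `M` is an integer form of the space bound. It dominates `n` and the number of rules, and it
measures both the buffers and the time per round. -/
theorem runs_program (S : SLP) {T : List ℕ} {α w : ℕ} (hg : S.Generates T) (hn : S.numVars ≤ T.length)
    (hX : S.LettersLE (T.length ^ α)) (hw : T.length ^ (α + 14) ≤ 2 ^ w) (ω : ℕ → Fin (2 ^ w)) {M : ℕ}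
    (hM : M = min T.length (S.numVars * (repair T).numVars * Nat.log 2 T.length)) :
    ∃ σ t, Runs w ω program (init program S.encode).2 σ t ∧ σ.cells ≤ 2200 * M ∧
      t ≤ (1000000 + 2000 * (α + 9)) * M * (repair T).numVars ∧
      ∀ i (h : i < (repair T).encode.length), σ.mem (σ.reg 0 + i) = (repair T).encode[i] := by
  have hcan := canon_repair T
  obtain ⟨rs, start, hrep⟩ : ∃ rs start, repair T = ⟨rs, start⟩ := ⟨_, _, rfl⟩
  rw [hrep] at hcan hM ⊢
  simp only [RePairGrammar.numVars, RePairGrammar.encode] at *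
  have hlen := hcan.length_add
  rw [List.length_map] at hlen
  set n := S.numVars with hnn
  set N := T.length with hN
  have hn0 : 0 < n := List.length_pos_iff.2 S.rules_ne_nil
  have hN2 : 2 ≤ N :=
    Derives.two_le hg
  have hL : 1 ≤ Nat.log 2 N := Nat.log_pos (by decide) hN2
  set L := Nat.log 2 N with hLL
  set q := rs.length with hq
  have hnM : n ≤ M := by
    rw [hM]
    refine le_min hn ?_
    rw [mul_assoc]
    exact Nat.le_mul_of_pos_right _ (by positivity)
  have hqM : q + 1 ≤ M := by
    rw [hM]
    refine le_min (by omega) ?_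
    rw [mul_right_comm]
    exact Nat.le_mul_of_pos_left _ (by positivity)
  have hMN : M ≤ N := hM ▸ min_le_left _ _
  have hML : M ≤ n * (q + 1) * L := hM ▸ min_le_right _ _
  -- The case decides which of the two token bounds is used.
  have hMc : M = N ∨ M = n * (q + 1) * L := by omega
  have hpow : ∀ k, 2 ^ k * N ^ α ≤ N ^ (α + k) := fun k => by
    rw [pow_add, mul_comm]; exact Nat.mul_le_mul_left _ (Nat.pow_le_pow_left hN2 _)
  have hw1 : 2 ^ 13 * N ≤ 2 ^ w := by
    refine le_trans ?_ hw
    calc 2 ^ 13 * N ≤ N ^ 13 * N := Nat.mul_le_mul_right _ (Nat.pow_le_pow_left hN2 _)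
      _ = N ^ 14 := (pow_succ N 13).symm
      _ ≤ N ^ (α + 14) := Nat.pow_le_pow_right (by omega) (by omega)
  set X := 2 * N ^ α + 2 * n with hXX
  have hNa : 1 ≤ N ^ α := Nat.one_le_pow _ _ (by omega)
  have hX1 : X + 1 ≤ 5 * N ^ (α + 1) := by
    have h1 : N ≤ N ^ (α + 1) := Nat.le_self_pow (by omega) _
    grind
  have hX2 : 2 * n * (2 * n * (X + 1)) < N ^ (α + 8) := by
    calc 2 * n * (2 * n * (X + 1)) ≤ 2 * N * (2 * N * (5 * N ^ (α + 1))) := by gcongr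
      _ = 20 * N ^ (α + 3) := by ring
      _ < 2 ^ 5 * N ^ (α + 3) := by grind
      _ ≤ N ^ 5 * N ^ (α + 3) := Nat.mul_le_mul_right _ (Nat.pow_le_pow_left hN2 _)
      _ = N ^ (α + 8) := by ring
  have hX3 : 2 * n * X < N ^ (α + 8) := lt_of_le_of_lt (Nat.mul_le_mul_left _ (by nlinarith)) hX2
  have hX4 : N ^ (α + 8) ≤ 2 ^ w := le_trans (Nat.pow_le_pow_right (by omega) (by omega : α + 8 ≤ α + 14)) hw
  -- Number of radix passes: the keys are below `N ^ (α + 8)`, and `N` is less than `2n` to the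
  -- power `log + 1`.
  set R := (α + 8) * (Nat.log (2 * n) N + 1) with hRR
  have hR : 2 * n * X < (2 * n) ^ R := by
    refine hX3.trans_le ?_
    rw [hRR, pow_mul']
    exact Nat.pow_le_pow_left (Nat.lt_pow_succ_log_self (by omega : 1 < 2 * n) N).le _
  -- With `l` the logarithm of `N` to base `2n`: `n * l ≤ n ^ l * 2 ^ l ≤ N` if `l` is positive, and
  -- `l` is at most the binary logarithm. So sorting stays within `M` in both cases.
  have hnR : n * R ≤ (α + 8) * (2 * M) := by
    have h1 : n * Nat.log (2 * n) N ≤ M := by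
      rw [hM]
      refine le_min ?_ ?_
      · refine le_trans ?_ (Nat.pow_log_le_self (2 * n) (by omega : N ≠ 0))
        rcases Nat.eq_zero_or_pos (Nat.log (2 * n) N) with h | h
        · rw [h]; simp
        · rw [mul_pow, mul_comm]
          exact Nat.mul_le_mul Nat.lt_two_pow_self.le (Nat.le_self_pow (by omega) _)
      · rw [mul_assoc]
        refine Nat.mul_le_mul_left _ ((Nat.log_anti_left (by decide : 1 < 2) (by omega : 2 ≤ 2 * n)).trans ?_)
        grind
    calc n * R = (α + 8) * (n * Nat.log (2 * n) N + n) := by rw [hRR]; ring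
      _ ≤ _ := Nat.mul_le_mul_left _ (by omega)
  -- The potential bounds the tokens and end markers by `2n + 28M + n ≤ 31M`, and a replacement
  -- needs twice that plus 3, hence 65. There is no output area yet.
  let C : Ctx := ⟨w, 2 * n + 1, 65 * M, 0, 2 * n + 1 + 32 * (65 * M), fun j => S.encode.getD j 0⟩
  have hcd : ∀ p < 2 * n, codeAt S p ≤ X := fun p hp => codeAt_le hX hp
  have hinp : ∀ p, C.inp (1 + p) = codeAt S p := fun p => by rw [add_comm]; rfl
  have hC : C.Valid := by
    refine ⟨le_rfl, ?_, fun j => ?_⟩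
    · grind
    · rcases j with _ | j
      · change n < 2 ^ w
        omega
      · rw [add_comm, hinp]
        change _ < 2 ^ w
        by_cases hj : j < 2 * n
        · grind
        · rw [codeAt, List.getD_eq_default _ _ (by rw [length_encodeRules]; exact not_lt.1 hj)]
          omega
  have hsrc : Src C n N X (codeAt S) := by
    refine ⟨hn0, ord_codeAt S, fun p _ => hinp p, rfl, ?_, hcd, hX2.trans_le hX4, ?_, fun idf V hV =>
      ((Derives.eval (g := id) (f := id) hV hg).2 _ rfl).1⟩
    · grind
    grind
  obtain ⟨σ₀, hr0, hrel0⟩ := loadP_runs hC ω rfl (n := n) rfl rfl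
    (by rw [SLP.encode, List.length_cons, length_encodeRules]; rfl) program
  set s₀ : St := ⟨fun x => if x = .n then n else 0, fun _ _ => 0, fun _ => 0⟩ with hs₀
  have hW : W C (setupC ;; mainC ;; scanC) s₀ (4200 * (65 * M + 1) + 1000 * n * (R + 1) + 1 +
      (9000 * (65 * M + 1) * (q + 1) + 100 * (65 * M + 1) + 1)) fun s' => ∃ K lt, ∃ (v : List ℕ) (r : List Tk),
      Tables K lt rs s' ∧ s'.v .n = n ∧ Seg (s'.a .av) (s'.a .ac) (n - 1) (r.map enc ++ [(0, 0)]) ∧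
      (∀ t ∈ r, ∃ x k, t = Tk.run x k ∧ x < K + rs.length ∧ 0 < k ∧ k ≤ 3) ∧
      items r = v.map .inl ∧ v.map (symOf K lt) = start ∧ s'.v .l = (items r).length ∧
      s'.v .o = C.b + 32 * (n - 1 + r.length + s'.v .h + s'.v .r + 1) ∧
      2 * (n + r.length) + 3 ≤ 65 * M ∧ K ≤ 2 * n := by
    refine W.bind (setupC_W hC hsrc hR rfl (fun x hx => if_neg hx) fun _ _ => rfl) (by
      change 4200 * (65 * M + 1) + _ + _ + _ ≤ _
      rw [add_right_comm]) ?_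
    rintro s₁ f1 ⟨K, idf, lt, occ, rf, V, hst⟩
    have hV : (V (n - 1)).map (symOf K lt) = T.map Symb.letter :=
      ((Derives.eval (g := symOf K lt) (f := Symb.letter) hst.val hg).2 _ rfl).2 hst.letter
    have hinv := hst.inv
    rw [hV] at hinv
    have hK := hst.le
    refine W.bind (mainC_W hC hst.mono hinv hcan ?_ ?_ ?_) le_rfl ?_
    · grind
    · grind
    · intro Z h1 h2
      have hsum := hst.sum
      have hsz : Nat.size N ≤ L + 1 := Nat.size_le.2 (Nat.lt_pow_succ_log_self (by decide) N)
      rcases hMc with hM' | hM'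
      · grind
      -- As `L ≥ 1`, the factor `2 * size N + 3 ≤ 2 * L + 5` is at most `7 * L`.
      · have h3 : (2 * rs.length + 1) * ((2 * Nat.size N + 3) * ∑ i ∈ Finset.range n, rf i) ≤
            2 * (q + 1) * (7 * L * (2 * n)) :=
          Nat.mul_le_mul (by omega) (Nat.mul_le_mul (by omega) hsum)
        grind
    rintro s₂ f2 ⟨⟨G, v, hG, hG0, hGt, hv, hvs, hGl⟩, htab⟩
    obtain ⟨hseg, hfl⟩ := hG.last hn0 hG0
    have hGp : ∀ t ∈ G (n - 1), ∃ x k, t = Tk.run x k ∧ x < K + rs.length ∧ 0 < k ∧ k ≤ 3 := fun t ht => by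
      obtain ⟨x, k, rfl, h1, h2⟩ := hGt t ht
      exact ⟨x, k, rfl, h1, hG.pos _ (by omega) _ _ ht, h2⟩
    have hGI : 2 * (flats G n).length + 3 ≤ 65 * M := hGl
    have hh := htab.vh
    have hr := htab.vr
    refine (scanC_W hC hG.nn hn0 hseg (fun t ht => by grind) ?_ rfl ?_).mono le_rfl ?_
    · omega
    · grind
    rintro s₃ f3 ⟨h1, h2⟩
    have e1 := f3.v .h rfl
    have e2 := f3.v .r rfl
    refine ⟨K, lt, v, G (n - 1), ⟨e1.trans hh, e2.trans hr, ?_, ?_⟩, (f3.v _ rfl).trans hG.nn, ?_, hGp, hv,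
      hvs, h1, ?_, by omega, hK⟩
    · rw [f3.a _ rfl]; exact htab.nm
    · rw [f3.a _ rfl, f3.a _ rfl]; exact htab.rules
    · rw [f3.a _ rfl, f3.a _ rfl]; exact hseg
    omega
  obtain ⟨s₁, t₁, ht₁, hev₁, K, lt, v, r, htab, hn1, hseg, hr, hv, hvs, hl, ho, hrl, hK⟩ := hW
  obtain ⟨σ₁, hr1, hrel1⟩ := hev₁.sim hC _ hrel0
  have hh := htab.vh
  have hrr := htab.vr
  have hsl : start.length ≤ 3 * r.length := by grind [length_items_le]
  -- The final string has at most three symbols per token, so the output fits into the records that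
  -- are given up.
  have hrel2 := hrel1.shrink (I := n - 1 + r.length + s₁.v .h + s₁.v .r + 1) (J := 2 * q + 2 + start.length)
    (by change _ ≤ 65 * M; omega)
  have hC' : Ctx.Valid { C with
      I := n - 1 + r.length + s₁.v .h + s₁.v .r + 1, J := 2 * q + 2 + start.length } := by
    refine ⟨?_, hC.small, hC.inp⟩
    grind
  obtain ⟨s₂, t₂, ht₂, hev₂, ho₂, hout⟩ := outC_W hC' (n := n) (s := { s₁ with
    o := fun j => σ₁.mem (C.b + 32 * (n - 1 + r.length + s₁.v .h + s₁.v .r + 1) + j) })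
    ⟨hh, hrr, htab.nm, htab.rules⟩ hn1 hn0 hseg hr hv hvs hl ho rfl le_rfl
  obtain ⟨σ₂, hr2, hrel3⟩ := hev₂.sim hC' _ hrel2
  refine ⟨σ₂, _, hr0.seq (hr1.seq hr2), ?_, ?_, ?_⟩
  · refine hrel3.cells.trans ?_
    grind
  · grind
  · intro i hi
    have h4 := hrel3.reg .o
    rw [ho₂] at h4
    have h5 := hrel3.out i ?_
    · rw [hout i hi] at h5
      rw [← h5]
      exact congrArg (fun x => σ₂.mem (x + i)) h4
    grind [length_encodeRules]

/-! ### Halting configurations, space at all times, and expected time -/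

theorem iterate_halted {w : ℕ} (ω : ℕ → Fin (2 ^ w)) (σ : Store) (k : ℕ) :
    (step w ω)^[k] ([], σ) = ([], σ) := Function.iterate_fixed rfl k

theorem cells_step (w : ℕ) (ω : ℕ → Fin (2 ^ w)) (c : Config) : c.2.cells ≤ (step w ω c).2.cells := by
  obtain ⟨_ | ⟨p, K⟩, σ⟩ := c
  · exact le_rfl
  · cases p <;> simp [step, Store.setReg]

/-- The number of used cells never decreases and is constant after halting, so its value at halting
bounds it at all times. -/
theorem cells_le {P : Prog} {w t : ℕ} {input : List ℕ} {ω : ℕ → Fin (2 ^ w)} {σ : Store}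
    (h : run P w input ω t = ([], σ)) (u : ℕ) : (run P w input ω u).2.cells ≤ σ.cells := by
  have hm : Monotone fun u => (run P w input ω u).2.cells := monotone_nat_of_le_succ fun u => by
    simp only [run, Function.iterate_succ_apply']
    exact cells_step _ _ _
  refine (hm (Nat.le_add_right u t)).trans (le_of_eq ?_)
  simp only [run] at h ⊢
  rw [Function.iterate_add_apply, h, iterate_halted]

/-- Halted configurations are fixed points, so the run has only one of them; correctness at one
halting time holds at all. -/
theorem eq_of_halted {P : Prog} {w t u : ℕ} {input : List ℕ} {ω : ℕ → Fin (2 ^ w)} {σ : Store}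
    (h : run P w input ω t = ([], σ)) (hu : Halted (run P w input ω u)) :
    (run P w input ω u).2 = σ := by
  obtain ⟨σ', hσ⟩ : ∃ σ', run P w input ω u = ([], σ') := ⟨_, Prod.ext hu rfl⟩
  rw [hσ]
  simp only [run] at h hσ
  have h1 := Function.iterate_add_apply (step w ω) t u (init P input)
  rw [hσ, iterate_halted, add_comm, Function.iterate_add_apply, h, iterate_halted] at h1
  simp_all

instance (w : ℕ) : IsProbabilityMeasure (randomWords w) := by
  unfold randomWords; infer_instance

/-- A bound that holds for every sequence of random words bounds the integral, because the law is a
probability measure. -/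
theorem expectedTime_le {P : Prog} {w B : ℕ} {input : List ℕ}
    (h : ∀ ω, ∃ t ≤ B, Halted (run P w input ω t)) : expectedTime P w input ≤ B := by
  refine (lintegral_mono (g := fun _ => (B : ℝ≥0∞)) fun ω => ?_).trans (by simp)
  obtain ⟨t, ht, hh⟩ := h ω
  have h1 : runTime P w input ω ≤ (t : ℕ∞) := iInf₂_le t hh
  have h2 : runTime P w input ω ≤ (B : ℕ∞) := h1.trans (by exact_mod_cast ht)
  calc (runTime P w input ω : ℝ≥0∞) ≤ ((B : ℕ∞) : ℝ≥0∞) := ENat.toENNReal_le.2 h2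
    _ = B := by simp

end RP

theorem theorem1 :
    ∃ (repair : List ℕ → RePairGrammar) (P : WordRAM.Prog),
      (∀ T : List ℕ, IsRePair T (repair T)) ∧
      ∀ α : ℕ, ∃ (C : ℝ) (K : ℕ),
        ∀ (S : SLP) (T : List ℕ) (N n m w : ℕ),
          S.Generates T → N = T.length → n = S.numVars → m = (repair T).numVars →
          n ≤ N → S.LettersLE (N ^ α) → N ^ K ≤ 2 ^ w →
            (∀ (ω : ℕ → Fin (2 ^ w)) (t : ℕ),
              WordRAM.Halted (WordRAM.run P w S.encode ω t) →
                WordRAM.Outputs (WordRAM.run P w S.encode ω t) (repair T).encode) ∧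
            (∀ (ω : ℕ → Fin (2 ^ w)) (t : ℕ),
              ((WordRAM.run P w S.encode ω t).2.cells : ℝ) ≤
                C * min (N : ℝ) (n * m * Real.logb 2 N)) ∧
            WordRAM.expectedTime P w S.encode ≤
              ENNReal.ofReal (C * min (N : ℝ) (n * m * Real.logb 2 N) * m) := by
  refine ⟨RP.repair, RP.program, RP.isRePair_repair, fun α =>
    ⟨((1000000 + 2000 * (α + 9) : ℕ) : ℝ), α + 14, ?_⟩⟩
  rintro S T N n m w hg rfl rfl rfl hn hX hw
  obtain ⟨M, hM⟩ : ∃ M, M = min T.length (S.numVars * (RP.repair T).numVars * Nat.log 2 T.length) := ⟨_, rfl⟩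
  have key := fun ω => RP.runs_program S hg hn hX hw ω hM
  -- The integer logarithm in `M` is the floor of the real one, so bounds in terms of `M` imply the
  -- stated ones.
  have hMr : (M : ℝ) ≤ min (T.length : ℝ) (S.numVars * (RP.repair T).numVars * Real.logb 2 T.length) := by
    rw [hM, Nat.cast_min]
    refine min_le_min le_rfl ?_
    push_cast
    exact mul_le_mul_of_nonneg_left (Real.natLog_le_logb _ _) (by positivity)
  set Mr := min (T.length : ℝ) (S.numVars * (RP.repair T).numVars * Real.logb 2 T.length)
  refine ⟨fun ω t ht => ?_, fun ω t => ?_, ?_⟩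
  · obtain ⟨σ, u, hr, -, -, ho⟩ := key ω
    have h1 : WordRAM.run RP.program w S.encode ω u = ([], σ) := hr []
    intro i hi
    grind [RP.eq_of_halted]
  · obtain ⟨σ, u, hr, hc, -, -⟩ := key ω
    have h1 : WordRAM.run RP.program w S.encode ω u = ([], σ) := hr []
    have h2 : (WordRAM.run RP.program w S.encode ω t).2.cells ≤ (1000000 + 2000 * (α + 9)) * M :=
      (RP.cells_le h1 t).trans (hc.trans (Nat.mul_le_mul_right _ (by omega)))
    calc ((WordRAM.run RP.program w S.encode ω t).2.cells : ℝ)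
        ≤ ((1000000 + 2000 * (α + 9)) * M : ℕ) := by exact_mod_cast h2
      _ = ((1000000 + 2000 * (α + 9) : ℕ) : ℝ) * M := Nat.cast_mul _ _
      _ ≤ _ := mul_le_mul_of_nonneg_left hMr (Nat.cast_nonneg _)
  · refine (RP.expectedTime_le (B := (1000000 + 2000 * (α + 9)) * M * (RP.repair T).numVars) fun ω => ?_).trans ?_
    · obtain ⟨σ, u, hr, -, ht, -⟩ := key ω
      exact ⟨u, ht, congrArg Prod.fst (hr [])⟩
    · rw [← ENNReal.ofReal_natCast]
      refine ENNReal.ofReal_le_ofReal ?_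
      rw [Nat.cast_mul, Nat.cast_mul]
      exact mul_le_mul_of_nonneg_right (mul_le_mul_of_nonneg_left hMr (Nat.cast_nonneg _)) (Nat.cast_nonneg _)
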